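/- **Setting.** Let $S$ be a compact smooth 3-manifold without boundary, $T\subset\mathbb R$ an open interval, and consider on $T\times S$ a smooth Lorentzian metric $-N^2dt^2+g_{ij}(dx^i+\beta^idt)(dx^j+\beta^jdt)$, $N>0$, with $g_{ij}$ Riemannian on the slices $S_t=\{t\}\times S$, with volume element $\mu_{\bar g}$, volume form $\eta_{ijk}$, norm $|\cdot|$ and covariant derivative $\bar\nabla$. Components are taken in the frame $e_0=\partial_0=\partial_t-\beta^i\partial_{x^i}$, $e_i=\partial_i=\partial_{x^i}$; $\nabla$ is the spacetime connection, $R_{\alpha\beta,\lambda\mu}$ the Riemann tensor, $R_{\beta\mu}=R^\alpha{}_{\beta,\alpha\mu}$, $K_{ij}=-\frac1{2N}(\partial_t-\mathcal L_\beta)g_{ij}$, $\tau=g^{ij}K_{ij}$. Let $\mu=\mu(p,s)$ be a smooth positive equation of state, and consider a smooth perfect fluid with pressure $p>0$, constant entropy $s>0$ and unit velocity $u$, $u^\alpha u_\alpha=-1$. Put $T_{\alpha\beta}=(\mu+p)u_\alpha u_\beta+pg_{\alpha\beta}$, $\rho_{\alpha\beta}=T_{\alpha\beta}-\frac12g_{\alpha\beta}T^\lambda{}_\lambda$,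 $f=\chi\exp\int_{p_0}^p\frac{dq}{\mu(q,s)+q}$, $C^\alpha=fu^\alpha$, $C_{\gamma\beta}=\nabla_\gamma C_\beta$, $\mu'_p=\partial\mu/\partial p$. Assume the Einstein equations $R_{\alpha\beta}=\rho_{\alpha\beta}$ and the fluid equations $C^\alpha(\nabla_\alpha C_\beta-\nabla_\beta C_\alpha)=0$, $\nabla_\alpha C^\alpha+(\mu'_p-1)\frac{C^\alpha C^\beta}{C^\lambda C_\lambda}\nabla_\alpha C_\beta=0$. Define $J_{\beta,\lambda\mu}=\nabla_\lambda\rho_{\mu\beta}-\nabla_\mu\rho_{\lambda\beta}$, $E_{ij}=R^0{}_{i,0j}$, $D_{ij}=\frac14\eta_{ihk}\eta_{jlm}R^{hk,lm}$, $H_{ij}=\frac12N^{-1}\eta_{ihk}R^{hk}{}_{,0j}$, $B_{ji}=\frac12N^{-1}\eta_{ihk}R_{0j,}{}^{hk}$, $$\mathcal B=\tfrac12(|E|^2+|H|^2+|D|^2+|B|^2),\qquad \mathcal S=J_{i,0j}E^{ij}-\tfrac12NJ_{i,lm}\,\eta_h{}^{lm}B^{ih}.$$ For each $\gamma$ put $U_0=C^\alpha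 C_{\gamma\alpha}$, $U_i=C_{\gamma i}-\frac{C_i}{C_0}C_{\gamma0}$, $\tilde g^{ij}=g^{ij}-\frac{C^iC^j}{C^\lambda C_\lambda}$, and let $$\mathcal F=f^{-2}\big[(\mu'_p-1)U_0^2+(U_0-C^iU_i)^2\big]+g^{ij}U_iU_j,\qquad \mathcal H^i=\tfrac1{C^0}\big\{C^i\big(\tfrac{\mu'_p}{f^2}U_0^2+\tilde g^{jk}U_jU_k\big)-2\tilde g^{ij}U_0U_j\big\},$$ where the products of two terms in the index $\gamma$ are contracted with the positive definite metric $\mathrm{diag}(N^{-2},g^{ij})$. Let $\mathcal E=\mathcal B+\mathcal F$. The *Bianchi–Euler system* for unknowns $R_{\alpha\beta,\lambda\mu}$ (antisymmetric in each pair, no symmetry between pairs imposed) and $C_{\gamma\alpha}$ consists, for all pairs $(\lambda\mu)=(0j),(ij)$ and all $\gamma$, of $$\nabla_0R_{hk,\lambda\mu}+\nabla_kR_{0h,\lambda\mu}-\nabla_hR_{0k,\lambda\mu}=0,\qquad \nabla_0R^0{}_{i,\lambda\mu}+\nabla_hR^h{}_{i,\lambda\mu}=J_{i,\lambda\mu},$$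 $$M_{\gamma i}-\tfrac{C_i}{C_0}M_{\gamma0}=0,\qquad g^{\alpha\beta}\nabla_\alpha C_{\gamma\beta}+(\mu'_p-1)\tfrac{C^\alpha C^\beta}{C^\lambda C_\lambda}\nabla_\alpha C_{\gamma\beta}+b_\gamma=0,$$ with $M_{\gamma\beta}=C^\alpha(\nabla_\alpha C_{\gamma\beta}-\nabla_\beta C_{\gamma\alpha})+C_\gamma{}^\alpha(C_{\alpha\beta}-C_{\beta\alpha})+C^\alpha C_\lambda R_{\gamma\alpha,\beta}{}^\lambda$, $b_\gamma=-R_{\gamma\lambda}C^\lambda+\nabla_\gamma\{(\mu'_p-1)\frac{C^\alpha C^\beta}{C^\lambda C_\lambda}\}C_{\alpha\beta}$; here the first derivatives of $C$ and $p$ occurring in $J$ and $b_\gamma$ are expressed algebraically through $C_{\gamma\alpha}$. **Theorem.** There are universal forms $Q_G$ and $Q_F$, the same for all such spacetimes, fluids and equations of state, such that the assertions below hold. $Q_G$ is a quadratic form in $(E,H,D,B)$ whose coefficients are linear in $\bar\nabla N$ and $NK$ and otherwise depend on $g_{ij}$ only. $Q_F$ is a quadratic form in $(C_{\gamma\alpha},R_{\alpha\beta,\lambda\mu})$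 whose coefficients depend on $N,g_{ij},C^\alpha,f,p,\mu,\mu'_p,\mu''_{p^2},\bar\nabla N,K$ and, at most affinely, on $C_{\gamma\alpha}$. 1. The Riemann tensor and $\nabla C$ satisfy the Bianchi–Euler system. 2. If $\mu'_p\ge1$, the Bianchi–Euler system is first order symmetric hyperbolic (FOSH) with respect to the slices, with energy density $\mathcal E$: it has the form $A^t\partial_tv+A^i\partial_{x^i}v+F(t,x,v)=0$ with smooth coefficients, and there is a smooth matrix $P$ such that $PA^t,PA^i$ are symmetric, $PA^t$ is positive definite and $\mathcal E=\frac12\,{}^tv\,PA^t\,v$. 3. $\partial_0\mathcal B+\bar\nabla_h\{N\eta^{lh}{}_i(E^{ij}H_{lj}-B^{ij}D_{lj})\}=Q_G+\mathcal S$ and $\partial_0\mathcal F+\bar\nabla_i\mathcal H^i=Q_F$. 4. For all $t_0,t\in T$ the following integrals exist and $$\int_{S_t}\mathcal E\,\mu_{\bar g}=\int_{S_{t_0}}\mathcal E\,\mu_{\bar g}+\int_{t_0}^t\int_{S_\theta}\{-N\tau\mathcal E+Q_G+\mathcal S+Q_F\}\,\mu_{\bar g}\,d\theta .$$ -/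

import Mathlib

open scoped Manifold ContDiff
open MeasureTheory Set

noncomputable section

namespace BianchiEuler

/-! ### Algebra at one point, in a Cauchy adapted frame

Frame indices are `Fin 4`: `0` is the index of `e₀ = ∂/∂t - βⁱ ∂/∂xⁱ`, `i.succ` that of
`eᵢ = ∂/∂xⁱ`; the dual coframe is `θ⁰ = dt`, `θⁱ = dxⁱ + βⁱ dt`. -/

/-- The model space of the space slices. -/
abbrev E3 := EuclideanSpace ℝ (Fin 3)

/-- Coordinates `(t, x¹, x², x³)`. -/
abbrev Coord := Fin 4 → ℝ

/-- Components of a covector or vector, of a 2-tensor, of a 4-tensor, in the frame. -/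
abbrev T1 := Fin 4 → ℝ
abbrev T2 := Fin 4 → Fin 4 → ℝ
abbrev T4 := Fin 4 → Fin 4 → Fin 4 → Fin 4 → ℝ

/-- `3 × 3` matrices: space 2-tensors. -/
abbrev Mat3 := Matrix (Fin 3) (Fin 3) ℝ

/-- `g_{αβ}` in the frame: `g₀₀ = -N²`, `g₀ᵢ = 0`, `gᵢⱼ = hᵢⱼ`. -/
def frameMetric (N : ℝ) (h : Mat3) : T2 := fun α β =>
  Fin.cases (Fin.cases (-N ^ 2) (fun _ => 0) β) (fun i => Fin.cases 0 (fun j => h i j) β) α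

/-- `g^{αβ}` in the frame. -/
def frameMetricInv (N : ℝ) (h : Mat3) : T2 := fun α β =>
  Fin.cases (Fin.cases (-(N ^ 2)⁻¹) (fun _ => 0) β)
    (fun i => Fin.cases 0 (fun j => h⁻¹ i j) β) α

/-- The positive definite metric `g^{αβ} + 2 n^α n^β`, `n` the unit normal of the slices. -/
def posMetricInv (N : ℝ) (h : Mat3) : T2 := fun α β =>
  Fin.cases (Fin.cases (N ^ 2)⁻¹ (fun _ => 0) β) (fun i => Fin.cases 0 (fun j => h⁻¹ i j) β) α

/-- The permutation symbol on three indices, `eps 0 1 2 = 1`. -/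
def eps (i j k : Fin 3) : ℝ :=
  (((j : ℕ) : ℝ) - ((i : ℕ) : ℝ)) * (((k : ℕ) : ℝ) - ((i : ℕ) : ℝ)) *
    (((k : ℕ) : ℝ) - ((j : ℕ) : ℝ)) / 2

/-- The volume form `η_{ijk}` of the space metric. -/
def eta (h : Mat3) (i j k : Fin 3) : ℝ := Real.sqrt h.det * eps i j k

/-- `η_i^{jk}`. -/
def etaUp (h : Mat3) (i j k : Fin 3) : ℝ := ∑ a, ∑ b, h⁻¹ j a * h⁻¹ k b * eta h i a b

/-- `X^{ij}`. -/
def raise (h : Mat3) (X : Mat3) : Mat3 := fun i j => ∑ k, ∑ l, h⁻¹ i k * h⁻¹ j l * X k l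

/-- `|X|²`, the norm of the space metric. -/
def normSq (h : Mat3) (X : Mat3) : ℝ := ∑ i, ∑ j, raise h X i j * X i j

/-- Electric field `E_{ij} = R⁰_{i,0j}` of a 4-tensor `R_{αβ,λμ}`. -/
def elE (N : ℝ) (h : Mat3) (r : T4) : Mat3 := fun i j =>
  ∑ α, frameMetricInv N h 0 α * r α i.succ 0 j.succ

/-- Electric induction `D_{ij} = ¼ η_{ihk} η_{jlm} R^{hk,lm}`. -/
def elD (h : Mat3) (r : T4) : Mat3 := fun i j =>
  (1 / 4) * ∑ a, ∑ b, ∑ l, ∑ m, etaUp h i a b * etaUp h j l m * r a.succ b.succ l.succ m.succ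

/-- Magnetic field `H_{ij} = ½ N⁻¹ η_{ihk} R^{hk}_{,0j}`. -/
def magH (N : ℝ) (h : Mat3) (r : T4) : Mat3 := fun i j =>
  (1 / 2) * N⁻¹ * ∑ a, ∑ b, etaUp h i a b * r a.succ b.succ 0 j.succ

/-- Magnetic induction, `B_{ji} = ½ N⁻¹ η_{ihk} R_{0j,}^{hk}`. -/
def magB (N : ℝ) (h : Mat3) (r : T4) : Mat3 := fun j i =>
  (1 / 2) * N⁻¹ * ∑ a, ∑ b, etaUp h i a b * r 0 j.succ a.succ b.succ

/-- The Bel-Robinson energy density `𝓑 = ½ (|E|² + |H|² + |D|² + |B|²)`. -/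
def belRobinson (N : ℝ) (h : Mat3) (r : T4) : ℝ :=
  (1 / 2) * (normSq h (elE N h r) + normSq h (magH N h r) + normSq h (elD h r)
    + normSq h (magB N h r))

/-- The space vector `N η^{lh}_i (E^{ij} H_{lj} - B^{ij} D_{lj})` (free index `h`, here `k`). -/
def belRobinsonFlux (N : ℝ) (h : Mat3) (r : T4) (k : Fin 3) : ℝ :=
  N * ∑ i, ∑ j, ∑ l, etaUp h i l k *
    (raise h (elE N h r) i j * magH N h r l j - raise h (magB N h r) i j * elD h r l j)

/-- The source `𝓢 = J_{i,0j} E^{ij} - ½ N J_{i,lm} η_h^{lm} B^{ih}`, where `J i λ μ` is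
`J_{i,λμ}`. -/
def sourceTerm (N : ℝ) (h : Mat3) (r : T4) (J : Fin 4 → Fin 4 → Fin 4 → ℝ) : ℝ :=
  (∑ i : Fin 3, ∑ j : Fin 3, J i.succ 0 j.succ * raise h (elE N h r) i j)
    - (1 / 2) * N * ∑ i : Fin 3, ∑ k : Fin 3, ∑ l : Fin 3, ∑ m : Fin 3,
        J i.succ l.succ m.succ * etaUp h k l m * raise h (magB N h r) i k

/-- Undifferentiated data of the metric and of the fluid at a point: lapse, space metric, frame
components `C^α` of the dynamical velocity, enthalpy index `f`, pressure, energy density `μ`, and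
the derivatives `μ'_p`, `μ''_{p²}` of the equation of state. -/
structure PointState where
  N : ℝ
  h : Mat3
  C : T1
  f : ℝ
  p : ℝ
  mu : ℝ
  mu1 : ℝ
  mu2 : ℝ

namespace PointState

variable (P : PointState)

/-- `g_{αβ}` -/
def g : T2 := frameMetric P.N P.h

/-- `g^{αβ}` -/
def gi : T2 := frameMetricInv P.N P.h

/-- `C_α` -/
def Cl (α : Fin 4) : ℝ := ∑ β, P.g α β * P.C β

/-- `C^λ C_λ` -/
def CC : ℝ := ∑ α, P.C α * P.Cl α

/-- `U₀ = C^α C_{γα}` (for the block `γ`). -/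
def U0 (c : T2) (γ : Fin 4) : ℝ := ∑ α, P.C α * c γ α

/-- `U_i = C_{γi} - (C_i / C₀) C_{γ0}` (for the block `γ`). -/
def Ui (c : T2) (γ : Fin 4) (i : Fin 3) : ℝ := c γ i.succ - P.Cl i.succ / P.Cl 0 * c γ 0

/-- `g̃^{ij} = g^{ij} - C^i C^j / (C^λ C_λ)` -/
def gt (i j : Fin 3) : ℝ := P.h⁻¹ i j - P.C i.succ * P.C j.succ / P.CC

/-- The energy density of the dynamical acceleration,
`𝓕 = f⁻² [(μ'_p - 1) U₀² + (U₀ - C^i U_i)²] + g^{ij} U_i U_j`,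
the blocks `γ` being summed with the positive definite metric `N⁻² ⊕ g^{ij}`. -/
def fluidEnergy (c : T2) : ℝ :=
  ∑ γ, ∑ δ, posMetricInv P.N P.h γ δ *
    ((P.f ^ 2)⁻¹ * ((P.mu1 - 1) * (P.U0 c γ * P.U0 c δ)
        + (P.U0 c γ - ∑ i : Fin 3, P.C i.succ * P.Ui c γ i)
          * (P.U0 c δ - ∑ i : Fin 3, P.C i.succ * P.Ui c δ i))
      + ∑ i, ∑ j, P.h⁻¹ i j * (P.Ui c γ i * P.Ui c δ j))

/-- The flux associated with `fluidEnergy`: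
`(1 / C⁰) { C^i (μ'_p f⁻² U₀² + g̃^{jk} U_j U_k) - 2 g̃^{ij} U₀ U_j }`, blocks summed as there. -/
def fluidFlux (c : T2) (i : Fin 3) : ℝ :=
  ∑ γ, ∑ δ, posMetricInv P.N P.h γ δ *
    ((P.C 0)⁻¹ * (P.C i.succ * (P.mu1 * (P.f ^ 2)⁻¹ * (P.U0 c γ * P.U0 c δ)
          + ∑ j, ∑ k, P.gt j k * (P.Ui c γ j * P.Ui c δ k))
        - 2 * ∑ j, P.gt i j * (P.U0 c γ * P.Ui c δ j)))

/-- `𝓔 = 𝓑 + 𝓕`. -/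
def totalEnergy (r : T4) (c : T2) : ℝ := belRobinson P.N P.h r + P.fluidEnergy c

/-- `∂_γ p = (μ + p) f⁻¹ ∂_γ f = (μ + p) (C^λ C_λ)⁻¹ C^α C_{γα}` (as `f² = - C^λ C_λ`). -/
def dp (c : T2) (γ : Fin 4) : ℝ := (P.mu + P.p) / P.CC * ∑ α, P.C α * c γ α

/-- `∇_γ ρ_{αβ}` for `ρ_{αβ} = (μ + p) f⁻² C_α C_β + ½ g_{αβ} (μ - p)`, as a function of
`C_{γα} = ∇_γ C_α`; one has `d((μ + p) f⁻²) = (μ'_p - 1) f⁻² dp`. -/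
def dRho (c : T2) (γ α β : Fin 4) : ℝ :=
  (P.mu1 - 1) * (P.f ^ 2)⁻¹ * P.dp c γ * P.Cl α * P.Cl β
    + (P.mu + P.p) * (P.f ^ 2)⁻¹ * (c γ α * P.Cl β + P.Cl α * c γ β)
    + (1 / 2) * P.g α β * (P.mu1 - 1) * P.dp c γ

/-- The right hand side `J_{β,λμ} = ∇_λ ρ_{μβ} - ∇_μ ρ_{λβ}` of the Bianchi equations, as a
function of `C_{γα}`. -/
def current (c : T2) (β l m : Fin 4) : ℝ := P.dRho c l m β - P.dRho c m l β

/-- `a_{γβ} = C_γ^α (C_{αβ} - C_{βα}) + C^α C_λ R_{γα,β}^λ`. -/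
def aTerm (r : T4) (c : T2) (γ β : Fin 4) : ℝ :=
  (∑ α, ∑ δ, P.gi α δ * c γ δ * (c α β - c β α)) + ∑ α, ∑ l, P.C α * P.C l * r γ α β l

/-- `∇_γ { (μ'_p - 1) C^α C^β / (C^λ C_λ) }` as a function of `C_{γα}`. -/
def dCoeff (c : T2) (γ α β : Fin 4) : ℝ :=
  P.mu2 * P.dp c γ * (P.C α * P.C β / P.CC)
    + (P.mu1 - 1) * (((∑ δ, P.gi α δ * c γ δ) * P.C β + P.C α * ∑ δ, P.gi β δ * c γ δ) / P.CC
        - 2 * P.C α * P.C β * (∑ l, P.C l * c γ l) / P.CC ^ 2)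

/-- `b_γ = - R_{γλ} C^λ + ∇_γ { (μ'_p - 1) C^α C^β / (C^λ C_λ) } C_{αβ}`, with
`R_{γλ} = R^α_{γ,αλ}`. -/
def bTerm (r : T4) (c : T2) (γ : Fin 4) : ℝ :=
  -(∑ l, (∑ α, ∑ β, P.gi α β * r β γ α l) * P.C l) + ∑ α, ∑ β, P.dCoeff c γ α β * c α β

end PointState

/-! ### Differential geometry in a coordinate patch -/

/-- Partial derivative with respect to the coordinate `a` (`0` is the time). -/
def pd (a : Fin 4) (φ : Coord → ℝ) (z : Coord) : ℝ := fderiv ℝ φ z (Pi.single a 1)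

/-- Lapse, shift and space metric in coordinates:
`ds² = - N² dt² + hᵢⱼ (dxⁱ + βⁱ dt) (dxʲ + βʲ dt)`. -/
structure LocalMetric where
  N : Coord → ℝ
  shift : Coord → Fin 3 → ℝ
  h : Coord → Mat3

namespace LocalMetric

variable (M : LocalMetric)

/-- The Pfaff derivatives `∂₀ = ∂/∂t - βⁱ ∂/∂xⁱ`, `∂ᵢ = ∂/∂xⁱ`. -/
def D (α : Fin 4) (φ : Coord → ℝ) (z : Coord) : ℝ :=
  Fin.cases (pd 0 φ z - ∑ i : Fin 3, M.shift z i * pd i.succ φ z) (fun i => pd i.succ φ z) α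

/-- `g_{αβ}` -/
def g (z : Coord) : T2 := frameMetric (M.N z) (M.h z)

/-- `g^{αβ}` -/
def gi (z : Coord) : T2 := frameMetricInv (M.N z) (M.h z)

/-- Structure coefficients: `[e_α, e_β] = c^γ_{αβ} e_γ`. The only nonzero ones are
`c^k_{0i} = ∂_i β^k = - c^k_{i0}`. -/
def bracket (γ α β : Fin 4) (z : Coord) : ℝ :=
  Fin.cases 0 (fun k =>
    Fin.cases (Fin.cases 0 (fun i => pd i.succ (fun w => M.shift w k) z) β)
      (fun i => Fin.cases (-pd i.succ (fun w => M.shift w k) z) (fun _ => 0) β) α) γ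

/-- Connection coefficients of the Levi-Civita connection of the spacetime metric (Koszul formula):
`∇_{e_β} e_γ = ω^α_{βγ} e_α`. -/
def omega (α β γ : Fin 4) (z : Coord) : ℝ :=
  (1 / 2) * ∑ δ, M.gi z α δ *
    (M.D β (fun w => M.g w γ δ) z + M.D γ (fun w => M.g w β δ) z - M.D δ (fun w => M.g w β γ) z
      + ∑ ε, (M.bracket ε β γ z * M.g z ε δ - M.bracket ε β δ z * M.g z ε γ
          - M.bracket ε γ δ z * M.g z ε β))

/-- `R^α_{β,λμ}`, the components of `∇_λ ∇_μ e_β - ∇_μ ∇_λ e_β - ∇_{[e_λ, e_μ]} e_β`. -/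
def riemUp (α β l m : Fin 4) (z : Coord) : ℝ :=
  M.D l (M.omega α m β) z - M.D m (M.omega α l β) z
    + ∑ ε, (M.omega α l ε z * M.omega ε m β z - M.omega α m ε z * M.omega ε l β z
        - M.bracket ε l m z * M.omega α ε β z)

/-- `R_{αβ,λμ}` -/
def riem (z : Coord) : T4 := fun α β l m => ∑ ε, M.g z α ε * M.riemUp ε β l m z

/-- `R_{βμ} = R^α_{β,αμ}` -/
def ricci (z : Coord) : T2 := fun β m => ∑ α, M.riemUp α β α m z

/-- `nabla1 X z γ β = ∇_γ X_β` -/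
def nabla1 (X : Coord → T1) (z : Coord) : T2 := fun γ β =>
  M.D γ (fun w => X w β) z - ∑ ε, M.omega ε γ β z * X z ε

/-- `nabla2 X z γ α β = ∇_γ X_{αβ}` -/
def nabla2 (X : Coord → T2) (z : Coord) : Fin 4 → T2 := fun γ α β =>
  M.D γ (fun w => X w α β) z
    - ∑ ε, (M.omega ε γ α z * X z ε β + M.omega ε γ β z * X z α ε)

/-- `nabla4 X z γ α β l m = ∇_γ X_{αβ,lm}` -/
def nabla4 (X : Coord → T4) (z : Coord) : Fin 4 → T4 := fun γ α β l m =>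
  M.D γ (fun w => X w α β l m) z
    - ∑ ε, (M.omega ε γ α z * X z ε β l m + M.omega ε γ β z * X z α ε l m
        + M.omega ε γ l z * X z α β ε m + M.omega ε γ m z * X z α β l ε)

/-- Extrinsic curvature of the slices, `K_{ij} = - (2N)⁻¹ (∂_t - L_β) h_{ij}`. -/
def K (z : Coord) : Mat3 := fun i j =>
  -(1 / 2) * (M.N z)⁻¹ * (M.D 0 (fun w => M.h w i j) z
    - ∑ k, (M.h z k j * pd i.succ (fun w => M.shift w k) z
        + M.h z i k * pd j.succ (fun w => M.shift w k) z))

/-- `τ = g^{ij} K_{ij}` -/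
def tau (z : Coord) : ℝ := ∑ i, ∑ j, (M.h z)⁻¹ i j * M.K z i j

/-- `∂_i N` -/
def dN (z : Coord) : Fin 3 → ℝ := fun i => pd i.succ M.N z

/-- Divergence `∇̄_i X^i` of a space vector field with respect to the space metric. -/
def div (X : Coord → Fin 3 → ℝ) (z : Coord) : ℝ :=
  (Real.sqrt (M.h z).det)⁻¹ * ∑ i : Fin 3, pd i.succ (fun w => Real.sqrt (M.h w).det * X w i) z

end LocalMetric

/-! ### First order symmetric hyperbolic systems -/

/-- The first order system `L u = 0` is, on `Ω`, symmetric hyperbolic with respect to the slices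
`t = constant`, with energy density `en`: `L u = A^a ∂_a u + F(z, u)`, and there is a symmetrizer
`P` such that all `P A^a` are symmetric, `M^t = P A^t` is positive definite, and
`en = ½ ᵗu M^t u`. Here `∂_a` are the usual partial derivatives. -/
def IsFOSH {ι : Type} [Fintype ι] (L : (Coord → ι → ℝ) → Coord → ι → ℝ) (Ω : Set Coord)
    (en : Coord → (ι → ℝ) → ℝ) : Prop :=
  ∃ (A : Fin 4 → Coord → Matrix ι ι ℝ) (P : Coord → Matrix ι ι ℝ)
    (F : Coord → (ι → ℝ) → ι → ℝ),
    (∀ a i j, ContDiffOn ℝ ∞ (fun z => A a z i j) Ω) ∧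
    (∀ i j, ContDiffOn ℝ ∞ (fun z => P z i j) Ω) ∧
    (∀ i, ContDiffOn ℝ ∞ (fun q : Coord × (ι → ℝ) => F q.1 q.2 i) (Ω ×ˢ univ)) ∧
    (∀ u : Coord → ι → ℝ, ∀ z ∈ Ω, DifferentiableAt ℝ u z →
      L u z = (∑ a, (A a z).mulVec fun i => pd a (fun w => u w i) z) + F z (u z)) ∧
    ∀ z ∈ Ω, (∀ a, (P z * A a z).IsSymm) ∧ (P z * A 0 z).PosDef ∧
      ∀ v : ι → ℝ, en z v = (1 / 2) * dotProduct v ((P z * A 0 z).mulVec v)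

/-! ### The Bianchi-Euler system -/

/-- Labels of the independent index pairs: `inl i` is `(0, i)`, `inr k` is the space pair
`(k + 1, k + 2)` (cyclically). -/
abbrev PairIdx := Fin 3 ⊕ Fin 3

def pairFst : PairIdx → Fin 4 := Sum.elim (fun _ => 0) fun k => (k + 1).succ
def pairSnd : PairIdx → Fin 4 := Sum.elim Fin.succ fun k => (k + 2).succ

/-- The antisymmetric 2-tensor with given independent components. -/
def biv (w : PairIdx → ℝ) : T2 := fun α β =>
  Fin.cases (Fin.cases 0 (fun j => w (Sum.inl j)) β)
    (fun i => Fin.cases (-w (Sum.inl i)) (fun j => ∑ k, eps i j k * w (Sum.inr k)) β) α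

/-- Labels of the unknowns: the components `R_{0h,0j}`, `R_{hk,0j}`, `R_{0h,ij}`, `R_{hk,ij}`
(antisymmetric in each pair, with no relation between the pairs) and `C_{γα}`. -/
abbrev Idx := (PairIdx × PairIdx) ⊕ (Fin 4 × Fin 4)

/-- The 4-tensor part of the unknown. -/
def riemPart (v : Idx → ℝ) : T4 := fun α β l m =>
  biv (fun a => biv (fun b => v (Sum.inl (a, b))) l m) α β

/-- The `C_{γα}` part of the unknown. -/
def accPart (v : Idx → ℝ) : T2 := fun γ α => v (Sum.inr (γ, α))

/-- The unknown formed by a 4-tensor and a 2-tensor. -/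
def packUnknown (r : T4) (c : T2) : Idx → ℝ :=
  Sum.elim (fun ab => r (pairFst ab.1) (pairSnd ab.1) (pairFst ab.2) (pairSnd ab.2))
    (fun γα => c γα.1 γα.2)

section System

variable (M : LocalMetric) (st : Coord → PointState)

/-- Left hand side of `∇₀ R_{hk,λμ} + ∇_k R_{0h,λμ} - ∇_h R_{0k,λμ} = 0`. -/
def bianchiCyclic (R : Coord → T4) (z : Coord) (h k l m : Fin 4) : ℝ :=
  M.nabla4 R z 0 h k l m + M.nabla4 R z k 0 h l m - M.nabla4 R z h 0 k l m

/-- `∇₀ R⁰_{i,λμ} + ∇_h R^h_{i,λμ} - J_{i,λμ}`. -/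
def bianchiDiv (R : Coord → T4) (c : Coord → T2) (z : Coord) (i l m : Fin 4) : ℝ :=
  (∑ α, ∑ β, M.gi z α β * M.nabla4 R z α β i l m) - (st z).current (c z) i l m

/-- `M_{γβ} = C^α (∇_α C_{γβ} - ∇_β C_{γα}) + a_{γβ}`. -/
def accM (R : Coord → T4) (c : Coord → T2) (z : Coord) (γ β : Fin 4) : ℝ :=
  (∑ α, (st z).C α * (M.nabla2 c z α γ β - M.nabla2 c z β γ α)) + (st z).aTerm (R z) (c z) γ β

/-- `M̃_{γi} = M_{γi} - (C_i / C₀) M_{γ0}`. -/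
def accMtilde (R : Coord → T4) (c : Coord → T2) (z : Coord) (γ : Fin 4) (i : Fin 3) : ℝ :=
  accM M st R c z γ i.succ - (st z).Cl i.succ / (st z).Cl 0 * accM M st R c z γ 0

/-- `g^{αβ} ∇_α C_{γβ} + (μ'_p - 1) (C^α C^β / C^λ C_λ) ∇_α C_{γβ} + b_γ`. -/
def accDiv (R : Coord → T4) (c : Coord → T2) (z : Coord) (γ : Fin 4) : ℝ :=
  (∑ α, ∑ β, (M.gi z α β + ((st z).mu1 - 1) * ((st z).C α * (st z).C β / (st z).CC))
      * M.nabla2 c z α γ β)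
    + (st z).bTerm (R z) (c z) γ

/-- The left hand sides of the Bianchi-Euler system (52 equations for 52 unknowns) on the
background given by the metric, its connection and the fluid state. -/
def system (u : Coord → Idx → ℝ) (z : Coord) : Idx → ℝ :=
  Sum.elim
    (fun ab => Sum.elim
      (fun i => bianchiDiv M st (fun w => riemPart (u w)) (fun w => accPart (u w)) z i.succ
        (pairFst ab.2) (pairSnd ab.2))
      (fun k => bianchiCyclic M (fun w => riemPart (u w)) z (k + 1).succ (k + 2).succ
        (pairFst ab.2) (pairSnd ab.2)) ab.1)
    (fun γα => Fin.cases
      (accDiv M st (fun w => riemPart (u w)) (fun w => accPart (u w)) z γα.1)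
      (fun i => accMtilde M st (fun w => riemPart (u w)) (fun w => accPart (u w)) z γα.1 i) γα.2)

end System

/-! ### Sliced spacetimes and perfect fluids -/

/-- An equation of state `μ = μ(p, S)`, and the constants in the definition of the enthalpy
index. -/
structure EquationOfState where
  mu : ℝ → ℝ → ℝ
  chi : ℝ
  p₀ : ℝ
  mu_pos : ∀ p S, 0 < p → 0 < S → 0 < mu p S
  mu_smooth : ContDiffOn ℝ ∞ (fun q : ℝ × ℝ => mu q.1 q.2) (Ioi 0 ×ˢ Ioi 0)
  chi_pos : 0 < chi
  p₀_pos : 0 < p₀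

namespace EquationOfState

variable (eos : EquationOfState)

/-- `μ'_p` -/
def mu1 (p S : ℝ) : ℝ := deriv (fun q => eos.mu q S) p

/-- `μ''_{p²}` -/
def mu2 (p S : ℝ) : ℝ := deriv (fun q => eos.mu1 q S) p

/-- The enthalpy index `f = χ exp ∫_{p₀}^p dq / (μ(q, S) + q)`. -/
def enthalpy (p S : ℝ) : ℝ := eos.chi * Real.exp (∫ q in eos.p₀..p, 1 / (eos.mu q S + q))

end EquationOfState

/-- The space coordinates of a point. -/
def spacePart (z : Coord) : E3 := WithLp.toLp 2 fun i => z i.succ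

/-- The point of coordinates `(t, y)`. -/
def mkCoord (t : ℝ) (y : E3) : Coord := Fin.cons t fun i => y i

section Manifold

variable {S : Type*} [TopologicalSpace S] [ChartedSpace E3 S]

/-- The coordinate domain in spacetime defined by a chart of `S`, for times in `T`. -/
def chartDomain (T : Set ℝ) (e : OpenPartialHomeomorph S E3) : Set Coord :=
  {z | z 0 ∈ T ∧ spacePart z ∈ e.target}

/-- A scalar in the chart `e`. -/
def scalarIn (e : OpenPartialHomeomorph S E3) (φ : ℝ → S → ℝ) (z : Coord) : ℝ :=
  φ (z 0) (e.symm (spacePart z))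

/-- Components of a time dependent vector field in the chart `e`. -/
def vectorIn (e : OpenPartialHomeomorph S E3) (X : ℝ → (x : S) → TangentSpace 𝓘(ℝ, E3) x)
    (z : Coord) (i : Fin 3) : ℝ :=
  (show E3 from mfderiv 𝓘(ℝ, E3) 𝓘(ℝ, E3) e (e.symm (spacePart z))
    (X (z 0) (e.symm (spacePart z)))) i

/-- The coordinate vector field `∂/∂xⁱ` of the chart `e` at the point of coordinates `y`. -/
def coordVec (e : OpenPartialHomeomorph S E3) (y : E3) (i : Fin 3) :
    TangentSpace 𝓘(ℝ, E3) (e.symm y) :=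
  mfderiv 𝓘(ℝ, E3) 𝓘(ℝ, E3) e.symm y (EuclideanSpace.single i (1 : ℝ) : E3)

/-- Components of a bilinear form on the tangent spaces, in the chart `e`. -/
def bilinIn (e : OpenPartialHomeomorph S E3)
    (b : (x : S) → LinearMap.BilinForm ℝ (TangentSpace 𝓘(ℝ, E3) x)) (y : E3) : Mat3 :=
  fun i j => b (e.symm y) (coordVec e y i) (coordVec e y j)

/-- The volume measure of a Riemannian metric on `S`: the least measure that dominates, for each
chart, the measure `√(det h) dx¹ dx² dx³` of the chart domain (on which it agrees with it). -/
def volMeasure [MeasurableSpace S]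
    (b : (x : S) → LinearMap.BilinForm ℝ (TangentSpace 𝓘(ℝ, E3) x)) : Measure S :=
  ⨆ e ∈ atlas E3 S, Measure.map e.symm
    ((volume.restrict e.target).withDensity fun y =>
      ENNReal.ofReal (Real.sqrt (bilinIn e b y).det))

end Manifold

/-- A smooth spacetime `T × S` foliated by the space slices `S_t = {t} × S`, given by its lapse,
shift and space metrics. -/
structure SlicedSpacetime (S : Type*) [TopologicalSpace S] [ChartedSpace E3 S] (T : Set ℝ) where
  N : ℝ → S → ℝ
  shift : ℝ → (x : S) → TangentSpace 𝓘(ℝ, E3) x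
  h : ℝ → (x : S) → LinearMap.BilinForm ℝ (TangentSpace 𝓘(ℝ, E3) x)
  N_pos : ∀ t ∈ T, ∀ x, 0 < N t x
  h_symm : ∀ t ∈ T, ∀ x v w, h t x v w = h t x w v
  h_pos : ∀ t ∈ T, ∀ x v, v ≠ 0 → 0 < h t x v v
  N_smooth : ∀ e ∈ IsManifold.maximalAtlas 𝓘(ℝ, E3) ∞ S,
    ContDiffOn ℝ ∞ (scalarIn e N) (chartDomain T e)
  shift_smooth : ∀ e ∈ IsManifold.maximalAtlas 𝓘(ℝ, E3) ∞ S, ∀ i,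
    ContDiffOn ℝ ∞ (fun z => vectorIn e shift z i) (chartDomain T e)
  h_smooth : ∀ e ∈ IsManifold.maximalAtlas 𝓘(ℝ, E3) ∞ S, ∀ i j,
    ContDiffOn ℝ ∞ (fun z => bilinIn e (h (z 0)) (spacePart z) i j) (chartDomain T e)

/-- The coordinate expression of the metric in a chart of `S`. -/
def SlicedSpacetime.inChart {S : Type*} [TopologicalSpace S] [ChartedSpace E3 S] {T : Set ℝ}
    (M : SlicedSpacetime S T) (e : OpenPartialHomeomorph S E3) : LocalMetric where
  N := scalarIn e M.N
  shift := vectorIn e M.shift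
  h := fun z => bilinIn e (M.h (z 0)) (spacePart z)

/-- A perfect fluid with constant entropy: pressure and unit velocity
`u = u⁰ e₀ + ū`, with `ū` tangent to the slices. -/
structure PerfectFluid {S : Type*} [TopologicalSpace S] [ChartedSpace E3 S] {T : Set ℝ}
    (M : SlicedSpacetime S T) (eos : EquationOfState) where
  entropy : ℝ
  p : ℝ → S → ℝ
  u₀ : ℝ → S → ℝ
  u : ℝ → (x : S) → TangentSpace 𝓘(ℝ, E3) x
  entropy_pos : 0 < entropy
  p_pos : ∀ t ∈ T, ∀ x, 0 < p t x
  unit : ∀ t ∈ T, ∀ x, -(M.N t x) ^ 2 * (u₀ t x) ^ 2 + M.h t x (u t x) (u t x) = -1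
  p_smooth : ∀ e ∈ IsManifold.maximalAtlas 𝓘(ℝ, E3) ∞ S,
    ContDiffOn ℝ ∞ (scalarIn e p) (chartDomain T e)
  u₀_smooth : ∀ e ∈ IsManifold.maximalAtlas 𝓘(ℝ, E3) ∞ S,
    ContDiffOn ℝ ∞ (scalarIn e u₀) (chartDomain T e)
  u_smooth : ∀ e ∈ IsManifold.maximalAtlas 𝓘(ℝ, E3) ∞ S, ∀ i,
    ContDiffOn ℝ ∞ (fun z => vectorIn e u z i) (chartDomain T e)

namespace PerfectFluid

variable {S : Type*} [TopologicalSpace S] [ChartedSpace E3 S] {T : Set ℝ}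
  {M : SlicedSpacetime S T} {eos : EquationOfState} (Φ : PerfectFluid M eos)
  (e : OpenPartialHomeomorph S E3)

/-- Frame components `u^α`. -/
def vel (z : Coord) : T1 := Fin.cons (scalarIn e Φ.u₀ z) (vectorIn e Φ.u z)

/-- The point state in a chart; the dynamical velocity is `C^α = f u^α`. -/
def state (z : Coord) : PointState where
  N := (M.inChart e).N z
  h := (M.inChart e).h z
  C := fun α => eos.enthalpy (scalarIn e Φ.p z) Φ.entropy * Φ.vel e z α
  f := eos.enthalpy (scalarIn e Φ.p z) Φ.entropy
  p := scalarIn e Φ.p z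
  mu := eos.mu (scalarIn e Φ.p z) Φ.entropy
  mu1 := eos.mu1 (scalarIn e Φ.p z) Φ.entropy
  mu2 := eos.mu2 (scalarIn e Φ.p z) Φ.entropy

/-- `T_{αβ} = (μ + p) u_α u_β + p g_{αβ}` -/
def stress (z : Coord) : T2 := fun α β =>
  ((Φ.state e z).mu + (Φ.state e z).p)
      * (∑ γ, (M.inChart e).g z α γ * Φ.vel e z γ) * (∑ γ, (M.inChart e).g z β γ * Φ.vel e z γ)
    + (Φ.state e z).p * (M.inChart e).g z α β

/-- `ρ_{αβ} = T_{αβ} - ½ g_{αβ} T` -/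
def rho (z : Coord) : T2 := fun α β =>
  Φ.stress e z α β - (1 / 2) * (M.inChart e).g z α β
    * ∑ γ, ∑ δ, (M.inChart e).gi z γ δ * Φ.stress e z γ δ

/-- The currents `J_{β,λμ} = ∇_λ ρ_{μβ} - ∇_μ ρ_{λβ}`. -/
def J (z : Coord) (β l m : Fin 4) : ℝ :=
  (M.inChart e).nabla2 (Φ.rho e) z l m β - (M.inChart e).nabla2 (Φ.rho e) z m l β

/-- The dynamical acceleration `C_{γα} = ∇_γ C_α`. -/
def acc (z : Coord) : T2 := (M.inChart e).nabla1 (fun w => (Φ.state e w).Cl) z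

/-- The Einstein equations `R_{αβ} = ρ_{αβ}`. -/
def Einstein : Prop :=
  ∀ e ∈ IsManifold.maximalAtlas 𝓘(ℝ, E3) ∞ S, ∀ z ∈ chartDomain T e, ∀ α β,
    (M.inChart e).ricci z α β = Φ.rho e z α β

/-- The equations of the fluid, `C^α (∇_α C_β - ∇_β C_α) = 0` and
`∇_α C^α + (μ'_p - 1) (C^α C^β / C^λ C_λ) ∇_α C_β = 0`. -/
def Euler : Prop :=
  ∀ e ∈ IsManifold.maximalAtlas 𝓘(ℝ, E3) ∞ S, ∀ z ∈ chartDomain T e,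
    (∀ β, ∑ α, (Φ.state e z).C α * (Φ.acc e z α β - Φ.acc e z β α) = 0) ∧
    ∑ α, ∑ β, ((M.inChart e).gi z α β
      + ((Φ.state e z).mu1 - 1) * ((Φ.state e z).C α * (Φ.state e z).C β / (Φ.state e z).CC))
        * Φ.acc e z α β = 0

/-- The Bel-Robinson energy density `𝓑` of the spacetime, in a chart. -/
def belRobinsonIn (z : Coord) : ℝ :=
  belRobinson ((M.inChart e).N z) ((M.inChart e).h z) ((M.inChart e).riem z)

/-- The fluid energy density `𝓕`, in a chart. -/
def fluidEnergyIn (z : Coord) : ℝ := (Φ.state e z).fluidEnergy (Φ.acc e z)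

/-- The energy density `𝓔 = 𝓑 + 𝓕`, in a chart. -/
def energyIn (z : Coord) : ℝ := (Φ.state e z).totalEnergy ((M.inChart e).riem z) (Φ.acc e z)

/-- The source `𝓢`, in a chart. -/
def sourceIn (z : Coord) : ℝ :=
  sourceTerm ((M.inChart e).N z) ((M.inChart e).h z) ((M.inChart e).riem z) (Φ.J e z)

end PerfectFluid

/-- Quadratic forms in four space 2-tensors `(E, H, D, B)`, whose coefficients are linear in
`∇̄N` and `N K` and depend otherwise only on the space metric. -/
abbrev GravForm :=
  Mat3 → ((Fin 3 → ℝ) × Mat3) →ₗ[ℝ] QuadraticForm ℝ (Mat3 × Mat3 × Mat3 × Mat3)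

/-- Quadratic forms in `(C_{γα}, R_{αβ,λμ})`, whose coefficients depend on the point state, on
`∇̄N` and `K`, and in an affine way on `C_{γα}`. -/
abbrev FluidForm :=
  PointState → (Fin 3 → ℝ) → Mat3 → T2 →ᵃ[ℝ] QuadraticForm ℝ (T2 × T4)

/-- The value of a `GravForm` on a spacetime, in a chart. -/
def GravForm.eval (Q : GravForm) (M : LocalMetric) (z : Coord) : ℝ :=
  Q (M.h z) (M.dN z, M.N z • M.K z)
    (elE (M.N z) (M.h z) (M.riem z), magH (M.N z) (M.h z) (M.riem z), elD (M.h z) (M.riem z),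
      magB (M.N z) (M.h z) (M.riem z))

/-- The value of a `FluidForm` on a spacetime with fluid, in a chart. -/
def FluidForm.eval {S : Type*} [TopologicalSpace S] [ChartedSpace E3 S] {T : Set ℝ}
    {M : SlicedSpacetime S T} {eos : EquationOfState} (Q : FluidForm) (Φ : PerfectFluid M eos)
    (e : OpenPartialHomeomorph S E3) (z : Coord) : ℝ :=
  Q (Φ.state e z) ((M.inChart e).dN z) ((M.inChart e).K z) (Φ.acc e z)
    (Φ.acc e z, (M.inChart e).riem z)

/-- The integrand `- N τ 𝓔 + Q_G + 𝓢 + Q_F`, in a chart. -/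
def PerfectFluid.rateIn {S : Type*} [TopologicalSpace S] [ChartedSpace E3 S] {T : Set ℝ}
    {M : SlicedSpacetime S T} {eos : EquationOfState} (Φ : PerfectFluid M eos) (QG : GravForm)
    (QF : FluidForm) (e : OpenPartialHomeomorph S E3) (z : Coord) : ℝ :=
  -((M.inChart e).N z * (M.inChart e).tau z * Φ.energyIn e z)
    + QG.eval (M.inChart e) z + Φ.sourceIn e z + QF.eval Φ e z

/-- The value at a point of `S`, at time `t`, of a scalar given by its expressions in charts. -/
def scalarAt {S : Type*} [TopologicalSpace S] [ChartedSpace E3 S]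
    (φ : OpenPartialHomeomorph S E3 → Coord → ℝ) (t : ℝ) (x : S) : ℝ :=
  φ (chartAt E3 x) (mkCoord t (chartAt E3 x x))

end BianchiEuler

end

open BianchiEuler

noncomputable section

namespace BianchiEuler

open scoped Matrix
open Finset (sum_comm sum_add_distrib sum_sub_distrib sum_neg_distrib sum_const_zero smul_sum mul_sum sum_mul)
open Matrix (of of_apply transpose_apply transpose_mul transpose_transpose map_apply trace_mul_comm trace transpose_add mulVec_mulVec one_mulVec trace_add transpose_smul trace_sub trace_smul)

/-- `4 × 4` matrices. -/
abbrev Mat4 (A : Type*) := Matrix (Fin 4) (Fin 4) A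

/-- Local coordinates on `S`. -/
abbrev Chart (S : Type*) [TopologicalSpace S] := OpenPartialHomeomorph S E3

/-- The charts of the smooth structure. -/
abbrev smoothAtlas (S : Type*) [TopologicalSpace S] [ChartedSpace E3 S] :=
  IsManifold.maximalAtlas 𝓘(ℝ, E3) ∞ S

notation "mfd" => mfderiv 𝓘(ℝ, E3) 𝓘(ℝ, E3)
notation "gI(" N "," h ")" => Matrix.of (frameMetricInv N h)
notation "pI(" N "," h ")" => Matrix.of (posMetricInv N h)

/-- Antisymmetry in the first pair of indices. -/
abbrev SkewLeft {A : Type*} [Neg A] (R : Fin 4 → Fin 4 → Fin 4 → Fin 4 → A) : Prop :=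
  ∀ α β l m, R α β l m = -R β α l m

/-- Antisymmetry in the second pair of indices. -/
abbrev SkewRight {A : Type*} [Neg A] (R : Fin 4 → Fin 4 → Fin 4 → Fin 4 → A) : Prop :=
  ∀ α β l m, R α β l m = -R α β m l

lemma sum_ext {ι A : Type*} [Fintype ι] [AddCommMonoid A] {f g : ι → A} (h : ∀ i, f i = g i) :
    ∑ i, f i = ∑ i, g i := Fintype.sum_congr f g h

/-! ### Moving frames over an algebra with derivations -/

/-- A moving frame over a commutative algebra: four derivations `D α` (the frame vectors), their
structure coefficients `[e_α, e_β] = br γ α β e_γ`, and a metric with its inverse. -/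
structure Frame (A : Type*) [CommRing A] [Algebra ℝ A] where
  D : Fin 4 → Derivation ℝ A A
  br : Fin 4 → Fin 4 → Fin 4 → A
  g : Mat4 A
  gi : Mat4 A
  g_symm : ∀ α β, g α β = g β α
  gi_symm : ∀ α β, gi α β = gi β α
  g_mul_gi : g * gi = 1
  br_antisymm : ∀ γ α β, br γ α β = -br γ β α
  comm : ∀ α β φ, D α (D β φ) - D β (D α φ) = ∑ γ, br γ α β * D γ φ
  jacobi : ∀ δ α β γ, D α (br δ β γ) + D β (br δ γ α) + D γ (br δ α β)
    + ∑ ε, (br ε β γ * br δ α ε + br ε γ α * br δ β ε + br ε α β * br δ γ ε) = 0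

lemma half_smul_eq {A : Type*} [CommRing A] [Algebra ℝ A] {x y : A} (h : x = y + y) :
    (1 / 2 : ℝ) • x = y := by
  rw [h, ← two_smul ℝ y, smul_smul]; norm_num

namespace Frame

variable {A : Type*} [CommRing A] [Algebra ℝ A] (G : Frame A)

lemma gi_mul_g : G.gi * G.g = 1 := mul_eq_one_comm.mp G.g_mul_gi

/-- Connection coefficients, `∇_{e_β} e_γ = ω^α_{βγ} e_α`. -/
def omega (α β γ : Fin 4) : A :=
  (1 / 2 : ℝ) • ∑ δ, G.gi α δ *
    (G.D β (G.g γ δ) + G.D γ (G.g β δ) - G.D δ (G.g β γ)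
      + ∑ ε, (G.br ε β γ * G.g ε δ - G.br ε β δ * G.g ε γ - G.br ε γ δ * G.g ε β))

/-- `R^α_{β,λμ}` -/
def riemUp (α β l m : Fin 4) : A :=
  G.D l (G.omega α m β) - G.D m (G.omega α l β)
    + ∑ ε, (G.omega α l ε * G.omega ε m β - G.omega α m ε * G.omega ε l β
        - G.br ε l m * G.omega α ε β)

/-- `R_{αβ,λμ}` -/
def riem (α β l m : Fin 4) : A := ∑ ε, G.g α ε * G.riemUp ε β l m

/-- `R_{βμ} = R^α_{β,αμ}` -/
def ricci (β m : Fin 4) : A := ∑ α, G.riemUp α β α m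

/-- `∇_γ X_β` -/
def nabla1 (X : Fin 4 → A) (γ β : Fin 4) : A := G.D γ (X β) - ∑ ε, G.omega ε γ β * X ε

/-- `∇_γ X_{αβ}` -/
def nabla2 (X : Fin 4 → Fin 4 → A) (γ α β : Fin 4) : A :=
  G.D γ (X α β) - ∑ ε, (G.omega ε γ α * X ε β + G.omega ε γ β * X α ε)

/-- `∇_γ X_{αβ,lm}` -/
def nabla4 (X : Fin 4 → Fin 4 → Fin 4 → Fin 4 → A) (γ α β l m : Fin 4) : A :=
  G.D γ (X α β l m)
    - ∑ ε, (G.omega ε γ α * X ε β l m + G.omega ε γ β * X α ε l m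
        + G.omega ε γ l * X α β ε m + G.omega ε γ m * X α β l ε)

/-- The matrix `(ω^α_{γε})_{αε}`. -/
def W (γ : Fin 4) : Mat4 A := of fun α ε => G.omega α γ ε

/-- Derivative of the entries of a matrix. -/
def dM {m n : Type*} (γ : Fin 4) (X : Matrix m n A) : Matrix m n A := X.map (G.D γ)

/-- The curvature matrix `(R^α_{β,λμ})_{αβ}`. -/
def curv (l m : Fin 4) : Mat4 A := of fun α β => G.riemUp α β l m

section dM
variable {m n k : Type*}

lemma dM_apply (γ : Fin 4) (X : Matrix m k A) (i : m) (j : k) : G.dM γ X i j = G.D γ (X i j) := rfl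

lemma dM_mul [Fintype n] (γ : Fin 4) (X : Matrix m n A) (Y : Matrix n k A) :
    G.dM γ (X * Y) = G.dM γ X * Y + X * G.dM γ Y := by
  ext i j
  simp only [dM_apply, Matrix.mul_apply, Matrix.add_apply, map_sum, Derivation.leibniz, smul_eq_mul,
    sum_add_distrib]
  rw [add_comm]
  congr 1
  exact sum_ext fun x => mul_comm _ _

lemma dM_add (γ : Fin 4) (X Y : Matrix m k A) : G.dM γ (X + Y) = G.dM γ X + G.dM γ Y := by
  ext i j; simp [dM_apply]

lemma dM_sub (γ : Fin 4) (X Y : Matrix m k A) : G.dM γ (X - Y) = G.dM γ X - G.dM γ Y := by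
  ext i j; simp [dM_apply]

lemma dM_transpose (γ : Fin 4) (X : Matrix m k A) : G.dM γ Xᵀ = (G.dM γ X)ᵀ := by
  ext i j; simp [dM_apply]

lemma dM_smul (γ : Fin 4) (a : A) (X : Matrix m k A) :
    G.dM γ (a • X) = G.D γ a • X + a • G.dM γ X := by
  ext i j; simp [dM_apply]; ring

lemma dM_sum {ι : Type*} (s : Finset ι) (γ : Fin 4) (X : ι → Matrix m k A) :
    G.dM γ (∑ i ∈ s, X i) = ∑ i ∈ s, G.dM γ (X i) := by
  ext i j; simp [dM_apply, Matrix.sum_apply]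

lemma dM_one [DecidableEq n] (γ : Fin 4) : G.dM γ (1 : Matrix n n A) = 0 := by
  ext i j
  by_cases h : i = j
  · subst h; simp [dM_apply]
  · simp [dM_apply, Matrix.one_apply_ne h]

lemma dM_comm (α β : Fin 4) (X : Matrix m k A) :
    G.dM α (G.dM β X) - G.dM β (G.dM α X) = ∑ γ, G.br γ α β • G.dM γ X := by
  ext i j
  simp [dM_apply, Matrix.sum_apply, G.comm]

lemma D_trace [Fintype n] (γ : Fin 4) (X : Matrix n n A) : G.D γ X.trace = (G.dM γ X).trace := by
  simp [trace, dM_apply]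

end dM

lemma curv_eq (l m : Fin 4) : G.curv l m = G.dM l (G.W m) - G.dM m (G.W l) + G.W l * G.W m
    - G.W m * G.W l - ∑ ε, G.br ε l m • G.W ε := by
  ext α β
  simp only [curv, riemUp, of_apply, Matrix.add_apply, Matrix.sub_apply, dM_apply, W,
    Matrix.mul_apply, Matrix.sum_apply, Matrix.smul_apply, smul_eq_mul, sum_sub_distrib]
  ring

lemma g_mul_omega (δ β γ : Fin 4) : ∑ α, G.g δ α * G.omega α β γ
    = (1 / 2 : ℝ) • (G.D β (G.g γ δ) + G.D γ (G.g β δ) - G.D δ (G.g β γ)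
    + ∑ ε, (G.br ε β γ * G.g ε δ - G.br ε β δ * G.g ε γ - G.br ε γ δ * G.g ε β)) := by
  set k : Fin 4 → A := fun δ => G.D β (G.g γ δ) + G.D γ (G.g β δ) - G.D δ (G.g β γ)
      + ∑ ε, (G.br ε β γ * G.g ε δ - G.br ε β δ * G.g ε γ - G.br ε γ δ * G.g ε β) with hk
  have h1 : ∀ α, G.omega α β γ = (1 / 2 : ℝ) • (G.gi.mulVec k) α := fun α => rfl
  simp only [h1, mul_smul_comm, ← smul_sum]
  congr 1
  change (G.g.mulVec (G.gi.mulVec k)) δ = k δ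
  rw [mulVec_mulVec, G.g_mul_gi, one_mulVec]

lemma torsion (γ α β : Fin 4) : G.omega γ α β - G.omega γ β α = G.br γ α β := by
  have key : G.g.mulVec (fun γ => G.omega γ α β - G.omega γ β α)
      = G.g.mulVec fun γ => G.br γ α β := by
    ext δ
    have h1 := G.g_mul_omega δ α β
    have h2 := G.g_mul_omega δ β α
    simp only [Matrix.mulVec, dotProduct, mul_sub, sum_sub_distrib, h1, h2]
    rw [← smul_sub]
    have e : ∀ ε, G.br ε β α = -G.br ε α β := fun ε => G.br_antisymm _ _ _
    simp only [e, G.g_symm β α, neg_mul, sum_neg_distrib]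
    have e3 : ∑ x, G.g δ x * G.br x α β = ∑ x, G.br x α β * G.g x δ :=
      sum_ext fun x => by rw [G.g_symm δ x, mul_comm]
    rw [e3]
    exact half_smul_eq (by ring)
  have := congrArg (G.gi.mulVec) key
  rw [mulVec_mulVec, mulVec_mulVec, G.gi_mul_g, one_mulVec, one_mulVec] at this
  exact congrFun this γ

lemma metric_compat (γ α β : Fin 4) :
    G.D γ (G.g α β) = ∑ ε, G.g α ε * G.omega ε γ β + ∑ ε, G.g β ε * G.omega ε γ α := by
  rw [G.g_mul_omega, G.g_mul_omega, ← smul_add]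
  have e : ∀ ε, G.br ε β α = -G.br ε α β := fun ε => G.br_antisymm _ _ _
  simp only [e, G.g_symm β α, neg_mul, sum_sub_distrib, sum_neg_distrib]
  exact (half_smul_eq (by ring)).symm

lemma dM_g (γ : Fin 4) : G.dM γ G.g = G.g * G.W γ + (G.W γ)ᵀ * G.g := by
  ext α β
  simp only [dM_apply, Matrix.add_apply, Matrix.mul_apply, W, of_apply, transpose_apply,
    G.metric_compat γ α β]
  congr 1
  exact sum_ext fun x => by rw [G.g_symm β x, mul_comm]

lemma dM_gi (γ : Fin 4) : G.dM γ G.gi = -(G.W γ * G.gi) - G.gi * (G.W γ)ᵀ := by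
  have h := congrArg (G.dM γ) G.g_mul_gi
  rw [dM_mul, dM_one, dM_g] at h
  have h2 := congrArg (G.gi * ·) h
  simp only [mul_add, add_mul, mul_zero, ← mul_assoc, G.gi_mul_g, one_mul] at h2
  simp only [mul_assoc, G.g_mul_gi, mul_one] at h2
  rw [eq_sub_iff_add_eq, eq_neg_iff_add_eq_zero, ← h2]
  abel

lemma g_transpose : G.gᵀ = G.g := by ext i j; exact G.g_symm _ _

/-- The curvature matrix is skew with respect to the metric. -/
lemma g_mul_curv_skew (l m : Fin 4) : G.g * G.curv l m + (G.curv l m)ᵀ * G.g = 0 := by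
  have h := G.dM_comm l m G.g
  simp only [dM_g, dM_add, dM_mul, dM_transpose] at h
  have hs : ∑ γ, G.br γ l m • (G.g * G.W γ + (G.W γ)ᵀ * G.g)
      = G.g * (∑ γ, G.br γ l m • G.W γ) + (∑ γ, G.br γ l m • G.W γ)ᵀ * G.g := by
    simp only [smul_add, sum_add_distrib, Matrix.mul_sum, Matrix.mul_smul, Matrix.transpose_sum,
      transpose_smul, Matrix.sum_mul, Matrix.smul_mul]
  rw [hs] at h
  rw [curv_eq]
  simp only [Matrix.transpose_sub, transpose_add, transpose_mul]
  rw [← sub_eq_zero] at h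
  rw [← h]
  noncomm_ring

lemma riem_eq (α β l m : Fin 4) : G.riem α β l m = (G.g * G.curv l m) α β := rfl

lemma riem_antisymm_left (α β l m : Fin 4) : G.riem α β l m = -G.riem β α l m := by
  have h := congrFun (congrFun (G.g_mul_curv_skew l m) α) β
  simp only [Matrix.add_apply, Matrix.zero_apply] at h
  have h2 : ((G.curv l m)ᵀ * G.g) α β = (G.g * G.curv l m) β α := by
    rw [← transpose_apply (G.g * G.curv l m), transpose_mul, G.g_transpose]
  rw [riem_eq, riem_eq, ← h2]
  exact eq_neg_of_add_eq_zero_left h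

lemma curv_antisymm (l m : Fin 4) : G.curv l m = -G.curv m l := by
  have : ∀ ε, G.br ε l m = -G.br ε m l := fun ε => G.br_antisymm _ _ _
  rw [curv_eq, curv_eq]
  simp only [this, neg_smul, sum_neg_distrib]
  abel

lemma riem_antisymm_right (α β l m : Fin 4) : G.riem α β l m = -G.riem α β m l := by
  rw [riem_eq, curv_antisymm, riem_eq, mul_neg, Matrix.neg_apply]

lemma riemUp_cyclic (α β l m : Fin 4) :
    G.riemUp α β l m + G.riemUp α l m β + G.riemUp α m β l = 0 := by
  have t : ∀ γ α β, G.omega γ α β = G.omega γ β α + G.br γ α β := fun γ α β => by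
    rw [← G.torsion]; ring
  have h := G.jacobi α l m β
  simp only [riemUp]
  rw [t α m β, t α β l, t α l m]
  simp only [map_add, sum_sub_distrib, sum_add_distrib] at h ⊢
  have e1 : ∀ a b c : Fin 4, ∑ ε, G.omega α a ε * G.omega ε b c
      = ∑ ε, G.omega α a ε * G.omega ε c b + ∑ ε, G.omega α a ε * G.br ε b c := fun a b c => by
    rw [← sum_add_distrib]
    exact sum_ext fun x => by rw [t x b c]; ring
  have e2 : ∀ a b c : Fin 4, ∑ ε, G.br ε b c * G.omega α ε a
      = ∑ ε, G.omega α a ε * G.br ε b c - ∑ ε, G.br ε b c * G.br α a ε := fun a b c => by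
    rw [← sum_sub_distrib]
    exact sum_ext fun x => by rw [t α a x]; ring
  rw [e1 l m β, e1 m β l, e1 β l m, e2 β l m, e2 l m β, e2 m β l]
  rw [← h]
  ring

lemma riem_cyclic (α β l m : Fin 4) : G.riem α β l m + G.riem α l m β + G.riem α m β l = 0 := by
  simp only [riem, ← sum_add_distrib, ← mul_add, G.riemUp_cyclic, mul_zero, sum_const_zero]

lemma riem_pair_symm (α β l m : Fin 4) : G.riem α β l m = G.riem l m α β := by
  have c1 := G.riem_cyclic α β l m
  have c2 := G.riem_cyclic β l m α
  have c3 := G.riem_cyclic l m α β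
  have c4 := G.riem_cyclic m α β l
  have a1 := G.riem_antisymm_left
  have a2 := G.riem_antisymm_right
  have h : G.riem α β l m - G.riem l m α β + (G.riem α β l m - G.riem l m α β) = 0 := by
    rw [a2 β l m α, a1 β m α l, a1 β α l m] at c2
    rw [a1 l α β m, a2 α l β m, a1 l β m α, a2 β l m α] at c3
    rw [a1 m α β l, a2 m β l α, a1 m l α β] at c4
    linear_combination c1 - c2 - c3 + c4
  rw [← sub_eq_zero, ← half_smul_eq h.symm, smul_zero]

end Frame

lemma entry_congr {m n A : Type*} {X Y : Matrix m n A} (h : X = Y) (i : m) (j : n) :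
    X i j = Y i j := by rw [h]

namespace Frame

variable {A : Type*} [CommRing A] [Algebra ℝ A] (G : Frame A)

/-- The covariant derivative `(∇_κ R^α_{β,lm})_{αβ}` of the curvature. -/
def nablaCurv (κ l m : Fin 4) : Mat4 A :=
  G.dM κ (G.curv l m) + G.W κ * G.curv l m - G.curv l m * G.W κ
    - ∑ ε, (G.omega ε κ l • G.curv ε m + G.omega ε κ m • G.curv l ε)

lemma nabla4_riem (κ α β l m : Fin 4) :
    G.nabla4 G.riem κ α β l m = (G.g * G.nablaCurv κ l m) α β := by
  have h : G.D κ (G.riem α β l m) = (G.dM κ (G.g * G.curv l m)) α β := rfl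
  have h1 : ∑ ε, G.omega ε κ α * G.riem ε β l m = ((G.W κ)ᵀ * (G.g * G.curv l m)) α β := rfl
  have h2 : ∑ ε, G.omega ε κ β * G.riem α ε l m = ((G.g * G.curv l m) * G.W κ) α β :=
    sum_ext fun x => mul_comm _ _
  have h3 : ∀ (c : Fin 4 → A) (F : Fin 4 → Mat4 A),
      ∑ ε, c ε * (G.g * F ε) α β = (G.g * ∑ ε, c ε • F ε) α β := fun c F => by
    simp [Matrix.mul_sum, Matrix.sum_apply]
  rw [nabla4, sum_add_distrib, sum_add_distrib, sum_add_distrib, h, h1, h2]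
  simp only [riem_eq, h3]
  rw [dM_mul, dM_g, ← Matrix.add_apply, ← Matrix.add_apply, ← Matrix.add_apply, ← Matrix.sub_apply,
    nablaCurv, sum_add_distrib]
  exact entry_congr (by noncomm_ring) _ _

lemma nablaCurv_antisymm (κ l m : Fin 4) : G.nablaCurv κ l m = -G.nablaCurv κ m l := by
  have h : ∀ a b, G.curv a b = -G.curv b a := G.curv_antisymm
  have h0 : G.dM κ (-G.curv m l) = -G.dM κ (G.curv m l) := by
    ext i j; simp [dM_apply]
  have h1 : ∑ ε, (G.omega ε κ l • G.curv ε m + G.omega ε κ m • G.curv l ε)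
      = -∑ ε, (G.omega ε κ m • G.curv ε l + G.omega ε κ l • G.curv m ε) := by
    rw [← sum_neg_distrib]
    refine sum_ext fun ε => ?_
    rw [h ε m, h l ε, smul_neg, smul_neg]; abel
  rw [nablaCurv, nablaCurv, h1, h l m, h0]
  noncomm_ring

lemma curv_bianchi (κ l m : Fin 4) : (G.dM κ (G.curv l m) + G.W κ * G.curv l m - G.curv l m * G.W κ
    - ∑ ε, G.br ε κ l • G.curv ε m) + (G.dM l (G.curv m κ) + G.W l * G.curv m κ - G.curv m κ * G.W l
    - ∑ ε, G.br ε l m • G.curv ε κ) + (G.dM m (G.curv κ l) + G.W m * G.curv κ l - G.curv κ l * G.W m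
    - ∑ ε, G.br ε m κ • G.curv ε l) = 0 := by
  have hbr : ∀ a b c, ∑ ε, G.br ε a b • G.curv ε c = ∑ ε, G.br ε a b • G.dM ε (G.W c)
      - ∑ ε, G.br ε a b • G.dM c (G.W ε) + (∑ ε, G.br ε a b • G.W ε) * G.W c
      - G.W c * (∑ ε, G.br ε a b • G.W ε) + ∑ ε, (∑ δ, G.br δ a b * G.br ε c δ) • G.W ε := fun a b
      c => by
    have e1 : ∑ ε, (∑ δ, G.br δ a b * G.br ε c δ) • G.W ε
        = -∑ ε, G.br ε a b • ∑ δ, G.br δ ε c • G.W δ := by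
      simp only [Finset.sum_smul, smul_sum, smul_smul]
      rw [sum_comm, ← sum_neg_distrib]
      refine sum_ext fun ε => ?_
      rw [← sum_neg_distrib]
      refine sum_ext fun δ => ?_
      rw [G.br_antisymm δ c ε, mul_neg, neg_smul]
    rw [e1]
    simp only [curv_eq, smul_sub, smul_add, sum_sub_distrib, sum_add_distrib, Matrix.sum_mul,
      Matrix.mul_sum, Matrix.smul_mul, Matrix.mul_smul]
    abel
  have hd : ∀ a b c, G.dM a (∑ ε, G.br ε b c • G.W ε)
      = ∑ ε, G.D a (G.br ε b c) • G.W ε + ∑ ε, G.br ε b c • G.dM a (G.W ε) := fun a b c => by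
    rw [dM_sum, ← sum_add_distrib]
    exact sum_ext fun ε => by rw [dM_smul]
  have hc := fun a b c => G.dM_comm a b (G.W c)
  have hj : ∑ ε, G.D κ (G.br ε l m) • G.W ε + ∑ ε, G.D l (G.br ε m κ) • G.W ε
      + ∑ ε, G.D m (G.br ε κ l) • G.W ε + ∑ ε, (∑ δ, G.br δ l m * G.br ε κ δ) • G.W ε
      + ∑ ε, (∑ δ, G.br δ m κ * G.br ε l δ) • G.W ε + ∑ ε, (∑ δ, G.br δ κ l * G.br ε m δ) • G.W ε
      = 0 := by
    simp only [← sum_add_distrib, ← add_smul]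
    refine Finset.sum_eq_zero fun ε _ => ?_
    have := G.jacobi ε κ l m
    simp only [sum_add_distrib] at this
    rw [show ∀ x : A, x = 0 → x • G.W ε = 0 from fun x hx => by rw [hx, zero_smul]]
    rw [← this]; abel
  simp only [hbr]
  rw [← hc κ l m, ← hc l m κ, ← hc m κ l]
  simp only [curv_eq, dM_add, dM_sub, dM_mul, hd]
  rw [← neg_eq_zero, ← hj]
  noncomm_ring

lemma nablaCurv_bianchi (κ l m : Fin 4) :
    G.nablaCurv κ l m + G.nablaCurv l m κ + G.nablaCurv m κ l = 0 := by
  rw [← G.curv_bianchi κ l m]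
  have h : ∀ a b c, ∑ ε, G.br ε a b • G.curv ε c
      = ∑ ε, G.omega ε a b • G.curv ε c + ∑ ε, G.omega ε b a • G.curv c ε := fun a b c => by
    rw [← sum_add_distrib]
    refine sum_ext fun ε => ?_
    rw [← G.torsion, sub_smul, G.curv_antisymm c ε, smul_neg, sub_eq_add_neg]
  simp only [nablaCurv, h, sum_add_distrib]
  abel

lemma riem_bianchi (κ α β l m : Fin 4) :
    G.nabla4 G.riem κ α β l m + G.nabla4 G.riem l α β m κ + G.nabla4 G.riem m α β κ l = 0 := by
  simp only [nabla4_riem, ← Matrix.add_apply, ← mul_add, nablaCurv_bianchi, mul_zero,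
    Matrix.zero_apply]

lemma nabla4_pair_symm (κ α β l m : Fin 4) :
    G.nabla4 G.riem κ α β l m = G.nabla4 G.riem κ l m α β := by
  simp only [nabla4]
  rw [G.riem_pair_symm α β l m]
  congr 1
  refine sum_ext fun ε => ?_
  rw [G.riem_pair_symm ε β, G.riem_pair_symm α ε, G.riem_pair_symm α β ε, G.riem_pair_symm α β l]
  ring

lemma nabla4_antisymm_left (κ α β l m : Fin 4) :
    G.nabla4 G.riem κ α β l m = -G.nabla4 G.riem κ β α l m := by
  rw [nabla4_pair_symm, nabla4_riem, nablaCurv_antisymm, nabla4_pair_symm, nabla4_riem, mul_neg,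
    Matrix.neg_apply]

/-- The Bianchi identities on the first pair of indices. -/
lemma riem_bianchi_left (h k l m : Fin 4) :
    G.nabla4 G.riem 0 h k l m + G.nabla4 G.riem k 0 h l m - G.nabla4 G.riem h 0 k l m = 0 := by
  have := G.riem_bianchi 0 l m h k
  rw [G.nabla4_pair_symm 0 l m, G.nabla4_pair_symm h l m, G.nabla4_pair_symm k l m,
    G.nabla4_antisymm_left h k 0] at this
  rw [← this]; ring

lemma nabla2_ricci (κ β m : Fin 4) : G.nabla2 G.ricci κ β m = ∑ α, G.nablaCurv κ α m α β := by
  have e : ∑ α, (G.W κ * G.curv α m) α β = ∑ α, ∑ ε, (G.omega ε κ α • G.curv ε m) α β := by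
    simp only [Matrix.mul_apply, W, of_apply, Matrix.smul_apply, smul_eq_mul]
    rw [sum_comm]
  have e2 : ∑ ε, G.omega ε κ β * G.ricci ε m = ∑ α, (G.curv α m * G.W κ) α β := by
    simp only [ricci, Matrix.mul_apply, W, of_apply, curv, mul_sum]
    rw [sum_comm]
    exact sum_ext fun _ => sum_ext fun _ => mul_comm _ _
  have e3 : ∑ ε, G.omega ε κ m * G.ricci β ε = ∑ α, ∑ ε, (G.omega ε κ m • G.curv α ε) α β := by
    simp only [ricci, Matrix.smul_apply, smul_eq_mul, curv, of_apply, mul_sum]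
    rw [sum_comm]
  have e4 : G.D κ (G.ricci β m) = ∑ α, (G.dM κ (G.curv α m)) α β := by
    simp [ricci, dM_apply, curv]
  simp only [nabla2, nablaCurv, Matrix.sub_apply, Matrix.add_apply, Matrix.sum_apply,
    sum_sub_distrib, sum_add_distrib, e, e2, e3, e4]
  ring

lemma riem_divergence (i l m : Fin 4) : ∑ α, ∑ β, G.gi α β * G.nabla4 G.riem α β i l m
    = G.nabla2 G.ricci l i m - G.nabla2 G.ricci m i l := by
  have h : ∀ α, ∑ β, G.gi α β * G.nabla4 G.riem α β i l m = G.nablaCurv α l m α i := fun α => by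
    simp only [nabla4_riem]
    change (G.gi * (G.g * G.nablaCurv α l m)) α i = _
    rw [← mul_assoc, G.gi_mul_g, one_mul]
  simp only [h, nabla2_ricci, ← sum_sub_distrib]
  refine sum_ext fun α => ?_
  have hb := congrFun (congrFun (G.nablaCurv_bianchi α l m) α) i
  rw [G.nablaCurv_antisymm l m α] at hb
  simp only [Matrix.add_apply, Matrix.neg_apply, Matrix.zero_apply] at hb
  linear_combination hb

/-- The Ricci identity for covectors. -/
lemma nabla2_nabla1_comm (X : Fin 4 → A) (γ α β : Fin 4) : G.nabla2 (G.nabla1 X) γ α β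
    - G.nabla2 (G.nabla1 X) α γ β = -∑ ε, G.riemUp ε β γ α * X ε := by
  set x : Matrix (Fin 1) (Fin 4) A := of fun _ β => X β with hx
  have h1 : ∀ γ β, G.nabla1 X γ β = (G.dM γ x - x * G.W γ) 0 β := fun γ β => by
    simp only [nabla1, Matrix.sub_apply, dM_apply, Matrix.mul_apply, hx, of_apply, W]
    congr 1
    exact sum_ext fun _ => mul_comm _ _
  have h2 : ∀ γ α β, G.nabla2 (G.nabla1 X) γ α β = (G.dM γ (G.dM α x - x * G.W α)
      - (G.dM α x - x * G.W α) * G.W γ - ∑ ε, G.omega ε γ α • (G.dM ε x - x * G.W ε)) 0 β := fun γ α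
      β => by
    simp only [nabla2, sum_add_distrib]
    have e1 : ∑ ε, G.omega ε γ β * G.nabla1 X α ε = ((G.dM α x - x * G.W α) * G.W γ) 0 β := by
      rw [Matrix.mul_apply]
      exact sum_ext fun ε => by rw [← h1, mul_comm]; rfl
    have e2 : ∑ ε, G.omega ε γ α * G.nabla1 X ε β
        = (∑ ε, G.omega ε γ α • (G.dM ε x - x * G.W ε)) 0 β := by
      rw [Matrix.sum_apply]
      exact sum_ext fun ε => by rw [h1]; rfl
    rw [e1, e2, h1, ← dM_apply, Matrix.sub_apply, Matrix.sub_apply]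
    ring
  have h3 : ∑ ε, G.riemUp ε β γ α * X ε = (x * G.curv γ α) 0 β :=
    sum_ext fun ε => mul_comm _ _
  rw [h2, h2, h3, ← Matrix.sub_apply, ← Matrix.neg_apply]
  refine entry_congr ?_ _ _
  have h4 : ∑ ε, G.omega ε γ α • (G.dM ε x - x * G.W ε) - ∑ ε, G.omega ε α γ •
      (G.dM ε x - x * G.W ε) = ∑ ε, G.br ε γ α • G.dM ε x - x * ∑ ε, G.br ε γ α • G.W ε := by
    simp only [← G.torsion, Matrix.mul_sum, ← sum_sub_distrib, sub_smul, smul_sub, Matrix.mul_sub,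
      Matrix.mul_smul]
    refine sum_ext fun ε => ?_
    abel
  rw [← G.dM_comm] at h4
  rw [curv_eq]
  simp only [Matrix.mul_sub, Matrix.mul_add, Matrix.sub_mul, dM_sub, dM_mul, ← Matrix.mul_assoc]
  rw [← sub_eq_zero] at h4 ⊢
  rw [← neg_eq_zero, ← h4]
  abel

end Frame

/-! ### Change of frame -/

/-- The frame `G` is obtained from `G'` by the change of coordinates `pull` and the change of frame
`e_α = L^β_α e'_β`. -/
structure FrameChange {A A' : Type*} [CommRing A] [Algebra ℝ A] [CommRing A'] [Algebra ℝ A']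
    (G : Frame A) (G' : Frame A') where
  pull : A' →ₐ[ℝ] A
  L : Mat4 A
  Li : Mat4 A
  L_mul_Li : L * Li = 1
  D_pull : ∀ α φ, G.D α (pull φ) = ∑ β, L β α * pull (G'.D β φ)
  g_eq : G.g = Lᵀ * G'.g.map pull * L
  br_eq : ∀ δ α β, ∑ γ, L δ γ * G.br γ α β = G.D α (L δ β) - G.D β (L δ α)
    + ∑ σ, ∑ τ, L σ α * L τ β * pull (G'.br δ σ τ)

namespace Frame

variable {A : Type*} [CommRing A] [Algebra ℝ A] (G : Frame A)

/-- The Levi-Civita connection is the only metric connection without torsion. -/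
lemma W_unique (V : Fin 4 → Mat4 A) (ht : ∀ α β γ, V β α γ - V γ α β = G.br α β γ)
    (hm : ∀ γ, G.dM γ G.g = G.g * V γ + (V γ)ᵀ * G.g) (β : Fin 4) : V β = G.W β := by
  set x : Fin 4 → Mat4 A := fun β => G.g * (V β - G.W β) with hx
  have h1 : ∀ δ β γ, x β δ γ = x γ δ β := fun δ β γ => by
    simp only [hx, Matrix.mul_apply, Matrix.sub_apply]
    refine sum_ext fun α => ?_
    have e1 := ht α β γ
    have e2 := G.torsion α β γ
    simp only [W, of_apply]
    linear_combination G.g δ α * e1 - G.g δ α * e2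
  have h2 : ∀ δ β γ, x β δ γ = -x β γ δ := fun δ β γ => by
    have e := (hm β).symm.trans (G.dM_g β)
    have e2 : x β + (x β)ᵀ = 0 := by
      simp only [hx, transpose_mul, G.g_transpose, Matrix.transpose_sub]
      rw [← sub_eq_zero] at e
      rw [← e]; noncomm_ring
    exact eq_neg_of_add_eq_zero_left (entry_congr e2 δ γ)
  have h3 : ∀ δ β γ, x β δ γ = 0 := fun δ β γ => by
    have : (0 : A) = x β δ γ + x β δ γ := by
      have a1 := h2 δ β γ
      have a2 := h1 γ β δ
      have a3 := h2 γ δ β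
      have a4 := h1 β δ γ
      have a5 := h2 β γ δ
      have a6 := h1 δ γ β
      linear_combination -a1 + a2 + a3 - a4 - a5 + a6
    rw [← half_smul_eq this, smul_zero]
  have h4 : x β = 0 := by ext δ γ; exact h3 δ β γ
  have h5 := congrArg (G.gi * ·) h4
  simp only [hx, ← mul_assoc, G.gi_mul_g, one_mul, mul_zero] at h5
  exact sub_eq_zero.mp h5

/-- `∇_γ Y^α` -/
def nablaUp (Y : Fin 4 → A) (γ α : Fin 4) : A := G.D γ (Y α) + ∑ ε, G.omega α γ ε * Y ε

end Frame

namespace FrameChange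

variable {A A' : Type*} [CommRing A] [Algebra ℝ A] [CommRing A'] [Algebra ℝ A']
    {G : Frame A} {G' : Frame A'} (Θ : FrameChange G G')

lemma Li_mul_L : Θ.Li * Θ.L = 1 := mul_eq_one_comm.mp Θ.L_mul_Li

/-- Pulled back matrices. -/
def pm {m n : Type*} (X : Matrix m n A') : Matrix m n A := X.map Θ.pull

lemma pm_mul {m n k : Type*} [Fintype n] (X : Matrix m n A') (Y : Matrix n k A') :
    Θ.pm (X * Y) = Θ.pm X * Θ.pm Y := by
  ext i j; simp [pm, Matrix.mul_apply]

lemma pm_sub {m n : Type*} (X Y : Matrix m n A') : Θ.pm (X - Y) = Θ.pm X - Θ.pm Y := by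
  ext i j; simp [pm]

lemma pm_add {m n : Type*} (X Y : Matrix m n A') : Θ.pm (X + Y) = Θ.pm X + Θ.pm Y := by
  ext i j; simp [pm]

lemma pm_transpose {m n : Type*} (X : Matrix m n A') : Θ.pm Xᵀ = (Θ.pm X)ᵀ := rfl

lemma dM_pm {m n : Type*} (α : Fin 4) (X : Matrix m n A') :
    G.dM α (Θ.pm X) = ∑ β, Θ.L β α • Θ.pm (G'.dM β X) := by
  ext i j
  simp [Frame.dM_apply, pm, Θ.D_pull, Matrix.sum_apply]

/-- `L^σ_β ω'_σ` -/
def Wt (β : Fin 4) : Mat4 A := ∑ σ, Θ.L σ β • Θ.pm (G'.W σ)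

lemma Wt_mul_L_apply (β δ γ : Fin 4) : (Θ.Wt β * Θ.L) δ γ
    = ∑ σ, ∑ τ, Θ.L σ β * Θ.L τ γ * Θ.pull (G'.omega δ σ τ) := by
  rw [Wt, Matrix.sum_mul, Matrix.sum_apply]
  refine sum_ext fun σ => ?_
  rw [Matrix.smul_mul, Matrix.smul_apply, Matrix.mul_apply, smul_eq_mul, mul_sum]
  refine sum_ext fun τ => ?_
  simp only [pm, map_apply, Frame.W, of_apply]
  ring

lemma L_mul_W (β : Fin 4) : Θ.L * G.W β = G.dM β Θ.L + Θ.Wt β * Θ.L := by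
  set V : Fin 4 → Mat4 A := fun β =>
    Θ.Li * (G.dM β Θ.L + Θ.Wt β * Θ.L) with hV
  have hLV : ∀ β, Θ.L * V β = G.dM β Θ.L + Θ.Wt β * Θ.L := fun β => by
    rw [hV, ← mul_assoc, Θ.L_mul_Li, one_mul]
  rw [← G.W_unique V ?_ ?_ β, hLV]
  · intro α β γ
    have h : Θ.L.mulVec (fun α => V β α γ - V γ α β) = Θ.L.mulVec fun α => G.br α β γ := by
      ext δ
      have e1 : ∀ β γ, ∑ α, Θ.L δ α * V β α γ = (Θ.L * V β) δ γ := fun β γ => rfl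
      simp only [Matrix.mulVec, dotProduct, mul_sub, sum_sub_distrib, e1, hLV, Matrix.add_apply,
        Wt_mul_L_apply, Θ.br_eq, Frame.dM_apply]
      rw [sum_comm (f := fun σ τ => Θ.L σ γ * Θ.L τ β * Θ.pull (G'.omega δ σ τ))]
      have e3 : ∑ σ, ∑ τ, Θ.L σ β * Θ.L τ γ * Θ.pull (G'.br δ σ τ)
          = ∑ σ, ∑ τ, Θ.L σ β * Θ.L τ γ * Θ.pull (G'.omega δ σ τ)
          - ∑ σ, ∑ τ, Θ.L τ γ * Θ.L σ β * Θ.pull (G'.omega δ τ σ) := by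
        simp only [← sum_sub_distrib]
        refine sum_ext fun σ => sum_ext fun τ => ?_
        rw [← G'.torsion, map_sub]; ring
      rw [e3]; ring
    have := congrArg Θ.Li.mulVec h
    rw [mulVec_mulVec, mulVec_mulVec, Θ.Li_mul_L, one_mulVec, one_mulVec] at this
    exact congrFun this α
  · intro γ
    have hg : G.g = Θ.Lᵀ * Θ.pm G'.g * Θ.L := Θ.g_eq
    have e1 : G.dM γ (Θ.pm G'.g) = Θ.pm G'.g * Θ.Wt γ + (Θ.Wt γ)ᵀ * Θ.pm G'.g := by
      simp only [dM_pm, Frame.dM_g, pm_add, pm_mul, pm_transpose, Wt, Matrix.transpose_sum,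
        transpose_smul, Matrix.mul_sum, Matrix.sum_mul, Matrix.mul_smul, Matrix.smul_mul,
        smul_add, sum_add_distrib]
    have e2 : G.g * V γ = Θ.Lᵀ * Θ.pm G'.g * (G.dM γ Θ.L + Θ.Wt γ * Θ.L) := by
      rw [hg, mul_assoc, hLV]
    have e3 : (V γ)ᵀ * G.g = (G.g * V γ)ᵀ := by
      rw [transpose_mul G.g, G.g_transpose]
    have e4 : (Θ.pm G'.g)ᵀ = Θ.pm G'.g := by rw [← pm_transpose, G'.g_transpose]
    rw [e3, e2, hg]
    simp only [Frame.dM_mul, Frame.dM_transpose, e1, transpose_mul, transpose_add,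
      transpose_transpose, e4]
    noncomm_ring

/-- The curvature of the second frame, transported to the first one. -/
def curvT (l m : Fin 4) : Mat4 A :=
  ∑ σ, ∑ τ, (Θ.L σ l * Θ.L τ m) • Θ.pm (G'.curv σ τ)

lemma dM_Wt (l m : Fin 4) : G.dM l (Θ.Wt m) = ∑ τ, G.D l (Θ.L τ m) • Θ.pm (G'.W τ)
    + ∑ σ, ∑ τ, (Θ.L σ l * Θ.L τ m) • Θ.pm (G'.dM σ (G'.W τ)) := by
  simp only [Wt, Frame.dM_sum, Frame.dM_smul, dM_pm, sum_add_distrib, smul_sum, smul_smul]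
  rw [sum_comm]
  simp only [mul_comm]

lemma Wt_mul_Wt (l m : Fin 4) : Θ.Wt l * Θ.Wt m
    = ∑ σ, ∑ τ, (Θ.L σ l * Θ.L τ m) • Θ.pm (G'.W σ * G'.W τ) := by
  simp only [Wt, Matrix.sum_mul, Matrix.mul_sum, Matrix.smul_mul, Matrix.mul_smul, pm_mul, smul_sum,
    smul_smul]
  rw [sum_comm]
  simp only [mul_comm]

lemma curvT_eq (l m : Fin 4) : Θ.curvT l m = G.dM l (Θ.Wt m) - G.dM m (Θ.Wt l)
    + Θ.Wt l * Θ.Wt m - Θ.Wt m * Θ.Wt l - ∑ ε, G.br ε l m • Θ.Wt ε := by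
  have swap : ∀ f : Fin 4 → Fin 4 → Mat4 A,
      ∑ σ, ∑ τ, (Θ.L σ m * Θ.L τ l) • f σ τ = ∑ σ, ∑ τ, (Θ.L σ l * Θ.L τ m) • f τ σ := fun f => by
    rw [sum_comm]; simp only [mul_comm]
  have e1 : ∑ ε, G.br ε l m • Θ.Wt ε = ∑ τ, G.D l (Θ.L τ m) • Θ.pm (G'.W τ)
      - ∑ τ, G.D m (Θ.L τ l) • Θ.pm (G'.W τ)
      + ∑ σ, ∑ τ, (Θ.L σ l * Θ.L τ m) • Θ.pm (∑ ε, G'.br ε σ τ • G'.W ε) := by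
    have : ∑ ε, G.br ε l m • Θ.Wt ε = ∑ δ, (∑ γ, Θ.L δ γ * G.br γ l m) • Θ.pm (G'.W δ) := by
      simp only [Wt, smul_sum, smul_smul, Finset.sum_smul]
      rw [sum_comm]; simp only [mul_comm]
    rw [this]
    simp only [Θ.br_eq, sub_smul, add_smul, sum_add_distrib, sum_sub_distrib]
    congr 1
    have hp : ∀ σ τ, Θ.pm (∑ ε, G'.br ε σ τ • G'.W ε)
        = ∑ ε, Θ.pull (G'.br ε σ τ) • Θ.pm (G'.W ε) := fun σ τ => by
      ext i j; simp [pm, Matrix.sum_apply]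
    simp only [hp, Finset.sum_smul, smul_sum, smul_smul]
    rw [sum_comm]
    exact sum_ext fun _ => sum_comm
  rw [e1, dM_Wt, dM_Wt, Wt_mul_Wt, Wt_mul_Wt, swap, swap]
  simp only [curvT, Frame.curv_eq, pm_sub, pm_add, smul_sub, smul_add, sum_sub_distrib,
    sum_add_distrib]
  abel

lemma L_mul_curv (l m : Fin 4) : Θ.L * G.curv l m = Θ.curvT l m * Θ.L := by
  have hd : ∀ l m, Θ.L * G.dM l (G.W m) = G.dM l (G.dM m Θ.L) + G.dM l (Θ.Wt m) * Θ.L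
      + Θ.Wt m * G.dM l Θ.L - G.dM l Θ.L * G.W m := fun l m => by
    have := congrArg (G.dM l) (Θ.L_mul_W m)
    simp only [Frame.dM_add, Frame.dM_mul] at this
    rw [eq_sub_iff_add_eq, add_comm, this]; abel
  have hs : Θ.L * ∑ ε, G.br ε l m • G.W ε
      = ∑ ε, G.br ε l m • G.dM ε Θ.L + (∑ ε, G.br ε l m • Θ.Wt ε) * Θ.L := by
    simp only [Matrix.mul_sum, Matrix.mul_smul, L_mul_W, Matrix.sum_mul, Matrix.smul_mul, smul_add,
      sum_add_distrib]
  have hw : ∀ l m, Θ.L * (G.W l * G.W m) = G.dM l Θ.L * G.W m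
      + Θ.Wt l * (G.dM m Θ.L + Θ.Wt m * Θ.L) := fun l m => by
    rw [← mul_assoc, L_mul_W, add_mul, mul_assoc, L_mul_W]
  rw [Frame.curv_eq, curvT_eq]
  simp only [mul_sub, mul_add, hd, hw, hs, ← G.dM_comm l m Θ.L]
  noncomm_ring

lemma riem_change (α β l m : Fin 4) : G.riem α β l m = ∑ σ, ∑ τ, Θ.L σ l * Θ.L τ m *
    (Θ.Lᵀ * Θ.pm (of fun a b => G'.riem a b σ τ) * Θ.L) α β := by
  have h : ∀ σ τ, Θ.pm (of fun a b => G'.riem a b σ τ)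
      = Θ.pm G'.g * Θ.pm (G'.curv σ τ) := fun σ τ => by rw [← pm_mul]; rfl
  have hg : G.g = Θ.Lᵀ * Θ.pm G'.g * Θ.L := Θ.g_eq
  rw [Frame.riem_eq, hg, mul_assoc, L_mul_curv, curvT]
  simp only [h, Matrix.sum_mul, Matrix.mul_sum, Matrix.smul_mul, Matrix.mul_smul, Matrix.sum_apply,
    Matrix.smul_apply, smul_eq_mul, mul_assoc]

lemma nabla1_change {X : Fin 4 → A} {X' : Fin 4 → A'} (hX : ∀ β, X β = ∑ σ, Θ.L σ β * Θ.pull (X' σ))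
    (γ β : Fin 4) : G.nabla1 X γ β = ∑ σ, ∑ τ, Θ.L σ γ * Θ.L τ β * Θ.pull (G'.nabla1 X' σ τ) := by
  have hW : ∀ δ, ∑ ε, Θ.L δ ε * G.omega ε γ β
      = G.D γ (Θ.L δ β) + ∑ σ, ∑ τ, Θ.L σ γ * Θ.L τ β * Θ.pull (G'.omega δ σ τ) := fun δ => by
    have := entry_congr (Θ.L_mul_W γ) δ β
    rwa [Matrix.add_apply, Wt_mul_L_apply] at this
  have h1 : ∑ ε, G.omega ε γ β * X ε = ∑ δ, Θ.pull (X' δ) * ∑ ε, Θ.L δ ε * G.omega ε γ β := by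
    simp only [hX, mul_sum]
    rw [sum_comm]
    exact sum_ext fun _ => sum_ext fun _ => by ring
  rw [Frame.nabla1, h1, hX]
  simp only [hW, map_sum, Derivation.leibniz, smul_eq_mul, Θ.D_pull, Frame.nabla1, map_sub, map_mul,
    mul_add, mul_sub, sum_add_distrib, sum_sub_distrib, mul_sum]
  have e1 : ∑ x, ∑ i, Θ.L x β * (Θ.L i γ * Θ.pull ((G'.D i) (X' x)))
      = ∑ x, ∑ y, Θ.L x γ * Θ.L y β * Θ.pull ((G'.D x) (X' y)) := by
    rw [sum_comm]
    exact sum_ext fun _ => sum_ext fun _ => by ring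
  have e2 : ∑ x, ∑ i, ∑ j, Θ.pull (X' x) * (Θ.L i γ * Θ.L j β * Θ.pull (G'.omega x i j))
      = ∑ x, ∑ y, ∑ i, Θ.L x γ * Θ.L y β * (Θ.pull (G'.omega i x y) * Θ.pull (X' i)) := by
    rw [sum_comm]
    refine sum_ext fun _ => ?_
    rw [sum_comm]
    exact sum_ext fun _ => sum_ext fun _ => by ring
  rw [e1, e2]
  ring

/-- Invariance of the divergence of a vector. -/
lemma divergence_change {Y : Fin 4 → A} {Y' : Fin 4 → A'} (hY : ∀ δ, ∑ α, Θ.L δ α * Y α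
    = Θ.pull (Y' δ)) : ∑ γ, G.nablaUp Y γ γ = Θ.pull (∑ γ, G'.nablaUp Y' γ γ) := by
  set y : Matrix (Fin 4) (Fin 1) A := of fun α _ => Y α with hy
  set y' : Matrix (Fin 4) (Fin 1) A' := of fun α _ => Y' α with hy'
  have h0 : Θ.L * y = Θ.pm y' := by
    ext δ i; exact hY δ
  have h1 : ∀ γ, Θ.L * (G.dM γ y + G.W γ * y)
      = ∑ σ, Θ.L σ γ • Θ.pm (G'.dM σ y' + G'.W σ * y') := fun γ => by
    have := congrArg (G.dM γ) h0
    rw [Frame.dM_mul, dM_pm] at this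
    simp only [pm_add, pm_mul, smul_add, sum_add_distrib, ← this]
    rw [Matrix.mul_add, ← Matrix.mul_assoc, L_mul_W, Matrix.add_mul, Matrix.mul_assoc, h0, Wt,
      Matrix.sum_mul]
    simp only [Matrix.smul_mul]
    abel
  have h2 : ∀ γ α, G.nablaUp Y γ α = ∑ δ, Θ.Li α δ * ∑ σ, Θ.L σ γ * Θ.pull (G'.nablaUp Y' σ δ) :=
    fun γ α => by
      have := congrArg (fun x : Matrix (Fin 4) (Fin 1) A => Θ.Li * x) (h1 γ)
      simp only [← Matrix.mul_assoc, Θ.Li_mul_L, Matrix.one_mul] at this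
      have := entry_congr this α 0
      rw [Matrix.mul_apply] at this
      refine this.trans (sum_ext fun δ => ?_)
      rw [Matrix.sum_apply]
      rfl
  simp only [h2, mul_sum, map_sum]
  rw [sum_comm]
  refine sum_ext fun δ => ?_
  rw [sum_comm]
  have h3 : ∀ σ, ∑ γ, Θ.Li γ δ * (Θ.L σ γ * Θ.pull (G'.nablaUp Y' σ δ))
      = (1 : Mat4 A) σ δ * Θ.pull (G'.nablaUp Y' σ δ) := fun σ => by
    rw [← Θ.L_mul_Li, Matrix.mul_apply, sum_mul]
    exact sum_ext fun _ => by ring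
  simp only [h3, Matrix.one_apply, ite_mul, one_mul, zero_mul, Finset.sum_ite_eq', Finset.mem_univ,
    if_true]

end FrameChange

/-! ### Frames adapted to a slicing -/

lemma sum4 {A : Type*} [AddCommMonoid A] (f : Fin 4 → A) :
    ∑ α, f α = f 0 + ∑ i : Fin 3, f i.succ := Fin.sum_univ_succ f

/-- A Cauchy adapted frame over a commutative algebra, given by lapse, shift and space metric; `sq`
is a square root of the determinant of the space metric. -/
structure Slicing (A : Type*) [CommRing A] [Algebra ℝ A] where
  D : Fin 4 → Derivation ℝ A A
  N : A
  Ni : A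
  h : Matrix (Fin 3) (Fin 3) A
  hi : Matrix (Fin 3) (Fin 3) A
  shift : Fin 3 → A
  sq : A
  sqi : A
  N_mul_Ni : N * Ni = 1
  h_symm : ∀ i j, h i j = h j i
  h_mul_hi : h * hi = 1
  sq_mul_sqi : sq * sqi = 1
  sq_mul_sq : sq * sq = h.det
  comm_space : ∀ (i j : Fin 3) φ, D i.succ (D j.succ φ) = D j.succ (D i.succ φ)
  comm_time : ∀ (i : Fin 3) φ, D 0 (D i.succ φ) - D i.succ (D 0 φ)
    = ∑ k : Fin 3, D i.succ (shift k) * D k.succ φ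

namespace Slicing

variable {A : Type*} [CommRing A] [Algebra ℝ A] (M : Slicing A)

/-- `g_{αβ}` -/
def metric : Mat4 A := of fun α β =>
  Fin.cases (Fin.cases (-M.N ^ 2) (fun _ => 0) β) (fun i => Fin.cases 0 (fun j => M.h i j) β) α

/-- `g^{αβ}` -/
def metricInv : Mat4 A := of fun α β =>
  Fin.cases (Fin.cases (-M.Ni ^ 2) (fun _ => 0) β) (fun i => Fin.cases 0 (fun j => M.hi i j) β) α

/-- Structure coefficients. -/
def bracket (γ α β : Fin 4) : A :=
  Fin.cases 0 (fun k =>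
    Fin.cases (Fin.cases 0 (fun i => M.D i.succ (M.shift k)) β)
      (fun i => Fin.cases (-M.D i.succ (M.shift k)) (fun _ => 0) β) α) γ

@[simp] lemma metric_zero_zero : M.metric 0 0 = -M.N ^ 2 := rfl
@[simp] lemma metric_zero_succ (i : Fin 3) : M.metric 0 i.succ = 0 := rfl
@[simp] lemma metric_succ_zero (i : Fin 3) : M.metric i.succ 0 = 0 := rfl
@[simp] lemma metric_succ_succ (i j : Fin 3) : M.metric i.succ j.succ = M.h i j := rfl
@[simp] lemma metricInv_zero_zero : M.metricInv 0 0 = -M.Ni ^ 2 := rfl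
@[simp] lemma metricInv_zero_succ (i : Fin 3) : M.metricInv 0 i.succ = 0 := rfl
@[simp] lemma metricInv_succ_zero (i : Fin 3) : M.metricInv i.succ 0 = 0 := rfl
@[simp] lemma metricInv_succ_succ (i j : Fin 3) : M.metricInv i.succ j.succ = M.hi i j := rfl
@[simp] lemma bracket_zero (α β : Fin 4) : M.bracket 0 α β = 0 := rfl
@[simp] lemma bracket_zero_zero (γ : Fin 4) : M.bracket γ 0 0 = 0 := by
  refine Fin.cases rfl (fun k => rfl) γ
@[simp] lemma bracket_succ_succ (γ : Fin 4) (i j : Fin 3) : M.bracket γ i.succ j.succ = 0 := by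
  refine Fin.cases rfl (fun k => rfl) γ
@[simp] lemma bracket_zero_succ (k i : Fin 3) :
    M.bracket k.succ 0 i.succ = M.D i.succ (M.shift k) := rfl
@[simp] lemma bracket_succ_zero (k i : Fin 3) :
    M.bracket k.succ i.succ 0 = -M.D i.succ (M.shift k) := rfl

lemma hi_mul_h : M.hi * M.h = 1 := mul_eq_one_comm.mp M.h_mul_hi

lemma h_transpose : M.hᵀ = M.h := by ext i j; exact M.h_symm _ _

lemma hi_transpose : M.hiᵀ = M.hi := by
  have h1 : M.h * M.hiᵀ = 1 := by
    rw [← M.h_transpose, ← transpose_mul, M.hi_mul_h, Matrix.transpose_one]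
  calc M.hiᵀ = M.hi * M.h * M.hiᵀ := by rw [M.hi_mul_h, one_mul]
    _ = M.hi := by rw [mul_assoc, h1, mul_one]

lemma hi_symm (i j : Fin 3) : M.hi i j = M.hi j i := entry_congr M.hi_transpose j i

/-- The frame of a slicing. -/
def frame : Frame A where
  D := M.D
  br := M.bracket
  g := M.metric
  gi := M.metricInv
  g_symm α β := by
    cases α using Fin.cases <;> cases β using Fin.cases <;>
      simp [M.h_symm]
  gi_symm α β := by
    cases α using Fin.cases <;> cases β using Fin.cases <;>
      simp
    exact M.hi_symm _ _
  g_mul_gi := by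
    have hN : M.N ^ 2 * M.Ni ^ 2 = 1 := by rw [← mul_pow, M.N_mul_Ni, one_pow]
    ext α β
    rw [Matrix.mul_apply, sum4]
    refine Fin.cases ?_ (fun i => ?_) α <;> refine Fin.cases ?_ (fun j => ?_) β
    · simp [hN]
    · simp [Matrix.one_apply]
      exact fun hh => absurd hh (Fin.succ_ne_zero j).symm
    · simp [Fin.succ_ne_zero]
    · have := entry_congr M.h_mul_hi i j
      rw [Matrix.mul_apply] at this
      simp [this, Matrix.one_apply]
  br_antisymm γ α β := by
    refine Fin.cases ?_ (fun k => ?_) γ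
    · simp
    · cases α using Fin.cases <;> cases β using Fin.cases <;> simp
  comm α β φ := by
    rw [sum4]
    refine Fin.cases ?_ (fun i => ?_) α <;> refine Fin.cases ?_ (fun j => ?_) β
    · simp
    · simpa using M.comm_time j φ
    · have := M.comm_time i φ
      simp only [bracket_zero, zero_mul, zero_add, bracket_succ_zero, neg_mul, sum_neg_distrib,
        ← this]
      ring
    · simp [M.comm_space i j φ]
  jacobi δ α β γ := by
    rw [sum4]
    refine Fin.cases ?_ (fun k => ?_) δ
    · simp
    · refine Fin.cases ?_ (fun i => ?_) α <;> refine Fin.cases ?_ (fun j => ?_) β <;>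
        refine Fin.cases ?_ (fun l => ?_) γ <;> simp [mul_comm]
      · rw [M.comm_space j l]; ring
      · rw [M.comm_space i l]; ring
      · rw [M.comm_space i j]; ring

@[simp] lemma frame_D : M.frame.D = M.D := rfl
@[simp] lemma frame_g : M.frame.g = M.metric := rfl
@[simp] lemma frame_gi : M.frame.gi = M.metricInv := rfl
@[simp] lemma frame_br : M.frame.br = M.bracket := rfl

/-- `K_{ij}` -/
def K (i j : Fin 3) : A :=
  (-(1 / 2 : ℝ)) • (M.Ni * (M.D 0 (M.h i j)
    - ∑ k, (M.h k j * M.D i.succ (M.shift k) + M.h i k * M.D j.succ (M.shift k))))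

lemma Ni_sq_N : M.Ni ^ 2 * M.N = M.Ni := by
  linear_combination M.Ni * M.N_mul_Ni

lemma D_Ni (γ : Fin 4) : M.D γ M.Ni = -(M.Ni ^ 2 * M.D γ M.N) := by
  have h := congrArg (M.D γ) M.N_mul_Ni
  simp only [Derivation.leibniz, smul_eq_mul, Derivation.map_one_eq_zero] at h
  linear_combination M.Ni * h - M.D γ M.Ni * M.N_mul_Ni

lemma omega_zero (β γ : Fin 4) : M.frame.omega 0 β γ = (1 / 2 : ℝ) •
    (-M.Ni ^ 2 * (M.D β (M.metric γ 0) + M.D γ (M.metric β 0) - M.D 0 (M.metric β γ)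
    + ∑ ε, (M.bracket ε β γ * M.metric ε 0 - M.bracket ε β 0 * M.metric ε γ
    - M.bracket ε γ 0 * M.metric ε β))) := by
  rw [Frame.omega, sum4]
  simp

lemma omega_zero_right (γ : Fin 4) : M.frame.omega 0 γ 0 = M.Ni * M.D γ M.N := by
  rw [omega_zero]
  refine half_smul_eq ?_
  have hs : ∀ α β, ∑ ε, M.bracket ε α β * M.metric ε 0 = 0 := fun α β => by simp [sum4]
  have hs' : ∀ α, ∑ ε, M.bracket ε α 0 * M.metric ε γ
      = -∑ ε, M.bracket ε 0 α * M.metric ε γ := fun α => by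
    rw [← sum_neg_distrib]
    exact sum_ext fun ε => by
      rw [show M.bracket ε α 0 = -M.bracket ε 0 α from M.frame.br_antisymm ε α 0]; ring
  have hsy : M.metric γ 0 = M.metric 0 γ := M.frame.g_symm γ 0
  simp only [sum_sub_distrib, hs, hsy]
  simp only [metric_zero_zero, map_neg, Derivation.leibniz_pow, bracket_zero_zero, zero_mul,
    sum_const_zero, smul_eq_mul, nsmul_eq_mul]
  push_cast
  have := M.Ni_sq_N
  linear_combination (2 * M.D γ M.N) * this

lemma omega_zero_left (γ : Fin 4) : M.frame.omega 0 0 γ = M.Ni * M.D γ M.N := by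
  rw [← omega_zero_right]
  have := M.frame.torsion 0 0 γ
  simp only [frame_br, bracket_zero] at this
  exact sub_eq_zero.mp this

lemma omega_zero_space (i j : Fin 3) : M.frame.omega 0 i.succ j.succ = -(M.Ni * M.K i j) := by
  rw [omega_zero]
  simp only [sum4, K, metric_succ_zero, metric_succ_succ, bracket_succ_succ, bracket_zero, zero_mul,
    bracket_succ_zero, map_zero, zero_sub, zero_add, sum_sub_distrib,
    neg_smul, mul_neg, mul_smul_comm, neg_neg, add_zero, neg_mul, sum_add_distrib,
    sum_neg_distrib]
  congr 1
  have e1 : ∑ x, M.D i.succ (M.shift x) * M.h x j = ∑ x, M.h x j * M.D i.succ (M.shift x) :=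
    sum_ext fun _ => mul_comm _ _
  have e2 : ∑ x, M.D j.succ (M.shift x) * M.h x i = ∑ x, M.h i x * M.D j.succ (M.shift x) :=
    sum_ext fun x => by rw [M.h_symm i x, mul_comm]
  rw [e1, e2]; ring

/-- `ω^i_{γ0} = N² g^{ij} ω^0_{γj}` -/
lemma omega_succ_zero (i : Fin 3) (γ : Fin 4) :
    M.frame.omega i.succ γ 0 = M.N ^ 2 * ∑ j, M.hi i j * M.frame.omega 0 γ j.succ := by
  have hc : ∀ j : Fin 3, ∑ k : Fin 3, M.h j k * M.frame.omega k.succ γ 0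
      = M.N ^ 2 * M.frame.omega 0 γ j.succ := fun j => by
    have h := M.frame.metric_compat γ j.succ 0
    simp only [sum4, frame_g, metric_succ_zero, map_zero, metric_succ_succ, metric_zero_zero,
      metric_zero_succ, zero_mul, zero_add, sum_const_zero, add_zero] at h
    linear_combination -h
  have h1 : M.h.mulVec (fun k => M.frame.omega k.succ γ 0)
      = fun j => M.N ^ 2 * M.frame.omega 0 γ j.succ := by
    ext j; exact hc j
  have h2 := congrArg M.hi.mulVec h1
  rw [mulVec_mulVec, M.hi_mul_h, one_mulVec] at h2
  rw [congrFun h2 i]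
  simp only [Matrix.mulVec, dotProduct, mul_sum]
  exact sum_ext fun _ => by ring

lemma omega_succ_zero_zero (i : Fin 3) :
    M.frame.omega i.succ 0 0 = M.N * ∑ j, M.hi i j * M.D j.succ M.N := by
  rw [omega_succ_zero, mul_sum, mul_sum]
  refine sum_ext fun j => ?_
  rw [omega_zero_left]
  linear_combination (M.N * M.hi i j * M.D j.succ M.N) * M.N_mul_Ni

lemma omega_succ_succ_zero (i k : Fin 3) :
    M.frame.omega i.succ k.succ 0 = -(M.N * ∑ j, M.hi i j * M.K k j) := by
  rw [omega_succ_zero, mul_sum, mul_sum, ← sum_neg_distrib]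
  refine sum_ext fun j => ?_
  rw [omega_zero_space]
  linear_combination (-M.N * M.hi i j * M.K k j) * M.N_mul_Ni

/-- The positive definite metric `g^{αβ} + 2 n^α n^β`. -/
def pos : Mat4 A := of fun α β =>
  Fin.cases (Fin.cases (M.Ni ^ 2) (fun _ => 0) β) (fun i => Fin.cases 0 (fun j => M.hi i j) β) α

@[simp] lemma pos_zero_zero : M.pos 0 0 = M.Ni ^ 2 := rfl
@[simp] lemma pos_zero_succ (i : Fin 3) : M.pos 0 i.succ = 0 := rfl
@[simp] lemma pos_succ_zero (i : Fin 3) : M.pos i.succ 0 = 0 := rfl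
@[simp] lemma pos_succ_succ (i j : Fin 3) : M.pos i.succ j.succ = M.hi i j := rfl

lemma pos_transpose : M.posᵀ = M.pos := by
  ext α β
  rw [transpose_apply]
  cases α using Fin.cases <;> cases β using Fin.cases <;> simp
  exact M.hi_symm _ _

/-- The covariant derivative `∇_γ p^{αβ}` of `pos`. -/
def npos (γ : Fin 4) : Mat4 A :=
  M.frame.dM γ M.pos + M.frame.W γ * M.pos + M.pos * (M.frame.W γ)ᵀ

lemma npos_eq (γ : Fin 4) : M.npos γ = of fun α β => Fin.cases
    (Fin.cases 0 (fun i => 2 * M.Ni ^ 2 * M.frame.omega i.succ γ 0) β)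
    (fun i => Fin.cases (2 * M.Ni ^ 2 * M.frame.omega i.succ γ 0) (fun _ => 0) β) α := by
  have h := M.frame.dM_gi γ
  set Z : Mat4 A := M.pos - M.metricInv with hZ
  have e : M.npos γ = M.frame.dM γ Z + M.frame.W γ * Z + Z * (M.frame.W γ)ᵀ := by
    rw [npos, hZ, Frame.dM_sub, ← frame_gi, h]; noncomm_ring
  have z0 : Z 0 0 = M.Ni ^ 2 + M.Ni ^ 2 := by simp [hZ]
  have z1 : ∀ i : Fin 3, Z 0 i.succ = 0 := fun i => by simp [hZ]
  have z2 : ∀ i : Fin 3, Z i.succ 0 = 0 := fun i => by simp [hZ]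
  have z3 : ∀ i j : Fin 3, Z i.succ j.succ = 0 := fun i j => by simp [hZ]
  rw [e]
  ext α β
  simp only [Matrix.add_apply, Matrix.mul_apply, sum4, transpose_apply, Frame.dM_apply, of_apply,
    Frame.W]
  cases α using Fin.cases <;> cases β using Fin.cases <;>
    simp [z0, z1, z2, z3]
  · rw [omega_zero_right, D_Ni]
    ring
  · ring
  · ring

lemma D_det (γ : Fin 4) : M.D γ M.h.det = M.h.det * ∑ i, ∑ j, M.hi i j * M.D γ (M.h i j) := by
  have ha : M.h.det • M.hi = M.h.adjugate := by
    calc M.h.det • M.hi = (M.h.adjugate * M.h) * M.hi := by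
          rw [Matrix.adjugate_mul, Matrix.smul_mul, one_mul]
      _ = M.h.adjugate := by rw [mul_assoc, M.h_mul_hi, mul_one]
  have hb : ∀ i j, M.h.det * M.hi i j = M.h.adjugate i j := fun i j => entry_congr ha i j
  have hs := M.h_symm
  simp only [mul_sum, ← mul_assoc, hb]
  rw [Matrix.adjugate_fin_three]
  simp only [Fin.sum_univ_three, Matrix.det_fin_three, map_add, map_sub, Derivation.leibniz,
    smul_eq_mul]
  simp only [hs 1 0, hs 2 0, hs 2 1, of_apply, Matrix.cons_val_zero, Matrix.cons_val_one,
    Matrix.cons_val]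
  ring

lemma D_sq (γ : Fin 4) : M.sqi * M.D γ M.sq
    = (1 / 2 : ℝ) • ∑ i, ∑ j, M.hi i j * M.D γ (M.h i j) := by
  symm
  refine half_smul_eq ?_
  have h := M.D_det γ
  rw [← M.sq_mul_sq] at h
  simp only [Derivation.leibniz, smul_eq_mul] at h
  have h2 := M.sq_mul_sqi
  linear_combination (-M.sqi ^ 2) * h + (2 * M.sqi * M.D γ M.sq -
    (∑ i, ∑ j, M.hi i j * M.D γ (M.h i j)) * (1 + M.sq * M.sqi)) * h2

lemma omega_space_trace (i : Fin 3) :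
    ∑ k : Fin 3, M.frame.omega k.succ i.succ k.succ = M.sqi * M.D i.succ M.sq := by
  rw [D_sq, eq_comm]
  refine half_smul_eq ?_
  have hc : ∀ j k : Fin 3, M.D i.succ (M.h j k) = ∑ l : Fin 3, M.h j l * M.frame.omega l.succ i.succ
      k.succ + ∑ l : Fin 3, M.h k l * M.frame.omega l.succ i.succ j.succ := fun j k => by
    have h := M.frame.metric_compat i.succ j.succ k.succ
    simpa only [sum4, frame_g, frame_D, metric_succ_zero, metric_succ_succ, zero_mul, zero_add] using h
  have hh : ∀ j k, ∑ l, M.hi j l * M.h l k = (1 : Matrix (Fin 3) (Fin 3) A) j k := fun j k => by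
    rw [← M.hi_mul_h]; rfl
  simp only [hc, mul_add, sum_add_distrib, mul_sum]
  have e1 : ∑ j, ∑ k, ∑ l, M.hi j k * (M.h j l * M.frame.omega l.succ i.succ k.succ)
      = ∑ k : Fin 3, M.frame.omega k.succ i.succ k.succ := by
    rw [sum_comm]
    refine sum_ext fun k => ?_
    rw [sum_comm]
    have : ∀ l, ∑ j, M.hi j k * (M.h j l * M.frame.omega l.succ i.succ k.succ)
        = (1 : Matrix (Fin 3) (Fin 3) A) k l * M.frame.omega l.succ i.succ k.succ := fun l => by
      rw [← hh, sum_mul]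
      exact sum_ext fun j => by rw [M.hi_symm k j]; ring
    simp [this, Matrix.one_apply]
  have e2 : ∑ j, ∑ k, ∑ l, M.hi j k * (M.h k l * M.frame.omega l.succ i.succ j.succ)
      = ∑ k : Fin 3, M.frame.omega k.succ i.succ k.succ := by
    refine sum_ext fun j => ?_
    rw [sum_comm]
    have : ∀ l, ∑ k, M.hi j k * (M.h k l * M.frame.omega l.succ i.succ j.succ)
        = (1 : Matrix (Fin 3) (Fin 3) A) j l * M.frame.omega l.succ i.succ j.succ := fun l => by
      rw [← hh, sum_mul]
      exact sum_ext fun k => by ring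
    simp [this, Matrix.one_apply]
  rw [e1, e2]

/-- `∇̄_i X^i` -/
def div (X : Fin 3 → A) : A := M.sqi * ∑ i, M.D i.succ (M.sq * X i)

lemma div_eq (X : Fin 3 → A) : M.div X = ∑ i, (M.D i.succ (X i)
    + ∑ k : Fin 3, M.frame.omega k.succ k.succ i.succ * X i) := by
  rw [div, mul_sum]
  refine sum_ext fun i => ?_
  have h : ∑ k : Fin 3, M.frame.omega k.succ k.succ i.succ * X i
      = (M.sqi * M.D i.succ M.sq) * X i := by
    rw [← omega_space_trace, sum_mul]
    refine sum_ext fun k => ?_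
    have := M.frame.torsion k.succ k.succ i.succ
    simp only [frame_br, bracket_succ_succ] at this
    rw [sub_eq_zero.mp this]
  rw [h]
  simp only [Derivation.leibniz, smul_eq_mul]
  linear_combination M.D i.succ (X i) * M.sq_mul_sqi

/-- `τ` -/
def tau : A := ∑ i, ∑ j, M.hi i j * M.K i j

lemma omega_trace_zero : ∑ k : Fin 3, M.frame.omega k.succ k.succ 0 = -(M.N * M.tau) := by
  simp only [omega_succ_succ_zero, tau, mul_sum, sum_neg_distrib]

/-- The `3 + 1` form of the divergence of a spacetime vector. -/
lemma divergence_split (Y : Fin 4 → A) : M.D 0 (Y 0) + M.div (fun i => Y i.succ) - M.N * M.tau * Y 0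
    = ∑ γ, M.frame.nablaUp Y γ γ - M.Ni * ∑ γ, Y γ * M.D γ M.N := by
  have h1 : ∑ k : Fin 3, ∑ j : Fin 3, M.frame.omega k.succ k.succ j.succ * Y j.succ
      = ∑ i : Fin 3, ∑ k : Fin 3, M.frame.omega k.succ k.succ i.succ * Y i.succ :=
    sum_comm
  have h2 : ∑ k : Fin 3, M.frame.omega k.succ k.succ 0 * Y 0 = -(M.N * M.tau) * Y 0 := by
    rw [← sum_mul, omega_trace_zero]
  rw [div_eq]
  simp only [Frame.nablaUp, sum4, sum_add_distrib, h1, h2, omega_zero_left, frame_D, mul_add,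
    mul_sum]
  have h3 : ∑ i : Fin 3, M.Ni * (Y i.succ * M.D i.succ M.N)
      = ∑ i : Fin 3, M.Ni * M.D i.succ M.N * Y i.succ :=
    sum_ext fun _ => by ring
  rw [h3]
  ring

end Slicing

/-! ### The energy identity of the Bianchi equations -/

namespace Frame

variable {A : Type*} [CommRing A] [Algebra ℝ A] (G : Frame A)

/-- Contraction of a covariant 2-tensor with the metric commutes with derivation. -/
lemma D_contract (κ : Fin 4) {X X' : Fin 4 → Fin 4 → A} (h : ∀ ε δ, G.D κ (X ε δ) = X' ε δ
    + ∑ σ, (G.omega σ κ ε * X σ δ + G.omega σ κ δ * X ε σ)) : G.D κ (∑ ε, ∑ δ, G.gi ε δ * X ε δ)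
    = ∑ ε, ∑ δ, G.gi ε δ * X' ε δ := by
  have e : ∀ X : Fin 4 → Fin 4 → A, ∑ ε, ∑ δ, G.gi ε δ * X ε δ
      = (G.gi * (of X)ᵀ).trace := fun X => rfl
  rw [e, e, D_trace, dM_mul, dM_gi, dM_transpose]
  have hX : G.dM κ (of X) = of X' + (G.W κ)ᵀ * of X + of X * G.W κ := by
    ext ε δ
    simp only [dM_apply, of_apply, h, Matrix.add_apply, Matrix.mul_apply, W, transpose_apply,
      sum_add_distrib, add_assoc]
    congr 2
    exact sum_ext fun _ => mul_comm _ _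
  rw [hX]
  simp only [transpose_add, transpose_mul, transpose_transpose]
  have hc := trace_mul_comm (G.W κ) (G.gi * (of X)ᵀ)
  simp only [mul_add, add_mul, sub_mul, neg_mul, trace_add, trace_sub, Matrix.trace_neg,
    mul_assoc] at hc ⊢
  rw [hc]
  ring

/-- The divergence of the mixed tensor obtained by raising an index of `T`. -/
lemma divergence_raise {T : Fin 4 → Fin 4 → A} {T' : Fin 4 → Fin 4 → Fin 4 → A}
    (h : ∀ κ ε δ, G.D κ (T ε δ) = T' κ ε δ + ∑ σ, (G.omega σ κ ε * T σ δ + G.omega σ κ δ * T ε σ))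
    (τ : Fin 4) : ∑ γ, G.nablaUp (fun α => ∑ β, G.gi α β * T β τ) γ γ
    = ∑ γ, ∑ β, G.gi γ β * T' γ β τ + ∑ γ, ∑ σ, G.omega σ γ τ * ∑ β, G.gi γ β * T β σ := by
  rw [← sum_add_distrib]
  refine sum_ext fun γ => ?_
  have e1 : G.D γ (∑ β, G.gi γ β * T β τ) = (G.dM γ (G.gi * of T)) γ τ := rfl
  have hX : G.dM γ (of T) = of (T' γ) + (G.W γ)ᵀ * of T + of T * G.W γ := by
    ext ε δ
    simp only [dM_apply, of_apply, h, Matrix.add_apply, Matrix.mul_apply, W, transpose_apply,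
      sum_add_distrib, add_assoc]
    congr 2
    exact sum_ext fun _ => mul_comm _ _
  have e2 : ∑ ε, G.omega γ γ ε * ∑ β, G.gi ε β * T β τ = (G.W γ * (G.gi * of T)) γ τ := rfl
  have e3 : ∑ σ, G.omega σ γ τ * ∑ β, G.gi γ β * T β σ = (G.gi * of T * G.W γ) γ τ :=
    sum_ext fun _ => mul_comm _ _
  have e4 : ∑ β, G.gi γ β * T' γ β τ = (G.gi * of (T' γ)) γ τ := rfl
  rw [nablaUp, e1, e2, e3, e4, ← Matrix.add_apply, ← Matrix.add_apply]
  refine entry_congr ?_ _ _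
  rw [dM_mul, dM_gi, hX]
  noncomm_ring

end Frame

namespace Slicing

variable {A : Type*} [CommRing A] [Algebra ℝ A] (M : Slicing A)

/-- The inner product `p^{λλ'} p^{μμ'} X_{λμ} Y_{λ'μ'}` of 2-tensors. -/
def ip (X Y : Mat4 A) : A := (M.pos * X * M.pos * Yᵀ).trace

/-- The bilinear form `∇_κ (p^{λλ'} p^{μμ'}) X_{λμ} Y_{λ'μ'}`. -/
def dip (κ : Fin 4) (X Y : Mat4 A) : A :=
  (M.npos κ * X * M.pos * Yᵀ).trace + (M.pos * X * M.npos κ * Yᵀ).trace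

lemma ip_comm (X Y : Mat4 A) : M.ip X Y = M.ip Y X := by
  rw [ip, ← Matrix.trace_transpose]
  simp only [transpose_mul, transpose_transpose, pos_transpose]
  have h1 := trace_mul_comm Y (M.pos * (Xᵀ * M.pos))
  have h2 := trace_mul_comm (M.pos * Xᵀ) (M.pos * Y)
  simp only [ip, mul_assoc] at h1 h2 ⊢
  rw [h1, h2]

lemma ip_add_left (X Y Z : Mat4 A) : M.ip (X + Y) Z = M.ip X Z + M.ip Y Z := by
  simp [ip, mul_add, add_mul]

lemma ip_neg_left (X Z : Mat4 A) : M.ip (-X) Z = -M.ip X Z := by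
  simp [ip]

lemma ip_smul_left (a : A) (X Z : Mat4 A) : M.ip (a • X) Z = a * M.ip X Z := by
  simp [ip]

lemma ip_sum_left {ι : Type*} (s : Finset ι) (X : ι → Mat4 A) (Z : Mat4 A) :
    M.ip (∑ i ∈ s, X i) Z = ∑ i ∈ s, M.ip (X i) Z := by
  simp [ip, Matrix.mul_sum, Matrix.sum_mul, Matrix.trace_sum]

lemma ip_add_right (X Y Z : Mat4 A) : M.ip Z (X + Y) = M.ip Z X + M.ip Z Y := by
  simp [ip, mul_add]

lemma ip_sub_right (X Y Z : Mat4 A) : M.ip Z (X - Y) = M.ip Z X - M.ip Z Y := by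
  simp [ip, mul_sub]

lemma ip_smul_right (a : A) (X Z : Mat4 A) : M.ip Z (a • X) = a * M.ip Z X := by
  simp [ip]

lemma ip_sum_right {ι : Type*} (s : Finset ι) (X : ι → Mat4 A) (Z : Mat4 A) :
    M.ip Z (∑ i ∈ s, X i) = ∑ i ∈ s, M.ip Z (X i) := by
  rw [ip_comm, ip_sum_left]
  exact Finset.sum_congr rfl fun i _ => M.ip_comm _ _

lemma D_ip (κ : Fin 4) {X Y X' Y' : Mat4 A} (hX : M.frame.dM κ X = X' + (M.frame.W κ)ᵀ * X
    + X * M.frame.W κ) (hY : M.frame.dM κ Y = Y' + (M.frame.W κ)ᵀ * Y + Y * M.frame.W κ) : M.D κ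
    (M.ip X Y) = M.ip X' Y + M.ip X Y' + M.dip κ X Y := by
  have hp : M.frame.dM κ M.pos = M.npos κ - M.frame.W κ * M.pos - M.pos * (M.frame.W κ)ᵀ := by
    rw [npos]; abel
  rw [ip, ← frame_D, Frame.D_trace]
  simp only [Frame.dM_mul, hX, hY, hp, Frame.dM_transpose, transpose_add, transpose_mul,
    transpose_transpose, ip, dip]
  have hc := trace_mul_comm (M.frame.W κ) (M.pos * (X * (M.pos * Yᵀ)))
  simp only [mul_add, add_mul, sub_mul, mul_sub, trace_add, trace_sub, mul_assoc]
    at hc ⊢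
  rw [hc]
  ring

section Energy

variable (R : Fin 4 → Fin 4 → Fin 4 → Fin 4 → A)

/-- The matrices `(R_{αβ,λμ})_{λμ}`. -/
def rm (α β : Fin 4) : Mat4 A := of (R α β)

/-- The matrices `(∇_κ R_{αβ,λμ})_{λμ}`. -/
def nrm (κ α β : Fin 4) : Mat4 A := of (M.frame.nabla4 R κ α β)

lemma dM_rm (κ α β : Fin 4) : M.frame.dM κ (rm R α β) = (M.nrm R κ α β
    + ∑ ε, (M.frame.omega ε κ α • rm R ε β + M.frame.omega ε κ β • rm R α ε))
    + (M.frame.W κ)ᵀ * rm R α β + rm R α β * M.frame.W κ := by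
  ext l m
  simp only [Frame.dM_apply, rm, nrm, of_apply, Matrix.add_apply, Matrix.sum_apply,
    Matrix.smul_apply, smul_eq_mul, Matrix.mul_apply, transpose_apply, Frame.W,
    Frame.nabla4, sum_add_distrib]
  simp only [mul_comm (R α β l _)]
  ring

/-- `⟨R_{αβ}, R_{γδ}⟩` -/
def ipR (α β γ δ : Fin 4) : A := M.ip (rm R α β) (rm R γ δ)

/-- `∇_κ ⟨R_{αβ}, R_{γδ}⟩` -/
def nipR (κ α β γ δ : Fin 4) : A :=
  M.ip (M.nrm R κ α β) (rm R γ δ) + M.ip (rm R α β) (M.nrm R κ γ δ)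
    + M.dip κ (rm R α β) (rm R γ δ)

lemma D_ipR (κ α β γ δ : Fin 4) : M.D κ (M.ipR R α β γ δ) = M.nipR R κ α β γ δ
    + ∑ σ, (M.frame.omega σ κ α * M.ipR R σ β γ δ + M.frame.omega σ κ γ * M.ipR R α β σ δ)
    + ∑ σ, (M.frame.omega σ κ β * M.ipR R α σ γ δ + M.frame.omega σ κ δ * M.ipR R α β γ σ) := by
  rw [ipR, M.D_ip κ (M.dM_rm R κ α β) (M.dM_rm R κ γ δ)]
  simp only [ip_add_left, ip_add_right, ip_sum_left, ip_sum_right, ip_smul_left, ip_smul_right,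
    nipR, ipR, sum_add_distrib]
  ring

/-- `g^{εδ} ⟨R_{αε}, R_{βδ}⟩` -/
def stressT (α β : Fin 4) : A := ∑ ε, ∑ δ, M.metricInv ε δ * M.ipR R α ε β δ

/-- Its covariant derivative. -/
def nstressT (κ α β : Fin 4) : A := ∑ ε, ∑ δ, M.metricInv ε δ * M.nipR R κ α ε β δ

lemma D_stressT (κ α β : Fin 4) : M.D κ (M.stressT R α β) = M.nstressT R κ α β
    + ∑ σ, (M.frame.omega σ κ α * M.stressT R σ β + M.frame.omega σ κ β * M.stressT R α σ) := by
  have h := M.frame.D_contract κ (X := fun ε δ => M.ipR R α ε β δ)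
    (X' := fun ε δ => M.nipR R κ α ε β δ
      + ∑ σ, (M.frame.omega σ κ α * M.ipR R σ ε β δ + M.frame.omega σ κ β * M.ipR R α ε σ δ))
    (fun ε δ => M.D_ipR R κ α ε β δ)
  simp only [frame_D, frame_gi] at h
  rw [stressT, h]
  simp only [mul_add, sum_add_distrib, nstressT, stressT, mul_sum]
  have e : ∀ (f : Fin 4 → A) (S : Fin 4 → Fin 4 → Fin 4 → A), ∑ ε, ∑ δ, ∑ σ, M.metricInv ε δ *
      (f σ * S σ ε δ) = ∑ σ, ∑ ε, ∑ δ, f σ * (M.metricInv ε δ * S σ ε δ) := fun f S => by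
    refine (sum_ext fun ε => sum_comm).trans (sum_comm.trans ?_)
    exact sum_ext fun _ => sum_ext fun _ =>
      sum_ext fun _ => by ring
  rw [e (fun σ => M.frame.omega σ κ α) fun σ ε δ => M.ipR R σ ε β δ,
    e (fun σ => M.frame.omega σ κ β) fun σ ε δ => M.ipR R α ε σ δ]

/-- The trace of `stressT`. -/
def traceT : A := ∑ α, ∑ β, M.metricInv α β * M.stressT R α β

/-- Its derivative. -/
def ntraceT (κ : Fin 4) : A := ∑ α, ∑ β, M.metricInv α β * M.nstressT R κ α β

lemma D_traceT (κ : Fin 4) : M.D κ (M.traceT R) = M.ntraceT R κ :=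
  M.frame.D_contract κ (X := M.stressT R) (X' := M.nstressT R κ) fun α β => M.D_stressT R κ α β

/-- The energy tensor, a sum of Maxwell tensors. -/
def maxwell (α β : Fin 4) : A := M.stressT R α β - (1 / 4 : ℝ) • (M.metric α β * M.traceT R)

/-- The mixed energy tensor. -/
def maxwellUp (α σ : Fin 4) : A := ∑ β, M.metricInv α β * M.maxwell R β σ

lemma D_maxwell (κ α β : Fin 4) : M.D κ (M.maxwell R α β)
    = (M.nstressT R κ α β - (1 / 4 : ℝ) • (M.metric α β * M.ntraceT R κ))
    + ∑ σ, (M.frame.omega σ κ α * M.maxwell R σ β + M.frame.omega σ κ β * M.maxwell R α σ) := by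
  have hg : M.D κ (M.metric α β)
      = ∑ σ, (M.frame.omega σ κ α * M.metric σ β + M.frame.omega σ κ β * M.metric α σ) := by
    have := M.frame.metric_compat κ α β
    simp only [frame_g, frame_D] at this
    rw [this, ← sum_add_distrib]
    refine sum_ext fun σ => ?_
    rw [show M.metric β σ = M.metric σ β from M.frame.g_symm β σ]; ring
  simp only [maxwell, map_sub, Derivation.map_smul, D_stressT, Derivation.leibniz, D_traceT, hg, smul_eq_mul,
    mul_sub, sum_add_distrib, sum_sub_distrib, mul_smul_comm, smul_add,
    smul_sum, mul_sum, mul_add]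
  have e : ∀ (f : Fin 4 → A) (b : Fin 4 → A), ∑ σ, (1 / 4 : ℝ) • (M.traceT R * (f σ * b σ))
      = ∑ σ, (1 / 4 : ℝ) • (f σ * (b σ * M.traceT R)) := fun f b =>
    sum_ext fun _ => by congr 1; ring
  rw [e, e]
  abel

/-- The source and quadratic terms of the energy identity. -/
def bianchiQuad : A :=
  ∑ κ, ∑ β, ∑ ε, ∑ δ, M.metricInv κ β * M.metricInv ε δ * M.dip κ (rm R β ε) (rm R 0 δ)
    - (1 / 4 : ℝ) • ∑ κ, ∑ β, ∑ ε, ∑ δ,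
        M.metricInv κ β * M.metricInv ε δ * M.dip 0 (rm R κ ε) (rm R β δ)
    + ∑ i : Fin 3, M.frame.omega i.succ 0 0 * M.maxwellUp R 0 i.succ
    + ∑ k : Fin 3, ∑ j : Fin 3, M.frame.omega j.succ k.succ 0 * M.maxwellUp R k.succ j.succ
    + M.N * M.tau * M.maxwellUp R 0 0

variable {R}

lemma nstressT_divergence (hR : SkewLeft R) (hcyc : ∀ h k l m, M.frame.nabla4 R 0 h k l m
    + M.frame.nabla4 R k 0 h l m - M.frame.nabla4 R h 0 k l m = 0) : ∑ κ, ∑ β, M.metricInv κ β *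
    M.nstressT R κ β 0 - (1 / 4 : ℝ) • M.ntraceT R 0 = ∑ ε, ∑ δ, M.metricInv ε δ * M.ip
    (∑ κ, ∑ β, M.metricInv κ β • M.nrm R κ β ε) (rm R 0 δ) +
    (∑ κ, ∑ β, ∑ ε, ∑ δ, M.metricInv κ β * M.metricInv ε δ * M.dip κ (rm R β ε) (rm R 0 δ)
    - (1 / 4 : ℝ) • ∑ κ, ∑ β, ∑ ε, ∑ δ, M.metricInv κ β * M.metricInv ε δ * M.dip 0 (rm R κ ε)
    (rm R β δ)) := by
  have gs : ∀ α β, M.metricInv α β = M.metricInv β α := M.frame.gi_symm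
  have hrm : ∀ α β, rm R α β = -rm R β α := fun α β => by
    ext l m; exact hR α β l m
  have hn : ∀ κ δ, M.nrm R 0 κ δ = M.nrm R κ 0 δ - M.nrm R δ 0 κ := fun κ δ => by
    ext l m
    have := hcyc κ δ l m
    simp only [nrm, of_apply, Matrix.sub_apply]
    linear_combination this
  set Z := ∑ κ, ∑ β, ∑ ε, ∑ δ,
    M.metricInv κ β * M.metricInv ε δ * M.ip (rm R β ε) (M.nrm R κ 0 δ) with hZ
  set V := ∑ κ, ∑ β, ∑ ε, ∑ δ,
    M.metricInv κ β * M.metricInv ε δ * M.ip (rm R β ε) (M.nrm R 0 κ δ) with hV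
  have hZ2 : Z = -∑ κ, ∑ β, ∑ ε, ∑ δ,
      M.metricInv κ β * M.metricInv ε δ * M.ip (rm R β ε) (M.nrm R δ 0 κ) := by
    rw [hZ]
    simp only [← sum_neg_distrib]
    refine (sum_ext fun κ => (sum_ext fun β =>
      sum_comm).trans sum_comm).trans (sum_comm.trans ?_)
    refine sum_ext fun δ => (sum_ext fun κ =>
      sum_comm).trans (sum_comm.trans ?_)
    refine sum_ext fun ε => sum_comm.trans ?_
    refine sum_ext fun β => sum_ext fun κ => ?_
    rw [hrm β ε, ip_neg_left, gs κ β, gs ε δ]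
    ring
  have hVZ : V = Z + Z := by
    nth_rewrite 2 [hZ2]
    rw [hV, hZ, ← sub_eq_add_neg]
    simp only [← sum_sub_distrib, hn, ip_sub_right, mul_sub]
  have h1 : ∑ κ, ∑ β, M.metricInv κ β * M.nstressT R κ β 0 = ∑ ε, ∑ δ, M.metricInv ε δ * M.ip
      (∑ κ, ∑ β, M.metricInv κ β • M.nrm R κ β ε) (rm R 0 δ) + Z
      + ∑ κ, ∑ β, ∑ ε, ∑ δ, M.metricInv κ β * M.metricInv ε δ * M.dip κ (rm R β ε) (rm R 0 δ) := by
    have e : ∑ ε, ∑ δ, M.metricInv ε δ * M.ip (∑ κ, ∑ β, M.metricInv κ β • M.nrm R κ β ε) (rm R 0 δ)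
        = ∑ κ, ∑ β, ∑ ε, ∑ δ, M.metricInv κ β * M.metricInv ε δ * M.ip (M.nrm R κ β ε)
        (rm R 0 δ) := by
      simp only [ip_sum_left, ip_smul_left, mul_sum]
      refine (sum_ext fun κ => (sum_comm.trans
        (sum_ext fun β => sum_comm))).trans (sum_comm.trans ?_)
      refine sum_ext fun κ => sum_comm.trans ?_
      refine sum_ext fun β => sum_ext fun ε =>
        sum_ext fun δ => by ring
    rw [e, hZ]
    simp only [nstressT, nipR, ← sum_add_distrib, mul_sum]
    refine sum_ext fun κ => sum_ext fun β =>
      sum_ext fun ε => sum_ext fun δ => by ring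
  have h2 : M.ntraceT R 0 = V + V + ∑ κ, ∑ β, ∑ ε, ∑ δ, M.metricInv κ β * M.metricInv ε δ * M.dip 0
      (rm R κ ε) (rm R β δ) := by
    have e1 : ∑ κ, ∑ β, ∑ ε, ∑ δ,
        M.metricInv κ β * M.metricInv ε δ * M.ip (M.nrm R 0 κ ε) (rm R β δ) = V := by
      rw [hV]
      refine sum_ext fun κ => sum_ext fun β => ?_
      rw [sum_comm]
      refine sum_ext fun δ => sum_ext fun ε => ?_
      rw [ip_comm, gs ε δ]
    have e2 : ∑ κ, ∑ β, ∑ ε, ∑ δ,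
        M.metricInv κ β * M.metricInv ε δ * M.ip (rm R κ ε) (M.nrm R 0 β δ) = V := by
      rw [hV, sum_comm]
      refine sum_ext fun β => sum_ext fun κ => ?_
      rw [gs β κ]
    rw [ntraceT]
    nth_rewrite 1 [← e1]
    rw [← e2]
    simp only [nstressT, nipR, ← sum_add_distrib, mul_sum]
    refine sum_ext fun κ => sum_ext fun β =>
      sum_ext fun ε => sum_ext fun δ => by ring
  rw [h1, h2, hVZ]
  have e4 : (1 / 4 : ℝ) • (Z + Z + (Z + Z)) = Z := by
    rw [← two_smul ℝ Z, ← two_smul ℝ ((2 : ℝ) • Z), smul_smul, smul_smul]; norm_num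
  rw [smul_add, e4]
  ring

/-- The energy identity for the Bianchi equations. -/
lemma maxwell_divergence (hR : SkewLeft R) (hcyc : ∀ h k l m, M.frame.nabla4 R 0 h k l m
    + M.frame.nabla4 R k 0 h l m - M.frame.nabla4 R h 0 k l m = 0) : M.D 0 (M.maxwellUp R 0 0)
    + M.div (fun i => M.maxwellUp R i.succ 0) = ∑ ε, ∑ δ, M.metricInv ε δ * M.ip
    (∑ κ, ∑ β, M.metricInv κ β • M.nrm R κ β ε) (rm R 0 δ) + M.bianchiQuad R := by
  have hd := M.divergence_split (fun α => M.maxwellUp R α 0)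
  have hr := M.frame.divergence_raise (T := M.maxwell R) (fun κ α β => M.D_maxwell R κ α β) 0
  simp only [frame_gi] at hr
  have hm : ∀ α σ, ∑ β, M.metricInv α β * M.maxwell R β σ = M.maxwellUp R α σ := fun _ _ => rfl
  simp only [hm] at hr
  rw [hr] at hd
  have e1 : ∑ γ, ∑ β, M.metricInv γ β *
      (M.nstressT R γ β 0 - (1 / 4 : ℝ) • (M.metric β 0 * M.ntraceT R γ))
      = ∑ κ, ∑ β, M.metricInv κ β * M.nstressT R κ β 0 - (1 / 4 : ℝ) • M.ntraceT R 0 := by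
    simp only [mul_sub, sum_sub_distrib, mul_smul_comm, ← smul_sum, ← mul_assoc, ← sum_mul]
    have : ∀ γ, ∑ β, M.metricInv γ β * M.metric β 0 = (1 : Mat4 A) γ 0 := fun γ => by
      rw [← M.frame.gi_mul_g]; rfl
    simp [this, Matrix.one_apply]
  rw [e1, M.nstressT_divergence hR hcyc] at hd
  have e2 : ∑ γ, ∑ σ, M.frame.omega σ γ 0 * M.maxwellUp R γ σ
      - M.Ni * ∑ γ, M.maxwellUp R γ 0 * M.D γ M.N = ∑ i : Fin 3, M.frame.omega i.succ 0 0 *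
      M.maxwellUp R 0 i.succ + ∑ k : Fin 3, ∑ j : Fin 3, M.frame.omega j.succ k.succ 0 * M.maxwellUp
      R k.succ j.succ := by
    rw [mul_sum]
    simp only [sum4, omega_zero_right, sum_add_distrib]
    have : ∑ i : Fin 3, M.Ni * (M.maxwellUp R i.succ 0 * M.D i.succ M.N)
        = ∑ i : Fin 3, M.Ni * M.D i.succ M.N * M.maxwellUp R i.succ 0 :=
      sum_ext fun _ => by ring
    rw [this]
    ring
  rw [bianchiQuad]
  linear_combination hd + e2

end Energy
end Slicing

/-! ### Perfect fluids over an algebra with derivations -/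

/-- Columns of length 4. -/
abbrev Col4 (A : Type*) := Matrix (Fin 4) (Fin 1) A

lemma sum_rotate {A : Type*} [AddCommMonoid A] (F : Fin 4 → Fin 4 → Fin 4 → A) :
    ∑ α, ∑ β, ∑ ε, F α β ε = ∑ ε, ∑ β, ∑ α, F α β ε := by
  rw [sum_comm]
  have : ∀ β, ∑ α, ∑ ε, F α β ε = ∑ ε, ∑ α, F α β ε := fun β => sum_comm
  simp only [this]
  rw [sum_comm]

namespace Frame

variable {A : Type*} [CommRing A] [Algebra ℝ A] (G : Frame A)

/-- Contraction of a contravariant with a covariant 2-tensor. -/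
lemma D_contract' (κ : Fin 4) {Q Q' : Mat4 A} {X X' : Fin 4 → Fin 4 → A}
    (hQ : G.dM κ Q = Q' - G.W κ * Q - Q * (G.W κ)ᵀ) (h : ∀ ε δ, G.D κ (X ε δ) = X' ε δ
    + ∑ σ, (G.omega σ κ ε * X σ δ + G.omega σ κ δ * X ε σ)) : G.D κ (∑ ε, ∑ δ, Q ε δ * X ε δ)
    = ∑ ε, ∑ δ, Q' ε δ * X ε δ + ∑ ε, ∑ δ, Q ε δ * X' ε δ := by
  have e : ∀ (Q : Mat4 A) (X : Fin 4 → Fin 4 → A), ∑ ε, ∑ δ, Q ε δ * X ε δ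
      = (Q * (of X)ᵀ).trace := fun Q X => rfl
  rw [e, e, e, D_trace, dM_mul, hQ, dM_transpose]
  have hX : G.dM κ (of X) = of X' + (G.W κ)ᵀ * of X + of X * G.W κ := by
    ext ε δ
    simp only [dM_apply, of_apply, h, Matrix.add_apply, Matrix.mul_apply, W, transpose_apply,
      sum_add_distrib, add_assoc]
    congr 2
    exact sum_ext fun _ => mul_comm _ _
  rw [hX]
  simp only [transpose_add, transpose_mul, transpose_transpose]
  have hc := trace_mul_comm (G.W κ) (Q * (of X)ᵀ)
  simp only [mul_add, add_mul, sub_mul, trace_add, trace_sub, mul_assoc] at hc ⊢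
  rw [hc]
  ring

lemma D_nabla2 (X : Fin 4 → Fin 4 → A) (κ ε δ : Fin 4) : G.D κ (X ε δ)
    = G.nabla2 X κ ε δ + ∑ σ, (G.omega σ κ ε * X σ δ + G.omega σ κ δ * X ε σ) := by
  rw [nabla2]; ring

lemma nabla1_contract (Y : Fin 4 → A) (X : Fin 4 → Fin 4 → A) (γ β : Fin 4) : G.nabla1
    (fun β => ∑ α, Y α * X α β) γ β = ∑ α, (G.nablaUp Y γ α * X α β + Y α * G.nabla2 X γ α β) := by
  simp only [nabla1, nablaUp, nabla2, map_sum, Derivation.leibniz, smul_eq_mul, add_mul, mul_sub,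
    sum_add_distrib, sum_sub_distrib, mul_add, mul_sum, sum_mul]
  have e1 : ∑ ε, ∑ α, G.omega ε γ β * (Y α * X α ε) = ∑ α, ∑ ε, Y α * (G.omega ε γ β * X α ε) :=
    sum_comm.trans (sum_ext fun _ => sum_ext fun _ => by ring)
  have e2 : ∑ α, ∑ ε, G.omega α γ ε * Y ε * X α β = ∑ α, ∑ ε, Y α * (G.omega ε γ α * X ε β) :=
    sum_comm.trans (sum_ext fun _ => sum_ext fun _ => by ring)
  have e3 : ∑ x, X x β * G.D γ (Y x) = ∑ x, G.D γ (Y x) * X x β :=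
    sum_ext fun _ => mul_comm _ _
  rw [e1, e2, e3]
  ring

end Frame

/-- A perfect fluid on a slicing: dynamical velocity `C^α`, enthalpy index `f`, pressure, energy
density and its derivatives. -/
structure Fluid {A : Type*} [CommRing A] [Algebra ℝ A] (M : Slicing A) where
  C : Fin 4 → A
  C0i : A
  f : A
  fi : A
  p : A
  mu : A
  mu1 : A
  mu2 : A
  C_mul_C0i : C 0 * C0i = 1
  f_mul_fi : f * fi = 1
  norm : ∑ α, C α * ∑ β, M.metric α β * C β = -f ^ 2
  D_mu : ∀ γ, M.D γ mu = mu1 * M.D γ p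
  D_mu1 : ∀ γ, M.D γ mu1 = mu2 * M.D γ p
  D_f : ∀ γ, (mu + p) * M.D γ f = f * M.D γ p

namespace Fluid

variable {A : Type*} [CommRing A] [Algebra ℝ A] {M : Slicing A} (Φ : Fluid M)

/-- `C_α` -/
def Cl (α : Fin 4) : A := ∑ β, M.metric α β * Φ.C β

/-- `C_{γα} = ∇_γ C_α` -/
def c (γ α : Fin 4) : A := M.frame.nabla1 Φ.Cl γ α

/-- `∇_γ C^α` -/
def Cd (γ α : Fin 4) : A := ∑ δ, M.metricInv α δ * Φ.c γ δ

/-- `C^α C_{γα}` -/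
def U (γ : Fin 4) : A := ∑ α, Φ.C α * Φ.c γ α

lemma C_eq (α : Fin 4) : Φ.C α = ∑ β, M.metricInv α β * Φ.Cl β := by
  have : M.metricInv.mulVec (M.metric.mulVec Φ.C) = Φ.C := by
    rw [mulVec_mulVec, ← Slicing.frame_gi, ← Slicing.frame_g, Frame.gi_mul_g, one_mulVec]
  exact (congrFun this α).symm

lemma nablaUp_C (γ α : Fin 4) : M.frame.nablaUp Φ.C γ α = Φ.Cd γ α := by
  set x : Col4 A := of fun β _ => Φ.Cl β with hx
  have h1 : (of fun α _ => Φ.C α : Col4 A) = M.metricInv * x := by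
    ext α i; exact Φ.C_eq α
  have h2 : (of fun β _ => Φ.c γ β : Col4 A) = M.frame.dM γ x - (M.frame.W γ)ᵀ * x := by
    ext β i
    simp only [c, Frame.nabla1, of_apply, Matrix.sub_apply, Frame.dM_apply, Matrix.mul_apply,
      transpose_apply, Frame.W, hx]
  have h3 : M.frame.nablaUp Φ.C γ α = (M.frame.dM γ (of fun α _ => Φ.C α : Col4 A)
      + M.frame.W γ * (of fun α _ => Φ.C α : Col4 A)) α 0 := rfl
  have h4 : Φ.Cd γ α = (M.metricInv * (of fun β _ => Φ.c γ β : Col4 A)) α 0 := rfl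
  rw [h3, h4, h1, h2]
  refine entry_congr ?_ _ _
  rw [Frame.dM_mul, ← Slicing.frame_gi, Frame.dM_gi]
  simp only [Matrix.mul_sub, Matrix.sub_mul, Matrix.neg_mul, Matrix.mul_assoc]
  abel

lemma D_f_eq (γ : Fin 4) : M.D γ Φ.f = -(Φ.fi * Φ.U γ) := by
  have h0 : ∑ α, ∑ β, M.metricInv α β * (Φ.Cl α * Φ.Cl β) = -Φ.f ^ 2 := by
    rw [← Φ.norm]
    refine sum_ext fun α => ?_
    rw [Φ.C_eq α, sum_mul]
    exact sum_ext fun β => by change _ = _ * Φ.Cl α; ring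
  have h1 := M.frame.D_contract γ (X := fun α β => Φ.Cl α * Φ.Cl β)
    (X' := fun α β => Φ.c γ α * Φ.Cl β + Φ.Cl α * Φ.c γ β) (fun α β => by
      simp only [c, Frame.nabla1, Derivation.leibniz, smul_eq_mul, sub_mul, mul_sub,
        sum_add_distrib, sum_mul, mul_sum]
      have e1 : ∑ i, Φ.Cl α * (M.frame.omega i γ β * Φ.Cl i)
          = ∑ i, M.frame.omega i γ β * (Φ.Cl α * Φ.Cl i) :=
        sum_ext fun _ => by ring
      have e2 : ∑ i, M.frame.omega i γ α * Φ.Cl i * Φ.Cl β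
          = ∑ i, M.frame.omega i γ α * (Φ.Cl i * Φ.Cl β) :=
        sum_ext fun _ => by ring
      rw [e1, e2]; ring)
  simp only [Slicing.frame_gi, Slicing.frame_D, h0] at h1
  have e1 : ∑ α, ∑ β, M.metricInv α β * (Φ.c γ α * Φ.Cl β + Φ.Cl α * Φ.c γ β) = Φ.U γ + Φ.U γ := by
    simp only [mul_add, sum_add_distrib]
    have a1 : ∑ α, ∑ β, M.metricInv α β * (Φ.c γ α * Φ.Cl β) = Φ.U γ := by
      refine sum_ext fun α => ?_
      rw [Φ.C_eq α, sum_mul]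
      exact sum_ext fun β => by ring
    have a2 : ∑ α, ∑ β, M.metricInv α β * (Φ.Cl α * Φ.c γ β) = Φ.U γ := by
      rw [← a1, sum_comm]
      refine sum_ext fun α => sum_ext fun β => ?_
      rw [show M.metricInv β α = M.metricInv α β from M.frame.gi_symm β α]; ring
    rw [a1, a2]
  rw [e1] at h1
  simp only [map_neg, Derivation.leibniz_pow, smul_eq_mul, nsmul_eq_mul] at h1
  have h2 : -(Φ.f * M.D γ Φ.f) = Φ.U γ := by
    rw [← half_smul_eq (x := -(2 * (Φ.f * M.D γ Φ.f))) (y := -(Φ.f * M.D γ Φ.f)) (by ring)]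
    refine half_smul_eq ?_
    rw [← h1]; push_cast; ring
  linear_combination -Φ.fi * h2 - M.D γ Φ.f * Φ.f_mul_fi

lemma D_fi (γ : Fin 4) : M.D γ Φ.fi = Φ.fi ^ 3 * Φ.U γ := by
  have h := congrArg (M.D γ) Φ.f_mul_fi
  simp only [Derivation.leibniz, smul_eq_mul, Derivation.map_one_eq_zero, D_f_eq] at h
  linear_combination Φ.fi * h - M.D γ Φ.fi * Φ.f_mul_fi

lemma D_p (γ : Fin 4) : M.D γ Φ.p = -((Φ.mu + Φ.p) * Φ.fi ^ 2 * Φ.U γ) := by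
  have h := Φ.D_f γ
  rw [D_f_eq] at h
  linear_combination -M.D γ Φ.p * Φ.f_mul_fi - Φ.fi * h

/-- `g^{αβ} + (μ'_p - 1) C^α C^β / C^λ C_λ` -/
def Q : Mat4 A := of fun α β =>
  M.metricInv α β - (Φ.mu1 - 1) * Φ.fi ^ 2 * (Φ.C α * Φ.C β)

/-- Its covariant derivative. -/
def nQ (γ : Fin 4) : Mat4 A := of fun α β =>
  Φ.mu2 * ((Φ.mu + Φ.p) * Φ.fi ^ 2 * Φ.U γ) * (Φ.fi ^ 2 * (Φ.C α * Φ.C β))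
    - (Φ.mu1 - 1) * (Φ.fi ^ 2 * (Φ.Cd γ α * Φ.C β + Φ.C α * Φ.Cd γ β)
      + 2 * Φ.fi ^ 4 * Φ.U γ * (Φ.C α * Φ.C β))

lemma D_C (γ α : Fin 4) : M.D γ (Φ.C α) = Φ.Cd γ α - ∑ ε, M.frame.omega α γ ε * Φ.C ε := by
  rw [← nablaUp_C, Frame.nablaUp, Slicing.frame_D]; ring

/-- Covariant derivative of `a C^α C^β`. -/
lemma dM_CC (a a' : A) (γ : Fin 4) (ha : M.D γ a = a') : M.frame.dM γ
    (of fun α β => a * (Φ.C α * Φ.C β) : Mat4 A) = (of fun α β => a' * (Φ.C α * Φ.C β)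
    + a * (Φ.Cd γ α * Φ.C β + Φ.C α * Φ.Cd γ β) : Mat4 A) - M.frame.W γ *
    (of fun α β => a * (Φ.C α * Φ.C β) : Mat4 A) - (of fun α β => a * (Φ.C α * Φ.C β) : Mat4 A) *
    (M.frame.W γ)ᵀ := by
  ext α β
  simp only [Frame.dM_apply, of_apply, Matrix.sub_apply, Matrix.mul_apply, Frame.W, transpose_apply,
    Derivation.leibniz, smul_eq_mul, Slicing.frame_D, D_C, ha]
  have e1 : ∑ x, M.frame.omega α γ x * (a * (Φ.C x * Φ.C β))
      = a * ((∑ x, M.frame.omega α γ x * Φ.C x) * Φ.C β) := by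
    rw [sum_mul, mul_sum]
    exact sum_ext fun _ => by ring
  have e2 : ∑ x, a * (Φ.C α * Φ.C x) * M.frame.omega β γ x
      = a * (Φ.C α * ∑ x, M.frame.omega β γ x * Φ.C x) := by
    rw [mul_sum, mul_sum]
    exact sum_ext fun _ => by ring
  rw [e1, e2]
  ring

lemma dM_Q (γ : Fin 4) : M.frame.dM γ Φ.Q = Φ.nQ γ - M.frame.W γ * Φ.Q - Φ.Q * (M.frame.W γ)ᵀ := by
  have h : Φ.Q = M.frame.gi
      - (of fun α β => (Φ.mu1 - 1) * Φ.fi ^ 2 * (Φ.C α * Φ.C β) : Mat4 A) := rfl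
  have hd := Φ.dM_CC ((Φ.mu1 - 1) * Φ.fi ^ 2) _ γ rfl
  have hn : Φ.nQ γ = -(of fun α β => M.D γ ((Φ.mu1 - 1) * Φ.fi ^ 2) * (Φ.C α * Φ.C β)
      + (Φ.mu1 - 1) * Φ.fi ^ 2 * (Φ.Cd γ α * Φ.C β + Φ.C α * Φ.Cd γ β) : Mat4 A) := by
    ext α β
    simp only [nQ, of_apply, Matrix.neg_apply, Derivation.leibniz, Derivation.leibniz_pow, map_sub,
      Derivation.map_one_eq_zero, D_mu1, D_p, D_fi, smul_eq_mul, nsmul_eq_mul]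
    push_cast
    ring
  rw [hn, h, Frame.dM_sub, hd, Frame.dM_gi]
  noncomm_ring

lemma riemUp_Cl (β l m : Fin 4) :
    ∑ ε, M.frame.riemUp ε β l m * Φ.Cl ε = ∑ ε, Φ.C ε * M.frame.riem ε β l m := by
  simp only [Cl, Frame.riem, mul_sum]
  rw [sum_comm]
  refine sum_ext fun ε => sum_ext fun δ => ?_
  rw [Slicing.frame_g, show M.metric δ ε = M.metric ε δ from M.frame.g_symm δ ε]
  ring

lemma CC_riem (l m : Fin 4) : ∑ α, ∑ ε, Φ.C α * (Φ.C ε * M.frame.riem ε α l m) = 0 := by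
  have h : ∑ α, ∑ ε, Φ.C α * (Φ.C ε * M.frame.riem ε α l m)
      = -∑ α, ∑ ε, Φ.C α * (Φ.C ε * M.frame.riem ε α l m) := by
    nth_rewrite 1 [sum_comm]
    simp only [← sum_neg_distrib]
    refine sum_ext fun α => sum_ext fun ε => ?_
    rw [M.frame.riem_antisymm_left α ε]; ring
  have h2 := half_smul_eq (x := (0 : A)) (y := ∑ α, ∑ ε, Φ.C α * (Φ.C ε * M.frame.riem ε α l m))
    (by nth_rewrite 1 [h]; ring)
  rw [← h2, smul_zero]

/-- `a_{γβ}` -/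
def a (γ β : Fin 4) : A :=
  (∑ α, ∑ δ, M.metricInv α δ * Φ.c γ δ * (Φ.c α β - Φ.c β α))
    + ∑ α, ∑ l, Φ.C α * Φ.C l * M.frame.riem γ α β l

/-- `b_γ` -/
def b (γ : Fin 4) : A :=
  -(∑ l, (∑ α, ∑ β, M.metricInv α β * M.frame.riem β γ α l) * Φ.C l)
    + ∑ α, ∑ β, Φ.nQ γ α β * Φ.c α β

/-- The differentiated equation of motion. -/
lemma accM_eq_zero (hE : ∀ β, ∑ α, Φ.C α * (Φ.c α β - Φ.c β α) = 0) (γ β : Fin 4) :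
    ∑ α, Φ.C α * (M.frame.nabla2 Φ.c α γ β - M.frame.nabla2 Φ.c β γ α) + Φ.a γ β = 0 := by
  have h0 : M.frame.nabla1 (fun β => ∑ α, Φ.C α * (Φ.c α β - Φ.c β α)) γ β = 0 := by
    simp only [hE, Frame.nabla1, map_zero, mul_zero, sum_const_zero, sub_zero]
  rw [M.frame.nabla1_contract Φ.C (fun α β => Φ.c α β - Φ.c β α) γ β] at h0
  have hn : ∀ α, M.frame.nabla2 (fun α β => Φ.c α β - Φ.c β α) γ α β
      = M.frame.nabla2 Φ.c γ α β - M.frame.nabla2 Φ.c γ β α := fun α => by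
    simp only [Frame.nabla2, map_sub, mul_sub, sum_add_distrib, sum_sub_distrib]
    ring
  have r1 : ∀ α, M.frame.nabla2 Φ.c γ α β = M.frame.nabla2 Φ.c α γ β
      - ∑ ε, Φ.C ε * M.frame.riem ε β γ α := fun α => by
    have := M.frame.nabla2_nabla1_comm Φ.Cl γ α β
    rw [riemUp_Cl] at this
    change M.frame.nabla2 (M.frame.nabla1 Φ.Cl) γ α β = M.frame.nabla2 (M.frame.nabla1 Φ.Cl) α γ β - _
    linear_combination this
  have r2 : ∀ α, M.frame.nabla2 Φ.c γ β α = M.frame.nabla2 Φ.c β γ α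
      - ∑ ε, Φ.C ε * M.frame.riem ε α γ β := fun α => by
    have := M.frame.nabla2_nabla1_comm Φ.Cl γ β α
    rw [riemUp_Cl] at this
    change M.frame.nabla2 (M.frame.nabla1 Φ.Cl) γ β α = M.frame.nabla2 (M.frame.nabla1 Φ.Cl) β γ α - _
    linear_combination this
  have z := Φ.CC_riem γ β
  have e1 : ∑ α, ∑ l, Φ.C α * Φ.C l * M.frame.riem γ α β l
      = -∑ α, ∑ ε, Φ.C α * (Φ.C ε * M.frame.riem ε β γ α) := by
    simp only [← sum_neg_distrib]
    refine sum_ext fun α => sum_ext fun ε => ?_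
    rw [M.frame.riem_antisymm_left ε β, M.frame.riem_pair_symm β ε]; ring
  simp only [hn, r1, r2, nablaUp_C] at h0
  rw [a, e1]
  simp only [sum_add_distrib, mul_sub, sum_sub_distrib, mul_sum, z, Cd, sum_mul] at h0 ⊢
  linear_combination h0

/-- The differentiated continuity equation. -/
lemma accDiv_eq_zero (hE : ∑ α, ∑ β, Φ.Q α β * Φ.c α β = 0) (γ : Fin 4) :
    ∑ α, ∑ β, Φ.Q α β * M.frame.nabla2 Φ.c α γ β + Φ.b γ = 0 := by
  have h := M.frame.D_contract' γ (Φ.dM_Q γ) (fun ε δ => M.frame.D_nabla2 Φ.c γ ε δ)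
  rw [hE, map_zero] at h
  have r1 : ∀ α β, M.frame.nabla2 Φ.c γ α β = M.frame.nabla2 Φ.c α γ β
      - ∑ ε, Φ.C ε * M.frame.riem ε β γ α := fun α β => by
    have := M.frame.nabla2_nabla1_comm Φ.Cl γ α β
    rw [riemUp_Cl] at this
    change M.frame.nabla2 (M.frame.nabla1 Φ.Cl) γ α β = M.frame.nabla2 (M.frame.nabla1 Φ.Cl) α γ β - _
    linear_combination this
  have e : ∑ α, ∑ β, Φ.Q α β * ∑ ε, Φ.C ε * M.frame.riem ε β γ α
      = ∑ l, (∑ α, ∑ β, M.metricInv α β * M.frame.riem β γ α l) * Φ.C l := by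
    have z : ∀ α, ∑ β, Φ.C β * ∑ ε, Φ.C ε * M.frame.riem ε β γ α = 0 := fun α => by
      rw [← Φ.CC_riem γ α]; simp only [mul_sum]
    have e1 : ∑ α, ∑ β, (Φ.mu1 - 1) * Φ.fi ^ 2 * (Φ.C α * Φ.C β) *
        ∑ ε, Φ.C ε * M.frame.riem ε β γ α = 0 := by
      refine Finset.sum_eq_zero fun α _ => ?_
      have : ∑ β, (Φ.mu1 - 1) * Φ.fi ^ 2 * (Φ.C α * Φ.C β) * ∑ ε, Φ.C ε * M.frame.riem ε β γ α
          = (Φ.mu1 - 1) * Φ.fi ^ 2 * Φ.C α * ∑ β, Φ.C β * ∑ ε, Φ.C ε * M.frame.riem ε β γ α := by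
        rw [mul_sum]; exact sum_ext fun _ => by ring
      rw [this, z, mul_zero]
    have hs : ∀ α β x, Φ.Q α β * x
        = M.metricInv α β * x - (Φ.mu1 - 1) * Φ.fi ^ 2 * (Φ.C α * Φ.C β) * x := fun α β x => by
      rw [Q, of_apply]; ring
    simp only [hs, sum_sub_distrib, e1, sub_zero]
    simp only [mul_sum, sum_mul]
    rw [sum_rotate]
    refine sum_ext fun ε => ?_
    refine sum_ext fun α => sum_ext fun β => ?_
    rw [M.frame.riem_pair_symm, M.frame.riem_antisymm_left, M.frame.riem_antisymm_right,
      show M.metricInv β α = M.metricInv α β from M.frame.gi_symm β α]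
    ring
  simp only [r1, mul_sub, sum_sub_distrib] at h
  rw [e] at h
  rw [b]
  linear_combination -h

end Fluid

/-! ### The energy identity of the fluid equations -/

section Generic

variable {R : Type*} [CommRing R] (p gt : Mat4 R) (np ng : Fin 4 → Mat4 R) (C : Col4 R)
  (c a : Mat4 R) (b : Col4 R) (Cd : Fin 4 → Col4 R) (m : R) (dm : Fin 4 → R)

/-- `μ'_p f⁻² U₀² + g̃^{αβ} C_{γα} C_{γβ}`, summed with the metric `p` over `γ`. -/
def fluidS : R :=
  m * ((c * C)ᵀ * p * (c * C)).trace + (p * c * gt * cᵀ).trace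

/-- The energy vector of the fluid, multiplied by `C⁰`. -/
def fluidT : Col4 R :=
  fluidS p gt C c m • C - (2 : R) • (gt * cᵀ * p * (c * C))

/-- The divergence of `fluidT`, with the first derivatives eliminated. -/
def fluidDivQ : R :=
  2 * ((c * C)ᵀ * p * b).trace - 2 * (p * a * gt * cᵀ).trace
    + fluidS p gt C c m * ∑ κ, Cd κ κ 0
    + ∑ κ, C κ 0 * (dm κ * ((c * C)ᵀ * p * (c * C)).trace
        + 2 * m * ((c * C)ᵀ * p * (c * Cd κ)).trace
        + m * ((c * C)ᵀ * np κ * (c * C)).trace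
        + (np κ * c * gt * cᵀ).trace + (p * c * ng κ * cᵀ).trace)
    - 2 * ∑ κ, (ng κ * cᵀ * p * (c * C) + gt * cᵀ * np κ * (c * C)
        + gt * cᵀ * p * (c * Cd κ)) κ 0

end Generic

namespace Fluid

variable {A : Type*} [CommRing A] [Algebra ℝ A] {M : Slicing A} (Φ : Fluid M)

/-- `C^α` as a column. -/
def Cc : Col4 A := of fun α _ => Φ.C α

/-- `∇_κ C^α` as columns. -/
def Cdc (κ : Fin 4) : Col4 A := of fun α _ => Φ.Cd κ α

/-- `C_{γα}` as a matrix. -/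
def cm : Mat4 A := of Φ.c

/-- `∇_κ C_{γα}` as matrices. -/
def nm (κ : Fin 4) : Mat4 A := of (M.frame.nabla2 Φ.c κ)

/-- `g̃^{αβ} = g^{αβ} - C^α C^β / C^λ C_λ` -/
def gt : Mat4 A := of fun α β => M.metricInv α β + Φ.fi ^ 2 * (Φ.C α * Φ.C β)

/-- `∇_κ g̃^{αβ}` -/
def ngt (κ : Fin 4) : Mat4 A := of fun α β =>
  2 * Φ.fi ^ 4 * Φ.U κ * (Φ.C α * Φ.C β)
    + Φ.fi ^ 2 * (Φ.Cd κ α * Φ.C β + Φ.C α * Φ.Cd κ β)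

/-- `μ'_p f⁻²` -/
def m : A := Φ.mu1 * Φ.fi ^ 2

/-- Its derivatives. -/
def dm (κ : Fin 4) : A :=
  -(Φ.mu2 * ((Φ.mu + Φ.p) * Φ.fi ^ 2 * Φ.U κ) * Φ.fi ^ 2) + 2 * Φ.mu1 * Φ.fi ^ 4 * Φ.U κ

lemma dM_Cc (κ : Fin 4) : M.frame.dM κ Φ.Cc = Φ.Cdc κ - M.frame.W κ * Φ.Cc := by
  ext α i
  simp only [Frame.dM_apply, Cc, Cdc, of_apply, Matrix.sub_apply, Matrix.mul_apply, Frame.W,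
    Slicing.frame_D, D_C]

lemma dM_cm (κ : Fin 4) : M.frame.dM κ Φ.cm
    = Φ.nm κ + (M.frame.W κ)ᵀ * Φ.cm + Φ.cm * M.frame.W κ := by
  ext γ α
  simp only [Frame.dM_apply, cm, nm, of_apply, Matrix.add_apply, Matrix.mul_apply, Frame.W,
    transpose_apply, Frame.nabla2, sum_add_distrib]
  simp only [mul_comm (Φ.c γ _)]
  ring

lemma dM_gt (κ : Fin 4) : M.frame.dM κ Φ.gt
    = Φ.ngt κ - M.frame.W κ * Φ.gt - Φ.gt * (M.frame.W κ)ᵀ := by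
  have h : Φ.gt = M.frame.gi + (of fun α β => Φ.fi ^ 2 * (Φ.C α * Φ.C β) : Mat4 A) := rfl
  have hd := Φ.dM_CC (Φ.fi ^ 2) (2 * Φ.fi ^ 4 * Φ.U κ) κ (by
    simp only [Derivation.leibniz_pow, D_fi, smul_eq_mul, nsmul_eq_mul]; push_cast; ring)
  rw [h, Frame.dM_add, hd, Frame.dM_gi, ngt]
  noncomm_ring

lemma D_m (κ : Fin 4) : M.D κ Φ.m = Φ.dm κ := by
  simp only [m, dm, Derivation.leibniz, Derivation.leibniz_pow, D_mu1, D_p, D_fi, smul_eq_mul,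
    nsmul_eq_mul]
  push_cast
  ring

/-- `∇_κ U` -/
def nU (κ : Fin 4) : Col4 A := Φ.nm κ * Φ.Cc + Φ.cm * Φ.Cdc κ

lemma dM_U (κ : Fin 4) : M.frame.dM κ (Φ.cm * Φ.Cc) = Φ.nU κ + (M.frame.W κ)ᵀ * (Φ.cm * Φ.Cc) := by
  rw [Frame.dM_mul, dM_Cc, dM_cm, nU]
  simp only [Matrix.add_mul, Matrix.mul_sub, Matrix.mul_assoc]
  abel

lemma dM_pos (κ : Fin 4) : M.frame.dM κ M.pos = M.npos κ - M.frame.W κ * M.pos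
    - M.pos * (M.frame.W κ)ᵀ := by
  rw [Slicing.npos]; abel

/-- The derivative of `fluidS`. -/
def nS (κ : Fin 4) : A :=
  Φ.dm κ * ((Φ.cm * Φ.Cc)ᵀ * M.pos * (Φ.cm * Φ.Cc)).trace
    + 2 * Φ.m * ((Φ.cm * Φ.Cc)ᵀ * M.pos * Φ.nU κ).trace
    + Φ.m * ((Φ.cm * Φ.Cc)ᵀ * M.npos κ * (Φ.cm * Φ.Cc)).trace
    + (M.npos κ * Φ.cm * Φ.gt * Φ.cmᵀ).trace
    + 2 * (M.pos * Φ.nm κ * Φ.gt * Φ.cmᵀ).trace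
    + (M.pos * Φ.cm * Φ.ngt κ * Φ.cmᵀ).trace

lemma gt_transpose : Φ.gtᵀ = Φ.gt := by
  ext α β
  simp only [gt, transpose_apply, of_apply]
  rw [show M.metricInv β α = M.metricInv α β from M.frame.gi_symm β α]; ring

lemma D_fluidS (κ : Fin 4) : M.D κ (fluidS M.pos Φ.gt Φ.Cc Φ.cm Φ.m) = Φ.nS κ := by
  set u := Φ.cm * Φ.Cc with hu
  have h1 : M.D κ (uᵀ * M.pos * u).trace
      = 2 * (uᵀ * M.pos * Φ.nU κ).trace + (uᵀ * M.npos κ * u).trace := by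
    rw [← Slicing.frame_D, Frame.D_trace]
    have hs : ((Φ.nU κ)ᵀ * M.pos * u).trace = (uᵀ * M.pos * Φ.nU κ).trace := by
      rw [← Matrix.trace_transpose]
      simp only [transpose_mul, transpose_transpose, M.pos_transpose, Matrix.mul_assoc]
    have hdu : M.frame.dM κ u = Φ.nU κ + (M.frame.W κ)ᵀ * u := Φ.dM_U κ
    simp only [Frame.dM_mul, Frame.dM_transpose, dM_pos, hdu, transpose_add, transpose_mul,
      transpose_transpose]
    simp only [Matrix.add_mul, Matrix.mul_add, Matrix.sub_mul, Matrix.mul_sub, Matrix.mul_assoc,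
      trace_add, trace_sub] at hs ⊢
    rw [hs]
    ring
  have h2 : M.D κ (M.pos * Φ.cm * Φ.gt * Φ.cmᵀ).trace = (M.npos κ * Φ.cm * Φ.gt * Φ.cmᵀ).trace
      + 2 * (M.pos * Φ.nm κ * Φ.gt * Φ.cmᵀ).trace + (M.pos * Φ.cm * Φ.ngt κ * Φ.cmᵀ).trace := by
    have hs : (M.pos * Φ.cm * Φ.gt * (Φ.nm κ)ᵀ).trace = (M.pos * Φ.nm κ * Φ.gt * Φ.cmᵀ).trace := by
      rw [← Matrix.trace_transpose]
      simp only [transpose_mul, transpose_transpose, M.pos_transpose, Φ.gt_transpose]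
      rw [← Matrix.mul_assoc, ← Matrix.mul_assoc, trace_mul_comm]
      simp only [Matrix.mul_assoc]
    have hc := trace_mul_comm (M.frame.W κ) (M.pos * Φ.cm * Φ.gt * Φ.cmᵀ)
    rw [← Slicing.frame_D, Frame.D_trace]
    simp only [Frame.dM_mul, Frame.dM_transpose, dM_pos, dM_cm, dM_gt, transpose_add, transpose_mul,
      transpose_transpose]
    simp only [Matrix.add_mul, Matrix.mul_add, Matrix.sub_mul, Matrix.mul_sub, Matrix.mul_assoc,
      trace_add, trace_sub] at hs hc ⊢
    rw [hs, hc]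
    ring
  rw [fluidS, map_add, Derivation.leibniz, h1, h2, D_m, nS, smul_eq_mul, smul_eq_mul]
  ring

/-- The energy vector of the fluid (multiplied by `C⁰`). -/
def T : Col4 A := fluidT M.pos Φ.gt Φ.Cc Φ.cm Φ.m

/-- `∇_κ T^α` -/
def nT (κ : Fin 4) : Col4 A :=
  Φ.nS κ • Φ.Cc + fluidS M.pos Φ.gt Φ.Cc Φ.cm Φ.m • Φ.Cdc κ
    - (2 : A) • (Φ.ngt κ * Φ.cmᵀ * M.pos * (Φ.cm * Φ.Cc)
      + Φ.gt * (Φ.nm κ)ᵀ * M.pos * (Φ.cm * Φ.Cc)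
      + Φ.gt * Φ.cmᵀ * M.npos κ * (Φ.cm * Φ.Cc)
      + Φ.gt * Φ.cmᵀ * M.pos * Φ.nU κ)

lemma dM_T (κ : Fin 4) : M.frame.dM κ Φ.T = Φ.nT κ - M.frame.W κ * Φ.T := by
  have h2 : M.frame.D κ (2 : A) = 0 := by
    have := (M.frame.D κ).map_natCast 2
    exact_mod_cast this
  have hv : M.frame.dM κ (Φ.gt * Φ.cmᵀ * M.pos * (Φ.cm * Φ.Cc))
      = (Φ.ngt κ * Φ.cmᵀ * M.pos * (Φ.cm * Φ.Cc) + Φ.gt * (Φ.nm κ)ᵀ * M.pos * (Φ.cm * Φ.Cc)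
      + Φ.gt * Φ.cmᵀ * M.npos κ * (Φ.cm * Φ.Cc) + Φ.gt * Φ.cmᵀ * M.pos * Φ.nU κ)
      - M.frame.W κ * (Φ.gt * Φ.cmᵀ * M.pos * (Φ.cm * Φ.Cc)) := by
    rw [Frame.dM_mul, dM_U, Frame.dM_mul, Frame.dM_mul, Frame.dM_transpose, dM_pos, dM_cm, dM_gt]
    simp only [transpose_add, transpose_mul, transpose_transpose, Matrix.add_mul, Matrix.mul_add,
      Matrix.sub_mul, Matrix.mul_sub, Matrix.mul_assoc]
    abel
  rw [T, fluidT, Frame.dM_sub, Frame.dM_smul, Frame.dM_smul, h2, hv, dM_Cc, Slicing.frame_D,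
    D_fluidS, nT]
  simp only [Matrix.mul_sub, Matrix.mul_smul, smul_sub, zero_smul]
  abel

lemma nablaUp_T (κ α : Fin 4) : M.frame.nablaUp (fun α => Φ.T α 0) κ α = Φ.nT κ α 0 := by
  have h := entry_congr (Φ.dM_T κ) α 0
  rw [Matrix.sub_apply, Frame.dM_apply] at h
  rw [Frame.nablaUp, h]
  change _ - ∑ ε, M.frame.omega α κ ε * Φ.T ε 0 + _ = _
  ring

lemma nT_divergence (hA : ∀ γ β, ∑ α, Φ.C α * (M.frame.nabla2 Φ.c α γ β - M.frame.nabla2 Φ.c β γ α)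
    + Φ.a γ β = 0) (hB : ∀ γ, ∑ α, ∑ β, Φ.Q α β * M.frame.nabla2 Φ.c α γ β + Φ.b γ = 0) : ∑ κ, Φ.nT
    κ κ 0 = fluidDivQ M.pos Φ.gt M.npos Φ.ngt Φ.Cc Φ.cm (of Φ.a)
    (of fun γ _ => Φ.b γ) Φ.Cdc Φ.m Φ.dm := by
  have i1 : Φ.m * ∑ κ, Φ.C κ * ((Φ.cm * Φ.Cc)ᵀ * M.pos * (Φ.nm κ * Φ.Cc)).trace
      - ∑ κ, (Φ.gt * (Φ.nm κ)ᵀ * M.pos * (Φ.cm * Φ.Cc)) κ 0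
      = ((Φ.cm * Φ.Cc)ᵀ * M.pos * (of fun γ _ => Φ.b γ : Col4 A)).trace := by
    set w : Col4 A := M.pos * (Φ.cm * Φ.Cc) with hw
    have hwt : (Φ.cm * Φ.Cc)ᵀ * M.pos = wᵀ := by
      rw [hw, transpose_mul M.pos, M.pos_transpose]
    have e1 : ∀ v : Col4 A, (wᵀ * v).trace = ∑ γ, w γ 0 * v γ 0 := fun v => by
      simp [trace, Matrix.mul_apply]
    have e2 : ∀ κ, (Φ.gt * (Φ.nm κ)ᵀ * M.pos * (Φ.cm * Φ.Cc)) κ 0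
        = ∑ γ, w γ 0 * ∑ β, Φ.gt κ β * Φ.nm κ γ β := fun κ => by
      rw [Matrix.mul_assoc, ← hw, Matrix.mul_apply]
      exact sum_ext fun γ => mul_comm _ _
    rw [hwt]
    simp only [e1, e2, mul_sum]
    rw [sum_comm]
    rw [sum_comm (f := fun κ γ => ∑ β, w γ 0 * (Φ.gt κ β * Φ.nm κ γ β))]
    rw [← sum_sub_distrib]
    refine sum_ext fun γ => ?_
    have hb : Φ.b γ = -∑ α, ∑ β, Φ.Q α β * M.frame.nabla2 Φ.c α γ β :=
      eq_neg_of_add_eq_zero_right (hB γ)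
    rw [of_apply, hb, mul_neg, mul_sum, ← sum_neg_distrib, ← sum_sub_distrib]
    refine sum_ext fun κ => ?_
    rw [Matrix.mul_apply, mul_sum, mul_sum, mul_sum, mul_sum, ← sum_sub_distrib, ← sum_neg_distrib]
    refine sum_ext fun β => ?_
    simp only [nm, Cc, gt, Q, m, of_apply]
    ring
  have i2 : ∑ κ, Φ.C κ * (M.pos * Φ.nm κ * Φ.gt * Φ.cmᵀ).trace
      - ∑ κ, (Φ.gt * Φ.cmᵀ * M.pos * (Φ.nm κ * Φ.Cc)) κ 0
      = -(M.pos * of Φ.a * Φ.gt * Φ.cmᵀ).trace := by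
    set Z : Mat4 A := Φ.gt * Φ.cmᵀ * M.pos with hZ
    have e1 : ∀ X : Mat4 A, (M.pos * X * Φ.gt * Φ.cmᵀ).trace
        = ∑ β, ∑ γ, Z β γ * X γ β := fun X => by
      rw [Matrix.mul_assoc, Matrix.mul_assoc, trace_mul_comm, Matrix.mul_assoc, ← hZ,
        trace_mul_comm]
      rfl
    have e2 : ∀ κ, (Z * (Φ.nm κ * Φ.Cc)) κ 0 = ∑ γ, Z κ γ * ∑ α, Φ.nm κ γ α * Φ.C α := fun κ => rfl
    simp only [e1, e2]
    have e3 : ∑ κ, Φ.C κ * ∑ β, ∑ γ, Z β γ * Φ.nm κ γ β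
        = ∑ β, ∑ γ, Z β γ * ∑ κ, Φ.C κ * Φ.nm κ γ β := by
      simp only [mul_sum]
      rw [sum_comm]
      refine sum_ext fun β => ?_
      rw [sum_comm]
      exact sum_ext fun γ => sum_ext fun κ => by ring
    rw [e3, ← sum_sub_distrib, ← sum_neg_distrib]
    refine sum_ext fun β => ?_
    rw [← sum_sub_distrib, ← sum_neg_distrib]
    refine sum_ext fun γ => ?_
    have ha := hA γ β
    simp only [mul_sub, sum_sub_distrib] at ha
    have e4 : ∑ α, Φ.nm β γ α * Φ.C α = ∑ α, Φ.C α * M.frame.nabla2 Φ.c β γ α :=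
      sum_ext fun _ => mul_comm _ _
    rw [e4, of_apply]
    change Z β γ * ∑ κ, Φ.C κ * M.frame.nabla2 Φ.c κ γ β - _ = _
    linear_combination Z β γ * ha
  have hC : ∀ κ, Φ.Cc κ 0 = Φ.C κ := fun κ => rfl
  simp only [nT, nS, nU, fluidDivQ, Matrix.sub_apply, Matrix.add_apply, Matrix.smul_apply,
    smul_eq_mul, hC, Matrix.mul_add, trace_add, mul_add, sum_add_distrib,
    sum_sub_distrib, add_mul, mul_sum] at i1 i2 ⊢
  have r : ∀ (x : A) (F : Fin 4 → A), ∑ κ, x * F κ * Φ.C κ = ∑ κ, Φ.C κ * (x * F κ) := fun x F =>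
    sum_ext fun _ => by ring
  have r' : ∀ (F : Fin 4 → A), ∑ κ, F κ * Φ.C κ = ∑ κ, Φ.C κ * F κ := fun F =>
    sum_ext fun _ => by ring
  simp only [r, r']
  have q1 : ∑ κ, Φ.C κ * (2 * Φ.m * ((Φ.cm * Φ.Cc)ᵀ * M.pos * (Φ.nm κ * Φ.Cc)).trace)
      = 2 * ∑ κ, Φ.m * (Φ.C κ * ((Φ.cm * Φ.Cc)ᵀ * M.pos * (Φ.nm κ * Φ.Cc)).trace) := by
    rw [mul_sum]; exact sum_ext fun _ => by ring
  have q2 : ∑ κ, Φ.C κ * (2 * (M.pos * Φ.nm κ * Φ.gt * Φ.cmᵀ).trace)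
      = 2 * ∑ κ, Φ.C κ * (M.pos * Φ.nm κ * Φ.gt * Φ.cmᵀ).trace := by
    rw [mul_sum]; exact sum_ext fun _ => by ring
  rw [q1, q2]
  simp only [← mul_sum]
  simp only [← mul_sum] at i1
  linear_combination 2 * i1 + 2 * i2

/-- The right hand side of the energy identity of the fluid. -/
def rate : A :=
  Φ.C0i * (M.N * M.tau * Φ.T 0 0
    + fluidDivQ M.pos Φ.gt M.npos Φ.ngt Φ.Cc Φ.cm (of Φ.a)
      (of fun γ _ => Φ.b γ) Φ.Cdc Φ.m Φ.dm
    - Φ.C0i * ∑ γ, Φ.T γ 0 * Φ.Cdc γ 0 0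
    + Φ.C0i * ∑ γ, Φ.T γ 0 * ∑ i : Fin 3, M.frame.omega 0 γ i.succ * Φ.C i.succ)

/-- The energy identity of the fluid. -/
lemma T_divergence (hA : ∀ γ β, ∑ α, Φ.C α * (M.frame.nabla2 Φ.c α γ β - M.frame.nabla2 Φ.c β γ α)
    + Φ.a γ β = 0) (hB : ∀ γ, ∑ α, ∑ β, Φ.Q α β * M.frame.nabla2 Φ.c α γ β + Φ.b γ = 0) : M.D 0
    (Φ.C0i * Φ.T 0 0) + M.div (fun i => Φ.C0i * Φ.T i.succ 0) = Φ.rate := by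
  have hd := M.divergence_split (fun α => Φ.C0i * Φ.T α 0)
  have hC : ∀ γ, M.D γ Φ.C0i = -(Φ.C0i ^ 2 * M.D γ (Φ.C 0)) := fun γ => by
    have h := congrArg (M.D γ) Φ.C_mul_C0i
    simp only [Derivation.leibniz, smul_eq_mul, Derivation.map_one_eq_zero] at h
    linear_combination Φ.C0i * h - M.D γ Φ.C0i * Φ.C_mul_C0i
  have hn : ∀ γ, M.frame.nablaUp (fun α => Φ.C0i * Φ.T α 0) γ γ - M.Ni * (Φ.C0i * Φ.T γ 0 * M.D γ M.N)
      = Φ.C0i * Φ.nT γ γ 0 - Φ.C0i * (Φ.C0i * (Φ.T γ 0 * Φ.Cdc γ 0 0))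
        + Φ.C0i * (Φ.C0i * (Φ.T γ 0 * ∑ i : Fin 3, M.frame.omega 0 γ i.succ * Φ.C i.succ)) :=
    fun γ => by
      have h1 := Φ.nablaUp_T γ γ
      have h2 := Φ.D_C γ 0
      rw [sum4, M.omega_zero_right] at h2
      have e : ∑ ε, M.frame.omega γ γ ε * (Φ.C0i * Φ.T ε 0)
          = Φ.C0i * ∑ ε, M.frame.omega γ γ ε * Φ.T ε 0 := by
        rw [mul_sum]; exact sum_ext fun _ => by ring
      rw [Frame.nablaUp, e]
      rw [Frame.nablaUp] at h1
      simp only [Derivation.leibniz, smul_eq_mul, Slicing.frame_D] at h1 ⊢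
      rw [hC, h2, ← h1]
      change _ = _ - Φ.C0i * (Φ.C0i * (Φ.T γ 0 * Φ.Cd γ 0)) + _
      linear_combination (Φ.T γ 0 * Φ.C0i * M.Ni * M.D γ M.N) * Φ.C_mul_C0i
  rw [mul_sum, ← sum_sub_distrib] at hd
  simp only [hn, sum_add_distrib, sum_sub_distrib, ← mul_sum] at hd
  rw [Φ.nT_divergence hA hB] at hd
  rw [rate]
  linear_combination hd

end Fluid

/-! ### The algebra of smooth functions on an open set of the coordinate space -/

open TopologicalSpace (Opens)

/-- Extension by zero. -/
def extZero (Ω : Opens Coord) (φ : Ω → ℝ) : Coord → ℝ :=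
  open Classical in fun z => if h : z ∈ Ω then φ ⟨z, h⟩ else 0

lemma extZero_of_mem {Ω : Opens Coord} (φ : Ω → ℝ) {z : Coord} (hz : z ∈ Ω) :
    extZero Ω φ z = φ ⟨z, hz⟩ := by
  simp [extZero, hz]

/-- The algebra of smooth functions on `Ω`. -/
def SmoothAlg (Ω : Opens Coord) : Subalgebra ℝ (Ω → ℝ) where
  carrier := {φ | ContDiffOn ℝ ∞ (extZero Ω φ) Ω}
  mul_mem' {a b} ha hb := by
    refine (ContDiffOn.mul ha hb).congr fun z hz => ?_
    simp only [extZero_of_mem _ (show z ∈ Ω from hz)]; rfl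
  add_mem' {a b} ha hb := by
    refine (ContDiffOn.add ha hb).congr fun z hz => ?_
    simp only [extZero_of_mem _ (show z ∈ Ω from hz)]; rfl
  algebraMap_mem' r := by
    refine (contDiffOn_const (c := r)).congr fun z hz => ?_
    simp only [extZero_of_mem _ (show z ∈ Ω from hz)]; rfl

namespace SmoothAlg

variable {Ω : Opens Coord}

/-- Evaluation at a point. -/
def ev (z : Ω) : SmoothAlg Ω →ₐ[ℝ] ℝ := (Pi.evalAlgHom ℝ (fun _ : Ω => ℝ) z).comp (SmoothAlg Ω).val

lemma ev_apply (z : Ω) (φ : SmoothAlg Ω) : ev z φ = φ.1 z := rfl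

lemma ext_ev {φ ψ : SmoothAlg Ω} (h : ∀ z, ev z φ = ev z ψ) : φ = ψ :=
  Subtype.ext (funext h)

/-- The element defined by a function smooth on `Ω`. -/
def mk (f : Coord → ℝ) (hf : ContDiffOn ℝ ∞ f Ω) : SmoothAlg Ω :=
  ⟨fun z => f z, hf.congr fun _ hz => extZero_of_mem _ hz⟩

@[simp] lemma ev_mk (f : Coord → ℝ) (hf : ContDiffOn ℝ ∞ f Ω) (z : Ω) : ev z (mk f hf) = f z := rfl

lemma contDiffOn (φ : SmoothAlg Ω) : ContDiffOn ℝ ∞ (extZero Ω φ.1) Ω := φ.2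

lemma contDiffOn_of_ev {φ : SmoothAlg Ω} {f : Coord → ℝ} (h : ∀ z : Ω, ev z φ = f z) :
    ContDiffOn ℝ ∞ f Ω :=
  (SmoothAlg.contDiffOn φ).congr fun z hz => by rw [extZero_of_mem _ (show z ∈ Ω from hz), ← h ⟨z, hz⟩]; rfl

lemma extZero_eventuallyEq {φ : SmoothAlg Ω} {f : Coord → ℝ} (h : ∀ z : Ω, ev z φ = f z) (z : Ω) :
    extZero Ω φ.1 =ᶠ[nhds z.1] f := by
  filter_upwards [Ω.isOpen.mem_nhds z.2] with w hw
  rw [extZero_of_mem _ hw]; exact h ⟨w, hw⟩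

lemma differentiableAt (φ : SmoothAlg Ω) (z : Ω) : DifferentiableAt ℝ (extZero Ω φ.1) z.1 :=
  (((SmoothAlg.contDiffOn φ).contDiffAt (Ω.isOpen.mem_nhds z.2)).differentiableAt (by simp))

lemma contDiffOn_pd (a : Fin 4) {f : Coord → ℝ} (hf : ContDiffOn ℝ ∞ f Ω) :
    ContDiffOn ℝ ∞ (pd a f) Ω := by
  have h : ContDiffOn ℝ ∞ (fderiv ℝ f) Ω := hf.fderiv_of_isOpen Ω.isOpen (by simp)
  exact h.clm_apply contDiffOn_const

/-- Partial derivatives of smooth functions. -/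
def pdFun (a : Fin 4) (φ : SmoothAlg Ω) : SmoothAlg Ω :=
  mk (pd a (extZero Ω φ.1)) (contDiffOn_pd a (SmoothAlg.contDiffOn φ))

lemma ev_pdFun (a : Fin 4) {φ : SmoothAlg Ω} {f : Coord → ℝ} (h : ∀ z : Ω, ev z φ = f z) (z : Ω) :
    ev z (pdFun a φ) = pd a f z := by
  rw [pdFun, ev_mk, pd, (extZero_eventuallyEq h z).fderiv_eq, pd]

lemma ev_extZero (φ : SmoothAlg Ω) (z : Ω) : ev z φ = extZero Ω φ.1 z := (extZero_of_mem _ z.2).symm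

lemma pdFun_add (a : Fin 4) (φ ψ : SmoothAlg Ω) : pdFun a (φ + ψ) = pdFun a φ + pdFun a ψ := by
  refine ext_ev fun z => ?_
  rw [ev_pdFun a (f := extZero Ω φ.1 + extZero Ω ψ.1)
    (fun w => by rw [map_add, Pi.add_apply, ev_extZero, ev_extZero]), map_add,
    ev_pdFun a (ev_extZero φ), ev_pdFun a (ev_extZero ψ), pd,
    fderiv_add (SmoothAlg.differentiableAt φ z) (SmoothAlg.differentiableAt ψ z)]
  rfl

lemma pdFun_smul (a : Fin 4) (r : ℝ) (φ : SmoothAlg Ω) : pdFun a (r • φ) = r • pdFun a φ := by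
  refine ext_ev fun z => ?_
  rw [ev_pdFun a (f := r • extZero Ω φ.1)
    (fun w => by rw [map_smul, Pi.smul_apply, ev_extZero]), map_smul,
    ev_pdFun a (ev_extZero φ), pd, fderiv_const_smul (SmoothAlg.differentiableAt φ z)]
  rfl

lemma pdFun_mul (a : Fin 4) (φ ψ : SmoothAlg Ω) :
    pdFun a (φ * ψ) = φ * pdFun a ψ + ψ * pdFun a φ := by
  refine ext_ev fun z => ?_
  rw [ev_pdFun a (f := extZero Ω φ.1 * extZero Ω ψ.1)
    (fun w => by rw [map_mul, Pi.mul_apply, ev_extZero, ev_extZero]), map_add, map_mul, map_mul,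
    ev_pdFun a (ev_extZero φ), ev_pdFun a (ev_extZero ψ), ev_extZero φ, ev_extZero ψ, pd,
    fderiv_mul (SmoothAlg.differentiableAt φ z) (SmoothAlg.differentiableAt ψ z)]
  rfl

/-- Partial derivatives as derivations. -/
def pdA (Ω : Opens Coord) (a : Fin 4) : Derivation ℝ (SmoothAlg Ω) (SmoothAlg Ω) :=
  Derivation.mk' { toFun := pdFun a, map_add' := pdFun_add a, map_smul' := pdFun_smul a }
    fun φ ψ => pdFun_mul a φ ψ

lemma ev_pdA (a : Fin 4) {φ : SmoothAlg Ω} {f : Coord → ℝ} (h : ∀ z : Ω, ev z φ = f z) (z : Ω) :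
    ev z (pdA Ω a φ) = pd a f z :=
  ev_pdFun a h z

lemma two_le_infty : (2 : WithTop ℕ∞) ≤ ∞ := WithTop.coe_le_coe.2 le_top

lemma pd_comm (a b : Fin 4) {f : Coord → ℝ} {z : Coord} (hf : ContDiffAt ℝ ∞ f z) :
    pd a (pd b f) z = pd b (pd a f) z := by
  have hs : IsSymmSndFDerivAt ℝ f z := hf.isSymmSndFDerivAt (by simp only [minSmoothness_of_isRCLikeNormedField]; exact two_le_infty)
  have hd : DifferentiableAt ℝ (fderiv ℝ f) z :=
    (hf.fderiv_right (m := 1) (by rw [one_add_one_eq_two]; exact two_le_infty)).differentiableAt (by simp)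
  have h : ∀ a b : Fin 4, pd a (pd b f) z
      = fderiv ℝ (fderiv ℝ f) z (Pi.single a 1) (Pi.single b 1) := fun a b => by
    change fderiv ℝ (fun w => fderiv ℝ f w (Pi.single b 1)) z (Pi.single a 1) = _
    rw [fderiv_clm_apply hd (differentiableAt_const _)]
    simp
  rw [h, h]
  exact hs _ _

lemma pdA_comm (a b : Fin 4) (φ : SmoothAlg Ω) : pdA Ω a (pdA Ω b φ) = pdA Ω b (pdA Ω a φ) := by
  refine ext_ev fun z => ?_
  have h : ∀ z : Ω, ev z φ = extZero Ω φ.1 z := fun z => (extZero_of_mem _ z.2).symm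
  rw [ev_pdA a (fun w => ev_pdA b h w), ev_pdA b (fun w => ev_pdA a h w)]
  exact pd_comm a b ((SmoothAlg.contDiffOn φ).contDiffAt (Ω.isOpen.mem_nhds z.2))

end SmoothAlg

open SmoothAlg

lemma derivation_sum_apply {A ι : Type*} [CommRing A] [Algebra ℝ A] (s : Finset ι)
    (X : ι → Derivation ℝ A A) (φ : A) : (∑ i ∈ s, X i) φ = ∑ i ∈ s, X i φ := by
  classical
  induction s using Finset.induction_on with
  | empty => simp
  | insert a s ha ih => rw [Finset.sum_insert ha, Finset.sum_insert ha, Derivation.add_apply, ih]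

/-- Regularity of a metric on an open set. -/
structure LocalMetric.RegularOn (M : LocalMetric) (Ω : Opens Coord) : Prop where
  N_pos : ∀ z ∈ Ω, 0 < M.N z
  h_posDef : ∀ z ∈ Ω, (M.h z).PosDef
  N_smooth : ContDiffOn ℝ ∞ M.N Ω
  shift_smooth : ∀ i, ContDiffOn ℝ ∞ (fun z => M.shift z i) Ω
  h_smooth : ∀ i j, ContDiffOn ℝ ∞ (fun z => M.h z i j) Ω

namespace LocalMetric.RegularOn

variable {M : LocalMetric} {Ω : Opens Coord}

lemma h_symm (hM : M.RegularOn Ω) {z : Coord} (hz : z ∈ Ω) (i j : Fin 3) : M.h z i j = M.h z j i := by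
  simpa using (hM.h_posDef z hz).isHermitian.apply j i

lemma det_pos (hM : M.RegularOn Ω) {z : Coord} (hz : z ∈ Ω) : 0 < (M.h z).det := (hM.h_posDef z hz).det_pos

lemma N_ne (hM : M.RegularOn Ω) {z : Coord} (hz : z ∈ Ω) : M.N z ≠ 0 := (hM.N_pos z hz).ne'

lemma Ninv_smooth (hM : M.RegularOn Ω) : ContDiffOn ℝ ∞ (fun z => (M.N z)⁻¹) Ω :=
  hM.N_smooth.inv fun _ hz => hM.N_ne hz

lemma det_smooth (hM : M.RegularOn Ω) : ContDiffOn ℝ ∞ (fun z => (M.h z).det) Ω := by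
  have hh := hM.h_smooth
  simp only [Matrix.det_fin_three]
  fun_prop

lemma hinv_smooth (hM : M.RegularOn Ω) (i j : Fin 3) : ContDiffOn ℝ ∞ (fun z => (M.h z)⁻¹ i j) Ω := by
  have hh := hM.h_smooth
  have hd := hM.det_smooth.inv fun _ hz => (hM.det_pos hz).ne'
  simp only [Matrix.inv_def, Ring.inverse_eq_inv', Matrix.smul_apply, smul_eq_mul]
  refine hd.mul ?_
  simp only [Matrix.adjugate_fin_three]
  fin_cases i <;> fin_cases j <;> simp <;> fun_prop

lemma sqrt_smooth (hM : M.RegularOn Ω) : ContDiffOn ℝ ∞ (fun z => Real.sqrt (M.h z).det) Ω :=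
  hM.det_smooth.sqrt fun _ hz => (hM.det_pos hz).ne'

/-- The slicing of the algebra of smooth functions defined by a metric. -/
def slicing (hM : M.RegularOn Ω) : Slicing (SmoothAlg Ω) where
  D := Fin.cases (pdA Ω 0 - ∑ i : Fin 3, SmoothAlg.mk (fun z => M.shift z i) (hM.shift_smooth i) • pdA Ω i.succ)
    fun i => pdA Ω i.succ
  N := SmoothAlg.mk M.N hM.N_smooth
  Ni := SmoothAlg.mk _ hM.Ninv_smooth
  h := of fun i j => SmoothAlg.mk _ (hM.h_smooth i j)
  hi := of fun i j => SmoothAlg.mk _ (hM.hinv_smooth i j)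
  shift i := SmoothAlg.mk _ (hM.shift_smooth i)
  sq := SmoothAlg.mk _ hM.sqrt_smooth
  sqi := SmoothAlg.mk (fun z => (Real.sqrt (M.h z).det)⁻¹)
    (hM.sqrt_smooth.inv fun _ hz => (Real.sqrt_pos.mpr (hM.det_pos hz)).ne')
  N_mul_Ni := ext_ev fun z => by simp [mul_inv_cancel₀ (hM.N_ne z.2)]
  h_symm i j := ext_ev fun z => by simp [hM.h_symm z.2 i j]
  h_mul_hi := by
    refine Matrix.ext fun i j => ext_ev fun z => ?_
    have h := entry_congr (Matrix.mul_nonsing_inv (M.h z) (isUnit_iff_ne_zero.2 (hM.det_pos z.2).ne')) i j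
    rw [Matrix.mul_apply] at h
    simp only [Matrix.mul_apply, map_sum, map_mul, of_apply, ev_mk, h, Matrix.one_apply]
    split_ifs <;> simp
  sq_mul_sqi := ext_ev fun z => by
    simp [mul_inv_cancel₀ (Real.sqrt_pos.mpr (hM.det_pos z.2)).ne']
  sq_mul_sq := ext_ev fun z => by
    rw [map_mul, ev_mk, Real.mul_self_sqrt (hM.det_pos z.2).le]
    simp only [Matrix.det_fin_three, map_mul, ev_mk, map_sub, map_add, of_apply]
  comm_space i j φ := pdA_comm _ _ _
  comm_time i φ := by
    simp only [Fin.cases_zero, Fin.cases_succ, Derivation.sub_apply, map_sub, derivation_sum_apply,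
      Derivation.smul_apply, map_sum, smul_eq_mul,
      Derivation.leibniz, sum_add_distrib, pdA_comm i.succ, mul_comm (pdA Ω _ φ)]
    ring

end LocalMetric.RegularOn

namespace LocalMetric.RegularOn

variable {M : LocalMetric} {Ω : Opens Coord} (hM : M.RegularOn Ω)

lemma ev_D (α : Fin 4) {φ : SmoothAlg Ω} {f : Coord → ℝ} (h : ∀ z : Ω, ev z φ = f z) (z : Ω) :
    ev z (hM.slicing.D α φ) = M.D α f z := by
  refine Fin.cases ?_ (fun i => ?_) α
  · simp only [slicing, Fin.cases_zero, D, Derivation.sub_apply, derivation_sum_apply,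
      Derivation.smul_apply, map_sub, map_sum, smul_eq_mul, map_mul, ev_mk, ev_pdA _ h]
  · simp only [slicing, Fin.cases_succ, D, ev_pdA _ h]

lemma ev_N (z : Ω) : ev z hM.slicing.N = M.N z := rfl

lemma ev_Ni (z : Ω) : ev z hM.slicing.Ni = (M.N z)⁻¹ := rfl

lemma ev_h (i j : Fin 3) (z : Ω) : ev z (hM.slicing.h i j) = M.h z i j := rfl

lemma ev_hi (i j : Fin 3) (z : Ω) : ev z (hM.slicing.hi i j) = (M.h z)⁻¹ i j := rfl

lemma ev_shift (i : Fin 3) (z : Ω) : ev z (hM.slicing.shift i) = M.shift z i := rfl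

lemma ev_sq (z : Ω) : ev z hM.slicing.sq = Real.sqrt (M.h z).det := rfl

lemma ev_sqi (z : Ω) : ev z hM.slicing.sqi = (Real.sqrt (M.h z).det)⁻¹ := rfl

lemma ev_metric (α β : Fin 4) (z : Ω) : ev z (hM.slicing.metric α β) = M.g z α β := by
  cases α using Fin.cases <;> cases β using Fin.cases <;>
    simp [g, frameMetric, ev_N, ev_h]

lemma ev_metricInv (α β : Fin 4) (z : Ω) : ev z (hM.slicing.metricInv α β) = M.gi z α β := by
  cases α using Fin.cases <;> cases β using Fin.cases <;>
    simp [gi, frameMetricInv, ev_Ni, ev_hi]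

lemma ev_pos (α β : Fin 4) (z : Ω) :
    ev z (hM.slicing.pos α β) = posMetricInv (M.N z) (M.h z) α β := by
  cases α using Fin.cases <;> cases β using Fin.cases <;>
    simp [posMetricInv, ev_Ni, ev_hi]

lemma ev_D_shift (i k : Fin 3) (z : Ω) : ev z (hM.slicing.D i.succ (hM.slicing.shift k))
    = pd i.succ (fun w => M.shift w k) z := by
  rw [hM.ev_D _ (f := fun w => M.shift w k) (hM.ev_shift k)]; rfl

lemma ev_bracket (γ α β : Fin 4) (z : Ω) : ev z (hM.slicing.bracket γ α β) = M.bracket γ α β z := by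
  refine Fin.cases ?_ (fun k => ?_) γ
  · simp [bracket]
  · cases α using Fin.cases <;> cases β using Fin.cases <;>
      simp [bracket, ev_D_shift]

lemma ev_omega (α β γ : Fin 4) (z : Ω) : ev z (hM.slicing.frame.omega α β γ) = M.omega α β γ z := by
  simp only [Frame.omega, omega, map_smul, map_sum, map_mul, map_add, map_sub, smul_eq_mul,
    Slicing.frame_D, Slicing.frame_g, Slicing.frame_gi, Slicing.frame_br, ev_metricInv,
    ev_bracket, ev_metric, fun a b c => hM.ev_D a (f := fun w => M.g w b c) (hM.ev_metric b c) z]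

lemma ev_riemUp (α β l m : Fin 4) (z : Ω) :
    ev z (hM.slicing.frame.riemUp α β l m) = M.riemUp α β l m z := by
  simp only [Frame.riemUp, riemUp, map_sum, map_mul, map_add, map_sub, Slicing.frame_D,
    Slicing.frame_br, ev_bracket, ev_omega, hM.ev_D _ (hM.ev_omega _ _ _)]

lemma ev_riem (α β l m : Fin 4) (z : Ω) :
    ev z (hM.slicing.frame.riem α β l m) = M.riem z α β l m := by
  simp only [Frame.riem, riem, map_sum, map_mul, Slicing.frame_g, ev_metric, ev_riemUp]

lemma ev_ricci (β m : Fin 4) (z : Ω) : ev z (hM.slicing.frame.ricci β m) = M.ricci z β m := by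
  simp only [Frame.ricci, ricci, map_sum, ev_riemUp]

lemma ev_nabla1 {X : Fin 4 → SmoothAlg Ω} {Y : Coord → T1} (h : ∀ β (z : Ω), ev z (X β) = Y z β)
    (γ β : Fin 4) (z : Ω) : ev z (hM.slicing.frame.nabla1 X γ β) = M.nabla1 Y z γ β := by
  simp only [Frame.nabla1, nabla1, map_sum, map_mul, map_sub, Slicing.frame_D, ev_omega,
    hM.ev_D γ (f := fun w => Y w β) (h β), h]

lemma ev_nabla2 {X : Fin 4 → Fin 4 → SmoothAlg Ω} {Y : Coord → T2}
    (h : ∀ α β (z : Ω), ev z (X α β) = Y z α β) (γ α β : Fin 4) (z : Ω) :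
    ev z (hM.slicing.frame.nabla2 X γ α β) = M.nabla2 Y z γ α β := by
  simp only [Frame.nabla2, nabla2, map_sum, map_mul, map_sub, map_add, Slicing.frame_D, ev_omega,
    hM.ev_D γ (f := fun w => Y w α β) (h α β), h]

lemma ev_nabla4 {X : Fin 4 → Fin 4 → Fin 4 → Fin 4 → SmoothAlg Ω} {Y : Coord → T4}
    (h : ∀ α β l m (z : Ω), ev z (X α β l m) = Y z α β l m) (γ α β l m : Fin 4) (z : Ω) :
    ev z (hM.slicing.frame.nabla4 X γ α β l m) = M.nabla4 Y z γ α β l m := by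
  simp only [Frame.nabla4, nabla4, map_sum, map_mul, map_sub, map_add, Slicing.frame_D, ev_omega,
    hM.ev_D γ (f := fun w => Y w α β l m) (h α β l m), h]

lemma ev_K (i j : Fin 3) (z : Ω) : ev z (hM.slicing.K i j) = M.K z i j := by
  simp only [Slicing.K, K, map_smul, map_sum, map_mul, map_sub, map_add, smul_eq_mul, ev_D_shift,
    hM.ev_D 0 (f := fun w => M.h w i j) (hM.ev_h i j), ev_h, ev_Ni, mul_assoc]

lemma ev_tau (z : Ω) : ev z hM.slicing.tau = M.tau z := by
  simp only [Slicing.tau, tau, map_sum, map_mul, ev_hi, ev_K]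

lemma ev_div {X : Fin 3 → SmoothAlg Ω} {Y : Coord → Fin 3 → ℝ} (h : ∀ i (z : Ω), ev z (X i) = Y z i)
    (z : Ω) : ev z (hM.slicing.div X) = M.div Y z := by
  have h' : ∀ i (z : Ω), ev z (hM.slicing.sq * X i) = Real.sqrt (M.h z).det * Y z i := fun i z => by
    rw [map_mul, h, ev_sq]
  simp only [Slicing.div, div, map_sum, map_mul, ev_sqi, fun i : Fin 3 => hM.ev_D i.succ (f := fun w => Real.sqrt (M.h w).det * Y w i) (h' i) z]
  rfl

lemma ev_dN (i : Fin 3) (z : Ω) : ev z (hM.slicing.D i.succ hM.slicing.N) = M.dN z i := by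
  rw [hM.ev_D _ hM.ev_N]; rfl

end LocalMetric.RegularOn

/-- Regularity of the state of a fluid on an open set. -/
structure FluidRegularOn (M : LocalMetric) (st : Coord → PointState) (Ω : Opens Coord) : Prop where
  N_eq : ∀ z, (st z).N = M.N z
  h_eq : ∀ z, (st z).h = M.h z
  C_smooth : ∀ α, ContDiffOn ℝ ∞ (fun z => (st z).C α) Ω
  f_smooth : ContDiffOn ℝ ∞ (fun z => (st z).f) Ω
  p_smooth : ContDiffOn ℝ ∞ (fun z => (st z).p) Ω
  mu_smooth : ContDiffOn ℝ ∞ (fun z => (st z).mu) Ω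
  mu1_smooth : ContDiffOn ℝ ∞ (fun z => (st z).mu1) Ω
  mu2_smooth : ContDiffOn ℝ ∞ (fun z => (st z).mu2) Ω
  C_ne : ∀ z ∈ Ω, (st z).C 0 ≠ 0
  f_ne : ∀ z ∈ Ω, (st z).f ≠ 0
  CC_eq : ∀ z ∈ Ω, (st z).CC = -(st z).f ^ 2
  pd_mu : ∀ z ∈ Ω, ∀ a, pd a (fun w => (st w).mu) z = (st z).mu1 * pd a (fun w => (st w).p) z
  pd_mu1 : ∀ z ∈ Ω, ∀ a, pd a (fun w => (st w).mu1) z = (st z).mu2 * pd a (fun w => (st w).p) z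
  pd_f : ∀ z ∈ Ω, ∀ a, ((st z).mu + (st z).p) * pd a (fun w => (st w).f) z
    = (st z).f * pd a (fun w => (st w).p) z

namespace FluidRegularOn

variable {M : LocalMetric} {st : Coord → PointState} {Ω : Opens Coord}

lemma D_relation (M : LocalMetric) {f f' : Coord → ℝ} {a b : ℝ} {z : Coord}
    (h : ∀ k, a * pd k f z = b * pd k f' z) (α : Fin 4) : a * M.D α f z = b * M.D α f' z := by
  refine Fin.cases ?_ (fun i => ?_) α
  · simp only [LocalMetric.D, Fin.cases_zero, mul_sub, h, mul_sum, mul_left_comm _ (M.shift _ _)]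
  · simp only [LocalMetric.D, Fin.cases_succ, h]

/-- The fluid over the algebra of smooth functions. -/
def fluid (hF : FluidRegularOn M st Ω) (hM : M.RegularOn Ω) : Fluid hM.slicing where
  C α := SmoothAlg.mk _ (hF.C_smooth α)
  C0i := SmoothAlg.mk _ ((hF.C_smooth 0).inv hF.C_ne)
  f := SmoothAlg.mk _ hF.f_smooth
  fi := SmoothAlg.mk _ (hF.f_smooth.inv hF.f_ne)
  p := SmoothAlg.mk _ hF.p_smooth
  mu := SmoothAlg.mk _ hF.mu_smooth
  mu1 := SmoothAlg.mk _ hF.mu1_smooth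
  mu2 := SmoothAlg.mk _ hF.mu2_smooth
  C_mul_C0i := ext_ev fun z => by simp [mul_inv_cancel₀ (hF.C_ne z z.2)]
  f_mul_fi := ext_ev fun z => by simp [mul_inv_cancel₀ (hF.f_ne z z.2)]
  norm := ext_ev fun z => by
    have h := hF.CC_eq z z.2
    simp only [PointState.CC, PointState.Cl, PointState.g, hF.N_eq, hF.h_eq] at h
    simpa only [map_sum, map_mul, ev_mk, hM.ev_metric, map_neg, map_pow, LocalMetric.g] using h
  D_mu γ := ext_ev fun z => by
    rw [map_mul, hM.ev_D γ (ev_mk _ _), hM.ev_D γ (ev_mk _ _), ev_mk]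
    simpa using D_relation (a := 1) M (fun k => by simpa using hF.pd_mu z z.2 k) γ
  D_mu1 γ := ext_ev fun z => by
    rw [map_mul, hM.ev_D γ (ev_mk _ _), hM.ev_D γ (ev_mk _ _), ev_mk]
    simpa using D_relation (a := 1) M (fun k => by simpa using hF.pd_mu1 z z.2 k) γ
  D_f γ := ext_ev fun z => by
    rw [map_mul, map_mul, hM.ev_D γ (ev_mk _ _), hM.ev_D γ (ev_mk _ _), map_add, ev_mk, ev_mk, ev_mk]
    exact D_relation M (hF.pd_f z z.2) γ

variable (hF : FluidRegularOn M st Ω) (hM : M.RegularOn Ω)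

lemma ev_C (α : Fin 4) (z : Ω) : ev z ((hF.fluid hM).C α) = (st z).C α := rfl

lemma ev_fi (z : Ω) : ev z (hF.fluid hM).fi = ((st z).f)⁻¹ := rfl

lemma ev_mu (z : Ω) : ev z (hF.fluid hM).mu = (st z).mu := rfl

lemma ev_p (z : Ω) : ev z (hF.fluid hM).p = (st z).p := rfl

lemma ev_mu1 (z : Ω) : ev z (hF.fluid hM).mu1 = (st z).mu1 := rfl

lemma ev_mu2 (z : Ω) : ev z (hF.fluid hM).mu2 = (st z).mu2 := rfl

lemma ev_C0i (z : Ω) : ev z (hF.fluid hM).C0i = ((st z).C 0)⁻¹ := rfl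

lemma g_eq (hF : FluidRegularOn M st Ω) (z : Coord) : (st z).g = M.g z := by rw [PointState.g, hF.N_eq, hF.h_eq]; rfl

lemma gi_eq (hF : FluidRegularOn M st Ω) (z : Coord) : (st z).gi = M.gi z := by rw [PointState.gi, hF.N_eq, hF.h_eq]; rfl

lemma ev_Cl (α : Fin 4) (z : Ω) : ev z ((hF.fluid hM).Cl α) = (st z).Cl α := by
  simp only [Fluid.Cl, PointState.Cl, map_sum, map_mul, hM.ev_metric, ev_C, hF.g_eq]

/-- The dynamical acceleration of the fluid in a coordinate patch. -/
def acc (M : LocalMetric) (st : Coord → PointState) (z : Coord) : T2 :=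
  M.nabla1 (fun w => (st w).Cl) z

lemma ev_c (γ α : Fin 4) (z : Ω) : ev z ((hF.fluid hM).c γ α) = acc M st z γ α :=
  hM.ev_nabla1 (fun β w => hF.ev_Cl hM β w) γ α z

lemma ev_Cd (γ α : Fin 4) (z : Ω) :
    ev z ((hF.fluid hM).Cd γ α) = ∑ δ, (st z).gi α δ * acc M st z γ δ := by
  simp only [Fluid.Cd, map_sum, map_mul, hM.ev_metricInv, ev_c, hF.gi_eq]

lemma ev_U (γ : Fin 4) (z : Ω) : ev z ((hF.fluid hM).U γ) = (st z).U0 (acc M st z) γ := by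
  simp only [Fluid.U, PointState.U0, map_sum, map_mul, ev_C, ev_c]

lemma ev_a (γ β : Fin 4) (z : Ω) :
    ev z ((hF.fluid hM).a γ β) = (st z).aTerm (M.riem z) (acc M st z) γ β := by
  simp only [Fluid.a, PointState.aTerm, map_sum, map_mul, map_add, map_sub, ev_C, ev_c,
    hM.ev_metricInv, hM.ev_riem, hF.gi_eq]

lemma ev_Q (α β : Fin 4) (z : Ω) : ev z ((hF.fluid hM).Q α β)
    = M.gi z α β + ((st z).mu1 - 1) * ((st z).C α * (st z).C β / (st z).CC) := by
  have hf := hF.f_ne z z.2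
  simp only [Fluid.Q, of_apply, map_mul, map_sub, map_pow, ev_C, hM.ev_metricInv, ev_fi, ev_mu1,
    hF.CC_eq z z.2, map_one]
  field_simp
  ring

lemma ev_nQ (γ α β : Fin 4) (z : Ω) : ev z ((hF.fluid hM).nQ γ α β)
    = (st z).dCoeff (acc M st z) γ α β := by
  have hf := hF.f_ne z z.2
  simp only [Fluid.nQ, of_apply, map_mul, map_sub, map_add, map_pow, ev_C, ev_fi, ev_Cd, ev_U,
    ev_mu1, ev_mu2, ev_mu, ev_p, map_one, map_ofNat, PointState.dCoeff, PointState.dp, PointState.U0,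
    hF.CC_eq z z.2]
  field_simp
  ring

lemma ev_b (γ : Fin 4) (z : Ω) :
    ev z ((hF.fluid hM).b γ) = (st z).bTerm (M.riem z) (acc M st z) γ := by
  simp only [Fluid.b, PointState.bTerm, map_sum, map_mul, map_add, map_neg, ev_C, ev_c, ev_nQ,
    hM.ev_metricInv, hM.ev_riem, hF.gi_eq]

end FluidRegularOn

/-! ### The Bianchi-Euler system holds -/

namespace Fluid

variable {A : Type*} [CommRing A] [Algebra ℝ A] {M : Slicing A} (Φ : Fluid M)

/-- `ρ_{αβ} = (μ + p) f⁻² C_α C_β + ½ (μ - p) g_{αβ}` -/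
def rho (α β : Fin 4) : A :=
  (Φ.mu + Φ.p) * Φ.fi ^ 2 * (Φ.Cl α * Φ.Cl β)
    + (1 / 2 : ℝ) • (M.metric α β * (Φ.mu - Φ.p))

lemma D_Cl (γ α : Fin 4) : M.D γ (Φ.Cl α) = Φ.c γ α + ∑ ε, M.frame.omega ε γ α * Φ.Cl ε := by
  simp only [c, Frame.nabla1, Slicing.frame_D]; ring

lemma D_density (γ : Fin 4) : M.D γ ((Φ.mu + Φ.p) * Φ.fi ^ 2)
    = (Φ.mu1 - 1) * Φ.fi ^ 2 * M.D γ Φ.p := by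
  have h1 := Φ.D_fi γ
  have h2 := Φ.D_p γ
  simp only [Derivation.leibniz, Derivation.leibniz_pow, smul_eq_mul, map_add, Φ.D_mu, h1]
  simp only [nsmul_eq_mul, Nat.cast_ofNat, h2]
  ring

lemma nabla2_rho (γ α β : Fin 4) : M.frame.nabla2 Φ.rho γ α β
    = (Φ.mu1 - 1) * Φ.fi ^ 2 * M.D γ Φ.p * (Φ.Cl α * Φ.Cl β)
    + (Φ.mu + Φ.p) * Φ.fi ^ 2 * (Φ.c γ α * Φ.Cl β + Φ.Cl α * Φ.c γ β)
    + (1 / 2 : ℝ) • (M.metric α β * ((Φ.mu1 - 1) * M.D γ Φ.p)) := by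
  have hg := M.frame.metric_compat γ α β
  simp only [Slicing.frame_D, Slicing.frame_g] at hg
  have e1 : M.D γ (Φ.rho α β) = (Φ.mu1 - 1) * Φ.fi ^ 2 * M.D γ Φ.p * (Φ.Cl α * Φ.Cl β)
      + (Φ.mu + Φ.p) * Φ.fi ^ 2 * (Φ.Cl α * M.D γ (Φ.Cl β) + M.D γ (Φ.Cl α) * Φ.Cl β)
      + (1 / 2 : ℝ) • (M.metric α β * ((Φ.mu1 - 1) * M.D γ Φ.p))
      + (1 / 2 : ℝ) • (M.D γ (M.metric α β) * (Φ.mu - Φ.p)) := by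
    rw [rho, map_add, Derivation.leibniz, Φ.D_density, Derivation.leibniz, Derivation.map_smul,
      Derivation.leibniz, map_sub, Φ.D_mu]
    simp only [smul_eq_mul, smul_add, Algebra.smul_def]
    ring
  have hs : ∀ α β, M.metric α β = M.metric β α := M.frame.g_symm
  have e2 : (∑ ε, (M.frame.omega ε γ α * Φ.rho ε β + M.frame.omega ε γ β * Φ.rho α ε))
      = (Φ.mu + Φ.p) * Φ.fi ^ 2 * (Φ.Cl α * ∑ ε, M.frame.omega ε γ β * Φ.Cl ε
      + (∑ ε, M.frame.omega ε γ α * Φ.Cl ε) * Φ.Cl β)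
      + (1 / 2 : ℝ) • ((∑ ε, M.metric α ε * M.frame.omega ε γ β
      + ∑ ε, M.metric β ε * M.frame.omega ε γ α) * (Φ.mu - Φ.p)) := by
    simp only [rho, mul_sum, sum_mul, mul_add, add_mul, smul_sum, smul_add, ← sum_add_distrib,
      Algebra.smul_def]
    refine sum_ext fun ε => ?_
    rw [hs β ε]
    ring
  rw [Frame.nabla2, Slicing.frame_D, e1, e2, D_Cl, D_Cl, hg]
  ring

end Fluid

namespace FluidRegularOn

variable {M : LocalMetric} {st : Coord → PointState} {Ω : Opens Coord}

lemma ev_D_p (hF : FluidRegularOn M st Ω) (hM : M.RegularOn Ω) (γ : Fin 4) (z : Ω) :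
    ev z (hM.slicing.D γ (hF.fluid hM).p) = (st z).dp (acc M st z) γ := by
  have hf := hF.f_ne z z.2
  rw [Fluid.D_p]
  simp only [map_neg, map_mul, map_add, map_pow, ev_mu, ev_p, ev_fi, ev_U, PointState.dp,
    hF.CC_eq z z.2, PointState.U0]
  field_simp

lemma ev_nabla2_rho (hF : FluidRegularOn M st Ω) (hM : M.RegularOn Ω) (γ α β : Fin 4) (z : Ω) :
    ev z (hM.slicing.frame.nabla2 (hF.fluid hM).rho γ α β) = (st z).dRho (acc M st z) γ α β := by
  rw [Fluid.nabla2_rho]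
  simp only [map_add, map_mul, map_sub, map_pow, map_one, map_smul, ev_D_p, ev_mu, ev_p, ev_fi,
    ev_mu1, ev_Cl, ev_c, hM.ev_metric, PointState.dRho, hF.g_eq, smul_eq_mul, inv_pow]
  ring

/-- The Einstein and fluid equations in a coordinate patch. -/
structure EinsteinEulerOn (M : LocalMetric) (st : Coord → PointState) (Ω : Set Coord) : Prop where
  einstein : ∀ z ∈ Ω, ∀ α β, M.ricci z α β
    = ((st z).mu + (st z).p) * ((st z).f ^ 2)⁻¹ * ((st z).Cl α * (st z).Cl β)
      + (1 / 2) * (M.g z α β * ((st z).mu - (st z).p))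
  euler : ∀ z ∈ Ω, ∀ β, ∑ α, (st z).C α * (acc M st z α β - acc M st z β α) = 0
  euler_div : ∀ z ∈ Ω, ∑ α, ∑ β, (M.gi z α β
      + ((st z).mu1 - 1) * ((st z).C α * (st z).C β / (st z).CC)) * acc M st z α β = 0

variable (hF : FluidRegularOn M st Ω) (hM : M.RegularOn Ω)

lemma ricci_eq (hE : EinsteinEulerOn M st Ω) : hM.slicing.frame.ricci = (hF.fluid hM).rho := by
  funext α β
  refine ext_ev fun z => ?_
  rw [hM.ev_ricci, hE.einstein z z.2]
  simp only [Fluid.rho, map_add, map_mul, map_sub, map_pow, map_smul, ev_mu, ev_p, ev_fi, ev_Cl,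
    hM.ev_metric, smul_eq_mul, inv_pow]

lemma fluid_accM (hE : EinsteinEulerOn M st Ω) (γ β : Fin 4) : ∑ α, (hF.fluid hM).C α *
    (hM.slicing.frame.nabla2 (hF.fluid hM).c α γ β - hM.slicing.frame.nabla2 (hF.fluid hM).c β γ α)
    + (hF.fluid hM).a γ β = 0 :=
  Fluid.accM_eq_zero _ (fun β => ext_ev fun z => by
    simpa only [map_sum, map_mul, map_sub, ev_C, ev_c, map_zero] using hE.euler z z.2 β) γ β

lemma fluid_accDiv (hE : EinsteinEulerOn M st Ω) (γ : Fin 4) : ∑ α, ∑ β,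
    (hF.fluid hM).Q α β * hM.slicing.frame.nabla2 (hF.fluid hM).c α γ β + (hF.fluid hM).b γ = 0 :=
  Fluid.accDiv_eq_zero _ (ext_ev fun z => by
    simpa only [map_sum, map_mul, ev_Q, ev_c, map_zero] using hE.euler_div z z.2) γ

/-- The divergence of the curvature. -/
lemma riem_divergence_eq (hF : FluidRegularOn M st Ω) (hM : M.RegularOn Ω)
    (hE : EinsteinEulerOn M st Ω) (i l m : Fin 4) (z : Ω) : ev z
    (∑ α, ∑ β, hM.slicing.metricInv α β * hM.slicing.frame.nabla4 hM.slicing.frame.riem α β i l m)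
    = (st z).current (acc M st z) i l m := by
  have h := hM.slicing.frame.riem_divergence i l m
  have hs : ∀ γ, ev z (hM.slicing.frame.nabla2 (hF.fluid hM).rho γ i m)
      = (st z).dRho (acc M st z) γ m i := fun γ => by
    rw [hF.ev_nabla2_rho]; simp only [PointState.dRho, hF.g_eq]
    rw [show M.g z i m = M.g z m i by
      rw [← hM.ev_metric, ← hM.ev_metric]; exact congrArg _ (hM.slicing.frame.g_symm i m)]
    ring
  have hs' : ∀ γ, ev z (hM.slicing.frame.nabla2 (hF.fluid hM).rho γ i l)
      = (st z).dRho (acc M st z) γ l i := fun γ => by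
    rw [hF.ev_nabla2_rho]; simp only [PointState.dRho, hF.g_eq]
    rw [show M.g z i l = M.g z l i by
      rw [← hM.ev_metric, ← hM.ev_metric]; exact congrArg _ (hM.slicing.frame.g_symm i l)]
    ring
  rw [Slicing.frame_gi] at h
  rw [h, hF.ricci_eq hM hE, map_sub, hs, hs']
  rfl

lemma system_eq_zero (hF : FluidRegularOn M st Ω) (hM : M.RegularOn Ω) (hE : EinsteinEulerOn M st Ω)
    {u : Coord → Idx → ℝ} (hR : ∀ z ∈ Ω, riemPart (u z) = M.riem z)
    (hc : ∀ z ∈ Ω, accPart (u z) = acc M st z) (z : Coord) (hz : z ∈ Ω) : system M st u z = 0 := by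
  have h4 : ∀ γ α β l m, M.nabla4 (fun w => riemPart (u w)) z γ α β l m
      = ev ⟨z, hz⟩ (hM.slicing.frame.nabla4 hM.slicing.frame.riem γ α β l m) := fun γ α β l m =>
    (hM.ev_nabla4 (fun α β l m w => by rw [hM.ev_riem, hR w w.2]) γ α β l m ⟨z, hz⟩).symm
  have h2 : ∀ γ α β, M.nabla2 (fun w => accPart (u w)) z γ α β
      = ev ⟨z, hz⟩ (hM.slicing.frame.nabla2 (hF.fluid hM).c γ α β) := fun γ α β =>
    (hM.ev_nabla2 (fun α β w => by rw [hF.ev_c, hc w w.2]) γ α β ⟨z, hz⟩).symm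
  have hM' : ∀ γ β, accM M st (fun w => riemPart (u w)) (fun w => accPart (u w)) z γ β = 0 := by
    intro γ β
    have := congrArg (ev ⟨z, hz⟩) (hF.fluid_accM hM hE γ β)
    simpa only [map_add, map_sum, map_mul, map_sub, ev_C, ev_a, map_zero, ← h2, accM, hR z hz,
      hc z hz] using this
  funext i
  rcases i with ⟨⟨i | k, lm⟩⟩ | ⟨γ, α⟩
  · simp only [system, Sum.elim_inl, Pi.zero_apply, bianchiDiv, h4, hc z hz]
    rw [← hF.riem_divergence_eq hM hE _ _ _ ⟨z, hz⟩]
    simp only [map_sum, map_mul, hM.ev_metricInv, sub_self]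
  · simp only [system, Sum.elim_inl, Sum.elim_inr, Pi.zero_apply, bianchiCyclic, h4, ← map_add,
      ← map_sub, Frame.riem_bianchi_left, map_zero]
  · refine Fin.cases ?_ (fun i => ?_) α
    · have := congrArg (ev ⟨z, hz⟩) (hF.fluid_accDiv hM hE γ)
      simpa only [system, Sum.elim_inr, Fin.cases_zero, Pi.zero_apply, accDiv, map_add, map_sum,
        map_mul, ev_Q, ev_b, map_zero, ← h2, hR z hz, hc z hz] using this
    · simp only [system, Sum.elim_inr, Fin.cases_succ, accMtilde, hM', mul_zero, sub_zero,
        Pi.zero_apply]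

end FluidRegularOn

@[simp] lemma biv_zero_zero (w : PairIdx → ℝ) : biv w 0 0 = 0 := rfl

@[simp] lemma biv_zero_succ (w : PairIdx → ℝ) (j : Fin 3) : biv w 0 j.succ = w (Sum.inl j) := rfl

@[simp] lemma biv_succ_zero (w : PairIdx → ℝ) (j : Fin 3) : biv w j.succ 0 = -w (Sum.inl j) := rfl

@[simp] lemma biv_succ_succ (w : PairIdx → ℝ) (i j : Fin 3) :
    biv w i.succ j.succ = ∑ k, eps i j k * w (Sum.inr k) := rfl

lemma biv_antisymm {X : T2} (h : ∀ α β, X α β = -X β α) :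
    biv (fun a => X (pairFst a) (pairSnd a)) = X := by
  have h0 : ∀ α, X α α = 0 := fun α => by linarith [h α α]
  funext α β
  refine Fin.cases ?_ (fun i => ?_) α <;> refine Fin.cases ?_ (fun j => ?_) β
  · simp [h0]
  · simp [pairFst, pairSnd]
  · simp [pairFst, pairSnd, h i.succ 0]
  · rw [biv_succ_succ]
    fin_cases i <;> fin_cases j <;>
      simp [pairFst, pairSnd, Fin.sum_univ_three, eps, h0] <;> norm_num
    · exact (h 1 3).symm
    · exact (h 2 1).symm
    · exact (h 3 2).symm

lemma riemPart_packUnknown {r : T4} {c : T2} (h : SkewLeft r)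
    (h' : SkewRight r) : riemPart (packUnknown r c) = r := by
  funext α β l m
  have e : ∀ a, biv (fun b => packUnknown r c (Sum.inl (a, b)))
      = r (pairFst a) (pairSnd a) := fun a => by
    exact biv_antisymm (X := r (pairFst a) (pairSnd a)) fun l m => h' _ _ l m
  simp only [riemPart, e]
  exact congrFun (congrFun (biv_antisymm (X := fun α β => r α β l m) fun α β => h α β l m) α) β

lemma LocalMetric.RegularOn.riem_antisymm {M : LocalMetric} {Ω : Opens Coord} (hM : M.RegularOn Ω)
    {z : Coord} (hz : z ∈ Ω) (α β l m : Fin 4) : M.riem z α β l m = -M.riem z β α l m := by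
  rw [← hM.ev_riem _ _ _ _ ⟨z, hz⟩, ← hM.ev_riem _ _ _ _ ⟨z, hz⟩, Frame.riem_antisymm_left, map_neg]

lemma LocalMetric.RegularOn.riem_antisymm' {M : LocalMetric} {Ω : Opens Coord} (hM : M.RegularOn Ω)
    {z : Coord} (hz : z ∈ Ω) (α β l m : Fin 4) : M.riem z α β l m = -M.riem z α β m l := by
  rw [← hM.ev_riem _ _ _ _ ⟨z, hz⟩, ← hM.ev_riem _ _ _ _ ⟨z, hz⟩, Frame.riem_antisymm_right, map_neg]

/-! ### Electric and magnetic decomposition at a point -/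

/-- The full contraction `p^{ij} F_{ij}`. -/
def pr {n : Type*} [Fintype n] (p : Matrix n n ℝ) (F : n → n → ℝ) : ℝ := ∑ i, ∑ j, p i j * F i j

section pr

variable {n m : Type*} [Fintype n] [Fintype m] (p : Matrix n n ℝ) (q : Matrix m m ℝ)

lemma pr_comm (F : n → n → m → m → ℝ) :
    pr p (fun i j => pr q (F i j)) = pr q fun k l => pr p fun i j => F i j k l := by
  have h1 : pr p (fun i j => pr q (F i j))
      = ∑ x : n × n, ∑ y : m × m, p x.1 x.2 * (q y.1 y.2 * F x.1 x.2 y.1 y.2) := by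
    simp only [pr, Fintype.sum_prod_type, mul_sum]
  have h2 : (pr q fun k l => pr p fun i j => F i j k l)
      = ∑ y : m × m, ∑ x : n × n, q y.1 y.2 * (p x.1 x.2 * F x.1 x.2 y.1 y.2) := by
    simp only [pr, Fintype.sum_prod_type, mul_sum]
  rw [h1, h2, sum_comm]
  simp only [mul_left_comm]

lemma mul_pr (c : ℝ) (F : n → n → ℝ) : c * pr p F = pr p fun i j => c * F i j := by
  simp only [pr, mul_sum, mul_left_comm c]

lemma pr_congr {p : Matrix n n ℝ} {F G : n → n → ℝ} (h : ∀ i j, F i j = G i j) :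
    pr p F = pr p G :=
  congrArg _ (funext fun i => funext (h i))

lemma pr_add (F G : n → n → ℝ) : pr p F + pr p G = pr p fun i j => F i j + G i j := by
  simp only [pr, mul_add, sum_add_distrib]

lemma pr_sum {ι : Type*} (s : Finset ι) (F : ι → n → n → ℝ) :
    ∑ k ∈ s, pr p (F k) = pr p fun i j => ∑ k ∈ s, F k i j := by
  classical
  induction s using Finset.induction_on with
  | empty => simp [pr]
  | insert a s ha ih => simp only [Finset.sum_insert ha, ih, pr_add]

lemma pr_swap (hp : pᵀ = p) (F : n → n → ℝ) : pr p F = pr p fun i j => F j i := by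
  simp only [pr]
  rw [sum_comm]
  refine sum_ext fun i => sum_ext fun j => ?_
  rw [← transpose_apply p i j, hp]

lemma trace_eq_pr (hp : pᵀ = p) (X Y : Matrix n m ℝ) (q : Matrix m m ℝ) : (p * X * q * Yᵀ).trace
    = pr p fun α α' => pr q fun β β' => X α β * Y α' β' := by
  rw [pr_swap p hp]
  simp only [trace, Matrix.diag, Matrix.mul_apply, pr, sum_mul, mul_sum, transpose_apply]
  refine sum_ext fun a => ?_
  rw [sum_comm]
  conv_rhs => rw [sum_comm]
  rw [sum_comm]
  conv_lhs => enter [2, x]; rw [sum_comm]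
  rw [sum_comm]
  conv_rhs => rw [sum_comm]
  refine sum_ext fun b => ?_
  conv_rhs => rw [sum_comm]
  refine sum_ext fun c => sum_ext fun d => ?_
  ring

end pr

lemma posMetricInv_transpose (N : ℝ) {h : Mat3} (hs : hᵀ = h) :
    pI(N, h)ᵀ = of (posMetricInv N h) := by
  have h' : ∀ i j, h⁻¹ i j = h⁻¹ j i := fun i j => by
    conv_lhs => rw [← hs, ← Matrix.transpose_nonsing_inv]
    rfl
  ext α β
  cases α using Fin.cases <;> cases β using Fin.cases <;>
    simp [posMetricInv]
  exact h' _ _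

lemma pr_posMetricInv (N : ℝ) (h : Mat3) (F : Fin 4 → Fin 4 → ℝ) :
    pr pI(N, h) F = (N ^ 2)⁻¹ * F 0 0 + pr h⁻¹ fun i j => F i.succ j.succ := by
  simp [pr, sum4, posMetricInv]

lemma pr_frameMetricInv (N : ℝ) (h : Mat3) (F : Fin 4 → Fin 4 → ℝ) : pr gI(N, h) F =
    -(N ^ 2)⁻¹ * F 0 0 + pr h⁻¹ fun i j => F i.succ j.succ := by
  simp [pr, sum4, frameMetricInv]

/-- The dual of a space 2-tensor. -/
def star3 (h : Mat3) (X : Fin 3 → Fin 3 → ℝ) (i : Fin 3) : ℝ :=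
  (1 / 2) * ∑ a, ∑ b, etaUp h i a b * X a b

lemma eps_contract (a b c d : Fin 3) : ∑ i, eps i a b * eps i c d
    = (if a = c then 1 else 0) * (if b = d then 1 else 0)
    - (if a = d then 1 else 0) * (if b = c then 1 else 0) := by
  rw [Fin.sum_univ_three]
  fin_cases a <;> fin_cases b <;> fin_cases c <;> fin_cases d <;> norm_num [eps]

lemma eps_cyclic (a b c : Fin 3) : eps a b c = eps b c a := by
  simp only [eps]; ring

lemma sum_eps (X : Mat3) (i j k : Fin 3) :
    ∑ a, ∑ b, ∑ c, X i a * X j b * X k c * eps a b c = X.det * eps i j k := by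
  simp only [Fin.sum_univ_three, Matrix.det_fin_three, eps]
  fin_cases i <;> fin_cases j <;> fin_cases k <;>
    simp only [Fin.reduceFinMk, Fin.zero_eta, Fin.mk_one] <;> norm_num <;> ring

section star3

variable {h : Mat3}

lemma hinv_symm (hh : h.PosDef) (i j : Fin 3) : h⁻¹ i j = h⁻¹ j i := by
  simpa using hh.inv.isHermitian.apply j i

lemma hinv_etaUp (hh : h.PosDef) (k a b : Fin 3) :
    ∑ i, h⁻¹ k i * etaUp h i a b = (Real.sqrt h.det)⁻¹ * eps k a b := by
  have h1 : ∑ i, h⁻¹ k i * etaUp h i a b = Real.sqrt h.det * (h⁻¹.det * eps k a b) := by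
    rw [← sum_eps]
    simp only [etaUp, eta, mul_sum]
    refine sum_ext fun i => sum_ext fun c =>
      sum_ext fun d => ?_
    ring
  have hs : Real.sqrt h.det ≠ 0 := (Real.sqrt_pos.2 hh.det_pos).ne'
  rw [h1, Matrix.det_nonsing_inv, Ring.inverse_eq_inv']
  nth_rewrite 2 [← Real.mul_self_sqrt hh.det_pos.le]
  field_simp

lemma etaUp_contract (hh : h.PosDef) (a b c d : Fin 3) : (pr h⁻¹ fun i j => etaUp h i a b * etaUp h
    j c d) = h⁻¹ a c * h⁻¹ b d - h⁻¹ a d * h⁻¹ b c := by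
  have hs : Real.sqrt h.det ≠ 0 := (Real.sqrt_pos.2 hh.det_pos).ne'
  have h1 : (pr h⁻¹ fun i j => etaUp h i a b * etaUp h j c d)
      = ∑ i, (Real.sqrt h.det)⁻¹ * eps i c d * etaUp h i a b := by
    simp only [pr, ← hinv_etaUp hh, sum_mul]
    refine sum_ext fun i => sum_ext fun j => ?_
    ring
  have h2 : ∑ i, (Real.sqrt h.det)⁻¹ * eps i c d * etaUp h i a b
      = ∑ x, ∑ y, h⁻¹ a x * h⁻¹ b y * ∑ i, eps i x y * eps i c d := by
    simp only [etaUp, eta, mul_sum]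
    rw [sum_comm]
    refine sum_ext fun x => ?_
    rw [sum_comm]
    refine sum_ext fun y => sum_ext fun i => ?_
    field_simp
  rw [h1, h2]
  simp [eps_contract, mul_sub, sum_sub_distrib]

lemma etaUp_mul_etaUp (hh : h.PosDef) (i k a b : Fin 3) : ∑ l, etaUp h i l k * etaUp h l a b
    = h⁻¹ k a * (if i = b then 1 else 0) - h⁻¹ k b * (if i = a then 1 else 0) := by
  have hs : Real.sqrt h.det ≠ 0 := (Real.sqrt_pos.2 hh.det_pos).ne'
  have h1 : ∑ l, etaUp h i l k * etaUp h l a b = ∑ d, h⁻¹ k d * ∑ c, eps c d i * eps c a b := by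
    have : ∀ c d, eps c d i * eps c a b
        = Real.sqrt h.det * eps i c d * ∑ l, h⁻¹ c l * etaUp h l a b := fun c d => by
      rw [hinv_etaUp hh, eps_cyclic i c d]; field_simp
    simp only [this]
    conv_lhs => enter [2, l]; rw [etaUp]
    simp only [eta, mul_sum, sum_mul]
    rw [sum_comm]
    conv_lhs => enter [2, x]; rw [sum_comm]
    rw [sum_comm]
    refine sum_ext fun d => sum_ext fun c =>
      sum_ext fun l => ?_
    rw [hinv_symm hh c l]
    ring
  rw [h1]
  simp [eps_contract, mul_sub, sum_sub_distrib, eq_comm]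

lemma pr_star3 (hh : h.PosDef) {X Y : Fin 3 → Fin 3 → ℝ} (hY : ∀ a b, Y a b = -Y b a) :
    (pr h⁻¹ fun i j => star3 h X i * star3 h Y j) = (1 / 2) * pr h⁻¹ fun a c => pr h⁻¹ fun b d => X
    a b * Y c d := by
  have h1 : (pr h⁻¹ fun i j => star3 h X i * star3 h Y j) =
      (1 / 4) * ∑ a, ∑ b, ∑ c, ∑ d, X a b * Y c d * pr h⁻¹ fun i j => etaUp h i a b * etaUp h j c d
      := by
    simp only [mul_pr, pr_sum]
    refine congrArg _ (funext fun i => funext fun j => ?_)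
    rw [mul_comm (star3 h X i)]
    simp only [star3, mul_sum, sum_mul]
    refine sum_ext fun a => sum_ext fun b =>
      sum_ext fun c => sum_ext fun d => ?_
    ring
  have h2 : ∑ a, ∑ b, ∑ c, ∑ d, X a b * Y c d * (h⁻¹ a c * h⁻¹ b d)
      = pr h⁻¹ fun a c => pr h⁻¹ fun b d => X a b * Y c d := by
    simp only [pr, mul_sum]
    refine sum_ext fun a => ?_
    rw [sum_comm]
    refine sum_ext fun c => sum_ext fun b =>
      sum_ext fun d => ?_
    ring
  have h3 : ∑ a, ∑ b, ∑ c, ∑ d, X a b * Y c d * (h⁻¹ a d * h⁻¹ b c)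
      = -∑ a, ∑ b, ∑ c, ∑ d, X a b * Y c d * (h⁻¹ a c * h⁻¹ b d) := by
    simp only [← sum_neg_distrib]
    refine sum_ext fun a => sum_ext fun b => ?_
    rw [sum_comm]
    refine sum_ext fun c => sum_ext fun d => ?_
    rw [hY d c]; ring
  simp only [h1, etaUp_contract hh, mul_sub, sum_sub_distrib, h3, h2]
  ring

lemma etaUp_star3 (hh : h.PosDef) {X : Fin 3 → Fin 3 → ℝ} (hX : ∀ a b, X a b = -X b a)
    (i k : Fin 3) : ∑ l, etaUp h i l k * star3 h X l = ∑ a, h⁻¹ k a * X a i := by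
  have h1 : ∑ l, etaUp h i l k * star3 h X l
      = (1 / 2) * ∑ a, ∑ b, (∑ l, etaUp h i l k * etaUp h l a b) * X a b := by
    simp only [star3, mul_sum, sum_mul]
    rw [sum_comm]
    refine sum_ext fun a => ?_
    rw [sum_comm]
    refine sum_ext fun b => sum_ext fun l => ?_
    ring
  rw [h1]
  simp only [etaUp_mul_etaUp hh, sub_mul, sum_sub_distrib, mul_assoc, ite_mul, one_mul, zero_mul,
    mul_ite, mul_zero, Finset.sum_ite_eq, Finset.mem_univ, if_true]
  have h2 : ∑ a, ∑ b, (if i = a then h⁻¹ k b * X a b else 0) = -∑ a, h⁻¹ k a * X a i := by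
    rw [sum_comm, ← sum_neg_distrib]
    refine sum_ext fun b => ?_
    rw [Finset.sum_ite_eq, if_pos (Finset.mem_univ _), hX i b]
    ring
  rw [h2]; ring

end star3

/-! ### The Bel-Robinson energy as a component of a stress tensor -/

/-- The inner product of 2-tensors. -/
def ipP (p X Y : Mat4 ℝ) : ℝ := (p * X * p * Yᵀ).trace

/-- The variation of the inner product of 2-tensors. -/
def dipP (p n X Y : Mat4 ℝ) : ℝ :=
  (n * X * p * Yᵀ).trace + (p * X * n * Yᵀ).trace

/-- The stress tensor of a 4-tensor. -/
def stressP (gi p : Mat4 ℝ) (r : T4) (α β : Fin 4) : ℝ :=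
  ∑ ε, ∑ δ, gi ε δ * ipP p (of (r α ε)) (of (r β δ))

/-- The trace-adjusted stress tensor with one index raised. -/
def maxP (gi p : Mat4 ℝ) (r : T4) (α σ : Fin 4) : ℝ :=
  ∑ β, gi α β * stressP gi p r β σ
    - (if α = σ then 1 else 0) * ((1 / 4) * ∑ α, ∑ β, gi α β * stressP gi p r α β)

/-- The quadratic form in the energy identity of the Bianchi equations. -/
def bianchiQ (gi p : Mat4 ℝ) (np : Fin 4 → Mat4 ℝ) (w : Fin 4 → Fin 3 → ℝ) (r : T4) : ℝ :=
  ∑ κ, ∑ β, ∑ ε, ∑ δ, gi κ β * gi ε δ * dipP p (np κ) (of (r β ε)) (of (r 0 δ))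
    - (1 / 4) * ∑ κ, ∑ β, ∑ ε, ∑ δ,
        gi κ β * gi ε δ * dipP p (np 0) (of (r κ ε)) (of (r β δ))
    + ∑ i : Fin 3, w 0 i * maxP gi p r 0 i.succ
    + ∑ k : Fin 3, ∑ j : Fin 3, w k.succ j * maxP gi p r k.succ j.succ
    - (∑ k : Fin 3, w k.succ k) * maxP gi p r 0 0

section decomposition

variable {N : ℝ} {h : Mat3} {r : T4}

lemma elE_apply (i j : Fin 3) : elE N h r i j = -(N ^ 2)⁻¹ * r 0 i.succ 0 j.succ := by
  simp [elE, sum4, frameMetricInv]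

lemma magH_eq (i j : Fin 3) :
    magH N h r i j = N⁻¹ * star3 h (fun a b => r a.succ b.succ 0 j.succ) i := by
  simp only [magH, star3]; ring

lemma magB_eq (i j : Fin 3) :
    magB N h r j i = N⁻¹ * star3 h (fun a b => r 0 j.succ a.succ b.succ) i := by
  simp only [magB, star3]; ring

lemma elD_eq (i j : Fin 3) : elD h r i j
    = star3 h (fun a b => star3 h (fun l m => r a.succ b.succ l.succ m.succ) j) i := by
  simp only [elD, star3, mul_sum]
  refine sum_ext fun a => sum_ext fun b =>
    sum_ext fun c => sum_ext fun d => ?_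
  ring

lemma sum_raise (X Y : Mat3) : ∑ i, ∑ j, raise h X i j * Y i j
    = pr h⁻¹ fun i k => pr h⁻¹ fun j l => X k l * Y i j := by
  simp only [raise, pr, sum_mul, mul_sum]
  refine sum_ext fun i => ?_
  rw [sum_comm]
  refine sum_ext fun j => sum_ext fun k =>
    sum_ext fun l => ?_
  ring

lemma hinv_transpose (hh : h.PosDef) : h⁻¹ᵀ = h⁻¹ := by
  ext i j; exact hinv_symm hh _ _

lemma posDef_transpose (hh : h.PosDef) : hᵀ = h := by
  ext i j; simpa using hh.isHermitian.apply i j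

lemma normSq_eq (X : Mat3) :
    normSq h X = pr h⁻¹ fun i k => pr h⁻¹ fun j l => X k l * X i j := sum_raise X X

lemma ipP_eq (hh : h.PosDef) {X Y : T2} (hX : ∀ α β, X α β = -X β α)
    (hY : ∀ α β, Y α β = -Y β α) : ipP pI(N, h) (of X) (of Y)
    = 2 * ((N ^ 2)⁻¹ * pr h⁻¹ fun i k => X 0 i.succ * Y 0 k.succ)
    + pr h⁻¹ fun i k => pr h⁻¹ fun j l => X i.succ j.succ * Y k.succ l.succ := by
  have h0 : X 0 0 = 0 := by linarith [hX 0 0]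
  rw [ipP, trace_eq_pr _ (posMetricInv_transpose N (posDef_transpose hh))]
  simp only [pr_posMetricInv, of_apply]
  rw [← pr_add, ← mul_pr]
  simp only [hX (Fin.succ _) 0, hY (Fin.succ _) 0, h0]
  simp only [neg_mul_neg]
  ring

lemma stressP_zero_zero (hr : SkewLeft r) (p : Mat4 ℝ) : stressP gI(N, h) p r 0 0
    = pr h⁻¹ fun i j => ipP p (of (r 0 i.succ)) (of (r 0 j.succ)) := by
  have h0 : r 0 0 = 0 := by funext l m; simpa using (by linarith [hr 0 0 l m] : r 0 0 l m = 0)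
  change pr _ _ = _
  rw [pr_frameMetricInv, h0]
  simp [ipP]

lemma ipP_neg_neg (p X Y : Mat4 ℝ) : ipP p (-X) (-Y) = ipP p X Y := by
  simp [ipP, Matrix.transpose_neg]

lemma traceP_eq (hr : SkewLeft r) (p : Mat4 ℝ) : (∑ α, ∑ β, of
    (frameMetricInv N h) α β * stressP gI(N, h) p r α β) = -2 * (N ^ 2)⁻¹ *
    (pr h⁻¹ fun i j => ipP p (of (r 0 i.succ)) (of (r 0 j.succ)))
    + pr h⁻¹ fun a b => pr h⁻¹ fun i j => ipP p (of (r a.succ i.succ)) (of (r b.succ j.succ)) := by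
  have hn : ∀ α β, (of (r α β) : Mat4 ℝ) = -of (r β α) := fun α β => by
    ext l m; exact hr α β l m
  change pr _ _ = _
  rw [pr_frameMetricInv, stressP_zero_zero hr]
  have : ∀ a b : Fin 3, stressP gI(N, h) p r a.succ b.succ =
      -(N ^ 2)⁻¹ * ipP p (of (r 0 a.succ)) (of (r 0 b.succ))
      + pr h⁻¹ fun i j => ipP p (of (r a.succ i.succ)) (of (r b.succ j.succ)) := by
    intro a b
    change pr _ _ = _
    rw [pr_frameMetricInv, hn a.succ 0, hn b.succ 0, ipP_neg_neg]
  simp only [this]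
  rw [← pr_add, ← mul_pr]
  ring

/-- The Bel-Robinson energy density is a component of the stress tensor. -/
lemma belRobinson_eq (hh : h.PosDef) (hr : SkewLeft r) (hr' : SkewRight r) : belRobinson N h r =
    -(1 / 2) * maxP gI(N, h) pI(N, h) r 0 0 := by
  have hE : normSq h (elE N h r) = (N ^ 2)⁻¹ * ((N ^ 2)⁻¹ * pr h⁻¹ fun i k => pr h⁻¹ fun j l =>
      r 0 i.succ 0 j.succ * r 0 k.succ 0 l.succ) := by
    rw [normSq_eq]
    simp only [elE_apply, mul_pr]
    refine pr_congr fun i k => pr_congr fun j l => ?_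
    ring
  have hB : normSq h (magB N h r) = (N ^ 2)⁻¹ * ((1 / 2) * pr h⁻¹ fun i k => pr h⁻¹ fun a c =>
      pr h⁻¹ fun b d => r 0 i.succ a.succ b.succ * r 0 k.succ c.succ d.succ) := by
    rw [normSq_eq, pr_swap _ (hinv_transpose hh)]
    simp only [magB_eq, mul_pr]
    refine pr_congr fun i k => ?_
    simp only [← mul_pr]
    rw [← pr_star3 hh fun a b => hr' _ _ _ _, mul_pr, pr_swap _ (hinv_transpose hh)]
    refine pr_congr fun j l => ?_
    ring
  have hH : normSq h (magH N h r) = (N ^ 2)⁻¹ * ((1 / 2) * pr h⁻¹ fun j l => pr h⁻¹ fun a c =>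
      pr h⁻¹ fun b d => r a.succ b.succ 0 j.succ * r c.succ d.succ 0 l.succ) := by
    rw [normSq_eq, pr_comm, pr_swap _ (hinv_transpose hh)]
    simp only [magH_eq, mul_pr]
    refine pr_congr fun i k => ?_
    simp only [← mul_pr]
    rw [← pr_star3 hh fun a b => hr _ _ _ _, mul_pr, pr_swap _ (hinv_transpose hh)]
    refine pr_congr fun j l => ?_
    ring
  have hD : normSq h (elD h r) = (1 / 4) * pr h⁻¹ fun a c => pr h⁻¹ fun b d => pr h⁻¹ fun i k =>
      pr h⁻¹ fun j l => r a.succ b.succ i.succ j.succ * r c.succ d.succ k.succ l.succ := by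
    rw [normSq_eq, pr_comm]
    have : ∀ j l : Fin 3, (pr h⁻¹ fun i k => elD h r k l * elD h r i j)
        = (1 / 2) * pr h⁻¹ fun a c => pr h⁻¹ fun b d => star3 h
        (fun l m => r a.succ b.succ l.succ m.succ) j * star3 h
        (fun l m => r c.succ d.succ l.succ m.succ) l := fun j l => by
      rw [← pr_star3 hh]
      · simp only [elD_eq, mul_comm]
      · intro a b
        simp only [star3, hr a.succ b.succ, mul_neg, sum_neg_distrib]
    simp only [this, ← mul_pr]
    rw [pr_comm]
    have e : ∀ a c : Fin 3, (pr h⁻¹ fun i j => pr h⁻¹ fun b d => star3 h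
        (fun l m => r a.succ b.succ l.succ m.succ) i * star3 h
        (fun l m => r c.succ d.succ l.succ m.succ) j) = (1 / 2) * pr h⁻¹ fun b d => pr h⁻¹ fun i
        k => pr h⁻¹ fun j l => r a.succ b.succ i.succ j.succ * r c.succ d.succ k.succ l.succ :=
        fun a c => by
      rw [pr_comm, mul_pr]
      refine pr_congr fun b d => ?_
      exact pr_star3 hh fun a b => hr' _ _ _ _
    simp only [e, ← mul_pr]
    ring
  have h1 : ∀ i j : Fin 3, ipP pI(N, h) (of (r 0 i.succ))
      (of (r 0 j.succ)) = _ := fun i j => ipP_eq hh (hr' _ _) (hr' _ _)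
  have h2 : ∀ a b i j : Fin 3, ipP pI(N, h) (of (r a.succ i.succ))
      (of (r b.succ j.succ)) = _ := fun a b i j => ipP_eq hh (hr' _ _) (hr' _ _)
  have hm : maxP gI(N, h) pI(N, h) r 0 0 = -(N ^ 2)⁻¹ * stressP gI(N, h) pI(N, h) r 0 0
      - (1 / 4) * ∑ α, ∑ β, of (frameMetricInv N h) α β * stressP gI(N, h) pI(N, h) r α β := by
    rw [maxP, sum4]
    simp only [if_true, one_mul]
    simp [frameMetricInv]
  have c1 : (pr h⁻¹ fun j l => pr h⁻¹ fun a c => pr h⁻¹ fun b d => r a.succ b.succ 0 j.succ * r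
      c.succ d.succ 0 l.succ) = pr h⁻¹ fun a c => pr h⁻¹ fun b d => pr h⁻¹ fun j l => r a.succ
      b.succ 0 j.succ * r c.succ d.succ 0 l.succ := by
    rw [pr_comm]
    refine pr_congr fun a c => ?_
    rw [pr_comm]
  rw [belRobinson, hE, hB, hH, hD, hm, traceP_eq hr, stressP_zero_zero hr]
  simp only [h1, h2, ← pr_add, ← mul_pr]
  rw [c1]
  ring

/-- The Bel-Robinson flux is a component of the stress tensor. -/
lemma belRobinsonFlux_eq (hh : h.PosDef) (hN : N ≠ 0) (hr : SkewLeft r) (hr' : SkewRight r)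
    (k : Fin 3) : belRobinsonFlux N h r k = -(1 / 2) * maxP gI(N, h) pI(N, h) r k.succ 0 := by
  have h0 : r 0 0 = 0 := by funext l m; simpa using (by linarith [hr 0 0 l m] : r 0 0 l m = 0)
  have hs : ∀ a : Fin 3, stressP gI(N, h) pI(N, h) r a.succ 0
      = pr h⁻¹ fun i k => (2 * ((N ^ 2)⁻¹ * pr h⁻¹ fun j l => r a.succ i.succ 0 j.succ * r 0 k.succ
      0 l.succ) + pr h⁻¹ fun b d => pr h⁻¹ fun j l => r a.succ i.succ b.succ j.succ * r 0 k.succ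
      d.succ l.succ) := by
    intro a
    change pr _ _ = _
    rw [pr_frameMetricInv, h0]
    have e : ∀ i j : Fin 3, ipP pI(N, h) (of (r a.succ i.succ))
      (of (r 0 j.succ)) = _ := fun i j => ipP_eq hh (hr' _ _) (hr' _ _)
    simp only [e]
    simp [ipP]
  have hm : maxP gI(N, h) pI(N, h) r k.succ 0 = ∑ a : Fin 3, h⁻¹ k a * stressP gI(N, h) pI(N, h) r
      a.succ 0 := by
    rw [maxP, sum4]
    simp [frameMetricInv, Fin.succ_ne_zero]
  have e1 : ∀ i j : Fin 3, ∑ l, etaUp h i l k * magH N h r l j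
      = N⁻¹ * ∑ a, h⁻¹ k a * r a.succ i.succ 0 j.succ := fun i j => by
    rw [← etaUp_star3 hh (X := fun a b => r a.succ b.succ 0 j.succ) fun a b => hr _ _ _ _, mul_sum]
    simp only [magH_eq, mul_left_comm]
  have e2 : ∀ i j : Fin 3, ∑ l, etaUp h i l k * elD h r l j
      = ∑ a, h⁻¹ k a * star3 h (fun l m => r a.succ i.succ l.succ m.succ) j := fun i j => by
    rw [← etaUp_star3 hh (X := fun a b => star3 h (fun l m => r a.succ b.succ l.succ m.succ) j)]
    · simp only [elD_eq]
    · intro a b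
      simp only [star3, hr a.succ b.succ, mul_neg, sum_neg_distrib]
  have e3 : belRobinsonFlux N h r k = N * (∑ i, ∑ j, raise h (elE N h r) i j *
      (N⁻¹ * ∑ a, h⁻¹ k a * r a.succ i.succ 0 j.succ) - ∑ i, ∑ j, raise h
      (magB N h r) i j * ∑ a, h⁻¹ k a * star3 h (fun l m => r a.succ i.succ l.succ m.succ) j) := by
    simp only [← e1, ← e2, belRobinsonFlux, mul_sum, ← sum_sub_distrib]
    refine sum_ext fun i => sum_ext fun j =>
      sum_ext fun l => ?_
    ring
  have e4 : ∑ i, ∑ j, raise h (elE N h r) i j * (N⁻¹ * ∑ a, h⁻¹ k a * r a.succ i.succ 0 j.succ) =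
      -(N⁻¹ * ((N ^ 2)⁻¹ * ∑ a, h⁻¹ k a * pr h⁻¹ fun i k => pr h⁻¹ fun j l => r a.succ i.succ 0
      j.succ * r 0 k.succ 0 l.succ)) := by
    rw [sum_raise (elE N h r) (fun i j => N⁻¹ * ∑ a, h⁻¹ k a * r a.succ i.succ 0 j.succ)]
    rw [← neg_mul]
    simp only [mul_pr, pr_sum]
    refine pr_congr fun i k => pr_congr fun j l => ?_
    simp only [elE_apply, mul_sum]
    refine sum_ext fun a => ?_
    ring
  have e5 : ∑ i, ∑ j, raise h (magB N h r) i j * ∑ a, h⁻¹ k a * star3 h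
      (fun l m => r a.succ i.succ l.succ m.succ) j = N⁻¹ * ((1 / 2) * ∑ a, h⁻¹ k a * pr h⁻¹ fun i
      k => pr h⁻¹ fun b d => pr h⁻¹ fun j l => r a.succ i.succ b.succ j.succ * r 0 k.succ d.succ
      l.succ) := by
    rw [sum_raise (magB N h r)
      (fun i j => ∑ a, h⁻¹ k a * star3 h (fun l m => r a.succ i.succ l.succ m.succ) j)]
    have : ∀ a i k : Fin 3, (pr h⁻¹ fun b d => pr h⁻¹ fun j l => r a.succ i.succ b.succ j.succ * r 0
        k.succ d.succ l.succ) = 2 * pr h⁻¹ fun j l => star3 h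
        (fun l m => r a.succ i.succ l.succ m.succ) j * star3 h
        (fun l m => r 0 k.succ l.succ m.succ) l := fun a i k => by
      rw [pr_star3 hh fun a b => hr' _ _ _ _]; ring
    simp only [this, mul_pr, pr_sum]
    refine pr_congr fun i k => pr_congr fun j l => ?_
    simp only [magB_eq, mul_sum]
    refine sum_ext fun a => ?_
    ring
  rw [e3, e4, e5, hm]
  simp only [hs, ← pr_add, ← mul_pr, mul_add, sum_add_distrib]
  simp only [mul_left_comm (h⁻¹ k _), ← mul_sum]
  field_simp
  ring

/-- The source term as a contraction. -/
lemma sourceTerm_eq (hh : h.PosDef) (hN : N ≠ 0) (hr : SkewLeft r) (hr' : SkewRight r)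
    {J : Fin 4 → Fin 4 → Fin 4 → ℝ} (hJ : ∀ i l m, J i l m = -J i m l) : sourceTerm N h r J =
    -(1 / 2) * ∑ ε, ∑ δ, frameMetricInv N h ε δ * ipP pI(N, h) (of (J ε)) (of (r 0 δ)) := by
  have h0 : r 0 0 = 0 := by funext l m; simpa using (by linarith [hr 0 0 l m] : r 0 0 l m = 0)
  have e0 : (∑ ε, ∑ δ, frameMetricInv N h ε δ * ipP pI(N, h) (of (J ε)) (of (r 0 δ)))
      = pr h⁻¹ fun i k => (2 * ((N ^ 2)⁻¹ * pr h⁻¹ fun j l => J i.succ 0 j.succ * r 0 k.succ 0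
      l.succ) + pr h⁻¹ fun b d => pr h⁻¹ fun j l => J i.succ b.succ j.succ * r 0 k.succ d.succ
      l.succ) := by
    change pr gI(N, h) _ = _
    rw [pr_frameMetricInv, h0]
    have e : ∀ i j : Fin 3, ipP pI(N, h) (of (J i.succ))
      (of (r 0 j.succ)) = _ := fun i j => ipP_eq hh (hJ _) (hr' _ _)
    simp only [e]
    simp [ipP]
  have e1 : (∑ i : Fin 3, ∑ j : Fin 3, J i.succ 0 j.succ * raise h (elE N h r) i j) =
      -((N ^ 2)⁻¹ * pr h⁻¹ fun i k => pr h⁻¹ fun j l => J i.succ 0 j.succ * r 0 k.succ 0 l.succ) :=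
      by
    simp only [mul_comm (J _ _ _)]
    rw [sum_raise (elE N h r) fun i j => J i.succ 0 j.succ, ← neg_mul]
    simp only [mul_pr]
    refine pr_congr fun i k => pr_congr fun j l => ?_
    rw [elE_apply]; ring
  have e2 : (∑ i : Fin 3, ∑ k : Fin 3, ∑ l : Fin 3, ∑ m : Fin 3, J i.succ l.succ m.succ * etaUp h k
      l m * raise h (magB N h r) i k) = N⁻¹ * pr h⁻¹ fun i k => pr h⁻¹ fun b d => pr h⁻¹ fun j l =>
      J i.succ b.succ j.succ * r 0 k.succ d.succ l.succ := by
    have : (∑ i : Fin 3, ∑ k : Fin 3, ∑ l : Fin 3, ∑ m : Fin 3, J i.succ l.succ m.succ * etaUp h k l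
        m * raise h (magB N h r) i k) = ∑ i : Fin 3, ∑ k : Fin 3, raise h (magB N h r) i k *
        (2 * star3 h (fun l m => J i.succ l.succ m.succ) k) := by
      simp only [star3, mul_sum]
      refine sum_ext fun a => sum_ext fun b =>
        sum_ext fun c => sum_ext fun d => ?_
      ring
    rw [this, sum_raise (magB N h r)
      fun i k => 2 * star3 h (fun l m => J i.succ l.succ m.succ) k]
    have e : ∀ i k : Fin 3, (pr h⁻¹ fun b d => pr h⁻¹ fun j l => J i.succ b.succ j.succ * r 0 k.succ
        d.succ l.succ) = 2 * pr h⁻¹ fun j l => star3 h (fun l m => J i.succ l.succ m.succ) j * star3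
        h (fun l m => r 0 k.succ l.succ m.succ) l := fun i k => by
      rw [pr_star3 hh fun a b => hr' _ _ _ _]; ring
    simp only [e, mul_pr]
    refine pr_congr fun i k => pr_congr fun j l => ?_
    rw [magB_eq]; ring
  rw [sourceTerm, e0, e1, e2]
  simp only [← pr_add, ← mul_pr]
  field_simp
  ring

end decomposition

/-! ### Linear, affine and quadratic functions -/

section functions

variable {V : Type*} [AddCommGroup V] [Module ℝ V]

variable (V) in
/-- The space of linear functions. -/
def linFun : Submodule ℝ (V → ℝ) where
  carrier := {f | ∃ ℓ : V →ₗ[ℝ] ℝ, ∀ x, f x = ℓ x}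
  add_mem' := by
    rintro f g ⟨a, ha⟩ ⟨b, hb⟩
    exact ⟨a + b, fun x => by simp [ha, hb]⟩
  zero_mem' := ⟨0, fun x => rfl⟩
  smul_mem' := by
    rintro c f ⟨a, ha⟩
    exact ⟨c • a, fun x => by simp [ha]⟩

variable (V) in
/-- The space of affine functions. -/
def affFun : Submodule ℝ (V → ℝ) where
  carrier := {f | ∃ ℓ : V →ₗ[ℝ] ℝ, ∃ b : ℝ, ∀ x, f x = ℓ x + b}
  add_mem' := by
    rintro f g ⟨a, s, ha⟩ ⟨b, t, hb⟩
    exact ⟨a + b, s + t, fun x => by simp [ha, hb]; ring⟩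
  zero_mem' := ⟨0, 0, fun x => by simp⟩
  smul_mem' := by
    rintro c f ⟨a, s, ha⟩
    exact ⟨c • a, c * s, fun x => by simp [ha]; ring⟩

variable (V) in
/-- The space of quadratic functions. -/
def quadFun : Submodule ℝ (V → ℝ) where
  carrier := {f | ∃ Q : QuadraticForm ℝ V, ∀ x, f x = Q x}
  add_mem' := by
    rintro f g ⟨a, ha⟩ ⟨b, hb⟩
    exact ⟨a + b, fun x => by simp [ha, hb]⟩
  zero_mem' := ⟨0, fun x => rfl⟩
  smul_mem' := by
    rintro c f ⟨a, ha⟩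
    exact ⟨c • a, fun x => by simp [ha]⟩

lemma linFun_le_affFun : linFun V ≤ affFun V := by
  rintro f ⟨ℓ, h⟩
  exact ⟨ℓ, 0, fun x => by simp [h]⟩

lemma const_mem_affFun (c : ℝ) : (fun _ => c) ∈ affFun V := ⟨0, c, fun x => by simp⟩

lemma isLinearMap_mem {f : V → ℝ} (hf : IsLinearMap ℝ f) : f ∈ linFun V :=
  ⟨hf.mk' f, fun _ => rfl⟩

lemma mul_mem_quadFun {f g : V → ℝ} (hf : f ∈ linFun V) (hg : g ∈ linFun V) :
    (fun x => f x * g x) ∈ quadFun V := by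
  obtain ⟨a, ha⟩ := hf
  obtain ⟨b, hb⟩ := hg
  exact ⟨QuadraticMap.linMulLin a b, fun x => by simp [ha, hb]⟩

lemma fun_add_mem {S : Submodule ℝ (V → ℝ)} {f g : V → ℝ} (hf : f ∈ S) (hg : g ∈ S) :
    (fun x => f x + g x) ∈ S := S.add_mem hf hg

lemma fun_sub_mem {S : Submodule ℝ (V → ℝ)} {f g : V → ℝ} (hf : f ∈ S) (hg : g ∈ S) :
    (fun x => f x - g x) ∈ S := S.sub_mem hf hg

lemma fun_neg_mem {S : Submodule ℝ (V → ℝ)} {f : V → ℝ} (hf : f ∈ S) :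
    (fun x => -f x) ∈ S := S.neg_mem hf

lemma const_mul_mem {S : Submodule ℝ (V → ℝ)} (c : ℝ) {f : V → ℝ} (hf : f ∈ S) :
    (fun x => c * f x) ∈ S := S.smul_mem c hf

lemma mul_const_mem {S : Submodule ℝ (V → ℝ)} {f : V → ℝ} (hf : f ∈ S) (c : ℝ) :
    (fun x => f x * c) ∈ S := by
  simpa only [mul_comm] using const_mul_mem c hf

lemma fun_sum_mem {S : Submodule ℝ (V → ℝ)} {ι : Type*} {s : Finset ι} {f : ι → V → ℝ}
    (hf : ∀ i, f i ∈ S) : (fun x => ∑ i ∈ s, f i x) ∈ S := by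
  have : (fun x => ∑ i ∈ s, f i x) = ∑ i ∈ s, f i := by funext x; simp
  rw [this]
  exact S.sum_mem fun i _ => hf i

/-- Matrix valued functions with entries in a space of functions. -/
def MatMem {m n : Type*} (S : Submodule ℝ (V → ℝ)) (F : V → Matrix m n ℝ) : Prop :=
  ∀ i j, (fun x => F x i j) ∈ S

namespace MatMem

variable {l m n k : Type*} {S : Submodule ℝ (V → ℝ)}

lemma const_mul [Fintype m] (X : Matrix l m ℝ) {F : V → Matrix m n ℝ} (hF : MatMem S F) :
    MatMem S fun x => X * F x := fun i j => by
  simp only [Matrix.mul_apply]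
  exact fun_sum_mem fun k => const_mul_mem _ (hF k j)

lemma mul_const [Fintype n] {F : V → Matrix m n ℝ} (hF : MatMem S F) (X : Matrix n l ℝ) :
    MatMem S fun x => F x * X := fun i j => by
  simp only [Matrix.mul_apply]
  exact fun_sum_mem fun k => mul_const_mem (hF i k) _

lemma mul [Fintype n] {F : V → Matrix m n ℝ} {G : V → Matrix n l ℝ} (hF : MatMem (linFun V) F)
    (hG : MatMem (linFun V) G) : MatMem (quadFun V) fun x => F x * G x := fun i j => by
  simp only [Matrix.mul_apply]
  exact fun_sum_mem fun k => mul_mem_quadFun (hF i k) (hG k j)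

lemma transpose {F : V → Matrix m n ℝ} (hF : MatMem S F) : MatMem S fun x => (F x)ᵀ :=
  fun i j => hF j i

lemma add {F G : V → Matrix m n ℝ} (hF : MatMem S F) (hG : MatMem S G) :
    MatMem S fun x => F x + G x := fun i j => fun_add_mem (hF i j) (hG i j)

lemma trace [Fintype n] {F : V → Matrix n n ℝ} (hF : MatMem S F) : (fun x => (F x).trace) ∈ S :=
  fun_sum_mem fun i => hF i i

end MatMem

/-- Quadratic forms depending linearly on a parameter. -/
lemma exists_linear_quadraticForm {W : Type*} [AddCommGroup W] [Module ℝ W] {q : W → V → ℝ}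
    (hq : ∀ w, q w ∈ quadFun V) (hw : ∀ x, (fun w => q w x) ∈ linFun W) :
    ∃ Q : W →ₗ[ℝ] QuadraticForm ℝ V, ∀ w x, Q w x = q w x := by
  choose Q hQ using hq
  refine ⟨{ toFun := Q, map_add' := fun a b => ?_, map_smul' := fun c a => ?_ },
    fun w x => (hQ w x).symm⟩
  · ext x
    obtain ⟨ℓ, hℓ⟩ := hw x
    simp only at hℓ
    rw [QuadraticMap.add_apply, ← hQ, ← hQ, ← hQ, hℓ, hℓ, hℓ, map_add]
  · ext x
    obtain ⟨ℓ, hℓ⟩ := hw x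
    simp only at hℓ
    rw [RingHom.id_apply, QuadraticMap.smul_apply, ← hQ, ← hQ, hℓ, hℓ, map_smul]

/-- Quadratic forms depending in an affine way on a parameter. -/
lemma exists_affine_quadraticForm {W : Type*} [AddCommGroup W] [Module ℝ W] {q : W → V → ℝ}
    (hq : ∀ w, q w ∈ quadFun V) (hw : ∀ x, (fun w => q w x) ∈ affFun W) :
    ∃ Q : W →ᵃ[ℝ] QuadraticForm ℝ V, ∀ w x, Q w x = q w x := by
  obtain ⟨L, hL⟩ := exists_linear_quadraticForm (q := fun w x => q w x - q 0 x)
    (fun w => fun_sub_mem (hq w) (hq 0)) (fun x => by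
      obtain ⟨ℓ, b, h⟩ := hw x
      simp only at h
      exact ⟨ℓ, fun w => by simp [h]⟩)
  obtain ⟨Q₀, h₀⟩ := hq 0
  refine ⟨L.toAffineMap + AffineMap.const ℝ W Q₀, fun w x => ?_⟩
  simp [hL, ← h₀]

end functions

/-! ### The quadratic form `Q_G` -/

/-- The dual of `star3`. -/
def unstar3 (h : Mat3) (x : Fin 3 → ℝ) (a b : Fin 3) : ℝ :=
  Real.sqrt h.det * ∑ k, ∑ i, eps k a b * h⁻¹ k i * x i

lemma unstar3_star3 {h : Mat3} (hh : h.PosDef) {X : Fin 3 → Fin 3 → ℝ}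
    (hX : ∀ a b, X a b = -X b a) : unstar3 h (star3 h X) = X := by
  have hs : Real.sqrt h.det ≠ 0 := (Real.sqrt_pos.2 hh.det_pos).ne'
  funext a b
  have h1 : ∀ k, ∑ i, h⁻¹ k i * star3 h X i
      = (Real.sqrt h.det)⁻¹ * ((1 / 2) * ∑ c, ∑ d, eps k c d * X c d) := fun k => by
    have : ∀ c d, eps k c d = Real.sqrt h.det * ∑ i, h⁻¹ k i * etaUp h i c d := fun c d => by
      rw [hinv_etaUp hh]; field_simp
    simp only [this, star3, mul_sum, sum_mul]
    rw [sum_comm]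
    refine sum_ext fun c => ?_
    rw [sum_comm]
    refine sum_ext fun d => sum_ext fun i => ?_
    field_simp
  have h2 : unstar3 h (star3 h X) a b = (1 / 2) * ∑ c, ∑ d, (∑ k, eps k a b * eps k c d) * X c d := by
    simp only [unstar3, mul_assoc, ← mul_sum, h1]
    simp only [mul_sum, sum_mul]
    rw [sum_comm]
    refine sum_ext fun c => ?_
    rw [sum_comm]
    refine sum_ext fun d => sum_ext fun i => ?_
    field_simp
  rw [h2]
  simp only [eps_contract, sub_mul, sum_sub_distrib, mul_assoc, ite_mul, one_mul, zero_mul, mul_ite,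
    mul_zero, Finset.sum_ite_eq, Finset.mem_univ, if_true, Finset.sum_ite_irrel,
    sum_const_zero]
  rw [hX b a]; ring

lemma sum_comm_pairs (F : Fin 3 → Fin 3 → Fin 3 → Fin 3 → ℝ) :
    ∑ a, ∑ b, ∑ c, ∑ d, F a b c d = ∑ c, ∑ d, ∑ a, ∑ b, F a b c d := by
  have h := sum_comm (s := Finset.univ (α := Fin 3 × Fin 3))
    (t := Finset.univ (α := Fin 3 × Fin 3)) (f := fun x y => F x.1 x.2 y.1 y.2)
  simpa only [Fintype.sum_prod_type] using h

/-- The antisymmetric array with given mixed and space components. -/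
def mkBiv {W : Type*} [AddCommGroup W] (e : Fin 3 → W) (s : Fin 3 → Fin 3 → W) (α β : Fin 4) : W :=
  Fin.cases (Fin.cases 0 (fun j => e j) β) (fun i => Fin.cases (-e i) (fun j => s i j) β) α

/-- The 4-tensor with given electric and magnetic parts, for unit lapse. -/
def ofElMag (h : Mat3) (x : Mat3 × Mat3 × Mat3 × Mat3) : T4 :=
  mkBiv (fun i => mkBiv (fun j => -x.1 i j) (unstar3 h (x.2.2.2 i)))
    fun a b => mkBiv (fun j => unstar3 h (fun c => x.2.1 c j) a b)
      fun l m => unstar3 h (fun c => unstar3 h (x.2.2.1 c) l m) a b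

/-- The scale factors of the frame. -/
def lapseScale (N : ℝ) (α : Fin 4) : ℝ := Fin.cases N (fun _ => 1) α

lemma riem_eq_scale {N : ℝ} {h : Mat3} {r : T4} (hh : h.PosDef) (hN : N ≠ 0) (hr : SkewLeft r)
    (hr' : SkewRight r) (α β l m : Fin 4) : r α β l m = lapseScale N α * lapseScale N β * lapseScale
    N l * lapseScale N m * ofElMag h (elE N h r, magH N h r, elD h r, magB N h r) α β l m := by
  have h0 : ∀ α l m, r α α l m = 0 := fun α l m => by linarith [hr α α l m]
  have h0' : ∀ α β l, r α β l l = 0 := fun α β l => by linarith [hr' α β l l]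
  have eB : ∀ i : Fin 3, unstar3 h (magB N h r i) = fun l m => N⁻¹ * r 0 i.succ l.succ m.succ := by
    intro i
    have : magB N h r i = star3 h fun l m => N⁻¹ * r 0 i.succ l.succ m.succ := by
      funext j
      rw [magB_eq]; simp only [star3, mul_sum]
      refine sum_ext fun c => sum_ext fun d => ?_
      ring
    rw [this, unstar3_star3 hh]
    intro a b
    rw [hr']; ring
  have eH : ∀ j : Fin 3, unstar3 h (fun c => magH N h r c j)
      = fun a b => N⁻¹ * r a.succ b.succ 0 j.succ := by
    intro i
    have : (fun c => magH N h r c i) = star3 h fun l m => N⁻¹ * r l.succ m.succ 0 i.succ := by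
      funext j
      rw [magH_eq]; simp only [star3, mul_sum]
      refine sum_ext fun c => sum_ext fun d => ?_
      ring
    rw [this, unstar3_star3 hh]
    intro a b
    rw [hr]; ring
  have eD : ∀ a b l m : Fin 3, unstar3 h (fun c => unstar3 h (elD h r c) l m) a b
      = r a.succ b.succ l.succ m.succ := by
    intro a b l m
    have e1 : ∀ c, unstar3 h (elD h r c)
        = fun l m => star3 h (fun a b => r a.succ b.succ l.succ m.succ) c := fun c => by
      have : elD h r c
          = star3 h fun l m => star3 h (fun a b => r a.succ b.succ l.succ m.succ) c := by
        funext j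
        rw [elD_eq]
        simp only [star3, mul_sum]
        rw [sum_comm_pairs]
        refine sum_ext fun a => sum_ext fun b =>
          sum_ext fun c => sum_ext fun d => ?_
        ring
      rw [this, unstar3_star3 hh]
      intro l m
      simp only [star3, hr' _ _ l.succ m.succ, mul_neg, sum_neg_distrib]
    simp only [e1]
    rw [unstar3_star3 hh]
    intro a b
    exact hr _ _ _ _
  refine Fin.cases ?_ (fun i => ?_) α <;> refine Fin.cases ?_ (fun j => ?_) β <;>
    refine Fin.cases ?_ (fun k => ?_) l <;> refine Fin.cases ?_ (fun n => ?_) m <;>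
    simp only [ofElMag, mkBiv, lapseScale, Fin.cases_zero, Fin.cases_succ, h0, h0', Pi.zero_apply,
      Pi.neg_apply, mul_zero, eB, eH, eD, elE_apply, neg_zero] <;> try field_simp
  · rw [hr' 0 j.succ k.succ 0]
  · rw [hr]
  · rw [hr, hr' 0 i.succ k.succ 0]; ring
  · rw [hr]
  · rw [hr' i.succ j.succ k.succ 0]

section scaling

variable {a : Fin 4 → ℝ}

lemma trace_rescale (ha : ∀ α, a α ≠ 0) {P X Q Y P' X' Q' Y' : Mat4 ℝ}
    (hP : ∀ α β, P α β = (a α)⁻¹ * (a β)⁻¹ * P' α β) (hX : ∀ α β, X α β = a α * a β * X' α β)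
    (hQ : ∀ α β, Q α β = (a α)⁻¹ * (a β)⁻¹ * Q' α β) (hY : ∀ α β, Y α β = a α * a β * Y' α β) :
    (P * X * Q * Yᵀ).trace = (P' * X' * Q' * Y'ᵀ).trace := by
  simp only [trace, Matrix.diag, Matrix.mul_apply, transpose_apply, hP, hX, hQ, hY, sum_mul]
  refine sum_ext fun i => sum_ext fun j =>
    sum_ext fun k => sum_ext fun l => ?_
  have h1 := ha i; have h2 := ha j; have h3 := ha k; have h4 := ha l
  field_simp

lemma dipP_smul (p n X Y : Mat4 ℝ) (s x y : ℝ) :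
    dipP p (s • n) (x • X) (y • Y) = s * x * y * dipP p n X Y := by
  simp only [dipP, Matrix.smul_mul, Matrix.mul_smul, transpose_smul, trace_smul, smul_eq_mul]
  ring

lemma ipP_smul (p X Y : Mat4 ℝ) (x y : ℝ) : ipP p (x • X) (y • Y) = x * y * ipP p X Y := by
  simp only [ipP, Matrix.smul_mul, Matrix.mul_smul, transpose_smul, trace_smul, smul_eq_mul]
  ring

variable {gi p gi' p' : Mat4 ℝ} {np np' : Fin 4 → Mat4 ℝ} {r r' : T4}

lemma ipP_rescale (ha : ∀ α, a α ≠ 0) (hp : ∀ α β, p α β = (a α)⁻¹ * (a β)⁻¹ * p' α β)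
    (hr : ∀ α β l m, r α β l m = a α * a β * a l * a m * r' α β l m) (α β γ δ : Fin 4) : ipP p
    (of (r α β)) (of (r γ δ)) = a α * a β * a γ * a δ * ipP p' (of (r' α β)) (of (r' γ δ)) := by
  rw [mul_assoc (a α * a β), ← ipP_smul]
  exact trace_rescale ha hp
    (fun l m => by simp only [of_apply, Matrix.smul_apply, smul_eq_mul, hr]; ring) hp
    (fun l m => by simp only [of_apply, Matrix.smul_apply, smul_eq_mul, hr]; ring)

lemma dipP_rescale (ha : ∀ α, a α ≠ 0) (hp : ∀ α β, p α β = (a α)⁻¹ * (a β)⁻¹ * p' α β)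
    (hn : ∀ κ α β, np κ α β = (a 0)⁻¹ * a κ * (a α)⁻¹ * (a β)⁻¹ * np' κ α β)
    (hr : ∀ α β l m, r α β l m = a α * a β * a l * a m * r' α β l m) (κ α β γ δ : Fin 4) : dipP p
    (np κ) (of (r α β)) (of (r γ δ)) = (a 0)⁻¹ * a κ * (a α * a β) * (a γ * a δ) * dipP p' (np' κ)
    (of (r' α β)) (of (r' γ δ)) := by
  rw [← dipP_smul]
  have h1 : ∀ α β, np κ α β = (a α)⁻¹ * (a β)⁻¹ * (((a 0)⁻¹ * a κ) • np' κ) α β := fun α β => by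
    rw [hn, Matrix.smul_apply, smul_eq_mul]; ring
  have h2 : ∀ α β l m, (of (r α β) : Mat4 ℝ) l m
      = a l * a m * ((a α * a β) • of (r' α β) : Mat4 ℝ) l m := fun α β l m => by
    simp only [of_apply, Matrix.smul_apply, smul_eq_mul, hr]; ring
  simp only [dipP]
  rw [trace_rescale ha h1 (h2 α β) hp (h2 γ δ), trace_rescale ha hp (h2 α β) h1 (h2 γ δ)]

lemma stressP_rescale (ha : ∀ α, a α ≠ 0) (hg : ∀ α β, gi α β = (a α)⁻¹ * (a β)⁻¹ * gi' α β)
    (hp : ∀ α β, p α β = (a α)⁻¹ * (a β)⁻¹ * p' α β)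
    (hr : ∀ α β l m, r α β l m = a α * a β * a l * a m * r' α β l m) (α β : Fin 4) :
    stressP gi p r α β = a α * a β * stressP gi' p' r' α β := by
  simp only [stressP, ipP_rescale ha hp hr, hg, mul_sum]
  refine sum_ext fun i => sum_ext fun j => ?_
  have h1 := ha i; have h2 := ha j
  field_simp

lemma maxP_rescale (ha : ∀ α, a α ≠ 0) (hg : ∀ α β, gi α β = (a α)⁻¹ * (a β)⁻¹ * gi' α β)
    (hp : ∀ α β, p α β = (a α)⁻¹ * (a β)⁻¹ * p' α β)
    (hr : ∀ α β l m, r α β l m = a α * a β * a l * a m * r' α β l m) (α σ : Fin 4) :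
    maxP gi p r α σ = (a α)⁻¹ * a σ * maxP gi' p' r' α σ := by
  have h1 : ∑ β, gi α β * stressP gi p r β σ
      = (a α)⁻¹ * a σ * ∑ β, gi' α β * stressP gi' p' r' β σ := by
    simp only [stressP_rescale ha hg hp hr, hg, mul_sum]
    refine sum_ext fun i => ?_
    have h1 := ha i
    field_simp
  have h2 : ∑ α, ∑ β, gi α β * stressP gi p r α β = ∑ α, ∑ β, gi' α β * stressP gi' p' r' α β := by
    simp only [stressP_rescale ha hg hp hr, hg]
    refine sum_ext fun i => sum_ext fun j => ?_
    have h1 := ha i; have h2 := ha j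
    field_simp
  rw [maxP, maxP, h1, h2]
  by_cases h : α = σ
  · subst h
    have := ha α
    simp only [if_true]
    field_simp
  · simp only [h, if_false]; ring

lemma bianchiQ_rescale {w w' : Fin 4 → Fin 3 → ℝ} (ha : ∀ α, a α ≠ 0)
    (ha' : ∀ i : Fin 3, a i.succ = 1) (hg : ∀ α β, gi α β = (a α)⁻¹ * (a β)⁻¹ * gi' α β)
    (hp : ∀ α β, p α β = (a α)⁻¹ * (a β)⁻¹ * p' α β) (hn : ∀ κ α β, np κ α β
    = (a 0)⁻¹ * a κ * (a α)⁻¹ * (a β)⁻¹ * np' κ α β) (hr : ∀ α β l m, r α β l m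
    = a α * a β * a l * a m * r' α β l m) (hw : ∀ κ i, w κ i = a κ * w' κ i) : bianchiQ gi p np w r
    = bianchiQ gi' p' np' w' r' := by
  have h0 := ha 0
  simp only [bianchiQ, maxP_rescale ha hg hp hr, dipP_rescale ha hp hn hr, hg, hw, ha']
  congr 1
  · congr 1
    · congr 1
      · congr 1
        · refine sum_ext fun i => sum_ext fun j =>
            sum_ext fun k => sum_ext fun l => ?_
          have h1 := ha i; have h2 := ha j; have h3 := ha k; have h4 := ha l
          field_simp
        · congr 1
          refine sum_ext fun i => sum_ext fun j =>
            sum_ext fun k => sum_ext fun l => ?_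
          have h1 := ha i; have h2 := ha j; have h3 := ha k; have h4 := ha l
          field_simp
      · refine sum_ext fun i => ?_
        field_simp
    · simp
  · field_simp

end scaling

/-- The components `ω^i_{γ0}` for unit lapse, as functions of `∇̄N` and `N K`. -/
def normalRate (h : Mat3) (x : (Fin 3 → ℝ) × Mat3) (γ : Fin 4) (i : Fin 3) : ℝ :=
  Fin.cases (∑ j, h⁻¹ i j * x.1 j) (fun k => -∑ j, h⁻¹ i j * x.2 k j) γ

/-- The derivative of the positive definite metric in terms of `ω^i_{γ0}`. -/
def dposP (N : ℝ) (w : Fin 4 → Fin 3 → ℝ) (γ : Fin 4) : Mat4 ℝ := of fun α β =>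
  Fin.cases (Fin.cases 0 (fun i => 2 * N⁻¹ ^ 2 * w γ i) β)
    (fun i => Fin.cases (2 * N⁻¹ ^ 2 * w γ i) (fun _ => 0) β) α

/-- The value of the form `Q_G`. -/
def gravQ (h : Mat3) (x : (Fin 3 → ℝ) × Mat3) (y : Mat3 × Mat3 × Mat3 × Mat3) : ℝ :=
  -(1 / 2) * bianchiQ gI(1, h) pI(1, h)
    (dposP 1 (normalRate h x)) (normalRate h x) (ofElMag h y)

lemma gravQ_scale {N : ℝ} {h : Mat3} {r : T4} (hh : h.PosDef) (hN : N ≠ 0) (hr : SkewLeft r)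
    (hr' : SkewRight r) {a : Fin 3 → ℝ} {k : Mat3} {w : Fin 4 → Fin 3 → ℝ}
    (h0 : ∀ i, w 0 i = N * ∑ j, h⁻¹ i j * a j) (hk : ∀ i l : Fin 3, w l.succ i =
    -(N * ∑ j, h⁻¹ i j * k l j)) : -(1 / 2) * bianchiQ gI(N, h) pI(N, h) (dposP N w) w r
    = gravQ h (a, N • k) (elE N h r, magH N h r, elD h r, magB N h r) := by
  have hw : ∀ κ i, w κ i = lapseScale N κ * normalRate h (a, N • k) κ i := fun κ i => by
    refine Fin.cases ?_ (fun l => ?_) κ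
    · simp only [h0, lapseScale, normalRate, Fin.cases_zero]
    · simp only [hk, lapseScale, normalRate, Fin.cases_succ, one_mul, Matrix.smul_apply,
        smul_eq_mul, mul_sum, mul_left_comm N]
  rw [gravQ]
  congr 1
  refine bianchiQ_rescale (a := lapseScale N) ?_ (fun i => rfl) ?_ ?_ ?_
    (riem_eq_scale hh hN hr hr') hw
  · refine Fin.cases hN fun i => one_ne_zero
  · intro α β
    cases α using Fin.cases <;> cases β using Fin.cases <;>
      simp [frameMetricInv, lapseScale, sq]
  · intro α β
    cases α using Fin.cases <;> cases β using Fin.cases <;>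
      simp [posMetricInv, lapseScale, sq]
  · intro κ α β
    cases α using Fin.cases <;> cases β using Fin.cases <;>
      simp [dposP, hw, lapseScale, sq] <;> ring

section gravForm

variable {V : Type*} [AddCommGroup V] [Module ℝ V]

lemma ipP_mem (p : Mat4 ℝ) {F G : V → Mat4 ℝ} (hF : MatMem (linFun V) F)
    (hG : MatMem (linFun V) G) : (fun x => ipP p (F x) (G x)) ∈ quadFun V :=
  (((hF.const_mul p).mul_const p).mul hG.transpose).trace

lemma dipP_mem (p n : Mat4 ℝ) {F G : V → Mat4 ℝ} (hF : MatMem (linFun V) F)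
    (hG : MatMem (linFun V) G) : (fun x => dipP p n (F x) (G x)) ∈ quadFun V :=
  fun_add_mem (((hF.const_mul n).mul_const p).mul hG.transpose).trace
    (((hF.const_mul p).mul_const n).mul hG.transpose).trace

lemma dipP_mem' {S : Submodule ℝ (V → ℝ)} (p X Y : Mat4 ℝ) {n : V → Mat4 ℝ} (hn : MatMem S n) :
    (fun x => dipP p (n x) X Y) ∈ S :=
  fun_add_mem (((hn.mul_const X).mul_const p).mul_const _).trace
    (((hn.const_mul (p * X))).mul_const _).trace

lemma stressP_mem (gi p : Mat4 ℝ) {r : V → T4} (hr : ∀ α β, MatMem (linFun V) fun x => of (r x α β))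
    (α β : Fin 4) : (fun x => stressP gi p (r x) α β) ∈ quadFun V :=
  fun_sum_mem fun _ => fun_sum_mem fun _ => const_mul_mem _ (ipP_mem p (hr _ _) (hr _ _))

lemma maxP_mem (gi p : Mat4 ℝ) {r : V → T4} (hr : ∀ α β, MatMem (linFun V) fun x => of (r x α β))
    (α σ : Fin 4) : (fun x => maxP gi p (r x) α σ) ∈ quadFun V :=
  fun_sub_mem (fun_sum_mem fun _ => const_mul_mem _ (stressP_mem gi p hr _ _))
    (const_mul_mem _ (const_mul_mem _
      (fun_sum_mem fun _ => fun_sum_mem fun _ => const_mul_mem _ (stressP_mem gi p hr _ _))))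

lemma bianchiQ_mem (gi p : Mat4 ℝ) (np : Fin 4 → Mat4 ℝ) (w : Fin 4 → Fin 3 → ℝ) {r : V → T4}
    (hr : ∀ α β, MatMem (linFun V) fun x => of (r x α β)) :
    (fun x => bianchiQ gi p np w (r x)) ∈ quadFun V :=
  fun_sub_mem (fun_add_mem (fun_add_mem (fun_sub_mem
    (fun_sum_mem fun _ => fun_sum_mem fun _ => fun_sum_mem fun _ => fun_sum_mem fun _ =>
      const_mul_mem _ (dipP_mem p _ (hr _ _) (hr _ _)))
    (const_mul_mem _ (fun_sum_mem fun _ => fun_sum_mem fun _ => fun_sum_mem fun _ =>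
      fun_sum_mem fun _ => const_mul_mem _ (dipP_mem p _ (hr _ _) (hr _ _)))))
    (fun_sum_mem fun _ => const_mul_mem _ (maxP_mem gi p hr _ _)))
    (fun_sum_mem fun _ => fun_sum_mem fun _ => const_mul_mem _ (maxP_mem gi p hr _ _)))
    (const_mul_mem _ (maxP_mem gi p hr _ _))

lemma bianchiQ_mem' {S : Submodule ℝ (V → ℝ)} (gi p : Mat4 ℝ) {np : V → Fin 4 → Mat4 ℝ}
    {w : V → Fin 4 → Fin 3 → ℝ} (r : T4) (hn : ∀ κ, MatMem S fun x => np x κ)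
    (hw : ∀ κ i, (fun x => w x κ i) ∈ S) : (fun x => bianchiQ gi p (np x) (w x) r) ∈ S :=
  fun_sub_mem (fun_add_mem (fun_add_mem (fun_sub_mem
    (fun_sum_mem fun _ => fun_sum_mem fun _ => fun_sum_mem fun _ => fun_sum_mem fun _ =>
      const_mul_mem _ (dipP_mem' p _ _ (hn _)))
    (const_mul_mem _ (fun_sum_mem fun _ => fun_sum_mem fun _ => fun_sum_mem fun _ =>
      fun_sum_mem fun _ => const_mul_mem _ (dipP_mem' p _ _ (hn _)))))
    (fun_sum_mem fun _ => mul_const_mem (hw _ _) _))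
    (fun_sum_mem fun _ => fun_sum_mem fun _ => mul_const_mem (hw _ _) _))
    (mul_const_mem (fun_sum_mem fun _ => hw _ _) _)

lemma unstar3_mem {S : Submodule ℝ (V → ℝ)} (h : Mat3) {y : V → Fin 3 → ℝ}
    (hy : ∀ i, (fun x => y x i) ∈ S) (a b : Fin 3) : (fun x => unstar3 h (y x) a b) ∈ S :=
  const_mul_mem _ (fun_sum_mem fun _ => fun_sum_mem fun _ => const_mul_mem _ (hy _))

lemma zero_fun_mem {S : Submodule ℝ (V → ℝ)} : (fun _ => (0 : ℝ)) ∈ S := S.zero_mem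

end gravForm

lemma mkBiv_mem {V : Type*} [AddCommGroup V] [Module ℝ V] {S : Submodule ℝ (V → ℝ)}
    {e : V → Fin 3 → ℝ} {s : V → Fin 3 → Fin 3 → ℝ} (he : ∀ i, (fun x => e x i) ∈ S)
    (hs : ∀ i j, (fun x => s x i j) ∈ S) (α β : Fin 4) : (fun x => mkBiv (e x) (s x) α β) ∈ S := by
  refine Fin.cases ?_ (fun i => ?_) α <;> refine Fin.cases ?_ (fun j => ?_) β
  · exact zero_fun_mem
  · exact he j
  · exact fun_neg_mem (he i)
  · exact hs i j

lemma mkBiv_apply (e : Fin 3 → T2) (s : Fin 3 → Fin 3 → T2) (α β l m : Fin 4) :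
    mkBiv e s α β l m = mkBiv (fun i => e i l m) (fun i j => s i j l m) α β := by
  cases α using Fin.cases <;> cases β using Fin.cases <;> rfl

lemma ofElMag_mem (h : Mat3) (α β : Fin 4) :
    MatMem (linFun (Mat3 × Mat3 × Mat3 × Mat3)) fun x => of (ofElMag h x α β) := by
  have e1 : ∀ i j, (fun x : Mat3 × Mat3 × Mat3 × Mat3 => x.1 i j) ∈ linFun _ :=
    fun i j => isLinearMap_mem ⟨fun _ _ => rfl, fun _ _ => rfl⟩
  have e2 : ∀ i j, (fun x : Mat3 × Mat3 × Mat3 × Mat3 => x.2.1 i j) ∈ linFun _ :=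
    fun i j => isLinearMap_mem ⟨fun _ _ => rfl, fun _ _ => rfl⟩
  have e3 : ∀ i j, (fun x : Mat3 × Mat3 × Mat3 × Mat3 => x.2.2.1 i j) ∈ linFun _ :=
    fun i j => isLinearMap_mem ⟨fun _ _ => rfl, fun _ _ => rfl⟩
  have e4 : ∀ i j, (fun x : Mat3 × Mat3 × Mat3 × Mat3 => x.2.2.2 i j) ∈ linFun _ :=
    fun i j => isLinearMap_mem ⟨fun _ _ => rfl, fun _ _ => rfl⟩
  intro l m
  simp only [of_apply, ofElMag, mkBiv_apply]
  exact mkBiv_mem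
    (fun i => mkBiv_mem (fun j => fun_neg_mem (e1 i j)) (unstar3_mem _ fun _ => e4 i _) l m)
    (fun a b => mkBiv_mem (fun j => unstar3_mem _ (fun _ => e2 _ j) a b)
      (fun l m => unstar3_mem _ (fun _ => unstar3_mem _ (fun _ => e3 _ _) l m) a b) l m) α β

lemma normalRate_mem (h : Mat3) (γ : Fin 4) (i : Fin 3) :
    (fun x => normalRate h x γ i) ∈ linFun ((Fin 3 → ℝ) × Mat3) := by
  refine Fin.cases ?_ (fun k => ?_) γ
  · simp only [normalRate, Fin.cases_zero]
    exact fun_sum_mem fun j => const_mul_mem _ (f := fun x : (Fin 3 → ℝ) × Mat3 => x.1 j)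
      (isLinearMap_mem ⟨fun _ _ => rfl, fun _ _ => rfl⟩)
  · simp only [normalRate, Fin.cases_succ]
    exact fun_neg_mem (fun_sum_mem fun j => const_mul_mem _
      (f := fun x : (Fin 3 → ℝ) × Mat3 => x.2 k j)
      (isLinearMap_mem ⟨fun _ _ => rfl, fun _ _ => rfl⟩))

lemma dposP_mem {V : Type*} [AddCommGroup V] [Module ℝ V] {S : Submodule ℝ (V → ℝ)} (N : ℝ)
    {w : V → Fin 4 → Fin 3 → ℝ} (hw : ∀ κ i, (fun x => w x κ i) ∈ S) (κ : Fin 4) :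
    MatMem S fun x => dposP N (w x) κ := by
  intro α β
  cases α using Fin.cases <;> cases β using Fin.cases <;>
    simp only [dposP, of_apply, Fin.cases_zero, Fin.cases_succ, zero_fun_mem]
  · exact const_mul_mem _ (hw _ _)
  · exact const_mul_mem _ (hw _ _)

lemma exists_gravForm : ∃ Q : GravForm, ∀ h x y, Q h x y = gravQ h x y := by
  have := fun h => exists_linear_quadraticForm (q := gravQ h)
    (fun x => const_mul_mem _ (bianchiQ_mem _ _ _ _ (ofElMag_mem h)))
    (fun y => const_mul_mem _ (bianchiQ_mem' _ _ _ (dposP_mem 1 (normalRate_mem h))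
      (normalRate_mem h)))
  choose Q hQ using this
  exact ⟨Q, hQ⟩

/-- The quadratic form of the energy identity of the Bianchi equations. -/
def gravForm : GravForm := exists_gravForm.choose

lemma gravForm_apply (h : Mat3) (x : (Fin 3 → ℝ) × Mat3) (y : Mat3 × Mat3 × Mat3 × Mat3) :
    gravForm h x y = gravQ h x y := exists_gravForm.choose_spec h x y

/-! ### The energy identity of the Bianchi equations in coordinates -/

namespace Slicing

variable {A : Type*} [CommRing A] [Algebra ℝ A] (M : Slicing A)

lemma maxwellUp_eq (R : Fin 4 → Fin 4 → Fin 4 → Fin 4 → A) (α σ : Fin 4) : M.maxwellUp R α σ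
    = ∑ β, M.metricInv α β * M.stressT R β σ - (if α = σ then 1 else 0) *
    ((1 / 4 : ℝ) • M.traceT R) := by
  have h := entry_congr M.frame.gi_mul_g α σ
  rw [Matrix.mul_apply, Matrix.one_apply] at h
  simp only [frame_g, frame_gi] at h
  simp only [maxwellUp, maxwell, mul_sub, sum_sub_distrib, ← h, sum_mul, mul_smul_comm, mul_assoc,
    smul_sum]

end Slicing

namespace LocalMetric.RegularOn

variable {M : LocalMetric} {Ω : Opens Coord} (hM : M.RegularOn Ω)

lemma ev_ip (X Y : Mat4 (SmoothAlg Ω)) (z : Ω) : ev z (hM.slicing.ip X Y)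
    = ipP (of (posMetricInv (M.N z) (M.h z))) (X.map (ev z)) (Y.map (ev z)) := by
  simp only [Slicing.ip, ipP, trace, Matrix.diag, Matrix.mul_apply, map_sum, map_mul, ev_pos,
    transpose_apply, map_apply, of_apply]

lemma ev_npos (κ α β : Fin 4) (z : Ω) : ev z (hM.slicing.npos κ α β)
    = dposP (M.N z) (fun γ i => M.omega i.succ γ 0 z) κ α β := by
  rw [Slicing.npos_eq]
  cases α using Fin.cases <;> cases β using Fin.cases <;>
    simp [dposP, ev_omega, ev_Ni, map_ofNat (ev z) 2]

lemma ev_dip (κ : Fin 4) (X Y : Mat4 (SmoothAlg Ω)) (z : Ω) : ev z (hM.slicing.dip κ X Y)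
    = dipP (of (posMetricInv (M.N z) (M.h z))) (dposP (M.N z) (fun γ i => M.omega i.succ γ 0 z) κ)
    (X.map (ev z)) (Y.map (ev z)) := by
  simp only [Slicing.dip, dipP, trace, Matrix.diag, Matrix.mul_apply, map_sum, map_mul, ev_pos,
    transpose_apply, map_apply, of_apply, map_add, ev_npos]

lemma map_rm_riem (α β : Fin 4) (z : Ω) :
    (Slicing.rm hM.slicing.frame.riem α β).map (ev z) = of (M.riem z α β) := by
  ext l m
  exact hM.ev_riem α β l m z

lemma ev_stressT (α β : Fin 4) (z : Ω) : ev z (hM.slicing.stressT hM.slicing.frame.riem α β)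
    = stressP (of (M.gi z)) (of (posMetricInv (M.N z) (M.h z))) (M.riem z) α β := by
  simp only [Slicing.stressT, Slicing.ipR, stressP, map_sum, map_mul, ev_metricInv, ev_ip,
    map_rm_riem, of_apply]

lemma ev_maxwellUp (α σ : Fin 4) (z : Ω) : ev z (hM.slicing.maxwellUp hM.slicing.frame.riem α σ)
    = maxP (of (M.gi z)) (of (posMetricInv (M.N z) (M.h z))) (M.riem z) α σ := by
  rw [Slicing.maxwellUp_eq, maxP]
  simp only [Slicing.traceT, map_sub, map_sum, map_mul, map_smul, ev_metricInv, ev_stressT,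
    of_apply, smul_eq_mul]
  split_ifs <;> simp

lemma ev_bianchiQuad (z : Ω) : ev z (hM.slicing.bianchiQuad hM.slicing.frame.riem)
    = bianchiQ (of (M.gi z)) (of (posMetricInv (M.N z) (M.h z)))
    (dposP (M.N z) fun γ i => M.omega i.succ γ 0 z) (fun γ i => M.omega i.succ γ 0 z)
    (M.riem z) := by
  have h : hM.slicing.N * hM.slicing.tau
      = -∑ k : Fin 3, hM.slicing.frame.omega k.succ k.succ 0 := by
    rw [Slicing.omega_trace_zero, neg_neg]
  rw [Slicing.bianchiQuad, h, bianchiQ]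
  simp only [map_add, map_sub, map_neg, map_sum, map_mul, map_smul, ev_metricInv, ev_dip, ev_omega,
    ev_maxwellUp, map_rm_riem, of_apply, smul_eq_mul]
  ring

lemma bianchiQ_eq_gravForm (hM : M.RegularOn Ω) {z : Coord} (hz : z ∈ Ω) :
    -(1 / 2) * bianchiQ (of (M.gi z)) (of (posMetricInv (M.N z) (M.h z)))
    (dposP (M.N z) fun γ i => M.omega i.succ γ 0 z) (fun γ i => M.omega i.succ γ 0 z) (M.riem z)
    = gravForm.eval M z := by
  rw [GravForm.eval, gravForm_apply]
  refine gravQ_scale (hM.h_posDef z hz) (hM.N_ne hz) (hM.riem_antisymm hz) (hM.riem_antisymm' hz)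
    (fun i => ?_) fun i l => ?_
  · rw [← hM.ev_omega _ _ _ ⟨z, hz⟩, Slicing.omega_succ_zero_zero]
    simp only [map_mul, map_sum, ev_N, ev_hi, ev_dN]
  · rw [← hM.ev_omega _ _ _ ⟨z, hz⟩, Slicing.omega_succ_succ_zero]
    simp only [map_neg, map_mul, map_sum, ev_N, ev_hi, ev_K]

lemma ev_belRobinson (z : Ω) : ev z ((-(1 / 2) : ℝ) • hM.slicing.maxwellUp hM.slicing.frame.riem 0
    0) = belRobinson (M.N z) (M.h z) (M.riem z) := by
  rw [belRobinson_eq (hM.h_posDef z z.2) (hM.riem_antisymm z.2) (hM.riem_antisymm' z.2), map_smul,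
    ev_maxwellUp]
  rfl

lemma ev_belRobinsonFlux (k : Fin 3) (z : Ω) : ev z
    ((-(1 / 2) : ℝ) • hM.slicing.maxwellUp hM.slicing.frame.riem k.succ 0)
    = belRobinsonFlux (M.N z) (M.h z) (M.riem z) k := by
  rw [belRobinsonFlux_eq (hM.h_posDef z z.2) (hM.N_ne z.2) (hM.riem_antisymm z.2)
    (hM.riem_antisymm' z.2), map_smul, ev_maxwellUp]
  rfl

end LocalMetric.RegularOn

lemma Slicing.div_smul {A : Type*} [CommRing A] [Algebra ℝ A] (M : Slicing A) (c : ℝ)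
    (X : Fin 3 → A) : M.div (fun i => c • X i) = c • M.div X := by
  simp only [Slicing.div, mul_smul_comm, Derivation.map_smul, ← smul_sum]

namespace FluidRegularOn

variable {M : LocalMetric} {st : Coord → PointState} {Ω : Opens Coord}

/-- The energy identity for the Bianchi equations. -/
lemma bianchi_energy (hF : FluidRegularOn M st Ω) (hM : M.RegularOn Ω) (hE : EinsteinEulerOn M st Ω)
    {z : Coord} (hz : z ∈ Ω) : M.D 0 (fun w => belRobinson (M.N w) (M.h w) (M.riem w)) z
    + M.div (fun w => belRobinsonFlux (M.N w) (M.h w) (M.riem w)) z = gravForm.eval M z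
    + sourceTerm (M.N z) (M.h z) (M.riem z) ((st z).current (acc M st z)) := by
  have h := hM.slicing.maxwell_divergence (R := hM.slicing.frame.riem)
    hM.slicing.frame.riem_antisymm_left hM.slicing.frame.riem_bianchi_left
  have h1 := congrArg (fun φ => ev ⟨z, hz⟩ ((-(1 / 2) : ℝ) • φ)) h
  simp only [smul_add, map_add] at h1
  rw [← Derivation.map_smul, ← Slicing.div_smul, hM.ev_D 0 (f := fun w => belRobinson (M.N w) (M.h w) (M.riem w)) hM.ev_belRobinson,
    hM.ev_div (Y := fun w => belRobinsonFlux (M.N w) (M.h w) (M.riem w)) hM.ev_belRobinsonFlux, map_smul _ _ (hM.slicing.bianchiQuad _), hM.ev_bianchiQuad,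
    smul_eq_mul, hM.bianchiQ_eq_gravForm hz] at h1
  have hJ : ∀ i l m, (st z).current (acc M st z) i l m = -(st z).current (acc M st z) i m l :=
    fun i l m => by simp only [PointState.current]; ring
  rw [h1, sourceTerm_eq (hM.h_posDef z hz) (hM.N_ne hz) (hM.riem_antisymm hz)
    (hM.riem_antisymm' hz) hJ, add_comm]
  congr 1
  rw [map_smul, smul_eq_mul]
  congr 1
  simp only [map_sum, map_mul, hM.ev_metricInv, hM.ev_ip, hM.map_rm_riem]
  refine sum_ext fun ε => sum_ext fun δ => ?_
  have : (∑ κ, ∑ β, hM.slicing.metricInv κ β • hM.slicing.nrm hM.slicing.frame.riem κ β ε).map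
      (ev ⟨z, hz⟩) = of ((st z).current (acc M st z) ε) := by
    ext l m
    rw [of_apply, ← hF.riem_divergence_eq hM hE ε l m ⟨z, hz⟩]
    simp only [map_apply, Matrix.sum_apply, Matrix.smul_apply, Slicing.nrm, of_apply, smul_eq_mul]
  rw [this]
  rfl

end FluidRegularOn

/-! ### The quadratic form `Q_F` -/

section membership

variable {V : Type*} [AddCommGroup V] [Module ℝ V]

lemma fluidS_mem (p gt : Mat4 ℝ) (C : Col4 ℝ) (m : ℝ) {c : V → Mat4 ℝ}
    (hc : MatMem (linFun V) c) : (fun x => fluidS p gt C (c x) m) ∈ quadFun V :=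
  fun_add_mem (const_mul_mem _ (((hc.mul_const C).transpose.mul_const p).mul (hc.mul_const C)).trace)
    (((hc.const_mul p).mul_const gt).mul hc.transpose).trace

lemma fluidT_mem (p gt : Mat4 ℝ) (C : Col4 ℝ) (m : ℝ) {c : V → Mat4 ℝ}
    (hc : MatMem (linFun V) c) : MatMem (quadFun V) fun x => fluidT p gt C (c x) m := fun i j =>
  fun_sub_mem (mul_const_mem (fluidS_mem p gt C m hc) _)
    (const_mul_mem _ (((hc.transpose.const_mul gt).mul_const p).mul (hc.mul_const C) i j))

lemma fluidDivQ_mem (p gt : Mat4 ℝ) (np ng : Fin 4 → Mat4 ℝ) (C : Col4 ℝ) (Cd : Fin 4 → Col4 ℝ)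
    (m : ℝ) (dm : Fin 4 → ℝ) {c a : V → Mat4 ℝ} {b : V → Col4 ℝ} (hc : MatMem (linFun V) c)
    (ha : MatMem (linFun V) a) (hb : MatMem (linFun V) b) :
    (fun x => fluidDivQ p gt np ng C (c x) (a x) (b x) Cd m dm) ∈ quadFun V := by
  have hU := hc.mul_const C
  have hq : ∀ q : Mat4 ℝ, (fun x => ((c x * C)ᵀ * q * (c x * C)).trace) ∈ quadFun V :=
    fun q => ((hU.transpose.mul_const q).mul hU).trace
  have hq' : ∀ q s : Mat4 ℝ, (fun x => (q * c x * s * (c x)ᵀ).trace) ∈ quadFun V :=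
    fun q s => (((hc.const_mul q).mul_const s).mul hc.transpose).trace
  have h1 : ∀ κ, MatMem (quadFun V) fun x => ng κ * (c x)ᵀ * p * (c x * C) := fun κ =>
    ((hc.transpose.const_mul _).mul_const p).mul hU
  have h2 : ∀ κ, MatMem (quadFun V) fun x => gt * (c x)ᵀ * np κ * (c x * C) := fun κ =>
    ((hc.transpose.const_mul _).mul_const _).mul hU
  have h3 : ∀ κ, MatMem (quadFun V) fun x => gt * (c x)ᵀ * p * (c x * Cd κ) := fun κ =>
    ((hc.transpose.const_mul _).mul_const _).mul (hc.mul_const _)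
  have h4 : ∀ κ, (fun x => ((c x * C)ᵀ * p * (c x * Cd κ)).trace) ∈ quadFun V := fun κ =>
    ((hU.transpose.mul_const p).mul (hc.mul_const _)).trace
  exact fun_sub_mem (fun_add_mem (fun_add_mem (fun_sub_mem
    (const_mul_mem _ ((hU.transpose.mul_const p).mul hb).trace)
    (const_mul_mem _ (((ha.const_mul p).mul_const gt).mul hc.transpose).trace))
    (mul_const_mem (fluidS_mem p gt C m hc) _))
    (fun_sum_mem fun κ => const_mul_mem _ (fun_add_mem (fun_add_mem (fun_add_mem (fun_add_mem
      (const_mul_mem _ (hq p)) (const_mul_mem _ (h4 κ))) (const_mul_mem _ (hq _)))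
      (hq' _ _)) (hq' _ _))))
    (const_mul_mem _ (fun_sum_mem fun κ => (((h1 κ).add (h2 κ)).add (h3 κ)) κ 0))

lemma fluidDivQ_mem' {S : Submodule ℝ (V → ℝ)} (hS : ∀ c : ℝ, (fun _ => c) ∈ S) (p gt : Mat4 ℝ)
    (np : Fin 4 → Mat4 ℝ) (C : Col4 ℝ) (m : ℝ) (c : Mat4 ℝ) {ng : V → Fin 4 → Mat4 ℝ}
    {Cd : V → Fin 4 → Col4 ℝ} {dm : V → Fin 4 → ℝ} {a : V → Mat4 ℝ} {b : V → Col4 ℝ}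
    (hng : ∀ κ, MatMem S fun x => ng x κ) (hCd : ∀ κ, MatMem S fun x => Cd x κ)
    (hdm : ∀ κ, (fun x => dm x κ) ∈ S) (ha : MatMem S a) (hb : MatMem S b) :
    (fun x => fluidDivQ p gt np (ng x) C c (a x) (b x) (Cd x) m (dm x)) ∈ S := by
  have h1 : ∀ κ, MatMem S fun x => ng x κ * cᵀ * p * (c * C) := fun κ =>
    (((hng κ).mul_const _).mul_const _).mul_const _
  have h2 : ∀ κ, MatMem S fun _ => gt * cᵀ * np κ * (c * C) := fun κ i j => hS _
  have h3 : ∀ κ, MatMem S fun x => gt * cᵀ * p * (c * Cd x κ) := fun κ =>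
    ((hCd κ).const_mul c).const_mul _
  exact fun_sub_mem (fun_add_mem (fun_add_mem (fun_sub_mem
    (const_mul_mem _ (hb.const_mul _).trace)
    (const_mul_mem _ (((ha.const_mul p).mul_const gt).mul_const _).trace))
    (const_mul_mem _ (fun_sum_mem fun κ => hCd κ κ 0)))
    (fun_sum_mem fun κ => const_mul_mem _ (fun_add_mem (fun_add_mem (fun_add_mem (fun_add_mem
      (mul_const_mem (hdm κ) _) (const_mul_mem _ (((hCd κ).const_mul c).const_mul _).trace)) (hS _))
      (hS _)) (((hng κ).const_mul _).mul_const _).trace)))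
    (const_mul_mem _ (fun_sum_mem fun κ => (((h1 κ).add (h2 κ)).add (h3 κ)) κ 0))

end membership

lemma map_fluidT {R R' : Type*} [CommRing R] [CommRing R'] (φ : R →+* R') (p gt : Mat4 R)
    (C : Col4 R) (c : Mat4 R) (m : R) (i : Fin 4) : φ (fluidT p gt C c m i 0)
    = fluidT (p.map φ) (gt.map φ) (C.map φ) (c.map φ) (φ m) i 0 := by
  simp only [fluidT, fluidS, Matrix.sub_apply, Matrix.smul_apply, smul_eq_mul, map_add, map_mul,
    map_sub, map_sum, trace, Matrix.diag, Matrix.mul_apply, transpose_apply,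
    map_apply, map_ofNat]

lemma map_fluidDivQ {R R' : Type*} [CommRing R] [CommRing R'] (φ : R →+* R') (p gt : Mat4 R)
    (np ng : Fin 4 → Mat4 R) (C : Col4 R) (c a : Mat4 R) (b : Col4 R) (Cd : Fin 4 → Col4 R) (m : R)
    (dm : Fin 4 → R) : φ (fluidDivQ p gt np ng C c a b Cd m dm)
    = fluidDivQ (p.map φ) (gt.map φ) (fun κ => (np κ).map φ) (fun κ => (ng κ).map φ) (C.map φ)
    (c.map φ) (a.map φ) (b.map φ) (fun κ => (Cd κ).map φ) (φ m) fun κ => φ (dm κ) := by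
  simp only [fluidDivQ, fluidS, map_add, map_mul, map_sub, map_sum, trace, Matrix.diag,
    Matrix.mul_apply, transpose_apply, map_apply, Matrix.add_apply, map_ofNat]

namespace PointState

variable (P : PointState)

/-- `g̃^{αβ} = g^{αβ} + f⁻² C^α C^β` -/
def gt4 : Mat4 ℝ := of fun α β => P.gi α β + (P.f)⁻¹ ^ 2 * (P.C α * P.C β)

/-- `C^α` as a column. -/
def Cc : Col4 ℝ := of fun α _ => P.C α

/-- `C_γ^α` as columns. -/
def Cd (c : T2) (γ : Fin 4) : Col4 ℝ := of fun α _ => ∑ δ, P.gi α δ * c γ δ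

/-- The derivative of `g̃^{αβ}`. -/
def dgt (c : T2) (κ : Fin 4) : Mat4 ℝ := of fun α β =>
  2 * (P.f)⁻¹ ^ 4 * P.U0 c κ * (P.C α * P.C β)
    + (P.f)⁻¹ ^ 2 * (P.Cd c κ α 0 * P.C β + P.C α * P.Cd c κ β 0)

/-- The derivative of `μ'_p f⁻²`. -/
def dm (c : T2) (κ : Fin 4) : ℝ :=
  -(P.mu2 * ((P.mu + P.p) * (P.f)⁻¹ ^ 2 * P.U0 c κ) * (P.f)⁻¹ ^ 2)
    + 2 * P.mu1 * (P.f)⁻¹ ^ 4 * P.U0 c κ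

/-- The derivative of the coefficients of the divergence equation. -/
def dQ (c : T2) (γ : Fin 4) (α β : Fin 4) : ℝ :=
  P.mu2 * ((P.mu + P.p) * (P.f)⁻¹ ^ 2 * P.U0 c γ) * ((P.f)⁻¹ ^ 2 * (P.C α * P.C β))
    - (P.mu1 - 1) * ((P.f)⁻¹ ^ 2 * (P.Cd c γ α 0 * P.C β + P.C α * P.Cd c γ β 0)
      + 2 * (P.f)⁻¹ ^ 4 * P.U0 c γ * (P.C α * P.C β))

/-- The term `a_{γβ}`, with one factor frozen. -/
def aP (c₀ : T2) (x : T2 × T4) : Mat4 ℝ := of fun γ β =>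
  (∑ α, ∑ δ, P.gi α δ * c₀ γ δ * (x.1 α β - x.1 β α)) + ∑ α, ∑ l, P.C α * P.C l * x.2 γ α β l

/-- The term `b_γ`, with one factor frozen. -/
def bP (c₀ : T2) (x : T2 × T4) : Col4 ℝ := of fun γ _ =>
  -(∑ l, (∑ α, ∑ β, P.gi α β * x.2 β γ α l) * P.C l) + ∑ α, ∑ β, P.dQ c₀ γ α β * x.1 α β

/-- The components `ω^i_{γ0}`. -/
def wP (a : Fin 3 → ℝ) (k : Mat3) (γ : Fin 4) (i : Fin 3) : ℝ :=
  Fin.cases (P.N * ∑ j, P.h⁻¹ i j * a j) (fun l => -(P.N * ∑ j, P.h⁻¹ i j * k l j)) γ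

/-- The components `ω^0_{γi}`. -/
def wP0 (a : Fin 3 → ℝ) (k : Mat3) (γ : Fin 4) (i : Fin 3) : ℝ :=
  Fin.cases (P.N⁻¹ * a i) (fun l => -(P.N⁻¹ * k l i)) γ

/-- The vector whose components give energy density and flux of the fluid. -/
def fluidVec (c : T2) : Col4 ℝ :=
  fluidT pI(P.N, P.h) P.gt4 P.Cc (of c) (P.mu1 * (P.f)⁻¹ ^ 2)

/-- The value of the form `Q_F`. -/
def fluidQ (a : Fin 3 → ℝ) (k : Mat3) (c₀ : T2) (x : T2 × T4) : ℝ :=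
  (P.C 0)⁻¹ * (P.N * (∑ i, ∑ j, P.h⁻¹ i j * k i j) * P.fluidVec x.1 0 0
    + fluidDivQ pI(P.N, P.h) P.gt4 (dposP P.N (P.wP a k)) (P.dgt c₀) P.Cc
      (of x.1) (P.aP c₀ x) (P.bP c₀ x) (P.Cd c₀) (P.mu1 * (P.f)⁻¹ ^ 2) (P.dm c₀)
    - (P.C 0)⁻¹ * ∑ γ, P.fluidVec x.1 γ 0 * P.Cd c₀ γ 0 0
    + (P.C 0)⁻¹ * ∑ γ, P.fluidVec x.1 γ 0 * ∑ i : Fin 3, P.wP0 a k γ i * P.C i.succ)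

lemma entry_mem (γ δ : Fin 4) : (fun c : T2 => c γ δ) ∈ linFun T2 :=
  isLinearMap_mem ⟨fun _ _ => rfl, fun _ _ => rfl⟩

lemma U0_mem (γ : Fin 4) : (fun c => P.U0 c γ) ∈ linFun T2 :=
  fun_sum_mem fun _ => const_mul_mem _ (entry_mem _ _)

lemma Cd_mem (κ : Fin 4) : MatMem (linFun T2) fun c => P.Cd c κ := fun α _ => by
  simp only [Cd, of_apply]
  exact fun_sum_mem fun _ => const_mul_mem _ (entry_mem _ _)

lemma dgt_mem (κ : Fin 4) : MatMem (linFun T2) fun c => P.dgt c κ := fun α β =>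
  fun_add_mem (mul_const_mem (const_mul_mem _ (P.U0_mem κ)) _)
    (const_mul_mem _ (fun_add_mem (mul_const_mem (P.Cd_mem κ α 0) _)
      (const_mul_mem _ (P.Cd_mem κ β 0))))

lemma dm_mem (κ : Fin 4) : (fun c => P.dm c κ) ∈ linFun T2 :=
  fun_add_mem (fun_neg_mem (mul_const_mem (const_mul_mem _ (const_mul_mem _ (P.U0_mem κ))) _))
    (const_mul_mem _ (P.U0_mem κ))

lemma dQ_mem (γ α β : Fin 4) : (fun c => P.dQ c γ α β) ∈ linFun T2 :=
  fun_sub_mem (mul_const_mem (const_mul_mem _ (const_mul_mem _ (P.U0_mem γ))) _)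
    (const_mul_mem _ (fun_add_mem (const_mul_mem _ (fun_add_mem
      (mul_const_mem (P.Cd_mem γ α 0) _) (const_mul_mem _ (P.Cd_mem γ β 0))))
      (mul_const_mem (const_mul_mem _ (P.U0_mem γ)) _)))

lemma fst_entry_mem (γ δ : Fin 4) : (fun x : T2 × T4 => x.1 γ δ) ∈ linFun (T2 × T4) :=
  isLinearMap_mem ⟨fun _ _ => rfl, fun _ _ => rfl⟩

lemma snd_entry_mem (α β γ δ : Fin 4) : (fun x : T2 × T4 => x.2 α β γ δ) ∈ linFun (T2 × T4) :=
  isLinearMap_mem ⟨fun _ _ => rfl, fun _ _ => rfl⟩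

lemma aP_mem (c₀ : T2) : MatMem (linFun (T2 × T4)) (P.aP c₀) := fun _ _ =>
  fun_add_mem (fun_sum_mem fun _ => fun_sum_mem fun _ =>
    const_mul_mem _ (fun_sub_mem (fst_entry_mem _ _) (fst_entry_mem _ _)))
    (fun_sum_mem fun _ => fun_sum_mem fun _ => const_mul_mem _ (snd_entry_mem _ _ _ _))

lemma bP_mem (c₀ : T2) : MatMem (linFun (T2 × T4)) (P.bP c₀) := fun _ _ =>
  fun_add_mem (fun_neg_mem (fun_sum_mem fun _ => mul_const_mem (fun_sum_mem fun _ =>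
    fun_sum_mem fun _ => const_mul_mem _ (snd_entry_mem _ _ _ _)) _))
    (fun_sum_mem fun _ => fun_sum_mem fun _ => const_mul_mem _ (fst_entry_mem _ _))

lemma aP_mem' (x : T2 × T4) : MatMem (affFun T2) fun c₀ => P.aP c₀ x := fun _ _ =>
  fun_add_mem (linFun_le_affFun (fun_sum_mem fun _ => fun_sum_mem fun _ =>
    mul_const_mem (const_mul_mem _ (entry_mem _ _)) _)) (const_mem_affFun _)

lemma bP_mem' (x : T2 × T4) : MatMem (affFun T2) fun c₀ => P.bP c₀ x := fun _ _ =>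
  fun_add_mem (const_mem_affFun _) (linFun_le_affFun (fun_sum_mem fun _ => fun_sum_mem fun _ =>
    mul_const_mem (P.dQ_mem _ _ _) _))

lemma fluidVec_mem : MatMem (quadFun (T2 × T4)) fun x => P.fluidVec x.1 :=
  fluidT_mem _ _ _ _ fun _ _ => fst_entry_mem _ _

lemma fluidQ_mem (a : Fin 3 → ℝ) (k : Mat3) (c₀ : T2) : P.fluidQ a k c₀ ∈ quadFun (T2 × T4) :=
  const_mul_mem _ (fun_add_mem (fun_sub_mem (fun_add_mem
    (const_mul_mem _ (P.fluidVec_mem 0 0))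
    (fluidDivQ_mem _ _ _ _ _ _ _ _ (fun _ _ => fst_entry_mem _ _) (P.aP_mem c₀) (P.bP_mem c₀)))
    (const_mul_mem _ (fun_sum_mem fun γ => mul_const_mem (P.fluidVec_mem γ 0) _)))
    (const_mul_mem _ (fun_sum_mem fun γ => mul_const_mem (P.fluidVec_mem γ 0) _)))

lemma fluidQ_mem' (a : Fin 3 → ℝ) (k : Mat3) (x : T2 × T4) :
    (fun c₀ => P.fluidQ a k c₀ x) ∈ affFun T2 :=
  const_mul_mem _ (fun_add_mem (fun_sub_mem (fun_add_mem
    (const_mem_affFun _)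
    (fluidDivQ_mem' const_mem_affFun _ _ _ _ _ _ (fun κ i j => linFun_le_affFun (P.dgt_mem κ i j))
      (fun κ i j => linFun_le_affFun (P.Cd_mem κ i j)) (fun κ => linFun_le_affFun (P.dm_mem κ))
      (P.aP_mem' x) (P.bP_mem' x)))
    (const_mul_mem _ (fun_sum_mem fun γ => const_mul_mem _
      (linFun_le_affFun (P.Cd_mem γ 0 0)))))
    (const_mem_affFun _))

end PointState

lemma exists_fluidForm : ∃ Q : FluidForm, ∀ P a k c₀ x, Q P a k c₀ x = P.fluidQ a k c₀ x := by
  have := fun (P : PointState) a k =>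
    exists_affine_quadraticForm (P.fluidQ_mem a k) (P.fluidQ_mem' a k)
  choose Q hQ using this
  exact ⟨Q, hQ⟩

/-- The quadratic form of the energy identity of the fluid. -/
def fluidForm : FluidForm := exists_fluidForm.choose

lemma fluidForm_apply (P : PointState) (a : Fin 3 → ℝ) (k : Mat3) (c₀ : T2) (x : T2 × T4) :
    fluidForm P a k c₀ x = P.fluidQ a k c₀ x := exists_fluidForm.choose_spec P a k c₀ x

/-! ### The energy identity of the fluid in coordinates -/

lemma fluidT_eq {p gt : Mat4 ℝ} (hp : pᵀ = p) (C : T1) (c : T2) (m : ℝ) (α : Fin 4) : fluidT p gt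
    (of fun α _ => C α) (of c) m α 0 = pr p fun γ δ => C α *
    (m * ((∑ β, C β * c γ β) * ∑ β, C β * c δ β) + pr gt fun β β' => c γ β * c δ β')
    - 2 * ((∑ β, C β * c γ β) * ∑ β, gt α β * c δ β) := by
  have h1 : ((of c * (of fun α _ => C α : Col4 ℝ))ᵀ * p *
      (of c * (of fun α _ => C α : Col4 ℝ))).trace
      = pr p fun γ δ => (∑ β, C β * c γ β) * ∑ β, C β * c δ β := by
    simp only [trace, Matrix.diag, Finset.univ_unique, Finset.sum_singleton, Matrix.mul_apply,
      transpose_apply, of_apply, pr, mul_comm (C _)]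
    conv_lhs => simp only [sum_mul _ _ (∑ _, _)]
    rw [sum_comm]
    refine sum_ext fun i => sum_ext fun j => ?_
    ring
  have h2 : (gt * (of c : Mat4 ℝ)ᵀ * p * (of c * (of fun α _ => C α : Col4 ℝ))) α 0
      = pr p fun γ δ => (∑ β, C β * c γ β) * ∑ β, gt α β * c δ β := by
    rw [pr_swap p hp]
    simp only [Matrix.mul_apply, transpose_apply, of_apply, pr, mul_comm (C _)]
    conv_lhs => simp only [sum_mul _ _ (∑ _, _)]
    rw [sum_comm]
    refine sum_ext fun i => sum_ext fun j => ?_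
    ring
  rw [fluidT, Matrix.sub_apply, Matrix.smul_apply, Matrix.smul_apply, h2, fluidS, h1,
    trace_eq_pr p hp, of_apply, smul_eq_mul, smul_eq_mul, sub_eq_add_neg, ← neg_mul]
  simp only [mul_pr, pr_add, add_mul]
  simp only [mul_comm _ (C α), mul_pr, pr_add, of_apply]
  refine pr_congr fun γ δ => ?_
  rw [mul_add, mul_pr gt (C α)]
  ring

/-- Nondegeneracy of the metric and of the velocity. -/
structure PointState.Regular (P : PointState) : Prop where
  h_posDef : P.h.PosDef
  N_ne : P.N ≠ 0
  f_ne : P.f ≠ 0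
  CC_eq : P.CC = -P.f ^ 2
  C_ne : P.C 0 ≠ 0

namespace PointState

variable {P : PointState}

lemma gt4_transpose (hh : P.h.PosDef) : P.gt4ᵀ = P.gt4 := by
  have hs := hinv_symm hh
  ext α β
  cases α using Fin.cases <;> cases β using Fin.cases <;>
    simp only [gt4, gi, frameMetricInv, transpose_apply, of_apply, Fin.cases_zero, Fin.cases_succ]
  · ring
  · ring
  · rw [hs]; ring

lemma gi_mul_g (hh : P.h.PosDef) (hN : P.N ≠ 0) (α γ : Fin 4) :
    ∑ β, P.gi α β * P.g β γ = if α = γ then 1 else 0 := by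
  have h := Matrix.nonsing_inv_mul P.h (isUnit_iff_ne_zero.2 hh.det_pos.ne')
  rw [sum4]
  refine Fin.cases ?_ (fun i => ?_) α <;> refine Fin.cases ?_ (fun j => ?_) γ
  · simp [gi, g, frameMetricInv, frameMetric, hN]
  · simp [gi, g, frameMetricInv, frameMetric, (Fin.succ_ne_zero j).symm]
  · simp [gi, g, frameMetricInv, frameMetric]
  · have h' := entry_congr h i j
    rw [Matrix.mul_apply, Matrix.one_apply] at h'
    simp [gi, g, frameMetricInv, frameMetric, h', Fin.succ_inj]

lemma gi_mul_Cl (hh : P.h.PosDef) (hN : P.N ≠ 0) (α : Fin 4) : ∑ β, P.gi α β * P.Cl β = P.C α := by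
  simp only [Cl, mul_sum]
  rw [sum_comm]
  simp only [← mul_assoc, ← sum_mul, gi_mul_g hh hN]
  simp

lemma gt4_mul_Cl (hh : P.h.PosDef) (hN : P.N ≠ 0) (hf : P.f ≠ 0) (hC : P.CC = -P.f ^ 2)
    (α : Fin 4) : ∑ β, P.gt4 α β * P.Cl β = 0 := by
  have h2 : ∑ β, P.C β * P.Cl β = -P.f ^ 2 := hC
  simp only [gt4, of_apply, add_mul, sum_add_distrib, gi_mul_Cl hh hN, mul_assoc, ← mul_sum, h2]
  field_simp
  ring

lemma Cl_zero : P.Cl 0 = -P.N ^ 2 * P.C 0 := by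
  simp [Cl, sum4, g, frameMetric]

lemma gt4_mul_acc (hP : P.Regular) (c : T2) (α γ : Fin 4) :
    ∑ β, P.gt4 α β * c γ β = ∑ j : Fin 3, P.gt4 α j.succ * P.Ui c γ j := by
  have ⟨hh, hN, hf, hC, h0⟩ := hP
  have h1 := gt4_mul_Cl hh hN hf hC α
  rw [sum4] at h1
  have h2 : P.Cl 0 ≠ 0 := by rw [Cl_zero]; simp [hN, h0]
  have h3 : P.gt4 α 0 = -(∑ j : Fin 3, P.gt4 α j.succ * P.Cl j.succ) / P.Cl 0 := by
    rw [eq_div_iff h2]; linarith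
  simp only [sum4, Ui, mul_sub, sum_sub_distrib, h3]
  have : ∑ j : Fin 3, P.gt4 α j.succ * (P.Cl j.succ / P.Cl 0 * c γ 0)
      = (∑ j : Fin 3, P.gt4 α j.succ * P.Cl j.succ) / P.Cl 0 * c γ 0 := by
    simp only [Finset.sum_div, sum_mul]
    exact sum_ext fun j => by ring
  rw [this]
  ring

lemma pr_gt4_acc (hP : P.Regular) (c c' : T2) (γ δ : Fin 4) : (pr P.gt4 fun β β' => c γ β * c' δ β')
    = ∑ j, ∑ k, P.gt j k * (P.Ui c γ j * P.Ui c' δ k) := by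
  have ⟨hh, hN, hf, hC, h0⟩ := hP
  have hs : ∀ α β, P.gt4 α β = P.gt4 β α := fun α β => entry_congr (gt4_transpose hh) β α
  have e1 : (pr P.gt4 fun β β' => c γ β * c' δ β')
      = ∑ β, c γ β * ∑ k : Fin 3, P.gt4 β k.succ * P.Ui c' δ k := by
    simp only [← gt4_mul_acc hP, pr, mul_sum, mul_left_comm]
  have e2 : ∑ β, c γ β * ∑ k : Fin 3, P.gt4 β k.succ * P.Ui c' δ k
      = ∑ k : Fin 3, P.Ui c' δ k * ∑ β, P.gt4 k.succ β * c γ β := by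
    simp only [mul_sum]
    rw [sum_comm]
    refine sum_ext fun k => sum_ext fun β => ?_
    rw [hs β k.succ]; ring
  rw [e1, e2]
  simp only [gt4_mul_acc hP, mul_sum]
  rw [sum_comm]
  refine sum_ext fun k => sum_ext fun β => ?_
  have : P.gt k β = P.gt4 k.succ β.succ := by
    rw [gt, hC]
    simp only [gt4, of_apply, gi, frameMetricInv, Fin.cases_succ]
    field_simp
    ring
  rw [this, hs]; ring

lemma fluidVec_eq (hP : P.Regular) (c : T2) (α : Fin 4) : P.fluidVec c α 0
    = pr pI(P.N, P.h) fun γ δ => P.C α * (P.mu1 * (P.f ^ 2)⁻¹ * (P.U0 c γ * P.U0 c δ)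
    + ∑ j, ∑ k, P.gt j k * (P.Ui c γ j * P.Ui c δ k)) - 2 *
    (P.U0 c γ * ∑ j : Fin 3, P.gt4 α j.succ * P.Ui c δ j) := by
  have ⟨hh, _, _, _, _⟩ := hP
  rw [fluidVec, Cc, fluidT_eq (posMetricInv_transpose _ (posDef_transpose hh))]
  refine pr_congr fun γ δ => ?_
  rw [pr_gt4_acc hP, gt4_mul_acc hP, inv_pow]
  rfl

lemma fluidFlux_eq (hP : P.Regular) (c : T2) (i : Fin 3) :
    P.fluidFlux c i = (P.C 0)⁻¹ * P.fluidVec c i.succ 0 := by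
  have ⟨_, hN, hf, hC, h0⟩ := hP
  rw [fluidVec_eq hP, mul_pr]
  refine congrArg (pr pI(P.N, P.h)) (funext fun γ => funext fun δ => ?_)
  congr 2
  simp only [mul_sum]
  refine sum_ext fun j => ?_
  rw [gt, hC]
  simp only [gt4, of_apply, gi, frameMetricInv, Fin.cases_succ]
  field_simp
  ring

lemma fluidEnergy_eq (hP : P.Regular) (c : T2) : P.fluidEnergy c = (P.C 0)⁻¹ * P.fluidVec c 0 0 := by
  have ⟨hh, hN, hf, hC, h0⟩ := hP
  rw [fluidVec_eq hP, mul_pr]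
  set V : Fin 4 → ℝ := fun γ => ∑ i : Fin 3, P.C i.succ * P.Ui c γ i with hV
  have e1 : ∀ γ δ, ∑ j, ∑ k, P.gt j k * (P.Ui c γ j * P.Ui c δ k)
      = ∑ i, ∑ j, P.h⁻¹ i j * (P.Ui c γ i * P.Ui c δ j) + (P.f ^ 2)⁻¹ * (V γ * V δ) := by
    intro γ δ
    simp only [hV, Finset.sum_mul_sum]
    simp only [mul_sum, ← sum_add_distrib]
    refine sum_ext fun i => sum_ext fun j => ?_
    rw [gt, hC]
    field_simp
    ring
  have e2 : ∀ δ, ∑ j : Fin 3, P.gt4 0 j.succ * P.Ui c δ j = (P.f ^ 2)⁻¹ * P.C 0 * V δ := by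
    intro δ
    simp only [hV, mul_sum]
    refine sum_ext fun j => ?_
    simp only [gt4, of_apply, gi, frameMetricInv, Fin.cases_zero, Fin.cases_succ]
    ring
  have hsw : (pr pI(P.N, P.h) fun γ δ => P.U0 c γ * V δ)
      = pr pI(P.N, P.h) fun γ δ => V γ * P.U0 c δ := by
    rw [pr_swap _ (posMetricInv_transpose _ (posDef_transpose hh))]
    simp only [mul_comm]
  have e3 : P.fluidEnergy c = pr pI(P.N, P.h) (fun γ δ => (P.C 0)⁻¹ *
      (P.C 0 * (P.mu1 * (P.f ^ 2)⁻¹ * (P.U0 c γ * P.U0 c δ)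
      + ∑ j, ∑ k, P.gt j k * (P.Ui c γ j * P.Ui c δ k))
      - 2 * (P.U0 c γ * ∑ j : Fin 3, P.gt4 0 j.succ * P.Ui c δ j)))
      + ((P.f ^ 2)⁻¹ * pr pI(P.N, P.h) (fun γ δ => P.U0 c γ * V δ)
      - (P.f ^ 2)⁻¹ * pr pI(P.N, P.h) fun γ δ => V γ * P.U0 c δ) := by
    rw [sub_eq_add_neg, ← neg_mul]
    simp only [mul_pr, pr_add]
    refine congrArg (pr pI(P.N, P.h)) (funext fun γ => funext fun δ => ?_)
    rw [e1, e2]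
    change (P.f ^ 2)⁻¹ * ((P.mu1 - 1) * (P.U0 c γ * P.U0 c δ)
        + (P.U0 c γ - V γ) * (P.U0 c δ - V δ))
      + ∑ i, ∑ j, P.h⁻¹ i j * (P.Ui c γ i * P.Ui c δ j) = _
    field_simp
    ring
  rw [e3, hsw, sub_self, add_zero]

end PointState

namespace FluidRegularOn

variable {M : LocalMetric} {st : Coord → PointState} {Ω : Opens Coord}
  (hF : FluidRegularOn M st Ω) (hM : M.RegularOn Ω)

lemma ev_T (i : Fin 4) (z : Ω) : ev z ((hF.fluid hM).T i 0) = (st z).fluidVec (acc M st z) i 0 := by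
  have h := map_fluidT (ev z : SmoothAlg Ω →+* ℝ) hM.slicing.pos (hF.fluid hM).gt (hF.fluid hM).Cc
    (hF.fluid hM).cm (hF.fluid hM).m i
  rw [Fluid.T, PointState.fluidVec]
  refine h.trans ?_
  congr 1
  congr 1
  · ext α β
    simp only [map_apply, RingHom.coe_coe, hM.ev_pos, of_apply, hF.N_eq, hF.h_eq]
  · ext α β
    simp only [map_apply, RingHom.coe_coe, Fluid.gt, PointState.gt4, of_apply, map_add, map_mul,
      map_pow, ev_fi, ev_C, hM.ev_metricInv, hF.gi_eq]
  · ext α β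
    exact hF.ev_c hM α β z

lemma ev_rate (z : Ω) : ev z (hF.fluid hM).rate
    = (st z).fluidQ (M.dN z) (M.K z) (acc M st z) (acc M st z, M.riem z) := by
  have h := map_fluidDivQ (ev z : SmoothAlg Ω →+* ℝ) hM.slicing.pos (hF.fluid hM).gt
    hM.slicing.npos (hF.fluid hM).ngt (hF.fluid hM).Cc (hF.fluid hM).cm
    (of (hF.fluid hM).a) (of fun γ _ => (hF.fluid hM).b γ) (hF.fluid hM).Cdc
    (hF.fluid hM).m (hF.fluid hM).dm
  have hw0 : ∀ (γ : Fin 4) (i : Fin 3), M.omega 0 γ i.succ z = (st z).wP0 (M.dN z) (M.K z) γ i := by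
    intro γ i
    rw [← hM.ev_omega]
    refine Fin.cases ?_ (fun k => ?_) γ
    · rw [Slicing.omega_zero_left]
      simp only [map_mul, hM.ev_Ni, hM.ev_dN, PointState.wP0, Fin.cases_zero, hF.N_eq]
    · rw [Slicing.omega_zero_space]
      simp only [map_mul, map_neg, hM.ev_Ni, hM.ev_K, PointState.wP0, Fin.cases_succ, hF.N_eq]
  have hw : (fun γ (i : Fin 3) => M.omega i.succ γ 0 z) = (st z).wP (M.dN z) (M.K z) := by
    funext γ i
    rw [← hM.ev_omega]
    refine Fin.cases ?_ (fun k => ?_) γ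
    · rw [Slicing.omega_succ_zero_zero]
      simp only [map_mul, map_sum, hM.ev_N, hM.ev_hi, hM.ev_dN, PointState.wP, Fin.cases_zero,
        hF.N_eq, hF.h_eq]
    · rw [Slicing.omega_succ_succ_zero]
      simp only [map_mul, map_neg, map_sum, hM.ev_N, hM.ev_hi, hM.ev_K, PointState.wP,
        Fin.cases_succ, hF.N_eq, hF.h_eq]
  have e1 : hM.slicing.pos.map (ev z : SmoothAlg Ω →+* ℝ)
      = of (posMetricInv (st z).N (st z).h) := by
    ext α β
    simp only [map_apply, RingHom.coe_coe, hM.ev_pos, of_apply, hF.N_eq, hF.h_eq]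
  have e2 : (hF.fluid hM).gt.map (ev z : SmoothAlg Ω →+* ℝ) = (st z).gt4 := by
    ext α β
    simp only [map_apply, RingHom.coe_coe, Fluid.gt, PointState.gt4, of_apply, map_add, map_mul,
      map_pow, ev_fi, ev_C, hM.ev_metricInv, hF.gi_eq]
  have e3 : (fun κ => (hM.slicing.npos κ).map (ev z : SmoothAlg Ω →+* ℝ))
      = dposP (st z).N ((st z).wP (M.dN z) (M.K z)) := by
    funext κ
    ext α β
    rw [map_apply, RingHom.coe_coe, hM.ev_npos, ← hw, hF.N_eq]
  have e4 : (fun κ => ((hF.fluid hM).ngt κ).map (ev z : SmoothAlg Ω →+* ℝ))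
      = (st z).dgt (acc M st z) := by
    funext κ
    ext α β
    simp only [map_apply, RingHom.coe_coe, Fluid.ngt, PointState.dgt, of_apply, map_add, map_mul,
      map_pow, ev_fi, ev_C, ev_U, ev_Cd, PointState.Cd, map_ofNat]
  have e5 : (of (hF.fluid hM).a : Mat4 _).map (ev z : SmoothAlg Ω →+* ℝ)
      = (st z).aP (acc M st z) (acc M st z, M.riem z) := by
    ext α β
    exact hF.ev_a hM α β z
  have e6 : (of fun γ _ => (hF.fluid hM).b γ : Col4 _).map (ev z : SmoothAlg Ω →+* ℝ)
      = (st z).bP (acc M st z) (acc M st z, M.riem z) := by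
    ext α β
    simp only [map_apply, RingHom.coe_coe, of_apply, Fluid.b, Fluid.nQ, PointState.bP,
      PointState.dQ, map_sum, map_mul, map_add, map_neg, map_sub, map_pow, ev_C, ev_c, ev_Cd, ev_fi,
      ev_U, hM.ev_metricInv, hM.ev_riem, hF.gi_eq, ev_mu, ev_p, ev_mu1, ev_mu2, PointState.Cd,
      map_ofNat, map_one]
  have e7 : (fun κ => ((hF.fluid hM).Cdc κ).map (ev z : SmoothAlg Ω →+* ℝ))
      = (st z).Cd (acc M st z) := by
    funext κ
    ext α β
    exact hF.ev_Cd hM κ α z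
  have e8 : (fun κ => (ev z : SmoothAlg Ω →+* ℝ) ((hF.fluid hM).dm κ))
      = (st z).dm (acc M st z) := by
    funext κ
    simp only [RingHom.coe_coe, Fluid.dm, PointState.dm, map_add, map_neg, map_mul, map_pow, ev_fi,
      ev_U, ev_mu, ev_p, ev_mu1, ev_mu2, map_ofNat]
  have e9 : (ev z : SmoothAlg Ω →+* ℝ) (hF.fluid hM).m = (st z).mu1 * (st z).f⁻¹ ^ 2 := by
    simp only [RingHom.coe_coe, Fluid.m, map_mul, map_pow, ev_fi, ev_mu1]
  have e10 : (hF.fluid hM).cm.map (ev z : SmoothAlg Ω →+* ℝ) = of (acc M st z) := by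
    ext α β
    exact hF.ev_c hM α β z
  rw [e1, e2, e3, e4, e5, e6, e7, e8, e9, e10] at h
  rw [Fluid.rate, PointState.fluidQ]
  simp only [map_mul, map_add, map_sub, map_sum, ev_T, ev_C0i, hM.ev_omega, hw0, ev_C, hM.ev_N,
    hM.ev_tau]
  rw [show ∀ x, (ev z) x = (ev z : SmoothAlg Ω →+* ℝ) x from fun _ => rfl, h]
  simp only [hF.N_eq, LocalMetric.tau, hF.h_eq]
  rw [← e7]
  rfl

lemma regular (hF : FluidRegularOn M st Ω) (hM : M.RegularOn Ω) {z : Coord} (hz : z ∈ Ω) :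
    (st z).Regular :=
  ⟨by rw [hF.h_eq]; exact hM.h_posDef z hz, by rw [hF.N_eq]; exact hM.N_ne hz, hF.f_ne z hz,
    hF.CC_eq z hz, hF.C_ne z hz⟩

lemma ev_fluidEnergy (z : Ω) : ev z ((hF.fluid hM).C0i * (hF.fluid hM).T 0 0)
    = (st z).fluidEnergy (acc M st z) := by
  rw [PointState.fluidEnergy_eq (hF.regular hM z.2), map_mul, ev_T]
  rfl

lemma ev_fluidFlux (i : Fin 3) (z : Ω) : ev z ((hF.fluid hM).C0i * (hF.fluid hM).T i.succ 0)
    = (st z).fluidFlux (acc M st z) i := by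
  rw [PointState.fluidFlux_eq (hF.regular hM z.2), map_mul, ev_T]
  rfl

/-- The energy identity of the fluid. -/
lemma fluid_energy (hF : FluidRegularOn M st Ω) (hM : M.RegularOn Ω) (hE : EinsteinEulerOn M st Ω)
    {z : Coord} (hz : z ∈ Ω) : M.D 0 (fun w => (st w).fluidEnergy (acc M st w)) z
    + M.div (fun w => (st w).fluidFlux (acc M st w)) z = fluidForm (st z) (M.dN z) (M.K z)
    (acc M st z) (acc M st z, M.riem z) := by
  have h := congrArg (ev ⟨z, hz⟩)
    (Fluid.T_divergence _ (hF.fluid_accM hM hE) (hF.fluid_accDiv hM hE))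
  rw [map_add, hM.ev_D 0 (f := fun w => (st w).fluidEnergy (acc M st w)) (hF.ev_fluidEnergy hM),
    hM.ev_div (Y := fun w => (st w).fluidFlux (acc M st w)) (hF.ev_fluidFlux hM), ev_rate] at h
  rw [h, fluidForm_apply]

end FluidRegularOn

/-! ### Positivity of the energy density -/

section positivity

variable {n m : Type*} [Fintype n] [Fintype m] [DecidableEq n] [DecidableEq m]

lemma pr_pos {p : Matrix n n ℝ} (hp : p.PosDef) {x : n → ℝ} (hx : x ≠ 0) :
    0 < pr p fun i j => x i * x j := by
  have h := hp.dotProduct_mulVec_pos hx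
  simp only [dotProduct, Matrix.mulVec, Pi.star_apply, star_trivial, mul_sum] at h
  refine h.trans_eq (sum_ext fun i => sum_ext fun j => ?_)
  ring

lemma pr_nonneg {p : Matrix n n ℝ} (hp : p.PosDef) (x : n → ℝ) : 0 ≤ pr p fun i j => x i * x j := by
  by_cases hx : x = 0
  · simp [hx, pr]
  · exact (pr_pos hp hx).le

lemma pr_pr_pos {p : Matrix n n ℝ} (hp : p.PosDef) {q : Matrix m m ℝ} (hq : q.PosDef)
    {X : n → m → ℝ} (hX : X ≠ 0) : 0 < pr p fun i k => pr q fun j l => X i j * X k l := by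
  have hne : (fun a : n × m => X a.1 a.2) ≠ 0 := fun h => hX <| by
    funext i j
    exact congrFun h (i, j)
  have h := pr_pos (hp.kronecker hq) hne
  refine h.trans_eq ?_
  simp only [pr, Fintype.sum_prod_type, Matrix.kroneckerMap_apply, mul_sum]
  refine sum_ext fun i => ?_
  rw [sum_comm]
  refine sum_ext fun j => sum_ext fun k =>
    sum_ext fun l => ?_
  ring

lemma pr_pr_nonneg {p : Matrix n n ℝ} (hp : p.PosDef) {q : Matrix m m ℝ} (hq : q.PosDef)
    (X : n → m → ℝ) : 0 ≤ pr p fun i k => pr q fun j l => X i j * X k l := by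
  by_cases hX : X = 0
  · simp [hX, pr]
  · exact (pr_pr_pos hp hq hX).le

end positivity

lemma posMetricInv_posDef {N : ℝ} (hN : N ≠ 0) {h : Mat3} (hh : h.PosDef) : pI(N, h).PosDef := by
  refine Matrix.posDef_iff_dotProduct_mulVec.2
    ⟨by simpa [Matrix.IsHermitian] using posMetricInv_transpose N (posDef_transpose hh),
      fun x hx => ?_⟩
  have e : dotProduct (star x) (pI(N, h).mulVec x) = pr pI(N, h) fun i j => x i * x j := by
    simp only [dotProduct, Matrix.mulVec, Pi.star_apply, star_trivial, mul_sum, pr]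
    refine sum_ext fun i => sum_ext fun j => ?_
    ring
  rw [e, pr_posMetricInv]
  have h1 : 0 < (N ^ 2)⁻¹ := by positivity
  by_cases h0 : (fun i : Fin 3 => x i.succ) = 0
  · have hx0 : x 0 ≠ 0 := fun h => hx <| by
      funext α
      exact Fin.cases h (fun i => congrFun h0 i) α
    exact add_pos_of_pos_of_nonneg (mul_pos h1 (mul_self_pos.2 hx0)) (pr_nonneg hh.inv fun i : Fin 3 => x i.succ)
  · exact add_pos_of_nonneg_of_pos (mul_nonneg h1.le (mul_self_nonneg _)) (pr_pos hh.inv h0)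

lemma normSq_nonneg {h : Mat3} (hh : h.PosDef) (X : Mat3) : 0 ≤ normSq h X := by
  rw [normSq_eq, pr_swap _ (hinv_transpose hh)]
  simp only [pr_swap _ (hinv_transpose hh) (fun j l => X _ l * X _ j)]
  exact pr_pr_nonneg hh.inv hh.inv X

lemma normSq_pos {h : Mat3} (hh : h.PosDef) {X : Mat3} (hX : X ≠ 0) : 0 < normSq h X := by
  rw [normSq_eq, pr_swap _ (hinv_transpose hh)]
  simp only [pr_swap _ (hinv_transpose hh) (fun j l => X _ l * X _ j)]
  exact pr_pr_pos hh.inv hh.inv hX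

lemma unstar3_zero (h : Mat3) : unstar3 h 0 = 0 := by
  funext a b; simp [unstar3]

lemma belRobinson_nonneg {N : ℝ} {h : Mat3} (hh : h.PosDef) (r : T4) : 0 ≤ belRobinson N h r := by
  have h1 := normSq_nonneg hh (elE N h r)
  have h2 := normSq_nonneg hh (magH N h r)
  have h3 := normSq_nonneg hh (elD h r)
  have h4 := normSq_nonneg hh (magB N h r)
  rw [belRobinson]; linarith

lemma belRobinson_pos {N : ℝ} (hN : N ≠ 0) {h : Mat3} (hh : h.PosDef) {r : T4} (hr : SkewLeft r)
    (hr' : SkewRight r) (h0 : r ≠ 0) : 0 < belRobinson N h r := by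
  refine (belRobinson_nonneg hh r).lt_of_ne fun he => h0 ?_
  have h1 := normSq_nonneg hh (elE N h r)
  have h2 := normSq_nonneg hh (magH N h r)
  have h3 := normSq_nonneg hh (elD h r)
  have h4 := normSq_nonneg hh (magB N h r)
  rw [belRobinson] at he
  have key : ∀ X : Mat3, normSq h X ≤ 0 → X = 0 := fun X hX => by
    by_contra hne
    exact (normSq_pos hh hne).not_ge hX
  have e1 := key (elE N h r) (by linarith)
  have e2 := key (magH N h r) (by linarith)
  have e3 := key (elD h r) (by linarith)
  have e4 := key (magB N h r) (by linarith)
  funext α β l m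
  rw [riem_eq_scale hh hN hr hr', e1, e2, e3, e4]
  have : ofElMag h (0, 0, 0, 0) α β l m = 0 := by
    have hz : ∀ i : Fin 3, unstar3 h ((0 : Mat3) i) = 0 := fun i => unstar3_zero h
    have hz' : ∀ i : Fin 3, unstar3 h (fun c => (0 : Mat3) c i) = 0 := fun i => unstar3_zero h
    have hz'' : (unstar3 h fun _ => (0 : ℝ)) = 0 := unstar3_zero h
    simp only [ofElMag, mkBiv_apply, hz, hz', Pi.zero_apply, hz'']
    refine Fin.cases ?_ (fun i => ?_) α <;> refine Fin.cases ?_ (fun j => ?_) β <;>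
      refine Fin.cases ?_ (fun k => ?_) l <;> refine Fin.cases ?_ (fun n => ?_) m <;>
      simp [mkBiv]
  rw [this, mul_zero]; rfl

namespace PointState

variable {P : PointState}

lemma fluidEnergy_eq_sum (c : T2) : P.fluidEnergy c = (P.f ^ 2)⁻¹ *
    ((P.mu1 - 1) * (pr pI(P.N, P.h) fun γ δ => P.U0 c γ * P.U0 c δ)
    + pr pI(P.N, P.h) fun γ δ => (P.U0 c γ - ∑ i : Fin 3, P.C i.succ * P.Ui c γ i) *
    (P.U0 c δ - ∑ i : Fin 3, P.C i.succ * P.Ui c δ i)) + pr pI(P.N, P.h) fun γ δ => pr P.h⁻¹ fun i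
    j => P.Ui c γ i * P.Ui c δ j := by
  simp only [mul_pr, pr_add]
  rfl

lemma fluidEnergy_pos (hP : P.Regular) (hmu : 1 ≤ P.mu1) {c : T2} (hc : c ≠ 0) : 0 < P.fluidEnergy c := by
  have ⟨hh, hN, hf, hC, h0⟩ := hP
  have hp := posMetricInv_posDef hN hh
  have hf2 : 0 < (P.f ^ 2)⁻¹ := by positivity
  have hl : P.Cl 0 ≠ 0 := by rw [Cl_zero]; simp [hN, h0]
  have a1 := pr_nonneg hp fun γ => P.U0 c γ
  have a2 := pr_nonneg hp fun γ => P.U0 c γ - ∑ i : Fin 3, P.C i.succ * P.Ui c γ i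
  rw [fluidEnergy_eq_sum]
  by_cases hU : P.Ui c = 0
  · have hV : (fun γ => P.U0 c γ) ≠ 0 := fun hz => hc <| by
      have hi : ∀ γ (i : Fin 3), c γ i.succ = P.Cl i.succ / P.Cl 0 * c γ 0 := fun γ i => by
        have := congrFun (congrFun hU γ) i
        simp only [Ui, Pi.zero_apply] at this
        linarith
      have hc0 : ∀ γ, c γ 0 = 0 := fun γ => by
        have h1 : P.U0 c γ = 0 := congrFun hz γ
        have h2 : P.U0 c γ = c γ 0 / P.Cl 0 * P.CC := by
          simp only [U0, CC, sum4, hi, mul_sum, mul_add]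
          congr 1
          · field_simp
          · exact sum_ext fun i => by field_simp
        rw [h2, hC] at h1
        simpa [hf, hl] using h1
      funext γ α
      refine Fin.cases (hc0 γ) (fun i => ?_) α
      rw [hi, hc0, mul_zero]; rfl
    have h1 := pr_pos hp hV
    have : (pr pI(P.N, P.h) fun γ δ => pr P.h⁻¹ fun i j =>
        P.Ui c γ i * P.Ui c δ j) = 0 := by simp [hU, pr]
    have e : ∀ γ, P.U0 c γ - ∑ i : Fin 3, P.C i.succ * P.Ui c γ i = P.U0 c γ := fun γ => by
      simp [hU]
    simp only [e] at a2 ⊢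
    rw [this, add_zero]
    exact mul_pos hf2 (add_pos_of_nonneg_of_pos (mul_nonneg (sub_nonneg.2 hmu) a1) h1)
  · have h1 := pr_pr_pos hp hh.inv hU
    exact add_pos_of_nonneg_of_pos
      (mul_nonneg hf2.le (add_nonneg (mul_nonneg (sub_nonneg.2 hmu) a1) a2)) h1

lemma fluidEnergy_zero : P.fluidEnergy 0 = 0 := by
  simp [fluidEnergy, U0, Ui]

end PointState

/-! ### Algebra of the symmetrizer -/

lemma biv_neg_swap (w : PairIdx → ℝ) (α β : Fin 4) : biv w α β = -biv w β α := by
  refine Fin.cases ?_ (fun i => ?_) α <;> refine Fin.cases ?_ (fun j => ?_) β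
  · simp
  · simp
  · simp
  · simp only [biv_succ_succ, ← sum_neg_distrib]
    refine sum_ext fun k => ?_
    simp only [eps]; ring

lemma biv_add (v w : PairIdx → ℝ) : biv (v + w) = biv v + biv w := by
  funext α β
  cases α using Fin.cases <;> cases β using Fin.cases <;>
    simp [mul_add, sum_add_distrib]
  ring

lemma biv_smul (c : ℝ) (v : PairIdx → ℝ) : biv (c • v) = c • biv v := by
  funext α β
  cases α using Fin.cases <;> cases β using Fin.cases <;>
    simp [mul_sum, mul_left_comm]

lemma riemPart_antisymm (v : Idx → ℝ) (α β l m : Fin 4) :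
    riemPart v α β l m = -riemPart v β α l m := biv_neg_swap _ _ _

lemma riemPart_antisymm' (v : Idx → ℝ) (α β l m : Fin 4) :
    riemPart v α β l m = -riemPart v α β m l := by
  have h : (fun a => biv (fun b => v (Sum.inl (a, b))) l m)
      = (-1 : ℝ) • fun a => biv (fun b => v (Sum.inl (a, b))) m l := by
    funext a; simp [biv_neg_swap _ l m]
  rw [riemPart, h, biv_smul]
  simp [riemPart]

lemma riemPart_add (v w : Idx → ℝ) : riemPart (v + w) = riemPart v + riemPart w := by
  funext α β l m
  have h : (fun a => biv (fun b => (v + w) (Sum.inl (a, b))) l m)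
      = (fun a => biv (fun b => v (Sum.inl (a, b))) l m)
      + fun a => biv (fun b => w (Sum.inl (a, b))) l m := by
    funext a
    have := congrFun (congrFun (biv_add (fun b => v (Sum.inl (a, b)))
      fun b => w (Sum.inl (a, b))) l) m
    exact this
  rw [riemPart, h, biv_add]
  rfl

lemma riemPart_smul (c : ℝ) (v : Idx → ℝ) : riemPart (c • v) = c • riemPart v := by
  funext α β l m
  have h : (fun a => biv (fun b => (c • v) (Sum.inl (a, b))) l m)
      = c • fun a => biv (fun b => v (Sum.inl (a, b))) l m := by
    funext a
    exact congrFun (congrFun (biv_smul c fun b => v (Sum.inl (a, b))) l) m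
  rw [riemPart, h, biv_smul]
  rfl

/-- `riemPart` as a linear map. -/
def riemPartL : (Idx → ℝ) →ₗ[ℝ] T4 where
  toFun := riemPart
  map_add' := riemPart_add
  map_smul' := riemPart_smul

lemma biv_pair (w : PairIdx → ℝ) (a : PairIdx) : biv w (pairFst a) (pairSnd a) = w a := by
  rcases a with i | k
  · simp [pairFst, pairSnd]
  · have h11 : (1 + 1 : Fin 3) = 2 := rfl
    have h12 : (1 + 2 : Fin 3) = 0 := rfl
    have h21 : (2 + 1 : Fin 3) = 0 := rfl
    have h22 : (2 + 2 : Fin 3) = 1 := rfl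
    simp only [pairFst, pairSnd, Sum.elim_inr, biv_succ_succ, Fin.sum_univ_three]
    obtain rfl | rfl | rfl : k = 0 ∨ k = 1 ∨ k = 2 := by fin_cases k <;> simp
    all_goals norm_num [eps, h11, h12, h21, h22]

lemma riemPart_pair (v : Idx → ℝ) (α β : Fin 4) (b : PairIdx) :
    riemPart v α β (pairFst b) (pairSnd b) = biv (fun a => v (Sum.inl (a, b))) α β := by
  simp only [riemPart, biv_pair]

lemma riemPart_inl (v : Idx → ℝ) (a b : PairIdx) :
    riemPart v (pairFst a) (pairSnd a) (pairFst b) (pairSnd b) = v (Sum.inl (a, b)) := by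
  rw [riemPart_pair, biv_pair]

lemma riemPart_eq_zero {v : Idx → ℝ} (h : riemPart v = 0) (a b : PairIdx) :
    v (Sum.inl (a, b)) = 0 := by
  rw [← riemPart_inl v a b, h]; rfl

/-! ### A criterion for symmetric hyperbolicity -/

lemma eq_sum_smul_single {ι : Type*} [Fintype ι] [DecidableEq ι] (v : ι → ℝ) :
    v = ∑ j, v j • Pi.single j (1 : ℝ) := by
  funext i
  simp only [Finset.sum_apply, Pi.smul_apply, smul_eq_mul]
  rw [Finset.sum_eq_single i (fun j _ hj => by simp [Pi.single_eq_of_ne' hj]) (by simp)]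
  simp

/-- A first order operator with principal symbol `σ`, in a frame of matrix `E`, is symmetric
hyperbolic if a bilinear form `β` makes the symbol of each covector symmetric and that of the
time covector equal to the (positive) energy density. -/
lemma isFOSH_of_symbol {ι : Type} [Fintype ι] [DecidableEq ι]
    {L : (Coord → ι → ℝ) → Coord → ι → ℝ} {Ω : Set Coord} {en : Coord → (ι → ℝ) → ℝ}
    (σ : Coord → (Fin 4 → ι → ℝ) →ₗ[ℝ] (ι → ℝ)) (β : Coord → (ι → ℝ) →ₗ[ℝ] (ι → ℝ) →ₗ[ℝ] ℝ)
    (E : Coord → Fin 4 → Fin 4 → ℝ) (F : Coord → (ι → ℝ) → ι → ℝ)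
    (hE : ∀ γ a, ContDiffOn ℝ ∞ (fun z => E z γ a) Ω)
    (hσ : ∀ γ i j, ContDiffOn ℝ ∞ (fun z => σ z (Pi.single γ (Pi.single j 1)) i) Ω)
    (hβ : ∀ i j, ContDiffOn ℝ ∞ (fun z => β z (Pi.single i 1) (Pi.single j 1)) Ω)
    (hF : ∀ i, ContDiffOn ℝ ∞ (fun q : Coord × (ι → ℝ) => F q.1 q.2 i) (Ω ×ˢ univ))
    (hL : ∀ u : Coord → ι → ℝ, ∀ z ∈ Ω, DifferentiableAt ℝ u z →
      L u z = σ z (fun γ i => ∑ a, E z γ a * pd a (fun w => u w i) z) + F z (u z))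
    (hE0 : ∀ z γ, E z γ 0 = if γ = 0 then 1 else 0)
    (hsymm : ∀ z ∈ Ω, ∀ (ξ : Fin 4 → ℝ) v w,
      β z v (σ z fun γ => ξ γ • w) = β z w (σ z fun γ => ξ γ • v))
    (hen : ∀ z ∈ Ω, ∀ v, en z v = (1 / 2) * β z v (σ z (Pi.single 0 v)))
    (hpos : ∀ z ∈ Ω, ∀ v, v ≠ 0 → 0 < en z v) : IsFOSH L Ω en := by
  let A : Fin 4 → Coord → Matrix ι ι ℝ := fun a z => of fun i j =>
    σ z (fun γ => E z γ a • Pi.single j 1) i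
  let P : Coord → Matrix ι ι ℝ := fun z => of fun i j =>
    β z (Pi.single i 1) (Pi.single j 1)
  have hA : ∀ a z w, (A a z).mulVec w = σ z fun γ => E z γ a • w := by
    intro a z w
    have : (fun γ => E z γ a • w) = ∑ j, w j • fun γ => E z γ a • Pi.single j (1 : ℝ) := by
      funext γ i
      simp only [Finset.sum_apply, Pi.smul_apply, smul_eq_mul]
      rw [Finset.sum_eq_single i (fun j _ hj => by simp [Pi.single_eq_of_ne' hj]) (by simp)]
      simp [mul_comm]
    rw [this, map_sum]
    funext i
    simp [A, Matrix.mulVec, dotProduct, mul_comm]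
  have hP : ∀ z v w, dotProduct v ((P z).mulVec w) = β z v w := by
    intro z v w
    conv_rhs => rw [eq_sum_smul_single v, eq_sum_smul_single w]
    simp only [map_sum, map_smul, LinearMap.sum_apply, LinearMap.smul_apply, smul_eq_mul,
      dotProduct, Matrix.mulVec, P, of_apply, mul_sum]
    rw [sum_comm]
    exact sum_ext fun i => sum_ext fun j => by ring
  have hPA : ∀ a z v w, dotProduct v ((P z * A a z).mulVec w)
      = β z v (σ z fun γ => E z γ a • w) := fun a z v w => by
    rw [← mulVec_mulVec, hA, hP]
  have h0 : ∀ z v, (fun γ => E z γ 0 • v) = Pi.single (M := fun _ => ι → ℝ) 0 v := fun z v => by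
    funext γ
    by_cases hγ : γ = 0
    · subst hγ; simp [hE0]
    · simp [hE0, hγ]
  have hsym : ∀ z ∈ Ω, ∀ a, (P z * A a z).IsSymm := fun z hz a => by
    ext i j
    have h := hsymm z hz (fun γ => E z γ a) (Pi.single j 1) (Pi.single i 1)
    rw [← hPA, ← hPA] at h
    simpa using h
  refine ⟨A, P, F, fun a i j => ?_, hβ, hF, fun u z hz hu => ?_, fun z hz =>
    ⟨hsym z hz, Matrix.posDef_iff_dotProduct_mulVec.2 ⟨?_, fun v hv => ?_⟩, fun v => ?_⟩⟩
  · have h : ∀ z, A a z i j = ∑ γ, E z γ a * σ z (Pi.single γ (Pi.single j 1)) i := fun z => by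
      have : (fun γ => E z γ a • Pi.single (M := fun _ => ℝ) j 1)
          = ∑ γ, E z γ a • Pi.single (M := fun _ => ι → ℝ) γ (Pi.single j (1 : ℝ)) := by
        funext γ
        rw [Finset.sum_apply, Finset.sum_eq_single γ
          (fun δ _ hδ => by simp [Pi.single_eq_of_ne' hδ]) (by simp)]
        simp
      simp [A, this]
    simp only [h]
    exact ContDiffOn.sum fun γ _ => (hE γ a).mul (hσ γ i j)
  · rw [hL u z hz hu]
    congr 1
    simp only [hA]
    rw [← map_sum]
    congr 1
  · rw [Matrix.IsHermitian, Matrix.conjTranspose_eq_transpose_of_trivial]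
    exact hsym z hz 0
  · have := hpos z hz v hv
    rw [hen z hz v, ← h0, ← hPA] at this
    simpa using this
  · rw [hen z hz v, hPA, h0]

/-! ### The symbol of the Bianchi-Euler system and its symmetrizer -/

lemma biv_eq_sum (w : PairIdx → ℝ) (l m : Fin 4) :
    biv w l m = ∑ b, biv (Pi.single b 1) l m * w b := by
  let φ : (PairIdx → ℝ) →ₗ[ℝ] ℝ :=
    { toFun := fun w => biv w l m
      map_add' := fun v w => by rw [biv_add]; rfl
      map_smul' := fun c w => by rw [biv_smul]; rfl }
  have : φ w = ∑ b, w b * φ (Pi.single b 1) := by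
    conv_lhs => rw [eq_sum_smul_single w]
    simp
  rw [show biv w l m = φ w from rfl, this]
  exact sum_ext fun b => mul_comm _ _

/-- The components `R_{·,lm}` of an unknown. -/
def slice (l m : Fin 4) : (Idx → ℝ) →ₗ[ℝ] (PairIdx → ℝ) where
  toFun v a := biv (fun b => v (Sum.inl (a, b))) l m
  map_add' v w := by
    funext a
    exact congrFun (congrFun (biv_add (fun b => v (Sum.inl (a, b))) fun b => w (Sum.inl (a, b))) l) m
  map_smul' c v := by
    funext a
    exact congrFun (congrFun (biv_smul c fun b => v (Sum.inl (a, b))) l) m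

/-- The components `C_{γ·}` of an unknown. -/
def row (γ : Fin 4) : (Idx → ℝ) →ₗ[ℝ] T1 where
  toFun v α := v (Sum.inr (γ, α))
  map_add' _ _ := rfl
  map_smul' _ _ := rfl

namespace PointState

variable (P : PointState)

/-- The principal part of the Bianchi equations for a fixed second pair of indices, as a function
of the frame derivatives. -/
def bianchiSymb : (Fin 4 → PairIdx → ℝ) →ₗ[ℝ] (PairIdx → ℝ) where
  toFun q := Sum.elim (fun i => ∑ α, ∑ β, P.gi α β * biv (q α) β i.succ)
    (fun k => biv (q 0) (k + 1).succ (k + 2).succ + biv (q (k + 2).succ) 0 (k + 1).succ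
      - biv (q (k + 1).succ) 0 (k + 2).succ)
  map_add' q q' := by
    funext a
    rcases a with i | k
    · simp [biv_add, mul_add, sum_add_distrib]
    · simp only [Pi.add_apply, biv_add, Sum.elim_inr]; ring
  map_smul' c q := by
    funext a
    rcases a with i | k
    · simp [biv_smul, mul_sum, mul_left_comm]
    · simp only [Pi.smul_apply, biv_smul, Sum.elim_inr, smul_eq_mul, RingHom.id_apply]; ring

/-- The principal part of the Euler equations for a fixed first index. -/
def accSymb : (Fin 4 → T1) →ₗ[ℝ] T1 where
  toFun q := Fin.cons
    (∑ α, ∑ β, (P.gi α β + (P.mu1 - 1) * (P.C α * P.C β / P.CC)) * q α β)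
    fun i => (∑ α, P.C α * (q α i.succ - q i.succ α))
      - P.Cl i.succ / P.Cl 0 * ∑ α, P.C α * (q α 0 - q 0 α)
  map_add' q q' := by
    funext α
    refine Fin.cases ?_ (fun i => ?_) α
    · simp [mul_add, sum_add_distrib]
    · simp only [Pi.add_apply, Fin.cons_succ, add_sub_add_comm, mul_add, sum_add_distrib]
  map_smul' c q := by
    funext α
    refine Fin.cases ?_ (fun i => ?_) α
    · simp [mul_sum, mul_left_comm]
    · simp only [Pi.smul_apply, Fin.cons_succ, smul_eq_mul, RingHom.id_apply, ← mul_sub,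
        mul_left_comm _ c, ← mul_sum]

/-- The principal part of the Bianchi-Euler system. -/
def symb : (Fin 4 → Idx → ℝ) →ₗ[ℝ] (Idx → ℝ) where
  toFun q := Sum.elim (fun ab => P.bianchiSymb (fun γ a => q γ (Sum.inl (a, ab.2))) ab.1)
    fun γα => P.accSymb (fun γ => row γα.1 (q γ)) γα.2
  map_add' q q' := by
    funext a
    rcases a with ab | γα
    · exact congrFun (map_add P.bianchiSymb (fun γ a => q γ (Sum.inl (a, ab.2)))
        fun γ a => q' γ (Sum.inl (a, ab.2))) ab.1
    · exact congrFun (map_add P.accSymb (fun γ => row γα.1 (q γ)) fun γ => row γα.1 (q' γ)) γα.2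
  map_smul' c q := by
    funext a
    rcases a with ab | γα
    · exact congrFun (map_smul P.bianchiSymb c (fun γ a => q γ (Sum.inl (a, ab.2)))) ab.1
    · exact congrFun (map_smul P.accSymb c fun γ => row γα.1 (q γ)) γα.2

lemma slice_symb (l m : Fin 4) (q : Fin 4 → Idx → ℝ) :
    slice l m (P.symb q) = P.bianchiSymb fun γ => slice l m (q γ) := by
  funext a
  have h : (fun γ => slice l m (q γ)) = ∑ b, biv (Pi.single b 1) l m •
      (fun γ a => q γ (Sum.inl (a, b)) : Fin 4 → PairIdx → ℝ) := by
    funext γ a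
    simp only [Finset.sum_apply, Pi.smul_apply, smul_eq_mul]
    exact biv_eq_sum (fun b => q γ (Sum.inl (a, b))) l m
  rw [h, map_sum]
  simp only [map_smul, Finset.sum_apply, Pi.smul_apply, smul_eq_mul]
  exact biv_eq_sum (fun b => P.symb q (Sum.inl (a, b))) l m

lemma row_symb (γ : Fin 4) (q : Fin 4 → Idx → ℝ) :
    row γ (P.symb q) = P.accSymb fun γ' => row γ (q γ') := rfl

/-- The symmetrizing form of the Bianchi equations. -/
def bianchiForm : (PairIdx → ℝ) →ₗ[ℝ] (PairIdx → ℝ) →ₗ[ℝ] ℝ :=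
  LinearMap.mk₂ ℝ (fun x y => -(1 / 2) * (pr P.h⁻¹ fun i j => x (Sum.inl i) * y (Sum.inl j))
      + (1 / 4) * pr P.h⁻¹ fun a c => pr P.h⁻¹ fun b d =>
        biv x a.succ b.succ * biv y c.succ d.succ)
    (fun x x' y => by
      simp only [Pi.add_apply, biv_add, add_mul, ← pr_add]; ring)
    (fun c x y => by
      simp only [Pi.smul_apply, biv_smul, smul_eq_mul, mul_assoc c, ← mul_pr]; ring)
    (fun x y y' => by
      simp only [Pi.add_apply, biv_add, mul_add, ← pr_add]; ring)
    (fun c x y => by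
      simp only [Pi.smul_apply, biv_smul, smul_eq_mul, mul_left_comm _ c, ← mul_pr]; ring)

/-- The symmetrizing form of the Euler equations. -/
def accForm : T1 →ₗ[ℝ] T1 →ₗ[ℝ] ℝ :=
  LinearMap.mk₂ ℝ (fun x y => 2 * (P.C 0)⁻¹ *
      ((∑ i, ∑ j, P.gt i j * (P.Ui (fun _ => x) 0 i * y j.succ)) - P.U0 (fun _ => x) 0 * y 0))
    (fun x x' y => by
      have h : ∀ i, P.Ui (fun _ => x + x') 0 i = P.Ui (fun _ => x) 0 i + P.Ui (fun _ => x') 0 i :=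
        fun i => by simp only [Ui, Pi.add_apply]; ring
      have h' : P.U0 (fun _ => x + x') 0 = P.U0 (fun _ => x) 0 + P.U0 (fun _ => x') 0 := by
        simp [U0, mul_add, sum_add_distrib]
      simp only [h, h', add_mul, mul_add, sum_add_distrib]; ring)
    (fun c x y => by
      have h : ∀ i, P.Ui (fun _ => c • x) 0 i = c * P.Ui (fun _ => x) 0 i :=
        fun i => by simp only [Ui, Pi.smul_apply, smul_eq_mul]; ring
      have h' : P.U0 (fun _ => c • x) 0 = c * P.U0 (fun _ => x) 0 := by
        simp [U0, mul_sum, mul_left_comm]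
      simp only [h, h', mul_assoc c, mul_left_comm _ c, ← mul_sum, smul_eq_mul]; ring)
    (fun x y y' => by
      simp only [Pi.add_apply, mul_add, sum_add_distrib]; ring)
    (fun c x y => by
      simp only [Pi.smul_apply, smul_eq_mul, mul_left_comm _ c, ← mul_sum]; ring)

/-- The symmetrizing form of the Bianchi-Euler system. -/
def symForm : (Idx → ℝ) →ₗ[ℝ] (Idx → ℝ) →ₗ[ℝ] ℝ :=
  (∑ l, ∑ l', ∑ m, ∑ m', (posMetricInv P.N P.h l l' * posMetricInv P.N P.h m m') •
      P.bianchiForm.compl₁₂ (slice l m) (slice l' m'))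
    + ∑ γ, ∑ δ, posMetricInv P.N P.h γ δ • P.accForm.compl₁₂ (row γ) (row δ)

lemma symForm_apply (v w : Idx → ℝ) : P.symForm v w = (∑ l, ∑ l', ∑ m, ∑ m', posMetricInv P.N P.h l
    l' * posMetricInv P.N P.h m m' * P.bianchiForm (slice l m v) (slice l' m' w))
    + ∑ γ, ∑ δ, posMetricInv P.N P.h γ δ * P.accForm (row γ v) (row δ w) := by
  simp [symForm, LinearMap.sum_apply, LinearMap.add_apply, LinearMap.smul_apply]

end PointState

namespace PointState

variable {P : PointState}

lemma bianchiSymb_inl (q : Fin 4 → PairIdx → ℝ) (i : Fin 3) : P.bianchiSymb q (Sum.inl i) =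
    -((P.N ^ 2)⁻¹ * q 0 (Sum.inl i)) + ∑ a : Fin 3, ∑ b : Fin 3, P.h⁻¹ a b * biv
    (q a.succ) b.succ i.succ := by
  have h := pr_frameMetricInv P.N P.h fun α β => biv (q α) β i.succ
  rw [biv_zero_succ, neg_mul] at h
  exact h

lemma biv_bianchiSymb (q : Fin 4 → PairIdx → ℝ) (a b : Fin 3) : biv (P.bianchiSymb q) a.succ b.succ
    = biv (q 0) a.succ b.succ + q b.succ (Sum.inl a) - q a.succ (Sum.inl b) := by
  have h11 : (1 + 1 : Fin 3) = 2 := rfl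
  have h12 : (1 + 2 : Fin 3) = 0 := rfl
  have h21 : (2 + 1 : Fin 3) = 0 := rfl
  have h22 : (2 + 2 : Fin 3) = 1 := rfl
  simp only [biv_succ_succ, bianchiSymb, LinearMap.coe_mk, AddHom.coe_mk, Sum.elim_inr,
    biv_zero_succ, Fin.sum_univ_three, zero_add, h11, h12, h21, h22]
  obtain rfl | rfl | rfl : a = 0 ∨ a = 1 ∨ a = 2 := by fin_cases a <;> simp
  all_goals
    obtain rfl | rfl | rfl : b = 0 ∨ b = 1 ∨ b = 2 := by fin_cases b <;> simp
    all_goals norm_num [eps]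
    all_goals ring

lemma bianchiForm_apply (x y : PairIdx → ℝ) : P.bianchiForm x y =
    -(1 / 2) * (pr P.h⁻¹ fun i j => x (Sum.inl i) * y (Sum.inl j))
    + (1 / 4) * pr P.h⁻¹ fun a c => pr P.h⁻¹ fun b d => biv x a.succ b.succ * biv y c.succ d.succ :=
    rfl

lemma bianchiForm_symb (hh : P.h.PosDef) (ξ : Fin 4 → ℝ) (x y : PairIdx → ℝ) : P.bianchiForm x
    (P.bianchiSymb fun γ => ξ γ • y) = P.bianchiForm y (P.bianchiSymb fun γ => ξ γ • x) := by
  have key : ∀ (g : Mat3) (X Y : Fin 3 → Fin 3 → ℝ) (x y ξ : Fin 3 → ℝ) (c d : ℝ),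
      (∀ i j, g i j = g j i) → (∀ i j, X i j = -X j i) → (∀ i j, Y i j = -Y j i) →
      -(1 / 2) * (pr g fun i j => x i * (-(c * (d * y j)) + ∑ a, ∑ b, g a b * (ξ a * Y b j)))
      + (1 / 4) * (pr g fun a c => pr g fun b e => X a b * (d * Y c e + ξ e * y c - ξ c * y e)) =
      -(1 / 2) * (pr g fun i j => y i * (-(c * (d * x j)) + ∑ a, ∑ b, g a b * (ξ a * X b j)))
      + (1 / 4) * (pr g fun a c => pr g fun b e => Y a b * (d * X c e + ξ e * x c - ξ c * x e)) :=
      by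
    intro g X Y x y ξ c d hg hX hY
    have h0 : ∀ i, X i i = 0 := fun i => by linarith [hX i i]
    have h0' : ∀ i, Y i i = 0 := fun i => by linarith [hY i i]
    simp only [pr, Fin.sum_univ_three, h0, h0', hX 1 0, hX 2 0, hX 2 1, hY 1 0, hY 2 0, hY 2 1,
      hg 1 0, hg 2 0, hg 2 1]
    ring
  simp only [bianchiForm_apply, bianchiSymb_inl, biv_bianchiSymb, biv_smul, Pi.smul_apply,
    smul_eq_mul]
  exact key P.h⁻¹ (fun a b => biv x a.succ b.succ) (fun a b => biv y a.succ b.succ)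
    (fun i => x (Sum.inl i)) (fun i => y (Sum.inl i)) (fun i => ξ i.succ) _ _ (hinv_symm hh)
    (fun i j => biv_neg_swap _ _ _) (fun i j => biv_neg_swap _ _ _)

lemma bianchiForm_symb_time (x y : PairIdx → ℝ) : P.bianchiForm x (P.bianchiSymb (Pi.single 0 y))
    = (1 / 2) * ((P.N ^ 2)⁻¹ * pr P.h⁻¹ fun i j => x (Sum.inl i) * y (Sum.inl j))
    + (1 / 4) * pr P.h⁻¹ fun a c => pr P.h⁻¹ fun b d => biv x a.succ b.succ * biv y c.succ d.succ :=
    by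
  have hz : ∀ i : Fin 3, (Pi.single 0 y : Fin 4 → PairIdx → ℝ) i.succ = 0 := fun i =>
    Pi.single_eq_of_ne (Fin.succ_ne_zero i) y
  have hb : ∀ α β, biv 0 α β = 0 := fun α β => by
    simpa using congrFun (congrFun (biv_smul 0 (0 : PairIdx → ℝ)) α) β
  simp only [bianchiForm_apply, bianchiSymb_inl, biv_bianchiSymb, Pi.single_eq_same, hz, hb,
    mul_zero, sum_const_zero, add_zero, sub_zero, Pi.zero_apply, mul_neg,
    mul_left_comm _ (P.N ^ 2)⁻¹]
  have : (pr P.h⁻¹ fun i j => -((P.N ^ 2)⁻¹ * (x (Sum.inl i) * y (Sum.inl j))))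
      = -((P.N ^ 2)⁻¹ * pr P.h⁻¹ fun i j => x (Sum.inl i) * y (Sum.inl j)) := by
    rw [neg_mul_eq_neg_mul, mul_pr]
    simp only [neg_mul]
  rw [this]; ring

lemma accForm_apply (x y : T1) : P.accForm x y = 2 * (P.C 0)⁻¹ *
    ((∑ i, ∑ j, P.gt i j * (P.Ui (fun _ => x) 0 i * y j.succ)) - P.U0 (fun _ => x) 0 * y 0) := rfl

lemma accForm_symb_eq (hP : P.Regular) (ξ x y : T1) : P.accForm x (P.accSymb fun γ => ξ γ • y)
    = 2 * (P.C 0)⁻¹ * ((∑ α, P.C α * ξ α) * (P.mu1 * (P.f)⁻¹ ^ 2 *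
    ((∑ α, P.C α * x α) * ∑ α, P.C α * y α) + pr P.gt4 fun α β => x α * y β)
    - (∑ α, P.C α * y α) * (pr P.gt4 fun α β => x α * ξ β)
    - (∑ α, P.C α * x α) * pr P.gt4 fun α β => ξ α * y β) := by
  have ⟨_, hN, hf, hC, h0⟩ := hP
  have e1 := pr_gt4_acc hP (fun _ => x) (fun _ => y) 0 0
  have e2 := pr_gt4_acc hP (fun _ => x) (fun _ => ξ) 0 0
  have hi : ∀ i : Fin 3, P.accSymb (fun γ => ξ γ • y) i.succ
      = (∑ α, P.C α * ξ α) * P.Ui (fun _ => y) 0 i - (∑ α, P.C α * y α) * P.Ui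
      (fun _ => ξ) 0 i := fun i => by
    have h : ∀ β, ∑ α, P.C α * (ξ α * y β - ξ β * y α)
        = (∑ α, P.C α * ξ α) * y β - (∑ α, P.C α * y α) * ξ β := fun β => by
      simp only [sum_mul, ← sum_sub_distrib]
      exact sum_ext fun α => by ring
    simp only [accSymb, LinearMap.coe_mk, AddHom.coe_mk, Fin.cons_succ, Pi.smul_apply, smul_eq_mul,
      h, Ui]
    ring
  have hz : P.accSymb (fun γ => ξ γ • y) 0 = (pr P.gt4 fun α β => ξ α * y β)
      - P.mu1 * (P.f)⁻¹ ^ 2 * ((∑ α, P.C α * ξ α) * ∑ α, P.C α * y α) := by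
    have h : P.mu1 * (P.f)⁻¹ ^ 2 * ((∑ α, P.C α * ξ α) * ∑ α, P.C α * y α)
        = ∑ α, ∑ β, P.mu1 * (P.f)⁻¹ ^ 2 * (P.C α * ξ α * (P.C β * y β)) := by
      rw [Finset.sum_mul_sum, mul_sum]
      exact sum_ext fun α => mul_sum _ _ _
    rw [h]
    simp only [accSymb, LinearMap.coe_mk, AddHom.coe_mk, Fin.cons_zero, Pi.smul_apply, smul_eq_mul,
      hC, pr, gt4, of_apply, ← sum_sub_distrib]
    refine sum_ext fun α => sum_ext fun β => ?_
    field_simp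
    ring
  have hs : (∑ i, ∑ j, P.gt i j * (P.Ui (fun _ => x) 0 i * P.accSymb (fun γ => ξ γ • y) j.succ))
      = (∑ α, P.C α * ξ α) * (∑ i, ∑ j, P.gt i j * (P.Ui (fun _ => x) 0 i * P.Ui (fun _ => y) 0 j))
      - (∑ α, P.C α * y α) * ∑ i, ∑ j, P.gt i j * (P.Ui (fun _ => x) 0 i * P.Ui (fun _ => ξ) 0 j) :=
      by
    simp only [hi, mul_sum (s := (Finset.univ : Finset (Fin 3))), ← sum_sub_distrib]
    exact sum_ext fun i => sum_ext fun j => by ring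
  rw [accForm_apply, hz, hs, ← e1, ← e2]
  simp only [U0]
  ring

lemma accForm_symb (hP : P.Regular) (ξ x y : T1) : P.accForm x (P.accSymb fun γ => ξ γ • y)
    = P.accForm y (P.accSymb fun γ => ξ γ • x) := by
  have ⟨hh, _, _, _, _⟩ := hP
  have h : ∀ x y : T1, (pr P.gt4 fun α β => x α * y β) = pr P.gt4 fun α β => y α * x β :=
    fun x y => by
      rw [pr_swap _ (gt4_transpose hh)]
      simp only [mul_comm]
  rw [accForm_symb_eq hP, accForm_symb_eq hP, h x ξ, h ξ y, h y x]
  ring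

lemma accForm_symb_time (hP : P.Regular) (x y : T1) : P.accForm x (P.accSymb (Pi.single 0 y))
    = 2 * (P.C 0)⁻¹ * (P.C 0 * (P.mu1 * (P.f)⁻¹ ^ 2 * ((∑ α, P.C α * x α) * ∑ α, P.C α * y α)
    + pr P.gt4 fun α β => x α * y β) - (∑ α, P.C α * y α) * (∑ β, P.gt4 0 β * x β)
    - (∑ α, P.C α * x α) * ∑ β, P.gt4 0 β * y β) := by
  have ⟨hh, _, _, _, _⟩ := hP
  have hs : (Pi.single 0 y : Fin 4 → T1) = fun γ => (Pi.single 0 1 : T1) γ • y := by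
    funext γ
    by_cases hγ : γ = 0
    · subst hγ; simp
    · simp [hγ]
  have h1 : ∀ y : T1, (pr P.gt4 fun α β => (Pi.single 0 1 : T1) α * y β)
      = ∑ β, P.gt4 0 β * y β := fun y => by
    rw [pr, Finset.sum_eq_single 0 (fun b _ hb => by simp [hb]) (by simp)]
    simp
  have h2 : (pr P.gt4 fun α β => x α * (Pi.single 0 1 : T1) β) = ∑ β, P.gt4 0 β * x β := by
    rw [pr_swap _ (gt4_transpose hh), ← h1]
    simp only [mul_comm]
  have h3 : ∑ α, P.C α * (Pi.single 0 1 : T1) α = P.C 0 := by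
    rw [Finset.sum_eq_single 0 (fun b _ hb => by simp [hb]) (by simp)]
    simp
  rw [hs, accForm_symb_eq hP, h1, h2, h3]

lemma symForm_symb (hP : P.Regular) (ξ : Fin 4 → ℝ) (v w : Idx → ℝ) :
    P.symForm v (P.symb fun γ => ξ γ • w) = P.symForm w (P.symb fun γ => ξ γ • v) := by
  have ⟨hh, _, _, _, _⟩ := hP
  have hp : ∀ l m, posMetricInv P.N P.h l m = posMetricInv P.N P.h m l := fun l m =>
    congrFun (congrFun (posMetricInv_transpose P.N (posDef_transpose hh)) m) l
  have hs : ∀ l m (w : Idx → ℝ), slice l m (P.symb fun γ => ξ γ • w)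
      = P.bianchiSymb fun γ => ξ γ • slice l m w := fun l m w => by
    rw [slice_symb]; simp only [LinearMap.map_smul]
  have hr : ∀ γ (w : Idx → ℝ), row γ (P.symb fun γ => ξ γ • w)
      = P.accSymb fun γ' => ξ γ' • row γ w := fun γ w => by
    rw [row_symb]; simp only [LinearMap.map_smul]
  rw [symForm_apply, symForm_apply]
  simp only [hs, hr]
  refine congrArg₂ (· + ·) ?_ ?_
  · rw [sum_comm]
    refine sum_ext fun l => Finset.sum_congr rfl fun l' _ => ?_
    rw [sum_comm]
    refine sum_ext fun m => Finset.sum_congr rfl fun m' _ => ?_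
    rw [bianchiForm_symb hh, hp l' l, hp m' m]
  · rw [sum_comm]
    refine sum_ext fun γ => sum_ext fun δ => ?_
    rw [accForm_symb hP, hp δ γ]

lemma belRobinson_eq_pr (hh : P.h.PosDef) (v : Idx → ℝ) : belRobinson P.N P.h (riemPart v)
    = ∑ l, ∑ l', ∑ m, ∑ m', posMetricInv P.N P.h l l' * posMetricInv P.N P.h m m' *
    ((1 / 4) * ((P.N ^ 2)⁻¹ * pr P.h⁻¹ fun i j => slice l m v (Sum.inl i) * slice l' m' v
    (Sum.inl j)) + (1 / 8) * pr P.h⁻¹ fun a c => pr P.h⁻¹ fun b d => biv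
    (slice l m v) a.succ b.succ * biv (slice l' m' v) c.succ d.succ) := by
  set p := of (posMetricInv P.N P.h) with hp
  have hps : pᵀ = p := posMetricInv_transpose P.N (posDef_transpose hh)
  have hip : ∀ X Y : T2, ipP p (of X) (of Y)
      = pr p fun l l' => pr p fun m m' => X l m * Y l' m' := fun X Y => by
    rw [ipP, trace_eq_pr p hps]; rfl
  have hS := stressP_zero_zero (N := P.N) (h := P.h) (riemPart_antisymm v) p
  have hT := traceP_eq (N := P.N) (h := P.h) (riemPart_antisymm v) p
  have h00 : ∑ β, of (frameMetricInv P.N P.h) 0 β * stressP gI(P.N, P.h) p (riemPart v) β 0 =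
      -(P.N ^ 2)⁻¹ * stressP gI(P.N, P.h) p (riemPart v) 0 0 := by
    simp [Fin.sum_univ_succ, frameMetricInv]
  rw [belRobinson_eq hh (riemPart_antisymm v) (riemPart_antisymm' v), maxP, ← hp, h00, hS, hT]
  simp only [hip, if_true]
  have e1 : (pr P.h⁻¹ fun i j => pr p fun l l' => pr p fun m m' => riemPart v 0 i.succ l m *
      riemPart v 0 j.succ l' m') = pr p fun l l' => pr p fun m m' => pr P.h⁻¹ fun i j => slice l m v
      (Sum.inl i) * slice l' m' v (Sum.inl j) := by
    rw [pr_comm]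
    simp only [pr_comm P.h⁻¹ p]
    rfl
  have e2 : (pr P.h⁻¹ fun a c => pr P.h⁻¹ fun b d => pr p fun l l' => pr p fun m m' => riemPart v
      a.succ b.succ l m * riemPart v c.succ d.succ l' m')
      = pr p fun l l' => pr p fun m m' => pr P.h⁻¹ fun a c => pr P.h⁻¹ fun b d => biv
      (slice l m v) a.succ b.succ * biv (slice l' m' v) c.succ d.succ := by
    simp only [pr_comm P.h⁻¹ p]
    rfl
  rw [e1, e2]
  have e3 : ∀ F : Fin 4 → Fin 4 → Fin 4 → Fin 4 → ℝ, (∑ l, ∑ l', ∑ m, ∑ m',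
      posMetricInv P.N P.h l l' * posMetricInv P.N P.h m m' * F l l' m m')
      = pr p fun l l' => pr p fun m m' => F l l' m m' := fun F => by
    simp only [pr, mul_sum, mul_assoc]; rfl
  rw [e3]
  simp only [← pr_add, ← mul_pr]
  ring

lemma totalEnergy_eq (hP : P.Regular) (v : Idx → ℝ) : P.totalEnergy (riemPart v) (accPart v)
    = (1 / 2) * P.symForm v (P.symb (Pi.single 0 v)) := by
  have ⟨hh, _, _, _, _⟩ := hP
  have hs : ∀ l m, slice l m (P.symb (Pi.single 0 v)) = P.bianchiSymb (Pi.single 0 (slice l m v)) :=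
    fun l m => by
      rw [slice_symb]
      congr 1
      funext γ
      by_cases hγ : γ = 0
      · subst hγ; simp
      · simp [hγ]
  have hr : ∀ γ, row γ (P.symb (Pi.single 0 v)) = P.accSymb (Pi.single 0 (row γ v)) :=
    fun γ => by
      rw [row_symb]
      congr 1
      funext γ
      by_cases hγ : γ = 0
      · subst hγ; simp
      · simp [hγ]
  have hp := posMetricInv_transpose P.N (posDef_transpose hh)
  rw [symForm_apply, mul_add, totalEnergy, belRobinson_eq_pr hh, fluidEnergy_eq hP]
  simp only [hs, hr, bianchiForm_symb_time, accForm_symb_time hP]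
  refine congrArg₂ (· + ·) ?_ ?_
  · simp only [mul_sum (s := (Finset.univ : Finset (Fin 4)))]
    refine sum_ext fun l => Finset.sum_congr rfl fun l' _ =>
      sum_ext fun m => Finset.sum_congr rfl fun m' _ => ?_
    ring
  · rw [fluidVec, Cc, fluidT_eq hp]
    have e : ∀ F G : Fin 4 → ℝ, (pr pI(P.N, P.h) fun γ δ => F γ * G δ)
        = pr pI(P.N, P.h) fun γ δ => F δ * G γ := fun F G =>
      pr_swap _ hp _
    have e' := e (fun γ => ∑ β, P.C β * accPart v γ β) fun γ => ∑ β, P.gt4 0 β * accPart v γ β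
    have l : (∑ γ, ∑ δ, posMetricInv P.N P.h γ δ * (2 * (P.C 0)⁻¹ *
        (P.C 0 * (P.mu1 * (P.f)⁻¹ ^ 2 * ((∑ α, P.C α * row γ v α) * ∑ α, P.C α * row δ v α)
        + pr P.gt4 fun α β => row γ v α * row δ v β) - (∑ α, P.C α * row δ v α) *
        (∑ β, P.gt4 0 β * row γ v β) - (∑ α, P.C α * row γ v α) * ∑ β, P.gt4 0 β * row δ v β)))
        = 2 * (P.C 0)⁻¹ * ((pr pI(P.N, P.h) fun γ δ => P.C 0 *
        (P.mu1 * (P.f)⁻¹ ^ 2 * ((∑ α, P.C α * row γ v α) * ∑ α, P.C α * row δ v α)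
        + pr P.gt4 fun α β => row γ v α * row δ v β)) + -1 *
        (pr pI(P.N, P.h) fun γ δ => (∑ α, P.C α * row δ v α) * (∑ β, P.gt4 0 β * row γ v β)) +
        -1 * (pr pI(P.N, P.h) fun γ δ => (∑ α, P.C α * row γ v α) * (∑ β, P.gt4 0 β * row δ v β)))
        := by
      rw [mul_pr, mul_pr, pr_add, pr_add, mul_pr]
      refine sum_ext fun γ => sum_ext fun δ => ?_
      rw [of_apply]
      ring
    rw [l]
    have r : (pr pI(P.N, P.h) fun γ δ => P.C 0 * (P.mu1 * (P.f)⁻¹ ^ 2 *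
        ((∑ β, P.C β * accPart v γ β) * ∑ β, P.C β * accPart v δ β)
        + pr P.gt4 fun β β' => accPart v γ β * accPart v δ β')
        - 2 * ((∑ β, P.C β * accPart v γ β) * ∑ β, P.gt4 0 β * accPart v δ β))
        = (pr pI(P.N, P.h) fun γ δ => P.C 0 * (P.mu1 * (P.f)⁻¹ ^ 2 *
        ((∑ β, P.C β * accPart v γ β) * ∑ β, P.C β * accPart v δ β)
        + pr P.gt4 fun β β' => accPart v γ β * accPart v δ β')) +
        -2 * pr pI(P.N, P.h) fun γ δ => (∑ β, P.C β * accPart v γ β) * ∑ β, P.gt4 0 β * accPart v δ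
        β := by
      rw [mul_pr, pr_add]
      congr 1
      funext γ δ
      ring
    rw [r, show (row : Fin 4 → _) = fun γ => row γ from rfl]
    change _ = 1 / 2 * (2 * (P.C 0)⁻¹ * (_ + -1 * (pr _ fun γ δ =>
      (∑ β, P.C β * accPart v δ β) * ∑ β, P.gt4 0 β * accPart v γ β) + -1 * _))
    rw [← e']
    change _ = 1 / 2 * (2 * (P.C 0)⁻¹ * ((pr pI(P.N, P.h) fun γ δ =>
        P.C 0 * (P.mu1 * (P.f)⁻¹ ^ 2 * ((∑ β, P.C β * accPart v γ β) * ∑ β, P.C β * accPart v δ β)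
          + pr P.gt4 fun β β' => accPart v γ β * accPart v δ β')) + -1 * _ + -1 *
        (pr _ fun γ δ => (∑ β, P.C β * accPart v γ β) * ∑ β, P.gt4 0 β * accPart v δ β)))
    ring

end PointState

/-! ### Symmetric hyperbolicity of the Bianchi-Euler system -/

namespace LocalMetric

variable (M : LocalMetric)

/-- The components of the Cauchy adapted frame in the coordinate frame. -/
def frameMatrix (z : Coord) (γ a : Fin 4) : ℝ :=
  Fin.cases (Fin.cases 1 (fun i => -M.shift z i) a) (fun i => if a = i.succ then 1 else 0) γ

lemma D_eq_sum (γ : Fin 4) (φ : Coord → ℝ) (z : Coord) :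
    M.D γ φ z = ∑ a, M.frameMatrix z γ a * pd a φ z := by
  refine Fin.cases ?_ (fun i => ?_) γ
  · simp [D, frameMatrix, Fin.sum_univ_succ (n := 3), sub_eq_add_neg, sum_neg_distrib]
  · simp [D, frameMatrix]

lemma D_linear {u : Coord → Idx → ℝ} {z : Coord} (hu : DifferentiableAt ℝ u z)
    (ℓ : (Idx → ℝ) →ₗ[ℝ] ℝ) (γ : Fin 4) :
    M.D γ (fun w => ℓ (u w)) z = ℓ fun i => M.D γ (fun w => u w i) z := by
  have hpd : ∀ a, pd a (fun w => ℓ (u w)) z = ℓ fun i => pd a (fun w => u w i) z := fun a => by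
    have h1 := (ℓ.toContinuousLinearMap.hasFDerivAt.comp z hu.hasFDerivAt).fderiv
    have h2 : (fun i => pd a (fun w => u w i) z) = fderiv ℝ u z (Pi.single a 1) := by
      funext i
      rw [pd, fderiv_apply hu i]
      rfl
    rw [h2, pd]
    exact congrArg (fun f : Coord →L[ℝ] ℝ => f (Pi.single a 1)) h1
  have hs : (fun i => M.D γ (fun w => u w i) z)
      = ∑ a, M.frameMatrix z γ a • fun i => pd a (fun w => u w i) z := by
    funext i
    simp only [D_eq_sum, Finset.sum_apply, Pi.smul_apply, smul_eq_mul]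
  rw [hs, D_eq_sum, map_sum]
  simp only [map_smul, smul_eq_mul, hpd]

lemma D_const (γ : Fin 4) (c : ℝ) (z : Coord) : M.D γ (fun _ => c) z = 0 := by
  simp [D_eq_sum, pd]

lemma nabla4_riemPart {u : Coord → Idx → ℝ} {z : Coord} (hu : DifferentiableAt ℝ u z)
    (γ α β l m : Fin 4) : M.nabla4 (fun w => riemPart (u w)) z γ α β l m
    = riemPart (fun i => M.D γ (fun w => u w i) z) α β l m + M.nabla4
    (fun _ => riemPart (u z)) z γ α β l m := by
  let ℓ : (Idx → ℝ) →ₗ[ℝ] ℝ := LinearMap.proj m ∘ₗ LinearMap.proj l ∘ₗ LinearMap.proj β ∘ₗ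
    LinearMap.proj α ∘ₗ riemPartL
  have h : M.D γ (fun w => riemPart (u w) α β l m) z
      = riemPart (fun i => M.D γ (fun w => u w i) z) α β l m := M.D_linear hu ℓ γ
  simp only [nabla4, h, D_const]
  ring

lemma nabla2_accPart {u : Coord → Idx → ℝ} {z : Coord} (γ α β : Fin 4) : M.nabla2
    (fun w => accPart (u w)) z γ α β = row α (fun i => M.D γ (fun w => u w i) z) β
    + M.nabla2 (fun _ => accPart (u z)) z γ α β := by
  have h : M.D γ (fun w => accPart (u w) α β) z = row α (fun i => M.D γ (fun w => u w i) z) β := rfl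
  simp only [nabla2, h, D_const]
  ring

end LocalMetric

namespace FluidRegularOn

variable {M : LocalMetric} {st : Coord → PointState} {Ω : Opens Coord}

lemma system_eq (hF : FluidRegularOn M st Ω) {u : Coord → Idx → ℝ} {z : Coord}
    (hu : DifferentiableAt ℝ u z) : system M st u z = (st z).symb
    (fun γ i => M.D γ (fun w => u w i) z) + system M st (fun _ => u z) z := by
  funext a
  rcases a with ⟨i | k, b⟩ | ⟨γ, α⟩
  · simp only [system, bianchiDiv, Sum.elim_inl, M.nabla4_riemPart hu, mul_add, sum_add_distrib,
      PointState.symb, PointState.bianchiSymb, LinearMap.coe_mk,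
      AddHom.coe_mk, Pi.add_apply, riemPart_pair, hF.gi_eq]
    ring
  · simp only [system, bianchiCyclic, Sum.elim_inl, Sum.elim_inr, M.nabla4_riemPart hu,
      PointState.symb, PointState.bianchiSymb, LinearMap.coe_mk,
      AddHom.coe_mk, Pi.add_apply, riemPart_pair]
    ring
  · refine Fin.cases ?_ (fun i => ?_) α
    · simp only [system, accDiv, Sum.elim_inr, Fin.cases_zero, M.nabla2_accPart (u := u), mul_add,
        sum_add_distrib, PointState.symb, PointState.accSymb, LinearMap.coe_mk,
        AddHom.coe_mk, Pi.add_apply, Fin.cons_zero, hF.gi_eq]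
      ring
    · have h : ∀ β, accM M st (fun w => riemPart (u w)) (fun w => accPart (u w)) z γ β
          = (∑ α, (st z).C α * (row γ (fun i => M.D α (fun w => u w i) z) β
          - row γ (fun i => M.D β (fun w => u w i) z) α)) + accM M st (fun _ => riemPart (u z))
          (fun _ => accPart (u z)) z γ β := fun β => by
        simp only [accM, M.nabla2_accPart (u := u), add_sub_add_comm, mul_add, sum_add_distrib]
        ring
      simp only [system, accMtilde, Sum.elim_inr, Fin.cases_succ, h, PointState.symb,
        PointState.accSymb, LinearMap.coe_mk, AddHom.coe_mk, Pi.add_apply, Fin.cons_succ]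
      ring

lemma hinv_smooth (hF : FluidRegularOn M st Ω) (hM : M.RegularOn Ω) (i j : Fin 3) :
    ContDiffOn ℝ ∞ (fun z => (st z).h⁻¹ i j) Ω := by
  simpa only [hF.h_eq] using hM.hinv_smooth i j

lemma gi_smooth (hF : FluidRegularOn M st Ω) (hM : M.RegularOn Ω) (α β : Fin 4) :
    ContDiffOn ℝ ∞ (fun z => (st z).gi α β) Ω := by
  simp only [hF.gi_eq]
  exact contDiffOn_of_ev (hM.ev_metricInv α β)

lemma g_smooth (hF : FluidRegularOn M st Ω) (hM : M.RegularOn Ω) (α β : Fin 4) :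
    ContDiffOn ℝ ∞ (fun z => (st z).g α β) Ω := by
  simp only [hF.g_eq]
  exact contDiffOn_of_ev (hM.ev_metric α β)

lemma posMetricInv_smooth (hF : FluidRegularOn M st Ω) (hM : M.RegularOn Ω) (α β : Fin 4) :
    ContDiffOn ℝ ∞ (fun z => posMetricInv (st z).N (st z).h α β) Ω := by
  simp only [hF.N_eq, hF.h_eq]
  exact contDiffOn_of_ev (hM.ev_pos α β)

lemma Cl_smooth (hF : FluidRegularOn M st Ω) (hM : M.RegularOn Ω) (α : Fin 4) :
    ContDiffOn ℝ ∞ (fun z => (st z).Cl α) Ω :=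
  contDiffOn_of_ev (hF.ev_Cl hM α)

lemma Cl_zero_ne (hF : FluidRegularOn M st Ω) (hM : M.RegularOn Ω) {z : Coord} (hz : z ∈ Ω) :
    (st z).Cl 0 ≠ 0 := by
  rw [PointState.Cl_zero, hF.N_eq]
  simp [hM.N_ne hz, hF.C_ne z hz]

lemma Cl_zero_inv_smooth (hF : FluidRegularOn M st Ω) (hM : M.RegularOn Ω) :
    ContDiffOn ℝ ∞ (fun z => ((st z).Cl 0)⁻¹) Ω :=
  (hF.Cl_smooth hM 0).inv fun _ hz => hF.Cl_zero_ne hM hz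

lemma finv_smooth (hF : FluidRegularOn M st Ω) : ContDiffOn ℝ ∞ (fun z => ((st z).f)⁻¹) Ω :=
  hF.f_smooth.inv hF.f_ne

lemma CCinv_smooth (hF : FluidRegularOn M st Ω) : ContDiffOn ℝ ∞ (fun z => ((st z).CC)⁻¹) Ω := by
  refine ((hF.finv_smooth.pow 2).neg).congr fun z hz => ?_
  have := hF.CC_eq z hz
  simp [this]

lemma symb_smooth (hF : FluidRegularOn M st Ω) (hM : M.RegularOn Ω) (q : Fin 4 → Idx → ℝ)
    (a : Idx) : ContDiffOn ℝ ∞ (fun z => (st z).symb q a) Ω := by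
  have hgi := hF.gi_smooth hM
  have hC := hF.C_smooth
  have hCl := hF.Cl_smooth hM
  have hCC := hF.CCinv_smooth
  have hC0 := hF.Cl_zero_inv_smooth hM
  have hmu := hF.mu1_smooth
  rcases a with ⟨i | k, b⟩ | ⟨γ, α⟩
  · simp only [PointState.symb, PointState.bianchiSymb, LinearMap.coe_mk, AddHom.coe_mk,
      Sum.elim_inl]
    fun_prop
  · exact contDiffOn_const
  · refine Fin.cases ?_ (fun i => ?_) α <;>
      simp only [PointState.symb, PointState.accSymb, LinearMap.coe_mk, AddHom.coe_mk, Sum.elim_inr,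
        Fin.cons_zero, Fin.cons_succ, div_eq_mul_inv] <;> fun_prop

lemma symForm_smooth (hF : FluidRegularOn M st Ω) (hM : M.RegularOn Ω) (v w : Idx → ℝ) :
    ContDiffOn ℝ ∞ (fun z => (st z).symForm v w) Ω := by
  have hp := hF.posMetricInv_smooth hM
  have hh := hF.hinv_smooth hM
  have hC := hF.C_smooth
  have hCl := hF.Cl_smooth hM
  have hCC := hF.CCinv_smooth
  have hC0 := hF.Cl_zero_inv_smooth hM
  have hCi := (hF.C_smooth 0).inv hF.C_ne
  simp only [PointState.symForm_apply, PointState.bianchiForm_apply, PointState.accForm_apply, pr,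
    PointState.gt, PointState.Ui, PointState.U0, div_eq_mul_inv]
  refine ContDiffOn.add (ContDiffOn.sum fun l _ => ContDiffOn.sum fun l' _ => ContDiffOn.sum
    fun m _ => ContDiffOn.sum fun m' _ => ((hp l l').mul (hp m m')).mul (ContDiffOn.add
      (contDiffOn_const.mul (ContDiffOn.sum fun i _ => ContDiffOn.sum fun j _ =>
        (hh i j).mul contDiffOn_const)) (contDiffOn_const.mul (ContDiffOn.sum fun i _ =>
        ContDiffOn.sum fun j _ => (hh i j).mul (ContDiffOn.sum fun a _ => ContDiffOn.sum fun b _ =>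
          (hh a b).mul contDiffOn_const)))))
    (ContDiffOn.sum fun γ _ => ContDiffOn.sum fun δ _ => (hp γ δ).mul ((contDiffOn_const.mul hCi).mul
      (ContDiffOn.sub (ContDiffOn.sum fun i _ => ContDiffOn.sum fun j _ =>
        ((hh i j).sub (((hC i.succ).mul (hC j.succ)).mul hCC)).mul ((contDiffOn_const.sub
          (((hCl i.succ).mul hC0).mul contDiffOn_const)).mul contDiffOn_const))
        ((ContDiffOn.sum fun α _ => (hC α).mul contDiffOn_const).mul contDiffOn_const))))

lemma contDiff_riemPart (α β l m : Fin 4) : ContDiff ℝ ∞ fun v : Idx → ℝ => riemPart v α β l m :=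
  (LinearMap.toContinuousLinearMap (LinearMap.proj m ∘ₗ LinearMap.proj l ∘ₗ LinearMap.proj β ∘ₗ
    LinearMap.proj α ∘ₗ riemPartL : (Idx → ℝ) →ₗ[ℝ] ℝ)).contDiff

lemma lower_order_smooth (hF : FluidRegularOn M st Ω) (hM : M.RegularOn Ω)
    (a : Idx) : ContDiffOn ℝ ∞ (fun q : Coord × (Idx → ℝ) => system M st (fun _ => q.2) q.1 a)
    ((Ω : Set Coord) ×ˢ univ) := by
  have lift : ∀ {φ : Coord → ℝ}, ContDiffOn ℝ ∞ φ Ω → ContDiffOn ℝ ∞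
      (fun q : Coord × (Idx → ℝ) => φ q.1) ((Ω : Set Coord) ×ˢ univ) := fun h =>
    h.comp contDiffOn_fst fun q hq => hq.1
  have hgi : ∀ α β, _ := fun α β => lift (hF.gi_smooth hM α β)
  have hg : ∀ α β, _ := fun α β => lift (hF.g_smooth hM α β)
  have hom : ∀ α β γ, _ := fun α β γ => lift (contDiffOn_of_ev (hM.ev_omega α β γ))
  have hC : ∀ α, _ := fun α => lift (hF.C_smooth α)
  have hCl : ∀ α, _ := fun α => lift (hF.Cl_smooth hM α)
  have hCC := lift hF.CCinv_smooth
  have hf := lift hF.finv_smooth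
  have hC0 := lift (hF.Cl_zero_inv_smooth hM)
  have hmu := lift hF.mu_smooth
  have hmu1 := lift hF.mu1_smooth
  have hmu2 := lift hF.mu2_smooth
  have hp := lift hF.p_smooth
  have hr : ∀ α β l m, ContDiffOn ℝ ∞ (fun q : Coord × (Idx → ℝ) => riemPart q.2 α β l m)
      ((Ω : Set Coord) ×ˢ univ) := fun α β l m =>
    ((contDiff_riemPart α β l m).comp contDiff_snd).contDiffOn
  have hc : ∀ α β, ContDiffOn ℝ ∞ (fun q : Coord × (Idx → ℝ) => accPart q.2 α β)
      ((Ω : Set Coord) ×ˢ univ) := fun α β =>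
    ((contDiff_apply ℝ ℝ (Sum.inr (α, β) : Idx)).comp contDiff_snd).contDiffOn
  rcases a with ⟨i | k, b⟩ | ⟨γ, α⟩
  · simp only [system, bianchiDiv, Sum.elim_inl, PointState.current, PointState.dRho, PointState.dp,
      LocalMetric.nabla4, LocalMetric.D_const, div_eq_mul_inv, ← inv_pow, ← hF.gi_eq]
    fun_prop
  · simp only [system, bianchiCyclic, Sum.elim_inl, Sum.elim_inr, LocalMetric.nabla4,
      LocalMetric.D_const]
    fun_prop
  · refine Fin.cases ?_ (fun i => ?_) α
    · simp only [system, accDiv, Sum.elim_inr, Fin.cases_zero, LocalMetric.nabla2,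
        LocalMetric.D_const, PointState.bTerm, PointState.dCoeff, PointState.dp, div_eq_mul_inv,
        ← inv_pow, ← hF.gi_eq]
      fun_prop
    · simp only [system, accMtilde, accM, Sum.elim_inr, Fin.cases_succ, LocalMetric.nabla2,
        LocalMetric.D_const, PointState.aTerm, div_eq_mul_inv]
      fun_prop

/-- The Bianchi-Euler system is symmetric hyperbolic if `μ'_p ≥ 1`. -/
theorem isFOSH (hF : FluidRegularOn M st Ω) (hM : M.RegularOn Ω)
    (hmu : ∀ z ∈ Ω, 1 ≤ (st z).mu1) : IsFOSH (system M st) Ω fun z v => (st z).totalEnergy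
    (riemPart v) (accPart v) := by
  have hP : ∀ z ∈ Ω, (st z).Regular := fun z hz => hF.regular hM hz
  refine isFOSH_of_symbol (fun z => (st z).symb) (fun z => (st z).symForm) M.frameMatrix
    (fun z v => system M st (fun _ => v) z) (fun γ a => ?_) (fun γ i j => hF.symb_smooth hM _ i)
    (fun i j => hF.symForm_smooth hM _ _) (hF.lower_order_smooth hM) (fun u z hz hu => ?_)
    (fun z γ => ?_) (fun z hz => PointState.symForm_symb (hP z hz))
    (fun z hz => PointState.totalEnergy_eq (hP z hz)) (fun z hz v hv => ?_)
  · refine Fin.cases ?_ (fun i => contDiffOn_const) γ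
    refine Fin.cases contDiffOn_const (fun i => ?_) a
    exact (hM.shift_smooth i).neg
  · rw [hF.system_eq hu]
    simp only [LocalMetric.D_eq_sum]
  · refine Fin.cases ?_ (fun i => ?_) γ
    · simp [LocalMetric.frameMatrix]
    · simp [LocalMetric.frameMatrix, (Fin.succ_ne_zero i).symm, Fin.succ_ne_zero i]
  · by_cases hr : riemPart v = 0
    · have hc : accPart v ≠ 0 := fun hc => hv <| by
        funext a
        rcases a with ⟨a, b⟩ | ⟨γ, α⟩
        · exact riemPart_eq_zero hr a b
        · exact congrFun (congrFun hc γ) α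
      exact add_pos_of_nonneg_of_pos (belRobinson_nonneg (hP z hz).h_posDef _)
        (PointState.fluidEnergy_pos (hP z hz) (hmu z hz) hc)
    · refine add_pos_of_pos_of_nonneg (belRobinson_pos (hP z hz).N_ne (hP z hz).h_posDef
        (riemPart_antisymm v) (riemPart_antisymm' v) hr) ?_
      by_cases hc : accPart v = 0
      · rw [hc, PointState.fluidEnergy_zero]
      · exact (PointState.fluidEnergy_pos (hP z hz) (hmu z hz) hc).le

end FluidRegularOn

/-! ### Charts -/

lemma contDiff_spacePart : ContDiff ℝ ∞ spacePart := by
  rw [contDiff_euclidean]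
  exact fun i => contDiff_apply ℝ ℝ i.succ

lemma euclidean_eq_sum (w : E3) : w = ∑ i, w i • EuclideanSpace.single i (1 : ℝ) := by
  ext j
  simp [Pi.single_apply]

section charts

variable {S : Type*} [TopologicalSpace S] [ChartedSpace E3 S] {T : Set ℝ}
  {e : Chart S}

lemma isOpen_chartDomain (hT : IsOpen T) (e : Chart S) : IsOpen (chartDomain T e) :=
  (hT.preimage (continuous_apply 0)).inter
    (e.open_target.preimage contDiff_spacePart.continuous)

/-- The coordinate domain of a chart as an open set. -/
def chartOpens (hT : IsOpen T) (e : Chart S) : Opens Coord :=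
  ⟨chartDomain T e, isOpen_chartDomain hT e⟩

variable [IsManifold 𝓘(ℝ, E3) ∞ S]

lemma mdifferentiable_chart (he : e ∈ smoothAtlas S) : e.MDifferentiable 𝓘(ℝ, E3) 𝓘(ℝ, E3) :=
  ⟨(contMDiffOn_of_mem_maximalAtlas he).mdifferentiableOn (by simp),
    (contMDiffOn_symm_of_mem_maximalAtlas he).mdifferentiableOn (by simp)⟩

/-- The components in a chart of a vector at the point of coordinates `y`. -/
def comps (e : Chart S) (y : E3) (v : TangentSpace 𝓘(ℝ, E3) (e.symm y)) (i : Fin 3) : ℝ :=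
  (show E3 from mfd e (e.symm y) v) i

lemma eq_sum_comps_smul (he : e ∈ smoothAtlas S) {y : E3} (hy : y ∈ e.target)
    (v : TangentSpace 𝓘(ℝ, E3) (e.symm y)) : v = ∑ i, comps e y v i • coordVec e y i := by
  have h := (mdifferentiable_chart he).symm_comp_deriv (e.map_target hy)
  rw [e.right_inv hy] at h
  have h1 : mfd e.symm y (mfd e (e.symm y) v) = v :=
    DFunLike.congr_fun h v
  have h3 : mfd e.symm y
      (show E3 from mfd e (e.symm y) v) = ∑ i, comps e y v i • coordVec e y i := by
    conv_lhs => rw [euclidean_eq_sum (show E3 from mfd e (e.symm y) v)]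
    exact (map_sum (mfd e.symm y : E3 →L[ℝ] E3) _ _).trans
      (sum_ext fun i => map_smul
        (mfd e.symm y : E3 →L[ℝ] E3) _ _)
  exact h1.symm.trans h3

lemma comps_sum_smul (he : e ∈ smoothAtlas S) {y : E3}
    (hy : y ∈ e.target) (a : Fin 3 → ℝ) : comps e y (∑ i, a i • coordVec e y i) = a := by
  have h := (mdifferentiable_chart he).comp_symm_deriv hy
  have h1 : ∀ w : E3, mfd e (e.symm y) (mfd e.symm y w) = w := fun w => DFunLike.congr_fun h w
  have h2 : (∑ i, a i • coordVec e y i : E3) = mfd e.symm y (WithLp.toLp 2 a : E3) := by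
    have : (WithLp.toLp 2 a : E3) = ∑ i, a i • EuclideanSpace.single i (1 : ℝ) :=
      euclidean_eq_sum _
    rw [this]
    exact ((map_sum (mfd e.symm y : E3 →L[ℝ] E3) _ _).trans
      (sum_ext fun i => map_smul
        (mfd e.symm y : E3 →L[ℝ] E3) _ _)).symm
  funext i
  have h3 := h1 (WithLp.toLp 2 a)
  rw [← h2] at h3
  exact congrArg (fun w : E3 => w i) h3

lemma bilin_eq_sum (he : e ∈ smoothAtlas S) {y : E3} (hy : y ∈ e.target)
    (b : (x : S) → LinearMap.BilinForm ℝ (TangentSpace 𝓘(ℝ, E3) x))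
    (v w : TangentSpace 𝓘(ℝ, E3) (e.symm y)) :
    b (e.symm y) v w = ∑ i, ∑ j, bilinIn e b y i j * (comps e y v i * comps e y w j) := by
  conv_lhs => rw [eq_sum_comps_smul he hy v, eq_sum_comps_smul he hy w]
  simp only [map_sum, map_smul, LinearMap.sum_apply, LinearMap.smul_apply, smul_eq_mul, mul_sum]
  rw [sum_comm]
  refine sum_ext fun i => sum_ext fun j => ?_
  rw [bilinIn]; ring

lemma bilinIn_posDef (he : e ∈ smoothAtlas S) {y : E3} (hy : y ∈ e.target)
    {b : (x : S) → LinearMap.BilinForm ℝ (TangentSpace 𝓘(ℝ, E3) x)}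
    (hs : ∀ x v w, b x v w = b x w v) (hb : ∀ x v, v ≠ 0 → 0 < b x v v) :
    (bilinIn e b y).PosDef := by
  refine Matrix.posDef_iff_dotProduct_mulVec.2 ⟨?_, fun a ha => ?_⟩
  · ext i j
    exact hs _ _ _
  · have hv : (∑ i, a i • coordVec e y i) ≠ 0 := fun h => ha <| by
      rw [← comps_sum_smul he hy a, h]
      funext i
      exact congrArg (fun w : E3 => w i)
        (map_zero (mfd e (e.symm y) : E3 →L[ℝ] E3))
    have h := hb (e.symm y) _ hv
    rw [bilin_eq_sum he hy b, comps_sum_smul he hy] at h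
    refine h.trans_eq ?_
    simp only [dotProduct, Matrix.mulVec, mul_sum, Pi.star_apply, star_trivial]
    exact sum_ext fun i => sum_ext fun j => by ring

namespace SlicedSpacetime

variable (M : SlicedSpacetime S T)

lemma regularOn (hT : IsOpen T) (he : e ∈ smoothAtlas S) :
    (M.inChart e).RegularOn (chartOpens hT e) where
  N_pos z hz := M.N_pos _ hz.1 _
  h_posDef z hz := bilinIn_posDef he hz.2 (M.h_symm _ hz.1) (M.h_pos _ hz.1)
  N_smooth := M.N_smooth e he
  shift_smooth := M.shift_smooth e he
  h_smooth := M.h_smooth e he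

end SlicedSpacetime

end charts

/-! ### Equations of state -/

namespace EquationOfState

variable (eos : EquationOfState) {s : ℝ}

lemma contDiffOn_mu (hs : 0 < s) : ContDiffOn ℝ ∞ (fun q => eos.mu q s) (Ioi 0) :=
  eos.mu_smooth.comp (contDiff_id.prodMk contDiff_const).contDiffOn fun _ hq => ⟨hq, hs⟩

lemma contDiffOn_deriv {φ : ℝ → ℝ} (h : ContDiffOn ℝ ∞ φ (Ioi 0)) :
    ContDiffOn ℝ ∞ (deriv φ) (Ioi 0) :=
  ((contDiffOn_infty_iff_deriv_of_isOpen isOpen_Ioi).1 h).2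

lemma contDiffOn_mu1 (hs : 0 < s) : ContDiffOn ℝ ∞ (fun q => eos.mu1 q s) (Ioi 0) :=
  contDiffOn_deriv (eos.contDiffOn_mu hs)

lemma contDiffOn_mu2 (hs : 0 < s) : ContDiffOn ℝ ∞ (fun q => eos.mu2 q s) (Ioi 0) :=
  contDiffOn_deriv (eos.contDiffOn_mu1 hs)

lemma mu_add_pos (hs : 0 < s) {q : ℝ} (hq : 0 < q) : 0 < eos.mu q s + q :=
  add_pos (eos.mu_pos q s hq hs) hq

lemma contDiffOn_integrand (hs : 0 < s) : ContDiffOn ℝ ∞ (fun q => 1 / (eos.mu q s + q)) (Ioi 0) :=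
  contDiffOn_const.div ((eos.contDiffOn_mu hs).add contDiffOn_id)
    fun _ hq => (eos.mu_add_pos hs hq).ne'

lemma hasDerivAt_integral (hs : 0 < s) {p : ℝ} (hp : 0 < p) :
    HasDerivAt (fun p => ∫ q in eos.p₀..p, 1 / (eos.mu q s + q)) (1 / (eos.mu p s + p)) p := by
  have hc := (eos.contDiffOn_integrand hs).continuousOn
  refine intervalIntegral.integral_hasDerivAt_right ((hc.mono ?_).intervalIntegrable) ?_ ?_
  · intro q hq
    exact (lt_min eos.p₀_pos hp).trans_le hq.1
  · exact hc.stronglyMeasurableAtFilter isOpen_Ioi p hp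
  · exact hc.continuousAt (Ioi_mem_nhds hp)

lemma hasDerivAt_enthalpy (hs : 0 < s) {p : ℝ} (hp : 0 < p) :
    HasDerivAt (fun p => eos.enthalpy p s) (eos.enthalpy p s / (eos.mu p s + p)) p := by
  have h := ((eos.hasDerivAt_integral hs hp).exp).const_mul eos.chi
  refine h.congr_deriv ?_
  rw [enthalpy]; ring

lemma contDiffOn_enthalpy (hs : 0 < s) : ContDiffOn ℝ ∞ (fun p => eos.enthalpy p s) (Ioi 0) := by
  refine contDiffOn_const.mul (Real.contDiff_exp.comp_contDiffOn ?_)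
  refine (contDiffOn_infty_iff_deriv_of_isOpen isOpen_Ioi).2 ⟨fun p hp =>
    (eos.hasDerivAt_integral hs hp).differentiableAt.differentiableWithinAt, ?_⟩
  exact (eos.contDiffOn_integrand hs).congr fun p hp => (eos.hasDerivAt_integral hs hp).deriv

lemma enthalpy_pos (p s : ℝ) : 0 < eos.enthalpy p s := mul_pos eos.chi_pos (Real.exp_pos _)

end EquationOfState

/-! ### Perfect fluids in charts -/

lemma pd_comp {φ : ℝ → ℝ} {f : Coord → ℝ} {z : Coord} {d : ℝ} (hφ : HasDerivAt φ d (f z))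
    (hf : DifferentiableAt ℝ f z) (a : Fin 4) : pd a (fun w => φ (f w)) z = d * pd a f z := by
  have h := (hφ.comp_hasFDerivAt z hf.hasFDerivAt).fderiv
  rw [pd, pd]
  exact congrArg (fun L : Coord →L[ℝ] ℝ => L (Pi.single a 1)) h

namespace PerfectFluid

variable {S : Type*} [TopologicalSpace S] [ChartedSpace E3 S] [IsManifold 𝓘(ℝ, E3) ∞ S] {T : Set ℝ}
  {M : SlicedSpacetime S T} {eos : EquationOfState} (Φ : PerfectFluid M eos)
  {e : Chart S}

lemma unit_frame (he : e ∈ smoothAtlas S) {z : Coord} (hz : z ∈ chartDomain T e) : ∑ α, Φ.vel e z α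
    * ∑ β, (M.inChart e).g z α β * Φ.vel e z β = -1 := by
  have h := Φ.unit (z 0) hz.1 (e.symm (spacePart z))
  rw [bilin_eq_sum he hz.2 (M.h (z 0))] at h
  rw [← h, Fin.sum_univ_succ]
  simp only [LocalMetric.g, frameMetric, Fin.cases_zero, Fin.cases_succ, Fin.sum_univ_succ (n := 3),
    zero_mul, zero_add, sum_const_zero, add_zero]
  refine congrArg₂ (· + ·) ?_ ?_
  · simp only [vel, Fin.cons_zero, scalarIn, SlicedSpacetime.inChart]; ring
  · simp only [mul_sum]
    refine sum_ext fun i => sum_ext fun j => ?_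
    simp only [vel, Fin.cons_succ, SlicedSpacetime.inChart]
    change vectorIn e Φ.u z i * (_ * vectorIn e Φ.u z j) = _ * (vectorIn e Φ.u z i * vectorIn e Φ.u z j)
    ring

lemma vel_zero_ne {z : Coord} (hz : z ∈ chartDomain T e) : Φ.vel e z 0 ≠ 0 := by
  intro h0
  have h := Φ.unit (z 0) hz.1 (e.symm (spacePart z))
  have h1 : Φ.u₀ (z 0) (e.symm (spacePart z)) = 0 := h0
  have h2 : 0 ≤ M.h (z 0) (e.symm (spacePart z)) (Φ.u (z 0) (e.symm (spacePart z)))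
      (Φ.u (z 0) (e.symm (spacePart z))) := by
    by_cases hu : Φ.u (z 0) (e.symm (spacePart z)) = 0
    · rw [hu]; simp
    · exact (M.h_pos _ hz.1 _ _ hu).le
  rw [h1] at h
  linarith

lemma CC_eq (he : e ∈ smoothAtlas S) {z : Coord}
    (hz : z ∈ chartDomain T e) : (Φ.state e z).CC = -(Φ.state e z).f ^ 2 := by
  have h := Φ.unit_frame he hz
  have : (Φ.state e z).CC = (Φ.state e z).f ^ 2 *
      ∑ α, Φ.vel e z α * ∑ β, (M.inChart e).g z α β * Φ.vel e z β := by
    simp only [PointState.CC, PointState.Cl, mul_sum]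
    refine sum_ext fun α => sum_ext fun β => ?_
    simp only [state, PointState.g, LocalMetric.g]
    ring
  rw [this, h]; ring

lemma regularOn (hT : IsOpen T) (he : e ∈ smoothAtlas S) :
    FluidRegularOn (M.inChart e) (Φ.state e) (chartOpens hT e) := by
  have hp := Φ.p_smooth e he
  have hpos : MapsTo (scalarIn e Φ.p) (chartDomain T e) (Ioi 0) := fun z hz => Φ.p_pos _ hz.1 _
  have hd : ∀ z ∈ chartDomain T e, DifferentiableAt ℝ (scalarIn e Φ.p) z := fun z hz =>
    (hp.differentiableOn (by simp)).differentiableAt ((isOpen_chartDomain hT e).mem_nhds hz)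
  have hs := Φ.entropy_pos
  have hf := (eos.contDiffOn_enthalpy hs).comp hp hpos
  have hmu := eos.contDiffOn_mu hs
  have hmu1 := eos.contDiffOn_mu1 hs
  have der : ∀ {φ : ℝ → ℝ}, ContDiffOn ℝ ∞ φ (Ioi 0) → ∀ q, 0 < q → HasDerivAt φ (deriv φ q) q :=
    fun h q hq => ((h.differentiableOn (by simp)).differentiableAt (Ioi_mem_nhds hq)).hasDerivAt
  refine
    { N_eq := fun _ => rfl
      h_eq := fun _ => rfl
      C_smooth := fun α => hf.mul ?_
      f_smooth := hf
      p_smooth := hp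
      mu_smooth := hmu.comp hp hpos
      mu1_smooth := hmu1.comp hp hpos
      mu2_smooth := (eos.contDiffOn_mu2 hs).comp hp hpos
      C_ne := fun z hz => mul_ne_zero (eos.enthalpy_pos _ _).ne' (Φ.vel_zero_ne hz)
      f_ne := fun z hz => (eos.enthalpy_pos _ _).ne'
      CC_eq := fun z hz => Φ.CC_eq he hz
      pd_mu := fun z hz a => pd_comp (der hmu _ (hpos hz)) (hd z hz) a
      pd_mu1 := fun z hz a => pd_comp (der hmu1 _ (hpos hz)) (hd z hz) a
      pd_f := fun z hz a => ?_ }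
  · refine Fin.cases (Φ.u₀_smooth e he) (fun i => Φ.u_smooth e he i) α
  · have h := pd_comp (eos.hasDerivAt_enthalpy hs (hpos hz)) (hd z hz) a
    have h0 := (eos.mu_add_pos hs (hpos hz)).ne'
    change (eos.mu (scalarIn e Φ.p z) Φ.entropy + scalarIn e Φ.p z) * pd a (fun w =>
      eos.enthalpy (scalarIn e Φ.p w) Φ.entropy) z = eos.enthalpy (scalarIn e Φ.p z) Φ.entropy * _
    rw [h]
    field_simp
    rfl

lemma rho_eq (hT : IsOpen T) (he : e ∈ smoothAtlas S) {z : Coord} (hz : z ∈ chartDomain T e)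
    (α β : Fin 4) : Φ.rho e z α β = ((Φ.state e z).mu + (Φ.state e z).p) * ((Φ.state e z).f ^ 2)⁻¹ *
    ((Φ.state e z).Cl α * (Φ.state e z).Cl β) + (1 / 2) * ((M.inChart e).g z α β *
    ((Φ.state e z).mu - (Φ.state e z).p)) := by
  set P := Φ.state e z with hP
  have hf : P.f ≠ 0 := (Φ.regularOn hT he).f_ne z hz
  have hh : P.h.PosDef := (M.regularOn hT he).h_posDef z hz
  have hN : P.N ≠ 0 := (M.regularOn hT he).N_ne hz
  have hg : (M.inChart e).g z = P.g := rfl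
  have hgi : (M.inChart e).gi z = P.gi := rfl
  have hu : ∀ α, ∑ γ, P.g α γ * Φ.vel e z γ = P.f⁻¹ * P.Cl α := fun α => by
    rw [PointState.Cl, mul_sum]
    refine sum_ext fun γ => ?_
    rw [show P.C γ = P.f * Φ.vel e z γ from rfl]
    field_simp
  have hst : ∀ α β, Φ.stress e z α β = (P.mu + P.p) * (P.f ^ 2)⁻¹ * (P.Cl α * P.Cl β)
      + P.p * P.g α β := fun α β => by
    rw [stress, hg, hu, hu, ← hP]
    ring
  have t1 : ∑ γ, ∑ δ, P.gi γ δ * (P.Cl γ * P.Cl δ) = -P.f ^ 2 := by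
    rw [← Φ.CC_eq he hz, PointState.CC]
    refine sum_ext fun γ => ?_
    rw [← hP, ← PointState.gi_mul_Cl hh hN γ, sum_mul]
    exact sum_ext fun δ => by ring
  have t2 : ∑ γ, ∑ δ, P.gi γ δ * P.g γ δ = 4 := by
    have hsym : ∀ γ δ, P.g γ δ = P.g δ γ := fun γ δ => by
      have hT' := posDef_transpose hh
      simp only [PointState.g, frameMetric]
      cases γ using Fin.cases <;> cases δ using Fin.cases <;> try rfl
      exact congrFun (congrFun hT' _) _
    have : ∀ γ, ∑ δ, P.gi γ δ * P.g γ δ = 1 := fun γ => by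
      have h := PointState.gi_mul_g hh hN γ γ
      rw [if_pos rfl] at h
      rw [← h]
      exact sum_ext fun δ => by rw [hsym]
    simp [this]
  have htr : ∑ γ, ∑ δ, P.gi γ δ * Φ.stress e z γ δ = 3 * P.p - P.mu := by
    have : ∀ γ δ, P.gi γ δ * Φ.stress e z γ δ = (P.mu + P.p) * (P.f ^ 2)⁻¹ *
        (P.gi γ δ * (P.Cl γ * P.Cl δ)) + P.p * (P.gi γ δ * P.g γ δ) := fun γ δ => by rw [hst]; ring
    simp only [this, sum_add_distrib, ← mul_sum, t1, t2]
    field_simp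
    ring
  rw [rho, hgi, htr, hst, hg]
  ring

lemma einsteinEulerOn (hT : IsOpen T) (he : e ∈ smoothAtlas S)
    (hE : Φ.Einstein) (hEu : Φ.Euler) :
    FluidRegularOn.EinsteinEulerOn (M.inChart e) (Φ.state e) (chartOpens hT e) where
  einstein z hz α β := (hE e he z hz α β).trans (Φ.rho_eq hT he hz α β)
  euler z hz β := (hEu e he z hz).1 β
  euler_div z hz := (hEu e he z hz).2

lemma J_eq (hT : IsOpen T) (he : e ∈ smoothAtlas S) {z : Coord}
    (hz : z ∈ chartDomain T e) : Φ.J e z = (Φ.state e z).current (Φ.acc e z) := by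
  have hM := M.regularOn hT he
  have hF := Φ.regularOn hT he
  have h : ∀ γ α β, (M.inChart e).nabla2 (Φ.rho e) z γ α β
      = (Φ.state e z).dRho (Φ.acc e z) γ α β := fun γ α β => by
    have h1 := hM.ev_nabla2 (X := (hF.fluid hM).rho) (Y := Φ.rho e) (fun α β w => by
      rw [Φ.rho_eq hT he w.2]
      simp only [Fluid.rho, map_add, map_mul, map_sub, map_pow, map_smul, hF.ev_mu, hF.ev_p,
        hF.ev_fi, hF.ev_Cl, hM.ev_metric, smul_eq_mul, inv_pow]) γ α β ⟨z, hz⟩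
    exact h1.symm.trans (hF.ev_nabla2_rho hM γ α β ⟨z, hz⟩)
  funext β l m
  simp only [J, h, PointState.current]

end PerfectFluid

/-! ### The energy vector under a change of frame -/

lemma pr_eq_trace {n : Type*} [Fintype n] (p F : Matrix n n ℝ) : pr p F = (p * Fᵀ).trace := by
  simp [pr, trace, Matrix.mul_apply]

lemma pr_change {n : Type*} [Fintype n] (p L F : Matrix n n ℝ) :
    pr p (Lᵀ * F * L) = pr (L * p * Lᵀ) F := by
  rw [pr_eq_trace, pr_eq_trace, trace_mul_comm (L * p * Lᵀ), transpose_mul, transpose_mul,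
    transpose_transpose, trace_mul_comm p]
  simp only [Matrix.mul_assoc]
  rw [trace_mul_comm]
  simp only [Matrix.mul_assoc]

lemma congr_apply {A : Type*} [CommRing A] (L F : Mat4 A) (α β : Fin 4) :
    (Lᵀ * F * L) α β = ∑ a, ∑ b, L a α * L b β * F a b := by
  simp only [Matrix.mul_apply, transpose_apply, sum_mul]
  rw [sum_comm]
  exact sum_ext fun a => sum_ext fun b => by ring

section change

variable {L gi p : Mat4 ℝ} {r r' : T4}

lemma ipP_change (X Y : Mat4 ℝ) : ipP p (Lᵀ * X * L) (Lᵀ * Y * L) = ipP (L * p * Lᵀ) X Y := by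
  rw [ipP, ipP, transpose_mul, transpose_mul, transpose_transpose]
  simp only [Matrix.mul_assoc]
  conv_rhs => rw [trace_mul_comm]
  simp only [Matrix.mul_assoc]

lemma stressP_change (hr : ∀ α ε, of (r α ε) = ∑ a, ∑ b, (L a α * L b ε) • (Lᵀ * of (r' a b) * L)) :
    of (stressP gi p r) = Lᵀ * of (stressP (L * gi * Lᵀ) (L * p * Lᵀ) r') * L := by
  have hip : ∀ α ε β δ, ipP p (of (r α ε)) (of (r β δ)) = ∑ a, ∑ c, L a α * L c β *
      (Lᵀ * (of fun b d => ipP (L * p * Lᵀ) (of (r' a b)) (of (r' c d))) * L) ε δ := by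
    intro α ε β δ
    have h1 : ∀ X : Mat4 ℝ, ipP p (of (r α ε)) X
        = ∑ a, ∑ b, L a α * L b ε * ipP p (Lᵀ * of (r' a b) * L) X := fun X => by
      rw [hr]
      simp only [ipP, Matrix.mul_sum, Matrix.sum_mul, Matrix.trace_sum, Matrix.mul_smul,
        Matrix.smul_mul, trace_smul, smul_eq_mul]
    have h2 : ∀ X : Mat4 ℝ, ipP p X (of (r β δ))
        = ∑ a, ∑ b, L a β * L b δ * ipP p X (Lᵀ * of (r' a b) * L) := fun X => by
      rw [hr]
      simp only [ipP, Matrix.transpose_sum, transpose_smul, Matrix.mul_sum, Matrix.trace_sum,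
        Matrix.mul_smul, trace_smul, smul_eq_mul]
    simp only [h1, h2, ipP_change, congr_apply, of_apply, mul_sum]
    refine sum_ext fun a => ?_
    rw [sum_comm]
    refine sum_ext fun c => sum_ext fun b =>
      sum_ext fun d => ?_
    ring
  ext α β
  rw [congr_apply]
  have h : ∀ a c, stressP (L * gi * Lᵀ) (L * p * Lᵀ) r' a c
      = pr gi fun ε δ => (Lᵀ * (of fun b d => ipP (L * p * Lᵀ) (of (r' a b)) (of (r' c d))) * L) ε δ
      :=
    fun a c => (pr_change gi L _).symm
  simp only [of_apply, h, mul_pr, pr_sum]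
  exact sum_ext fun ε => sum_ext fun δ => by rw [hip]

lemma maxP_change (hr : ∀ α ε, of (r α ε) = ∑ a, ∑ b, (L a α * L b ε) • (Lᵀ * of (r' a b) * L)) : L
    * of (maxP gi p r) = of (maxP (L * gi * Lᵀ) (L * p * Lᵀ) r') * L := by
  have h : ∀ (gi p : Mat4 ℝ) r, of (maxP gi p r) = gi * of (stressP gi p r)
      - ((1 / 4) * pr gi (of (stressP gi p r))) • (1 : Mat4 ℝ) := fun gi p r => by
    ext α σ
    simp [maxP, Matrix.mul_apply, Matrix.one_apply, pr]
  rw [h, h, stressP_change hr, pr_change, mul_sub, sub_mul]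
  simp only [Matrix.mul_smul, Matrix.smul_mul, Matrix.mul_one, Matrix.one_mul, Matrix.mul_assoc]

lemma fluidT_change (p gt c' : Mat4 ℝ) (C : Col4 ℝ) (m : ℝ) : L * fluidT p gt C (Lᵀ * c' * L) m
    = fluidT (L * p * Lᵀ) (L * gt * Lᵀ) (L * C) c' m := by
  have hS : fluidS p gt C (Lᵀ * c' * L) m = fluidS (L * p * Lᵀ) (L * gt * Lᵀ) (L * C) c' m := by
    rw [fluidS, fluidS]
    simp only [transpose_mul, transpose_transpose, Matrix.mul_assoc]
    congr 1
    rw [trace_mul_comm L]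
    simp only [Matrix.mul_assoc]
  rw [fluidT, fluidT, hS, Matrix.mul_sub]
  simp only [transpose_mul, transpose_transpose, Matrix.mul_smul, Matrix.mul_assoc]

end change

namespace PointState

/-- The vector formed by the energy density and the fluxes. -/
def energyVec (P : PointState) (r : T4) (c : T2) (α : Fin 4) : ℝ :=
  -(1 / 2) * maxP (of P.gi) pI(P.N, P.h) r α 0
    + (P.C 0)⁻¹ * P.fluidVec c α 0

lemma posMetricInv_eq (N : ℝ) (h : Mat3) : of (posMetricInv N h) = of (frameMetricInv N h)
    + (2 * (N ^ 2)⁻¹) • of fun α β : Fin 4 => if α = 0 ∧ β = 0 then (1 : ℝ) else 0 := by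
  ext α β
  cases α using Fin.cases <;> cases β using Fin.cases <;>
    simp [posMetricInv, frameMetricInv, Fin.succ_ne_zero]
  ring

lemma energyVec_change {P P' : PointState} {L : Mat4 ℝ} (hL : ∀ δ, L δ 0 = if δ = 0 then 1 else 0)
    (hL' : ∀ α, L 0 α = if α = 0 then 1 else 0) (hN : P.N = P'.N) (hf : P.f = P'.f)
    (hmu : P.mu1 = P'.mu1) (hgi : L * of P.gi * Lᵀ = of P'.gi)
    (hC : ∀ δ, ∑ α, L δ α * P.C α = P'.C δ) {r r' : T4} {c c' : T2}
    (hr : ∀ α ε, of (r α ε) = ∑ a, ∑ b, (L a α * L b ε) • (Lᵀ * of (r' a b) * L))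
    (hc : of c = Lᵀ * of c' * L) (δ : Fin 4) : ∑ α, L δ α * P.energyVec r c α
    = P'.energyVec r' c' δ := by
  have h00 : L * (of fun α β : Fin 4 => if α = 0 ∧ β = 0 then (1 : ℝ) else 0) * Lᵀ
      = of fun α β : Fin 4 => if α = 0 ∧ β = 0 then (1 : ℝ) else 0 := by
    ext α β
    simp [Matrix.mul_apply, Fin.sum_univ_four, hL, ← ite_and, and_comm]
  have hp : L * of (posMetricInv P.N P.h) * Lᵀ = of (posMetricInv P'.N P'.h) := by
    rw [posMetricInv_eq, posMetricInv_eq, mul_add, add_mul, Matrix.mul_smul, Matrix.smul_mul, h00,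
      hN]
    rw [← hN]
    exact congrArg (· + _) (hgi.trans (by rw [gi, hN]))
  have hCc : L * P.Cc = P'.Cc := by
    ext δ j
    simpa [Matrix.mul_apply, Cc] using hC δ
  have hgt : L * P.gt4 * Lᵀ = P'.gt4 := by
    have e : ∀ P : PointState, P.gt4 = of P.gi + ((P.f)⁻¹ ^ 2) • (P.Cc * P.Ccᵀ) := fun P => by
      ext α β
      simp [gt4, Cc, Matrix.mul_apply]
    rw [e, e, mul_add, add_mul, hgi, ← hCc, hf, Matrix.mul_smul, Matrix.smul_mul]
    simp only [transpose_mul, Matrix.mul_assoc]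
  have h0 : P.C 0 = P'.C 0 := by simpa [hL'] using hC 0
  have hm := congrFun (congrFun (maxP_change (gi := of P.gi)
    (p := of (posMetricInv P.N P.h)) hr) δ) 0
  have hT := congrFun (congrFun (fluidT_change (L := L) pI(P.N, P.h) P.gt4
    (of c') P.Cc (P.mu1 * (P.f)⁻¹ ^ 2)) δ) 0
  rw [hgi, hp] at hm
  rw [← hc, hp, hgt, hCc, hmu, hf] at hT
  simp only [Matrix.mul_apply, hL, mul_ite, mul_one, mul_zero, Finset.sum_ite_eq', Finset.mem_univ,
    if_true, of_apply] at hm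
  rw [Matrix.mul_apply] at hT
  rw [energyVec, ← hm, ← h0, fluidVec, ← hT, mul_sum, mul_sum, ← sum_add_distrib]
  refine sum_ext fun α => ?_
  rw [energyVec, fluidVec, hmu, hf]
  ring

end PointState

/-! ### Changes of charts -/

lemma pd_chain {Ψ : Coord → Coord} {f : Coord → ℝ} {z : Coord} (hΨ : DifferentiableAt ℝ Ψ z)
    (hf : DifferentiableAt ℝ f (Ψ z)) (a : Fin 4) :
    pd a (fun w => f (Ψ w)) z = ∑ b, pd a (fun w => Ψ w b) z * pd b f (Ψ z) := by
  have h := (hf.hasFDerivAt.comp z hΨ.hasFDerivAt).fderiv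
  have h1 : pd a (fun w => f (Ψ w)) z = fderiv ℝ f (Ψ z) (fderiv ℝ Ψ z (Pi.single a 1)) :=
    congrArg (fun A : Coord →L[ℝ] ℝ => A (Pi.single a 1)) h
  have h2 : fderiv ℝ Ψ z (Pi.single a 1) = ∑ b, pd a (fun w => Ψ w b) z • Pi.single b (1 : ℝ) := by
    rw [eq_sum_smul_single (fderiv ℝ Ψ z (Pi.single a 1))]
    refine sum_ext fun b => ?_
    rw [pd, fderiv_apply hΨ b]
    rfl
  rw [h1, h2, map_sum]
  simp only [map_smul, smul_eq_mul]
  rfl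

namespace SmoothAlg

variable {Ω Ω' : Opens Coord}

/-- Pull back by a smooth map. -/
def pull (Ψ : Coord → Coord) (hΨ : ContDiffOn ℝ ∞ Ψ Ω) (hm : MapsTo Ψ Ω Ω') :
    SmoothAlg Ω' →ₐ[ℝ] SmoothAlg Ω where
  toFun φ := mk (fun z => extZero Ω' φ.1 (Ψ z)) ((SmoothAlg.contDiffOn φ).comp hΨ hm)
  map_one' := ext_ev fun z => by
    rw [ev_mk, ← ev_extZero _ ⟨Ψ z, hm z.2⟩, map_one, map_one]
  map_mul' φ ψ := ext_ev fun z => by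
    rw [map_mul]
    simp only [ev_mk]
    rw [← ev_extZero _ ⟨Ψ z, hm z.2⟩, ← ev_extZero φ ⟨Ψ z, hm z.2⟩, ← ev_extZero ψ ⟨Ψ z, hm z.2⟩,
      map_mul]
  map_zero' := ext_ev fun z => by
    rw [ev_mk, ← ev_extZero _ ⟨Ψ z, hm z.2⟩, map_zero, map_zero]
  map_add' φ ψ := ext_ev fun z => by
    rw [map_add]
    simp only [ev_mk]
    rw [← ev_extZero _ ⟨Ψ z, hm z.2⟩, ← ev_extZero φ ⟨Ψ z, hm z.2⟩, ← ev_extZero ψ ⟨Ψ z, hm z.2⟩,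
      map_add]
  commutes' r := ext_ev fun z => by
    rw [ev_mk, ← ev_extZero _ ⟨Ψ z, hm z.2⟩, AlgHom.commutes, AlgHom.commutes]

lemma ev_pull {Ψ : Coord → Coord} (hΨ : ContDiffOn ℝ ∞ Ψ Ω) (hm : MapsTo Ψ Ω Ω') (z : Ω)
    (φ : SmoothAlg Ω') : ev z (pull Ψ hΨ hm φ) = ev ⟨Ψ z, hm z.2⟩ φ :=
  (ev_mk _ _ z).trans (ev_extZero φ ⟨Ψ z, hm z.2⟩).symm

end SmoothAlg

lemma LocalMetric.RegularOn.mono {M : LocalMetric} {Ω Ω' : Opens Coord} (hM : M.RegularOn Ω)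
    (h : Ω' ≤ Ω) : M.RegularOn Ω' where
  N_pos z hz := hM.N_pos z (h hz)
  h_posDef z hz := hM.h_posDef z (h hz)
  N_smooth := hM.N_smooth.mono h
  shift_smooth i := (hM.shift_smooth i).mono h
  h_smooth i j := (hM.h_smooth i j).mono h

lemma FluidRegularOn.mono {M : LocalMetric} {st : Coord → PointState} {Ω Ω' : Opens Coord}
    (hF : FluidRegularOn M st Ω) (h : Ω' ≤ Ω) : FluidRegularOn M st Ω' where
  N_eq := hF.N_eq
  h_eq := hF.h_eq
  C_smooth α := (hF.C_smooth α).mono h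
  f_smooth := hF.f_smooth.mono h
  p_smooth := hF.p_smooth.mono h
  mu_smooth := hF.mu_smooth.mono h
  mu1_smooth := hF.mu1_smooth.mono h
  mu2_smooth := hF.mu2_smooth.mono h
  C_ne z hz := hF.C_ne z (h hz)
  f_ne z hz := hF.f_ne z (h hz)
  CC_eq z hz := hF.CC_eq z (h hz)
  pd_mu z hz := hF.pd_mu z (h hz)
  pd_mu1 z hz := hF.pd_mu1 z (h hz)
  pd_f z hz := hF.pd_f z (h hz)

@[simp] lemma spacePart_mkCoord (t : ℝ) (y : E3) : spacePart (mkCoord t y) = y := rfl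
@[simp] lemma mkCoord_zero (t : ℝ) (y : E3) : mkCoord t y 0 = t := rfl

section transition

variable {S : Type*} [TopologicalSpace S] [ChartedSpace E3 S] {T : Set ℝ}
  {e e' : Chart S}

/-- The change of coordinates between two charts. -/
def transition (e e' : Chart S) (z : Coord) : Coord :=
  mkCoord (z 0) (e' (e.symm (spacePart z)))

/-- The part of the domain of `e` that is covered by `e'`. -/
def overlap (hT : IsOpen T) (e e' : Chart S) : Opens Coord :=
  ⟨{z | z 0 ∈ T ∧ spacePart z ∈ e.target ∩ e.symm ⁻¹' e'.source},
    (hT.preimage (continuous_apply 0)).inter ((e.symm.isOpen_inter_preimage e'.open_source).preimage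
      contDiff_spacePart.continuous)⟩

lemma overlap_le (hT : IsOpen T) (e e' : Chart S) :
    overlap hT e e' ≤ chartOpens hT e := fun _ hz => ⟨hz.1, hz.2.1⟩

lemma transition_mem (hT : IsOpen T) {z : Coord} (hz : z ∈ overlap hT e e') :
    transition e e' z ∈ chartOpens hT e' := ⟨hz.1, e'.map_source hz.2.2⟩

lemma symm_transition (hT : IsOpen T) {z : Coord} (hz : z ∈ overlap hT e e') :
    e'.symm (spacePart (transition e e' z)) = e.symm (spacePart z) := e'.left_inv hz.2.2

lemma scalarIn_transition (hT : IsOpen T) {z : Coord} (hz : z ∈ overlap hT e e') (φ : ℝ → S → ℝ) :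
    scalarIn e' φ (transition e e' z) = scalarIn e φ z :=
  congrArg (φ (z 0)) (symm_transition hT hz)

variable [IsManifold 𝓘(ℝ, E3) ∞ S]

lemma contDiffOn_coordChange (he : e ∈ smoothAtlas S) (he' : e' ∈ smoothAtlas S) : ContDiffOn ℝ ∞
    (fun y => e' (e.symm y)) (e.target ∩ e.symm ⁻¹' e'.source) :=
  ((contMDiffOn_of_mem_maximalAtlas he').comp ((contMDiffOn_symm_of_mem_maximalAtlas he).mono
    inter_subset_left) fun _ hy => hy.2).contDiffOn

lemma contDiffOn_transition (hT : IsOpen T) (he : e ∈ smoothAtlas S)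
    (he' : e' ∈ smoothAtlas S) : ContDiffOn ℝ ∞ (transition e e') (overlap hT e e') := by
  rw [contDiffOn_pi]
  refine Fin.cases (contDiff_apply ℝ ℝ 0).contDiffOn fun k => ?_
  exact (contDiffOn_euclidean.1 (contDiffOn_coordChange he he') k).comp
    contDiff_spacePart.contDiffOn fun z hz => hz.2

/-- The Jacobian matrix of the change of coordinates. -/
def jac (e e' : Chart S) (y : E3) (k i : Fin 3) : ℝ :=
  fderiv ℝ (fun y => e' (e.symm y)) y (EuclideanSpace.single i 1) k

lemma hasFDerivAt_coordChange (he : e ∈ smoothAtlas S) (he' : e' ∈ smoothAtlas S) {y : E3}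
    (hy : y ∈ e.target ∩ e.symm ⁻¹' e'.source) : HasFDerivAt (fun y => e' (e.symm y))
    (fderiv ℝ (fun y => e' (e.symm y)) y) y :=
  (((contDiffOn_coordChange he he').differentiableOn (by simp)).differentiableAt
    ((e.symm.isOpen_inter_preimage e'.open_source).mem_nhds hy)).hasFDerivAt

lemma mfderiv_coordVec (he : e ∈ smoothAtlas S) (he' : e' ∈ smoothAtlas S) {y : E3}
    (hy : y ∈ e.target ∩ e.symm ⁻¹' e'.source) (i k : Fin 3) :
    (show E3 from mfd e' (e.symm y) (coordVec e y i)) k = jac e e' y k i := by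
  have h := mfderiv_comp y ((mdifferentiable_chart he').mdifferentiableAt hy.2)
    ((mdifferentiable_chart he).symm.mdifferentiableAt hy.1)
  have h1 : mfd (e' ∘ e.symm) y = fderiv ℝ (fun y => e' (e.symm y)) y :=
    mfderiv_eq_fderiv
  rw [h1] at h
  exact congrArg (fun A : E3 →L[ℝ] E3 => A (EuclideanSpace.single i 1) k) h.symm

lemma vectorIn_transition (hT : IsOpen T) (he : e ∈ smoothAtlas S)
    (he' : e' ∈ smoothAtlas S) {z : Coord} (hz : z ∈ overlap hT e e')
    (X : ℝ → (x : S) → TangentSpace 𝓘(ℝ, E3) x) (k : Fin 3) :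
    vectorIn e' X (transition e e' z) k = ∑ i, jac e e' (spacePart z) k i * vectorIn e X z i := by
  have h1 : vectorIn e' X (transition e e' z) k = (show E3 from mfd e'
      (e.symm (spacePart z)) (X (z 0) (e.symm (spacePart z)))) k :=
    congrArg (fun x => (show E3 from mfd e' x (X (z 0) x)) k)
      (symm_transition hT hz)
  rw [h1, eq_sum_comps_smul he hz.2.1 (X (z 0) (e.symm (spacePart z)))]
  have h2 : ∀ (A : E3 →L[ℝ] E3) (c : Fin 3 → ℝ) (v : Fin 3 → E3),
      A (∑ i, c i • v i) k = ∑ i, A (v i) k * c i := fun A c v => by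
    have := map_sum ((EuclideanSpace.proj k : E3 →L[ℝ] ℝ).comp A) (fun i => c i • v i) Finset.univ
    refine this.trans (sum_ext fun i => ?_)
    rw [map_smul, smul_eq_mul, mul_comm]; rfl
  refine (h2 _ _ _).trans (sum_ext fun i => ?_)
  rw [← mfderiv_coordVec he he' hz.2]
  rfl

lemma bilinIn_transition (he : e ∈ smoothAtlas S) (he' : e' ∈ smoothAtlas S) {y : E3}
    (hy : y ∈ e.target ∩ e.symm ⁻¹' e'.source) (b : (x : S)
    → LinearMap.BilinForm ℝ (TangentSpace 𝓘(ℝ, E3) x)) (i j : Fin 3) : bilinIn e b y i j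
    = ∑ k, ∑ l, bilinIn e' b (e' (e.symm y)) k l * (jac e e' y k i * jac e e' y l j) := by
  have key : ∀ (x : S) (hx : x ∈ e'.source) (v w : TangentSpace 𝓘(ℝ, E3) x), b x v w
      = ∑ k, ∑ l, bilinIn e' b (e' x) k l * ((show E3 from mfd e' x v) k *
      (show E3 from mfd e' x w) l) := fun x hx => by
    obtain ⟨y, hy, rfl⟩ : ∃ y ∈ e'.target, e'.symm y = x := ⟨e' x, e'.map_source hx, e'.left_inv hx⟩
    intro v w
    rw [e'.right_inv hy]
    exact bilin_eq_sum he' hy b v w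
  rw [bilinIn, key _ hy.2]
  simp only [mfderiv_coordVec he he' hy]

lemma pd_transition_zero (a : Fin 4) (z : Coord) :
    pd a (fun w => transition e e' w 0) z = if a = 0 then 1 else 0 := by
  have h := (ContinuousLinearMap.proj (R := ℝ) (φ := fun _ : Fin 4 => ℝ) 0).hasFDerivAt
    (x := z) |>.fderiv
  refine (congrArg (fun A : Coord →L[ℝ] ℝ => A (Pi.single a 1)) h).trans ?_
  simp [Pi.single_apply, eq_comm]

/-- `spacePart` as a continuous linear map. -/
def spacePartL : Coord →L[ℝ] E3 := LinearMap.toContinuousLinearMap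
  { toFun := spacePart
    map_add' := fun _ _ => rfl
    map_smul' := fun _ _ => rfl }

lemma pd_transition_succ (he : e ∈ smoothAtlas S) (he' : e' ∈ smoothAtlas S) {z : Coord}
    (hz : spacePart z ∈ e.target ∩ e.symm ⁻¹' e'.source) (a : Fin 4) (k : Fin 3) : pd a
    (fun w => transition e e' w k.succ) z = Fin.cases 0 (fun i => jac e e' (spacePart z) k i) a :=
    by
  have h1 := (hasFDerivAt_coordChange he he' hz).comp z spacePartL.hasFDerivAt
  have h2 := ((EuclideanSpace.proj k : E3 →L[ℝ] ℝ).hasFDerivAt.comp z h1).fderiv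
  have h3 : pd a (fun w => transition e e' w k.succ) z
      = fderiv ℝ (fun y => e' (e.symm y)) (spacePart z) (spacePart (Pi.single a 1)) k :=
    congrArg (fun A : Coord →L[ℝ] ℝ => A (Pi.single a 1)) h2
  rw [h3]
  refine Fin.cases ?_ (fun i => ?_) a
  · have : spacePart (Pi.single 0 1) = 0 := by
      ext i
      exact Pi.single_eq_of_ne (Fin.succ_ne_zero i) 1
    rw [this, map_zero]; rfl
  · have : spacePart (Pi.single i.succ 1) = EuclideanSpace.single i 1 := by
      ext j
      by_cases h : j = i
      · subst h; simp [spacePart]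
      · simp [spacePart, h]
    rw [this]; rfl

end transition

/-! ### Invariance of the energy density and of its rate -/

namespace FrameChange

variable {A A' : Type*} [CommRing A] [Algebra ℝ A] [CommRing A'] [Algebra ℝ A']
    {G : Frame A} {G' : Frame A'} (Θ : FrameChange G G')

lemma gi_change : Θ.L * G.gi * Θ.Lᵀ = Θ.pm G'.gi := by
  have h1 : Θ.L * G.gi * Θ.Lᵀ * Θ.pm G'.g * Θ.L = Θ.L := by
    have : Θ.L * G.gi * Θ.Lᵀ * Θ.pm G'.g * Θ.L = Θ.L * (G.gi * (Θ.Lᵀ * G'.g.map Θ.pull * Θ.L)) := by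
      simp only [Matrix.mul_assoc]; rfl
    rw [this, ← Θ.g_eq, G.gi_mul_g, mul_one]
  have h2 : Θ.L * G.gi * Θ.Lᵀ * Θ.pm G'.g = 1 := by
    rw [← mul_one (Θ.L * G.gi * Θ.Lᵀ * Θ.pm G'.g), ← Θ.L_mul_Li, ← Matrix.mul_assoc, h1]
  have h3 : Θ.pm G'.g * Θ.pm G'.gi = 1 := by
    rw [← Θ.pm_mul, G'.g_mul_gi, pm, Matrix.map_one _ (map_zero _) (map_one _)]
  rw [← mul_one (Θ.L * G.gi * Θ.Lᵀ), ← h3, ← Matrix.mul_assoc, h2, one_mul]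

lemma sum_mul_D_change {Y : Fin 4 → A} {Y' : Fin 4 → A'} (hY : ∀ δ, ∑ α, Θ.L δ α * Y α
    = Θ.pull (Y' δ)) (φ : A') : ∑ γ, Y γ * G.D γ (Θ.pull φ) = Θ.pull (∑ γ, Y' γ * G'.D γ φ) := by
  simp only [map_sum, map_mul, ← hY, Θ.D_pull, mul_sum, sum_mul]
  rw [sum_comm]
  exact sum_ext fun β => sum_ext fun γ => by ring

end FrameChange

namespace Slicing

variable {A A' : Type*} [CommRing A] [Algebra ℝ A] [CommRing A'] [Algebra ℝ A']
  (M : Slicing A) (M' : Slicing A') (pull : A' →ₐ[ℝ] A) (ψ : Fin 3 → A)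

/-- The matrix of the change of frame to space coordinates `ψ`. -/
def jac : Mat4 A := of fun δ α =>
  Fin.cases (Fin.cases 1 (fun _ => 0) α)
    (fun k => Fin.cases 0 (fun i => M.D i.succ (ψ k)) α) δ

@[simp] lemma jac_zero_zero : M.jac ψ 0 0 = 1 := rfl
@[simp] lemma jac_zero_succ (i : Fin 3) : M.jac ψ 0 i.succ = 0 := rfl
@[simp] lemma jac_succ_zero (k : Fin 3) : M.jac ψ k.succ 0 = 0 := rfl
lemma jac_succ_succ (k i : Fin 3) : M.jac ψ k.succ i.succ = M.D i.succ (ψ k) := rfl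

variable {M M' pull ψ}

lemma bracket_change (hψ : ∀ k, M.D 0 (ψ k) = -pull (M'.shift k))
    (hD : ∀ α φ, M.D α (pull φ) = ∑ β, M.jac ψ β α * pull (M'.D β φ))
    (δ α β : Fin 4) : ∑ γ, M.jac ψ δ γ * M.bracket γ α β = M.D α (M.jac ψ δ β) - M.D β (M.jac ψ δ α)
    + ∑ σ, ∑ τ, M.jac ψ σ α * M.jac ψ τ β * pull (M'.bracket δ σ τ) := by
  have key : ∀ k i : Fin 3, ∑ l : Fin 3, M.jac ψ k.succ l.succ * M.D i.succ (M.shift l)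
      = M.D 0 (M.D i.succ (ψ k)) + ∑ m : Fin 3, M.jac ψ m.succ i.succ * pull
      (M'.D m.succ (M'.shift k)) := fun k i => by
    have h := M.comm_time i (ψ k)
    rw [hψ, map_neg, hD, sum4, jac_zero_succ, zero_mul, zero_add, sub_neg_eq_add] at h
    rw [h]
    exact sum_ext fun l => mul_comm _ _
  simp only [sum4, bracket_zero, bracket_zero_zero, bracket_succ_succ, mul_zero, map_zero,
    sum_const_zero, zero_add, add_zero]
  refine Fin.cases ?_ (fun k => ?_) δ
  · cases α using Fin.cases <;> cases β using Fin.cases <;> simp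
  · refine Fin.cases ?_ (fun i => ?_) α <;> refine Fin.cases ?_ (fun j => ?_) β
    · simp
    · simp only [bracket_zero_succ]
      rw [key]
      simp only [jac_zero_zero, jac_succ_zero, jac_zero_succ, one_mul, zero_mul, mul_zero, map_zero,
        sub_zero, sum_const_zero, add_zero,
        jac_succ_succ _ _ k]
    · simp only [bracket_succ_zero, bracket_zero_succ, mul_neg, sum_neg_distrib]
      rw [key]
      simp only [jac_zero_zero, jac_succ_zero, jac_zero_succ, zero_mul, mul_zero, mul_one, map_zero, map_neg, mul_neg, sum_neg_distrib,
        zero_sub, sum_const_zero, zero_add,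
        jac_succ_succ _ _ k, neg_add]
    · simp [jac_succ_succ, M.comm_space i j]

/-- The change of frame given by a change of space coordinates. -/
def frameChange (hψ : ∀ k, M.D 0 (ψ k) = -pull (M'.shift k))
    (hD : ∀ α φ, M.D α (pull φ) = ∑ β, M.jac ψ β α * pull (M'.D β φ))
    (hg : M.metric = (M.jac ψ)ᵀ * M'.metric.map pull * M.jac ψ) :
    FrameChange M.frame M'.frame where
  pull := pull
  L := M.jac ψ
  Li := M.metricInv * (M.jac ψ)ᵀ * M'.metric.map pull
  L_mul_Li := by
    rw [mul_eq_one_comm, Matrix.mul_assoc, Matrix.mul_assoc, ← Matrix.mul_assoc _ _ (M.jac ψ), ← hg]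
    exact M.frame.gi_mul_g
  D_pull := hD
  g_eq := hg
  br_eq := bracket_change hψ hD

end Slicing

section transition

variable {S : Type*} [TopologicalSpace S] [ChartedSpace E3 S] [IsManifold 𝓘(ℝ, E3) ∞ S] {T : Set ℝ}
  (M : SlicedSpacetime S T) (hT : IsOpen T) {e e' : Chart S}
  (he : e ∈ smoothAtlas S) (he' : e' ∈ smoothAtlas S)

/-- The metric in the chart `e`, on the part covered by `e'`. -/
lemma SlicedSpacetime.regularOn_overlap (M : SlicedSpacetime S T) (hT : IsOpen T)
    (he : e ∈ smoothAtlas S) (e' : Chart S) : (M.inChart e).RegularOn (overlap hT e e') :=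
  (M.regularOn hT he).mono (overlap_le hT e _)

/-- The space coordinates of `e'` as functions in the chart `e`. -/
def coordFun (k : Fin 3) : SmoothAlg (overlap hT e e') :=
  SmoothAlg.mk (fun z => transition e e' z k.succ)
    (contDiffOn_pi.1 (contDiffOn_transition hT he he') k.succ)

lemma ev_coordFun (k : Fin 3) (z : overlap hT e e') :
    ev z (coordFun hT he he' k) = transition e e' z k.succ := ev_mk _ _ z

/-- Pull back of functions from the chart `e'` to the chart `e`. -/
def pullChart : SmoothAlg (chartOpens hT e') →ₐ[ℝ] SmoothAlg (overlap hT e e') :=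
  SmoothAlg.pull (transition e e') (contDiffOn_transition hT he he') fun _ => transition_mem hT

lemma ev_pullChart (z : overlap hT e e') (φ : SmoothAlg (chartOpens hT e')) :
    ev z (pullChart hT he he' φ) = ev ⟨transition e e' z, transition_mem hT z.2⟩ φ :=
  ev_pull _ _ z φ

lemma ev_pullChart_ext (φ : SmoothAlg (chartOpens hT e')) (z : overlap hT e e') :
    ev z (pullChart hT he he' φ) = extZero (chartOpens hT e') φ.1 (transition e e' z) := ev_mk _ _ z

/-- The matrix of the change of frame between two charts. -/
def frameJac : Mat4 (SmoothAlg (overlap hT e e')) :=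
  (M.regularOn_overlap hT he e').slicing.jac (coordFun hT he he')

@[simp] lemma frameJac_zero_zero : frameJac M hT he he' 0 0 = 1 := rfl
@[simp] lemma frameJac_zero_succ (i : Fin 3) : frameJac M hT he he' 0 i.succ = 0 := rfl
@[simp] lemma frameJac_succ_zero (k : Fin 3) : frameJac M hT he he' k.succ 0 = 0 := rfl
lemma frameJac_succ_succ (k i : Fin 3) : frameJac M hT he he' k.succ i.succ
    = (M.regularOn_overlap hT he e').slicing.D i.succ (coordFun hT he he' k) := rfl

lemma ev_frameJac (z : overlap hT e e') (k i : Fin 3) :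
    ev z (frameJac M hT he he' k.succ i.succ) = jac e e' (spacePart z) k i := by
  rw [frameJac_succ_succ, LocalMetric.RegularOn.ev_D _ _
    (f := fun w => transition e e' w k.succ) (ev_coordFun hT he he' k)]
  exact pd_transition_succ he he' z.2.2 i.succ k

lemma D_coordFun (k : Fin 3) : (M.regularOn_overlap hT he e').slicing.D 0 (coordFun hT he he' k)
    = -pullChart hT he he' ((M.regularOn hT he').slicing.shift k) := ext_ev fun z => by
  rw [LocalMetric.RegularOn.ev_D _ _
    (f := fun w => transition e e' w k.succ) (ev_coordFun hT he he' k), map_neg, ev_pullChart,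
    LocalMetric.RegularOn.ev_shift]
  change pd 0 _ (z : Coord) - ∑ i, vectorIn e M.shift z i * pd i.succ _ (z : Coord)
    = -vectorIn e' M.shift _ k
  simp only [vectorIn_transition hT he he' z.2, pd_transition_succ he he' z.2.2, Fin.cases_zero,
    Fin.cases_succ, zero_sub, mul_comm]

lemma D_pullChart (α : Fin 4) (φ : SmoothAlg (chartOpens hT e')) :
    (M.regularOn_overlap hT he e').slicing.D α (pullChart hT he he' φ)
    = ∑ β, frameJac M hT he he' β α * pullChart hT he he'
    ((M.regularOn hT he').slicing.D β φ) := ext_ev fun z => by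
  have hm := transition_mem hT z.2
  have hF : DifferentiableAt ℝ (extZero (chartOpens hT e') φ.1) (transition e e' z) :=
    ((SmoothAlg.contDiffOn φ).differentiableOn (by simp)).differentiableAt
      ((chartOpens hT e').2.mem_nhds hm)
  have hΨ : DifferentiableAt ℝ (transition e e') z :=
    ((contDiffOn_transition hT he he').differentiableOn (by simp)).differentiableAt
      ((overlap hT e e').2.mem_nhds z.2)
  rw [LocalMetric.RegularOn.ev_D _ _
    (f := fun w => extZero (chartOpens hT e') φ.1 (transition e e' w)) (ev_pullChart_ext hT he he' φ), sum4, map_add, map_sum]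
  simp only [map_mul, ev_pullChart, LocalMetric.RegularOn.ev_D _ _ (ev_extZero φ)]
  have h0 := pd_chain hΨ hF 0
  have hs := fun i : Fin 3 => pd_chain hΨ hF i.succ
  simp only [Fin.sum_univ_succ (n := 3), pd_transition_zero, pd_transition_succ he he' z.2.2,
    Fin.cases_zero, Fin.cases_succ, if_true, one_mul, zero_mul, sum_const_zero, add_zero,
    Fin.succ_ne_zero, if_false, zero_add] at h0 hs
  refine Fin.cases ?_ (fun i => ?_) α
  · simp only [frameJac_zero_zero, frameJac_succ_zero, map_one, map_zero, one_mul, zero_mul,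
      sum_const_zero, add_zero]
    change pd 0 _ (z : Coord) - ∑ i, vectorIn e M.shift z i * pd i.succ _ (z : Coord)
      = pd 0 _ _ - ∑ k, vectorIn e' M.shift _ k * pd k.succ _ _
    simp only [vectorIn_transition hT he he' z.2, h0, hs, mul_sum, sum_mul]
    rw [sum_comm]
    congr 1
    exact sum_ext fun k => sum_ext fun i => by ring
  · simp only [frameJac_zero_succ, map_zero, zero_mul, zero_add, ev_frameJac]
    exact hs i

lemma metric_transition : (M.regularOn_overlap hT he e').slicing.metric
    = (frameJac M hT he he')ᵀ * (M.regularOn hT he').slicing.metric.map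
    (pullChart hT he he') * frameJac M hT he he' := by
  ext1 α β
  refine ext_ev fun z => ?_
  rw [congr_apply, sum4]
  simp only [sum4, map_apply]
  refine Fin.cases ?_ (fun i => ?_) α <;> refine Fin.cases ?_ (fun j => ?_) β
  · simp only [frameJac_zero_zero, frameJac_succ_zero, Slicing.metric_zero_zero, zero_mul, one_mul,
      mul_zero, sum_const_zero, add_zero, ev_pullChart, map_neg, map_pow,
      LocalMetric.RegularOn.ev_N]
    exact congrArg (fun x => -x ^ 2) (scalarIn_transition hT z.2 M.N).symm
  · simp
  · simp
  · simp only [frameJac_zero_succ, Slicing.metric_succ_succ, zero_mul, mul_zero, sum_const_zero,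
      zero_add, map_sum, map_mul, ev_frameJac, ev_pullChart,
      LocalMetric.RegularOn.ev_h]
    refine (bilinIn_transition he he' z.2.2 (M.h (z.1 0)) i j).trans ?_
    exact sum_ext fun k => sum_ext fun l => mul_comm _ _

/-- The change of frame between two charts. -/
def chartChange : FrameChange (M.regularOn_overlap hT he e').slicing.frame
    (M.regularOn hT he').slicing.frame :=
  Slicing.frameChange (D_coordFun M hT he he') (D_pullChart M hT he he')
    (metric_transition M hT he he')

lemma ev_chartChange_pull (z : overlap hT e e') (φ : SmoothAlg (chartOpens hT e')) :
    ev z ((chartChange M hT he he').pull φ) = ev ⟨transition e e' z, transition_mem hT z.2⟩ φ :=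
  ev_pullChart hT he he' z φ

end transition

namespace FluidRegularOn

variable {M : LocalMetric} {st : Coord → PointState} {Ω : Opens Coord}

/-- The energy vector as a family of smooth functions. -/
def energyVec (hF : FluidRegularOn M st Ω) (hM : M.RegularOn Ω) (α : Fin 4) : SmoothAlg Ω :=
  (-(1 / 2) : ℝ) • hM.slicing.maxwellUp hM.slicing.frame.riem α 0
    + (hF.fluid hM).C0i * (hF.fluid hM).T α 0

lemma ev_energyVec (hF : FluidRegularOn M st Ω) (hM : M.RegularOn Ω) (α : Fin 4) (z : Ω) :
    ev z (hF.energyVec hM α) = (st z).energyVec (M.riem z) (acc M st z) α := by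
  rw [energyVec, map_add, map_smul, hM.ev_maxwellUp, map_mul, hF.ev_T, hF.ev_C0i,
    PointState.energyVec, PointState.gi, hF.N_eq, hF.h_eq]
  rfl

lemma ev_energyVec_zero (hF : FluidRegularOn M st Ω) (hM : M.RegularOn Ω) (z : Ω) :
    ev z (hF.energyVec hM 0) = (st z).totalEnergy (M.riem z) (acc M st z) := by
  rw [energyVec, map_add, hM.ev_belRobinson, hF.ev_fluidEnergy, PointState.totalEnergy, hF.N_eq,
    hF.h_eq]

/-- The energy balance in terms of the spacetime divergence of the energy vector. -/
lemma energy_balance (hF : FluidRegularOn M st Ω) (hM : M.RegularOn Ω) (hE : EinsteinEulerOn M st Ω)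
    (z : Ω) : ev z (hM.slicing.D 0 (hF.energyVec hM 0) + hM.slicing.div
    (fun i => hF.energyVec hM i.succ)) = gravForm.eval M z
    + sourceTerm (M.N z) (M.h z) (M.riem z) ((st z).current (acc M st z))
    + fluidForm (st z) (M.dN z) (M.K z) (acc M st z) (acc M st z, M.riem z) := by
  rw [← hF.bianchi_energy hM hE z.2, ← hF.fluid_energy hM hE z.2,
    ← hM.ev_D 0 (f := fun w => belRobinson (M.N w) (M.h w) (M.riem w)) hM.ev_belRobinson,
    ← hM.ev_D 0 (f := fun w => (st w).fluidEnergy (acc M st w)) (hF.ev_fluidEnergy hM),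
    ← hM.ev_div (Y := fun w => belRobinsonFlux (M.N w) (M.h w) (M.riem w)) hM.ev_belRobinsonFlux,
    ← hM.ev_div (Y := fun w => (st w).fluidFlux (acc M st w)) (hF.ev_fluidFlux hM)]
  simp only [energyVec, Slicing.div, mul_add, sum_add_distrib, map_add]
  ring

end FluidRegularOn

namespace PerfectFluid

variable {S : Type*} [TopologicalSpace S] [ChartedSpace E3 S] [IsManifold 𝓘(ℝ, E3) ∞ S] {T : Set ℝ}
  {M : SlicedSpacetime S T} {eos : EquationOfState} (Φ : PerfectFluid M eos) (hT : IsOpen T)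
  {e e' : Chart S} (he : e ∈ smoothAtlas S)
  (he' : e' ∈ smoothAtlas S)

/-- The energy vector in the chart `e`. -/
def vecIn (e : Chart S) (z : Coord) (α : Fin 4) : ℝ :=
  (Φ.state e z).energyVec ((M.inChart e).riem z) (Φ.acc e z) α

lemma energyIn_eq {Ω : Opens Coord} (hM : (M.inChart e).RegularOn Ω)
    (hF : FluidRegularOn (M.inChart e) (Φ.state e) Ω) {z : Coord} (hz : z ∈ Ω) :
    Φ.energyIn e z = Φ.vecIn e z 0 :=
  (hF.ev_energyVec_zero hM ⟨z, hz⟩).symm.trans (hF.ev_energyVec hM 0 ⟨z, hz⟩)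

lemma rateIn_eq {Ω : Opens Coord} (hM : (M.inChart e).RegularOn Ω)
    (hF : FluidRegularOn (M.inChart e) (Φ.state e) Ω) (hΩ : Ω ≤ chartOpens hT e)
    (he : e ∈ smoothAtlas S) (hE : Φ.Einstein) (hEu : Φ.Euler)
    (z : Ω) : Φ.rateIn gravForm fluidForm e z = ev z
    (hM.slicing.D 0 (hF.energyVec hM 0) + hM.slicing.div (fun i => hF.energyVec hM i.succ)
    - hM.slicing.N * hM.slicing.tau * hF.energyVec hM 0) := by
  have hEE := Φ.einsteinEulerOn hT he hE hEu
  rw [map_sub, hF.energy_balance hM ⟨fun z hz => hEE.einstein z (hΩ hz),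
    fun z hz => hEE.euler z (hΩ hz), fun z hz => hEE.euler_div z (hΩ hz)⟩, map_mul, map_mul,
    hM.ev_N, hM.ev_tau, hF.ev_energyVec_zero, rateIn, sourceIn, Φ.J_eq hT he (hΩ z.2)]
  rw [show FluidRegularOn.acc (M.inChart e) (Φ.state e) z = Φ.acc e z from rfl, FluidForm.eval,
    energyIn]
  ring

lemma C_transition {z : Coord} (hz : z ∈ overlap hT e e') (δ : Fin 4) : ∑ α, ev ⟨z, hz⟩
    (frameJac M hT he he' δ α) * (Φ.state e z).C α = (Φ.state e' (transition e e' z)).C δ := by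
  have hp : scalarIn e' Φ.p (transition e e' z) = scalarIn e Φ.p z := scalarIn_transition hT hz _
  simp only [state, hp]
  rw [sum4]
  refine Fin.cases ?_ (fun k => ?_) δ
  · simp only [frameJac_zero_zero, frameJac_zero_succ, map_one, map_zero, one_mul, zero_mul,
      sum_const_zero, add_zero]
    exact congrArg _ (scalarIn_transition hT hz Φ.u₀).symm
  · simp only [frameJac_succ_zero, map_zero, zero_mul, zero_add, ev_frameJac]
    change _ = _ * vectorIn e' Φ.u _ k
    rw [vectorIn_transition hT he he' hz, mul_sum]
    exact sum_ext fun i => mul_left_comm _ _ _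

/-- The fluid in the chart `e`, on the part covered by `e'`. -/
lemma regularOn_overlap (he : e ∈ smoothAtlas S) (e' : Chart S) : FluidRegularOn (M.inChart e)
    (Φ.state e) (overlap hT e e') :=
  (Φ.regularOn hT he).mono (overlap_le hT e _)

lemma acc_transition {z : Coord} (hz : z ∈ overlap hT e e') (α β : Fin 4) : Φ.acc e z α β
    = ∑ a, ∑ b, ev ⟨z, hz⟩ (frameJac M hT he he' a α) * ev ⟨z, hz⟩
    (frameJac M hT he he' b β) * Φ.acc e' (transition e e' z) a b := by
  have hX : ∀ β, ((Φ.regularOn_overlap hT he e').fluid (M.regularOn_overlap hT he e')).Cl β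
      = ∑ σ, (chartChange M hT he he').L σ β * (chartChange M hT he he').pull
      (((Φ.regularOn hT he').fluid (M.regularOn hT he')).Cl σ) := fun β => by
    have hC : ∀ δ, pullChart hT he he' (((Φ.regularOn hT he').fluid (M.regularOn hT he')).C δ)
        = ∑ α, frameJac M hT he he' δ α * ((Φ.regularOn_overlap hT he e').fluid
        (M.regularOn_overlap hT he e')).C α :=
      fun δ => ext_ev fun z => by
        simp only [ev_pullChart, map_sum, map_mul, FluidRegularOn.ev_C]
        exact (Φ.C_transition hT he he' z.2 δ).symm
    have hg : ∀ α, (M.regularOn_overlap hT he e').slicing.metric β α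
        = ∑ a, ∑ b, frameJac M hT he he' a β * frameJac M hT he he' b α * pullChart hT he he'
        ((M.regularOn hT he').slicing.metric a b) := fun α =>
      (entry_congr (metric_transition M hT he he') β α).trans (congr_apply _ _ β α)
    change ∑ α, _ * _ = ∑ σ, frameJac M hT he he' σ β * pullChart hT he he' (∑ δ, _ * _)
    simp only [hg, map_sum, map_mul, hC, mul_sum, sum_mul]
    rw [sum_comm]
    refine sum_ext fun a => ?_
    rw [sum_comm]
    exact sum_ext fun b => sum_ext fun c => by ring
  have h := congrArg (ev ⟨z, hz⟩) ((chartChange M hT he he').nabla1_change hX α β)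
  simp only [map_sum, map_mul] at h
  refine ((Φ.regularOn_overlap hT he e').ev_c (M.regularOn_overlap hT he e') α β ⟨z, hz⟩).symm.trans
    (h.trans ?_)
  refine sum_ext fun a => sum_ext fun b => congrArg _ ?_
  exact (ev_pullChart hT he he' _ _).trans
    ((Φ.regularOn hT he').ev_c (M.regularOn hT he') a b ⟨_, transition_mem hT hz⟩)

end PerfectFluid

lemma FrameChange.riem_change_left {A A' : Type*} [CommRing A] [Algebra ℝ A] [CommRing A']
    [Algebra ℝ A'] {G : Frame A} {G' : Frame A'} (Θ : FrameChange G G')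
    (α β l m : Fin 4) : G.riem α β l m = ∑ a, ∑ b, Θ.L a α * Θ.L b β * ∑ c, ∑ d, Θ.L c l * Θ.L d m *
    Θ.pull (G'.riem a b c d) := by
  rw [Frame.riem_pair_symm, Θ.riem_change]
  simp only [congr_apply]
  refine sum_ext fun a => sum_ext fun b => congrArg _ ?_
  refine sum_ext fun c => sum_ext fun d => ?_
  rw [G'.riem_pair_symm a b c d]; rfl

lemma Slicing.balance_change {A A' : Type*} [CommRing A] [Algebra ℝ A] [CommRing A'] [Algebra ℝ A']
    {M : Slicing A} {M' : Slicing A'} (Θ : FrameChange M.frame M'.frame) (hN : Θ.pull M'.N = M.N)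
    {Y : Fin 4 → A} {Y' : Fin 4 → A'} (hY : ∀ δ, ∑ α, Θ.L δ α * Y α = Θ.pull (Y' δ)) : M.D 0 (Y 0)
    + M.div (fun i => Y i.succ) - M.N * M.tau * Y 0 = Θ.pull
    (M'.D 0 (Y' 0) + M'.div (fun i => Y' i.succ) - M'.N * M'.tau * Y' 0) := by
  have h := Θ.sum_mul_D_change hY M'.N
  have hNi : Θ.pull M'.Ni = M.Ni := by
    have h3 := congrArg Θ.pull M'.N_mul_Ni
    rw [map_mul, map_one, hN] at h3
    linear_combination M.Ni * h3 - Θ.pull M'.Ni * M.N_mul_Ni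
  rw [M.divergence_split, M'.divergence_split, Θ.divergence_change hY, map_sub, map_mul, hNi]
  refine congrArg (fun x => _ - _ * x) (Eq.trans ?_ h)
  rw [hN]; rfl

lemma SlicedSpacetime.riem_transition {S : Type*} [TopologicalSpace S] [ChartedSpace E3 S]
    [IsManifold 𝓘(ℝ, E3) ∞ S] {T : Set ℝ} (M : SlicedSpacetime S T) (hT : IsOpen T) {e e' : Chart S}
    (he : e ∈ smoothAtlas S) (he' : e' ∈ smoothAtlas S) {z : Coord} (hz : z ∈ overlap hT e e')
    {L : Mat4 ℝ} (hL : L = (frameJac M hT he he').map (ev ⟨z, hz⟩)) (α β : Fin 4) : of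
    ((M.inChart e).riem z α β) = ∑ a, ∑ b, (L a α * L b β) •
    (Lᵀ * of ((M.inChart e').riem (transition e e' z) a b) * L) := by
  have hR : ∀ a b c d, ev ⟨z, hz⟩ ((chartChange M hT he he').pull
      ((M.regularOn hT he').slicing.frame.riem a b c d))
      = (M.inChart e').riem (transition e e' z) a b c d := fun a b c d => by
    rw [ev_chartChange_pull, (M.regularOn hT he').ev_riem]
  have hL' : ∀ a b, ev ⟨z, hz⟩ ((chartChange M hT he he').L a b) = L a b := fun a b => by
    rw [hL]; rfl
  ext l m
  have h := congrArg (ev ⟨z, hz⟩) ((chartChange M hT he he').riem_change_left α β l m)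
  rw [(M.regularOn_overlap hT he e').ev_riem] at h
  simp only [map_sum, map_mul, hL', hR] at h
  rw [of_apply, h]
  simp only [Matrix.sum_apply, Matrix.smul_apply, congr_apply, smul_eq_mul, of_apply]

namespace PerfectFluid

variable {S : Type*} [TopologicalSpace S] [ChartedSpace E3 S] [IsManifold 𝓘(ℝ, E3) ∞ S] {T : Set ℝ}
  {M : SlicedSpacetime S T} {eos : EquationOfState} (Φ : PerfectFluid M eos) (hT : IsOpen T)
  {e e' : Chart S} (he : e ∈ smoothAtlas S)
  (he' : e' ∈ smoothAtlas S)

lemma vecIn_transition {z : Coord} (hz : z ∈ overlap hT e e') (δ : Fin 4) : ∑ α, ev ⟨z, hz⟩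
    (frameJac M hT he he' δ α) * Φ.vecIn e z α = Φ.vecIn e' (transition e e' z) δ := by
  have hp : scalarIn e' Φ.p (transition e e' z) = scalarIn e Φ.p z := scalarIn_transition hT hz _
  refine PointState.energyVec_change (L := (frameJac M hT he he').map (ev ⟨z, hz⟩))
    (fun δ => ?_) (fun α => ?_) (scalarIn_transition hT hz M.N).symm ?_ ?_ ?_
    (Φ.C_transition hT he he' hz) (M.riem_transition hT he he' hz rfl) ?_ δ
  · refine Fin.cases ?_ (fun k => ?_) δ <;> simp [Fin.succ_ne_zero]
  · refine Fin.cases ?_ (fun k => ?_) α <;> simp [Fin.succ_ne_zero]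
  · simp only [state, hp]
  · simp only [state, hp]
  · have h := congrArg (fun X => X.map (ev ⟨z, hz⟩)) (chartChange M hT he he').gi_change
    have hgi : ((M.regularOn_overlap hT he e').slicing.metricInv).map (ev ⟨z, hz⟩)
        = of (Φ.state e z).gi := by
      ext α β
      exact (M.regularOn_overlap hT he e').ev_metricInv α β ⟨z, hz⟩
    rw [← hgi]
    simp only [Matrix.map_mul] at h
    refine h.trans ?_
    ext α β
    exact (ev_pullChart hT he he' _ _).trans
      ((M.regularOn hT he').ev_metricInv α β ⟨_, transition_mem hT hz⟩)
  · ext α β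
    rw [congr_apply]
    exact Φ.acc_transition hT he he' hz α β

lemma energyVec_change (δ : Fin 4) : ∑ α, (chartChange M hT he he').L δ α *
    (Φ.regularOn_overlap hT he e').energyVec (M.regularOn_overlap hT he e') α
    = (chartChange M hT he he').pull ((Φ.regularOn hT he').energyVec (M.regularOn hT he') δ) :=
  ext_ev fun z => by
    simp only [map_sum, map_mul, FluidRegularOn.ev_energyVec]
    refine (Φ.vecIn_transition hT he he' z.2 δ).trans (Eq.symm ?_)
    exact (ev_pullChart hT he he' _ _).trans (FluidRegularOn.ev_energyVec _ _ _ _)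

lemma energyIn_transition (he : e ∈ smoothAtlas S) (he' : e' ∈ smoothAtlas S) {z : Coord}
    (hz : z ∈ overlap hT e e') : Φ.energyIn e' (transition e e' z) = Φ.energyIn e z := by
  rw [Φ.energyIn_eq (M.regularOn hT he') (Φ.regularOn hT he') (transition_mem hT hz),
    Φ.energyIn_eq (M.regularOn hT he) (Φ.regularOn hT he) (overlap_le hT e e' hz),
    ← Φ.vecIn_transition hT he he' hz, sum4]
  simp

lemma rateIn_transition (he : e ∈ smoothAtlas S) (he' : e' ∈ smoothAtlas S) (hE : Φ.Einstein)
    (hEu : Φ.Euler) {z : Coord} (hz : z ∈ overlap hT e e') : Φ.rateIn gravForm fluidForm e'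
    (transition e e' z) = Φ.rateIn gravForm fluidForm e z := by
  rw [Φ.rateIn_eq hT (M.regularOn hT he') (Φ.regularOn hT he') le_rfl he' hE hEu
      ⟨_, transition_mem hT hz⟩,
    Φ.rateIn_eq hT (M.regularOn_overlap hT he e') (Φ.regularOn_overlap hT he e')
      (overlap_le hT e e') he hE hEu ⟨z, hz⟩,
    Slicing.balance_change (chartChange M hT he he') (ext_ev fun z => ?_)
      (Φ.energyVec_change hT he he')]
  · rw [ev_chartChange_pull]
  · rw [ev_chartChange_pull]
    rw [LocalMetric.RegularOn.ev_N, LocalMetric.RegularOn.ev_N]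
    exact scalarIn_transition hT z.2 M.N

/-- The derivative of a function on `S` along the energy vector, in the chart `e`. -/
def fluxIn (χ : S → ℝ) (e : Chart S) (z : Coord) : ℝ :=
  ∑ γ, Φ.vecIn e z γ * (M.inChart e).D γ (scalarIn e fun _ => χ) z

lemma contDiffOn_scalarIn (he : e ∈ smoothAtlas S) {χ : S → ℝ}
    (hχ : ContMDiff 𝓘(ℝ, E3) 𝓘(ℝ, ℝ) ∞ χ) :
    ContDiffOn ℝ ∞ (scalarIn e fun _ => χ) {z | spacePart z ∈ e.target} :=
  ((hχ.contMDiffOn (s := univ)).comp (contMDiffOn_symm_of_mem_maximalAtlas he)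
    fun _ _ => mem_univ _).contDiffOn.comp contDiff_spacePart.contDiffOn fun _ hz => hz

lemma fluxIn_transition (he : e ∈ smoothAtlas S)
    (he' : e' ∈ smoothAtlas S) {χ : S → ℝ}
    (hχ : ContMDiff 𝓘(ℝ, E3) 𝓘(ℝ, ℝ) ∞ χ) {z : Coord} (hz : z ∈ overlap hT e e') : Φ.fluxIn χ e' (transition e e' z) = Φ.fluxIn χ e z := by
  have h' := (contDiffOn_scalarIn he' hχ).mono fun w (hw : w ∈ chartOpens hT e') => hw.2
  have h := (chartChange M hT he he').sum_mul_D_change (Φ.energyVec_change hT he he')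
    (SmoothAlg.mk _ h')
  have hp : ∀ w : overlap hT e e', ev w ((chartChange M hT he he').pull (SmoothAlg.mk _ h'))
      = scalarIn e (fun _ => χ) w := fun w =>
    ((ev_pullChart hT he he' _ _).trans (ev_mk _ _ _)).trans (scalarIn_transition hT w.2 fun _ => χ)
  have h1 := congrArg (ev ⟨z, hz⟩) h
  simp only [map_sum, map_mul] at h1
  refine Eq.trans ?_ (h1.symm.trans ?_)
  · refine sum_ext fun γ => Eq.symm ?_
    exact congrArg₂ (· * ·)
      ((ev_pullChart hT he he' _ _).trans (FluidRegularOn.ev_energyVec _ _ _ _))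
      ((ev_pullChart hT he he' _ _).trans ((M.regularOn hT he').ev_D _ (ev_mk _ _) _))
  · refine sum_ext fun γ => ?_
    exact congrArg₂ (· * ·) (FluidRegularOn.ev_energyVec _ _ _ _)
      ((M.regularOn_overlap hT he e').ev_D _ hp _)

end PerfectFluid

/-! ### The volume measure in charts -/

section volume

variable {S : Type*} [TopologicalSpace S] [ChartedSpace E3 S] [MeasurableSpace S]
  {e e' : Chart S}
  {b : (x : S) → LinearMap.BilinForm ℝ (TangentSpace 𝓘(ℝ, E3) x)}

/-- The volume measure of the domain of the chart `e`. -/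
def chartMeasure (b : (x : S) → LinearMap.BilinForm ℝ (TangentSpace 𝓘(ℝ, E3) x))
    (e : Chart S) : Measure S :=
  Measure.map e.symm ((volume.restrict e.target).withDensity fun y =>
    ENNReal.ofReal (Real.sqrt (bilinIn e b y).det))

lemma aemeasurable_symm [BorelSpace S] (ρ : E3 → ENNReal) :
    AEMeasurable e.symm ((volume.restrict e.target).withDensity ρ) :=
  (e.continuousOn_symm.aemeasurable e.open_target.measurableSet).mono_ac
    (withDensity_absolutelyContinuous _ _)

lemma chartMeasure_apply [BorelSpace S] {B : Set S} (hB : MeasurableSet B) : chartMeasure b e B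
    = ∫⁻ y in e.target ∩ e.symm ⁻¹' B, ENNReal.ofReal (Real.sqrt (bilinIn e b y).det) := by
  rw [chartMeasure, Measure.map_apply_of_aemeasurable (aemeasurable_symm _) hB, withDensity_apply',
    Measure.restrict_restrict' e.open_target.measurableSet, inter_comm]

lemma det_transition [IsManifold 𝓘(ℝ, E3) ∞ S] (he : e ∈ smoothAtlas S) (he' : e' ∈ smoothAtlas S)
    {y : E3} (hy : y ∈ e.target ∩ e.symm ⁻¹' e'.source) : Real.sqrt (bilinIn e b y).det
    = |(fderiv ℝ (fun y => e' (e.symm y)) y).det| * Real.sqrt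
    (bilinIn e' b (e' (e.symm y))).det := by
  have h1 : bilinIn e b y = (of (jac e e' y))ᵀ * bilinIn e' b (e' (e.symm y))
      * of (jac e e' y) := by
    ext i j
    rw [bilinIn_transition he he' hy, Matrix.mul_apply, sum_comm]
    refine sum_ext fun l => ?_
    rw [Matrix.mul_apply, sum_mul]
    refine sum_ext fun k => ?_
    simp only [transpose_apply, of_apply]; ring
  have h2 : (fderiv ℝ (fun y => e' (e.symm y)) y).det = (of (jac e e' y)).det := by
    rw [ContinuousLinearMap.det, ← LinearMap.det_toMatrix (EuclideanSpace.basisFun (Fin 3) ℝ).toBasis]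
    congr 1
  rw [h1, h2, Matrix.det_mul, Matrix.det_mul, Matrix.det_transpose, mul_right_comm,
    Real.sqrt_mul (mul_self_nonneg _), Real.sqrt_mul_self_eq_abs]

variable [IsManifold 𝓘(ℝ, E3) ∞ S] [BorelSpace S]

lemma chartMeasure_le (he : e ∈ smoothAtlas S) (he' : e' ∈ smoothAtlas S) {B : Set S}
    (hB : MeasurableSet B) (hs : B ⊆ e'.source) : chartMeasure b e B ≤ chartMeasure b e' B := by
  have hsub : e.target ∩ e.symm ⁻¹' B ⊆ e.target ∩ e.symm ⁻¹' e'.source :=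
    inter_subset_inter_right _ (preimage_mono hs)
  have hm : MeasurableSet (e.target ∩ e.symm ⁻¹' B) := by
    have := e.open_target.measurableSet.subtype_image
      ((continuousOn_iff_continuous_restrict.1 e.continuousOn_symm).measurable hB)
    exact (Subtype.image_preimage_coe e.target (e.symm ⁻¹' B)) ▸ this
  rw [chartMeasure_apply hB, chartMeasure_apply hB, setLIntegral_congr_fun hm
    (g := fun y => ENNReal.ofReal |(fderiv ℝ (fun y => e' (e.symm y)) y).det|
      * ENNReal.ofReal (Real.sqrt (bilinIn e' b (e' (e.symm y))).det)) fun y hy => by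
        rw [det_transition he he' (hsub hy), ENNReal.ofReal_mul (abs_nonneg _)],
    ← lintegral_image_eq_lintegral_abs_det_fderiv_mul volume hm
      (f := fun y => e' (e.symm y)) (fun y hy =>
        (hasFDerivAt_coordChange he he' (hsub hy)).hasFDerivWithinAt)
      (fun y hy y' hy' h => e.symm.injOn hy.1 hy'.1 (e'.injOn (hs hy.2) (hs hy'.2) h))
      fun y => ENNReal.ofReal (Real.sqrt (bilinIn e' b y).det)]
  refine lintegral_mono_set ?_
  rintro _ ⟨y, hy, rfl⟩
  exact ⟨e'.map_source (hs hy.2), by rw [mem_preimage, e'.left_inv (hs hy.2)]; exact hy.2⟩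

lemma volMeasure_restrict (he : e ∈ atlas E3 S) :
    (volMeasure b).restrict e.source = chartMeasure b e := by
  have hm := e.open_source.measurableSet
  refine le_antisymm ?_ ?_
  · have h : volMeasure b ≤ chartMeasure b e
        + (((⊤ : ENNReal) • Measure.count).restrict e.sourceᶜ) := by
      refine iSup₂_le fun e' he' => Measure.le_iff.2 fun B hB => ?_
      rw [← measure_inter_add_diff B hm]
      refine add_le_add ((chartMeasure_le (IsManifold.subset_maximalAtlas he')
        (IsManifold.subset_maximalAtlas he) (hB.inter hm) inter_subset_right).trans
          (measure_mono inter_subset_left)) ?_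
      refine le_trans ?_ (Measure.restrict_apply hB).ge
      rw [← diff_eq]
      rcases eq_empty_or_nonempty (B \ e.source) with h0 | h0
      · simp [h0]
      · rw [Measure.smul_apply, smul_eq_mul, ENNReal.top_mul]
        · exact le_top
        · exact Measure.count_ne_zero h0
    refine (Measure.restrict_mono le_rfl h).trans ?_
    rw [Measure.restrict_add, Measure.restrict_restrict hm, inter_compl_self,
      Measure.restrict_empty, add_zero]
    exact Measure.restrict_le_self
  · have h : chartMeasure b e ≤ volMeasure b := le_iSup₂ (f := fun e (_ : e ∈ atlas E3 S) =>
      chartMeasure b e) e he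
    refine Measure.le_iff.2 fun B hB => ?_
    rw [Measure.restrict_apply hB]
    refine le_trans (le_of_eq ?_) (h _)
    rw [chartMeasure_apply hB, chartMeasure_apply (hB.inter hm), preimage_inter, inter_comm (_ ⁻¹' _),
      ← inter_assoc, inter_eq_left.2 (show e.target ⊆ e.symm ⁻¹' e.source from fun y hy => e.map_target hy)]

lemma integral_volMeasure (he : e ∈ atlas E3 S) (hρ : ContinuousOn
    (fun y => Real.sqrt (bilinIn e b y).det) e.target) {g : S → ℝ} (hg : Continuous g)
    (hs : ∀ x ∉ e.source, g x = 0) : ∫ x, g x ∂volMeasure b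
    = ∫ y in e.target, Real.sqrt (bilinIn e b y).det * g (e.symm y) := by
  rw [← setIntegral_eq_integral_of_forall_compl_eq_zero hs, volMeasure_restrict he, chartMeasure,
    integral_map (aemeasurable_symm _) hg.aestronglyMeasurable,
    integral_withDensity_eq_integral_toReal_smul₀
      (hρ.aemeasurable e.open_target.measurableSet).ennreal_ofReal (by simp)]
  simp [ENNReal.toReal_ofReal, Real.sqrt_nonneg]

lemma isLocallyFiniteMeasure_volMeasure (hρ : ∀ e ∈ atlas E3 S,
    ContinuousOn (fun y => Real.sqrt (bilinIn e b y).det) e.target) :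
    IsLocallyFiniteMeasure (volMeasure b) := ⟨fun x => by
  have hx := mem_chart_source E3 x
  obtain ⟨K, hK, hKe, hKc⟩ := local_compact_nhds ((chartAt E3 x).open_target.mem_nhds
    (mem_chart_target E3 x))
  have ho := (chartAt E3 x).isOpen_inter_preimage (isOpen_interior (s := K))
  refine ⟨_, ho.mem_nhds ⟨hx, mem_interior_iff_mem_nhds.2 hK⟩, ?_⟩
  rw [← Measure.restrict_eq_self _ (inter_subset_left (s := (chartAt E3 x).source)
      (t := chartAt E3 x ⁻¹' interior K)),
    volMeasure_restrict (chart_mem_atlas E3 x), chartMeasure_apply ho.measurableSet]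
  refine (lintegral_mono_set (t := K) fun y hy => ?_).trans_lt
    (((hρ _ (chart_mem_atlas E3 x)).mono hKe).integrableOn_compact hKc).lintegral_lt_top
  have := hy.2.2
  rw [mem_preimage, (chartAt E3 x).right_inv hy.1] at this
  exact interior_subset this⟩

end volume

/-! ### The balance law in a chart -/

namespace Slicing

variable {A : Type*} [CommRing A] [Algebra ℝ A] (M : Slicing A)

lemma N_mul_tau : M.N * M.tau = ∑ i : Fin 3, M.D i.succ (M.shift i) - M.sqi * M.D 0 M.sq := by
  have h1 : ∑ i, ∑ j, M.hi i j * ∑ k, (M.h k j * M.D i.succ (M.shift k)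
      + M.h i k * M.D j.succ (M.shift k)) = 2 * ∑ i : Fin 3, M.D i.succ (M.shift i) := by
    have h2 : ∀ a k, ∑ b, M.hi a b * M.h b k = if a = k then 1 else 0 := fun a k => by
      rw [← Matrix.mul_apply, M.hi_mul_h, Matrix.one_apply]
    have h3 : ∑ i, ∑ j, M.hi i j * ∑ k, M.h i k * M.D j.succ (M.shift k)
        = ∑ i : Fin 3, M.D i.succ (M.shift i) := by
      rw [sum_comm]
      refine sum_ext fun j => ?_
      simp only [mul_sum, M.hi_symm _ j]
      rw [sum_comm]
      simp only [← mul_assoc, ← sum_mul, h2, ite_mul, one_mul, zero_mul, Finset.sum_ite_eq,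
        Finset.mem_univ, if_true]
    have h4 : ∑ i, ∑ j, M.hi i j * ∑ k, M.h k j * M.D i.succ (M.shift k)
        = ∑ i : Fin 3, M.D i.succ (M.shift i) := by
      rw [sum_comm, ← h3]
      exact sum_ext fun i => sum_ext fun j => by
        rw [M.hi_symm]; simp only [M.h_symm _ i]
    simp only [sum_add_distrib, mul_add, h3, h4]
    ring
  rw [M.D_sq, tau]
  have h5 : ∑ i, ∑ j, M.hi i j * (M.Ni * (M.D 0 (M.h i j) - ∑ k, (M.h k j * M.D i.succ (M.shift k)
      + M.h i k * M.D j.succ (M.shift k)))) = M.Ni * (∑ i, ∑ j, M.hi i j * M.D 0 (M.h i j)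
        - 2 * ∑ i : Fin 3, M.D i.succ (M.shift i)) := by
    simp only [← h1, ← sum_sub_distrib, mul_sum (a := M.Ni), ← mul_sub]
    exact sum_ext fun i => sum_ext fun j => mul_left_comm _ _ _
  simp only [K, mul_smul_comm, ← smul_sum, h5]
  rw [neg_smul, ← mul_assoc, M.N_mul_Ni, one_mul, smul_sub, neg_sub]
  exact congrArg (· - _) (half_smul_eq (two_mul _))

/-- The balance law for a vector, as a conservation law for densities. -/
lemma density_balance (Y : Fin 4 → A) : M.sq * (M.D 0 (Y 0) + M.div (fun i => Y i.succ)
    - M.N * M.tau * Y 0) = (M.D 0 (M.sq * Y 0) + ∑ i : Fin 3, M.shift i * M.D i.succ (M.sq * Y 0))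
    + ∑ i : Fin 3, M.D i.succ (M.sq * (Y i.succ - M.shift i * Y 0)) := by
  have h1 : M.sq * (M.sqi * M.D 0 M.sq) = M.D 0 M.sq := by rw [← mul_assoc, M.sq_mul_sqi, one_mul]
  have h2 : M.sq * M.div (fun i => Y i.succ) = ∑ i : Fin 3, M.D i.succ (M.sq * Y i.succ) := by
    rw [div, ← mul_assoc, M.sq_mul_sqi, one_mul]
  have h3 : ∀ i : Fin 3, M.D i.succ (M.sq * (Y i.succ - M.shift i * Y 0))
      = M.D i.succ (M.sq * Y i.succ) - M.shift i * M.D i.succ (M.sq * Y 0)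
      - M.sq * Y 0 * M.D i.succ (M.shift i) := fun i => by
    have : M.sq * (Y i.succ - M.shift i * Y 0) = M.sq * Y i.succ - M.shift i * (M.sq * Y 0) := by
      ring
    rw [this, map_sub, Derivation.leibniz (M.D i.succ) (M.shift i), smul_eq_mul, smul_eq_mul]
    ring
  simp only [h3, sum_sub_distrib, ← mul_sum]
  rw [N_mul_tau, mul_sub, mul_add, h2, Derivation.leibniz, smul_eq_mul, smul_eq_mul]
  linear_combination Y 0 * h1

lemma weighted_balance (X : A) (Y : Fin 4 → A) : M.D 0 (M.sq * (X * Y 0))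
    + ∑ i : Fin 3, M.shift i * M.D i.succ (M.sq * (X * Y 0))
    = M.sq * (X * (M.D 0 (Y 0) + M.div (fun i => Y i.succ) - M.N * M.tau * Y 0)
    + ∑ γ, Y γ * M.D γ X) - ∑ i : Fin 3, M.D i.succ (X * (M.sq * (Y i.succ - M.shift i * Y 0))) :=
    by
  have h := M.density_balance fun γ => X * Y γ
  have h1 : M.div (fun i => X * Y i.succ)
      = X * M.div (fun i => Y i.succ) + ∑ i : Fin 3, Y i.succ * M.D i.succ X := by
    have h2 : ∀ i : Fin 3, M.D i.succ (M.sq * (X * Y i.succ))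
        = X * M.D i.succ (M.sq * Y i.succ) + M.sq * (Y i.succ * M.D i.succ X) := fun i => by
      rw [mul_left_comm, Derivation.leibniz, smul_eq_mul, smul_eq_mul]; ring
    simp only [div, h2, sum_add_distrib, ← mul_sum]
    linear_combination (∑ i : Fin 3, Y i.succ * M.D i.succ X) * M.sq_mul_sqi
  have h3 : ∀ i : Fin 3, M.sq * (X * Y i.succ - M.shift i * (X * Y 0))
      = X * (M.sq * (Y i.succ - M.shift i * Y 0)) := fun i => by ring
  simp only [h1, h3, Derivation.leibniz _ X, smul_eq_mul] at h
  simp only [sum4 (fun γ => Y γ * M.D γ X), Derivation.leibniz _ X, smul_eq_mul]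
  linear_combination -h

end Slicing

namespace PerfectFluid

variable {S : Type*} [TopologicalSpace S] [ChartedSpace E3 S] [IsManifold 𝓘(ℝ, E3) ∞ S] {T : Set ℝ}
  {M : SlicedSpacetime S T} {eos : EquationOfState} (Φ : PerfectFluid M eos)
  {e : Chart S}

/-- The balance law for `χ 𝓔` in a chart, for a function `χ` on `S`. -/
lemma local_balance (hT : IsOpen T) (he : e ∈ smoothAtlas S) (hE : Φ.Einstein) (hEu : Φ.Euler)
    {χ : S → ℝ} (hχ : ContMDiff 𝓘(ℝ, E3) 𝓘(ℝ, ℝ) ∞ χ) : ContDiffOn ℝ ∞ (Φ.energyIn e)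
    (chartDomain T e) ∧ ContDiffOn ℝ ∞ (Φ.rateIn gravForm fluidForm e) (chartDomain T e)
    ∧ ContDiffOn ℝ ∞ (Φ.fluxIn χ e) (chartDomain T e)
    ∧ ContDiffOn ℝ ∞ (fun z => Real.sqrt ((M.inChart e).h z).det) (chartDomain T e) ∧ ∃ W : Fin 3
    → Coord → ℝ, (∀ i, ContDiffOn ℝ ∞ (W i) (chartDomain T e))
    ∧ ∀ z ∈ chartDomain T e, pd 0 (fun w => Real.sqrt ((M.inChart e).h w).det *
    (scalarIn e (fun _ => χ) w * Φ.energyIn e w)) z = Real.sqrt ((M.inChart e).h z).det *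
    (scalarIn e (fun _ => χ) z * Φ.rateIn gravForm fluidForm e z + Φ.fluxIn χ e z)
    - ∑ i : Fin 3, pd i.succ (fun w => scalarIn e (fun _ => χ) w * W i w) z := by
  have hM := M.regularOn hT he
  have hF := Φ.regularOn hT he
  have hE0 := hF.ev_energyVec_zero hM
  have hX := (contDiffOn_scalarIn he hχ).mono fun w (hw : w ∈ chartOpens hT e) => hw.2
  set X := SmoothAlg.mk _ hX
  have hXe : ∀ z : chartOpens hT e, ev z X = scalarIn e (fun _ => χ) z := ev_mk _ _
  have hfl : ∀ z : chartOpens hT e, ev z (∑ γ, hF.energyVec hM γ * hM.slicing.D γ X)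
      = Φ.fluxIn χ e z := fun z => by
    simp only [map_sum, map_mul, hF.ev_energyVec, hM.ev_D _ hXe]; rfl
  have hr : ∀ z : chartOpens hT e, _ := fun z =>
    (Φ.rateIn_eq hT hM hF le_rfl he hE hEu z).symm
  refine ⟨contDiffOn_of_ev (f := Φ.energyIn e) hE0, contDiffOn_of_ev hr, contDiffOn_of_ev hfl,
    contDiffOn_of_ev (f := fun z => Real.sqrt ((M.inChart e).h z).det) hM.ev_sq, fun i => extZero _ (hM.slicing.sq * (hF.energyVec hM i.succ
      - hM.slicing.shift i * hF.energyVec hM 0)).1, fun i => SmoothAlg.contDiffOn _, fun z hz => ?_⟩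
  have hpd : ∀ {φ : SmoothAlg (chartOpens hT e)} {f : Coord → ℝ}
      (_ : ∀ w : chartOpens hT e, ev w φ = f w), pd 0 f z = ev ⟨z, hz⟩
      (hM.slicing.D 0 φ + ∑ i : Fin 3, hM.slicing.shift i * hM.slicing.D i.succ φ) := fun h => by
    simp only [map_add, map_sum, map_mul, hM.ev_D _ h, hM.ev_shift]
    simp [LocalMetric.D]
  rw [hpd (φ := hM.slicing.sq * (X * hF.energyVec hM 0)) fun w => by
      rw [map_mul, map_mul, hM.ev_sq, hXe, hE0]; rfl,
    hM.slicing.weighted_balance, map_sub, map_mul, map_add, map_mul, hM.ev_sq, hXe, hr, hfl, map_sum]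
  refine congrArg (_ - ·) (Finset.sum_congr rfl fun i _ => hM.ev_D i.succ (fun w => ?_) ⟨z, hz⟩)
  rw [map_mul, hXe]
  exact congrArg _ (ev_extZero _ w)

end PerfectFluid

/-! ### Integration of a balance law with compact space support -/

lemma continuous_mkCoord : Continuous fun q : ℝ × E3 => mkCoord q.1 q.2 :=
  continuous_pi (Fin.cases continuous_fst fun i => by
    exact (EuclideanSpace.proj (𝕜 := ℝ) i).continuous.comp continuous_snd)

lemma hasDerivAt_time {F : Coord → ℝ} {θ : ℝ} {y : E3} (hF : DifferentiableAt ℝ F (mkCoord θ y)) :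
    HasDerivAt (fun s => F (mkCoord s y)) (pd 0 F (mkCoord θ y)) θ :=
  hF.hasFDerivAt.comp_hasDerivAt θ (hasDerivAt_pi.2 (Fin.cases (hasDerivAt_id θ) fun i => by
    rw [Pi.single_eq_of_ne (Fin.succ_ne_zero i)]
    exact hasDerivAt_const θ (y i)))

lemma hasLineDerivAt_space {F : Coord → ℝ} {t : ℝ} {y : E3} (i : Fin 3)
    (hF : DifferentiableAt ℝ F (mkCoord t y)) : HasLineDerivAt ℝ (fun y => F (mkCoord t y))
    (pd i.succ F (mkCoord t y)) y (EuclideanSpace.single i 1) := by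
  have h : HasDerivAt (fun s : ℝ => mkCoord t (y + s • EuclideanSpace.single i (1 : ℝ)))
      (Pi.single i.succ 1) 0 := by
    refine hasDerivAt_pi.2 (Fin.cases (by simpa using hasDerivAt_const (0 : ℝ) t) fun j => ?_)
    have := ((hasDerivAt_id (0 : ℝ)).mul_const (EuclideanSpace.single i (1 : ℝ) j)).const_add (y j)
    simpa [mkCoord, Pi.single_apply] using this
  have h0 : mkCoord t (y + (0 : ℝ) • EuclideanSpace.single i (1 : ℝ)) = mkCoord t y := by simp
  exact hF.hasFDerivAt.comp_hasDerivAt_of_eq (0 : ℝ) h h0.symm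

section

variable {T : Set ℝ} {K : Set E3}

lemma integrable_slice {φ : Coord → ℝ} (hφ : ContinuousOn φ {z | z 0 ∈ T}) (hK : IsCompact K)
    (h0 : ∀ z, z 0 ∈ T → spacePart z ∉ K → φ z = 0) {t : ℝ} (ht : t ∈ T) :
    Integrable fun y => φ (mkCoord t y) :=
  Continuous.integrable_of_hasCompactSupport
    (hφ.comp_continuous (continuous_mkCoord.comp (by fun_prop : Continuous fun y : E3 => (t, y)))
      fun _ => ht) (HasCompactSupport.intro hK fun y hy => h0 _ ht hy)

lemma continuousOn_pd (hT : IsOpen T) {φ : Coord → ℝ} (hφ : ContDiffOn ℝ ∞ φ {z | z 0 ∈ T})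
    (a : Fin 4) : ContinuousOn (pd a φ) {z | z 0 ∈ T} :=
  (hφ.continuousOn_fderiv_of_isOpen (hT.preimage (continuous_apply 0)) (by simp)).clm_apply
    continuousOn_const

lemma pd_eq_zero (hT : IsOpen T) (hK : IsCompact K) {φ : Coord → ℝ}
    (h0 : ∀ z, z 0 ∈ T → spacePart z ∉ K → φ z = 0) (a : Fin 4) (z : Coord) (hz : z 0 ∈ T)
    (hzK : spacePart z ∉ K) : pd a φ z = 0 := by
  have h : φ =ᶠ[nhds z] fun _ => 0 := by
    filter_upwards [(hT.preimage (continuous_apply 0)).mem_nhds hz,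
      (hK.isClosed.isOpen_compl.preimage contDiff_spacePart.continuous).mem_nhds hzK] with w h1 h2
    exact h0 w h1 h2
  rw [pd, h.fderiv_eq, fderiv_const_apply]
  rfl

lemma integral_balance (hT : IsOpen T) (hT' : T.OrdConnected) (hK : IsCompact K) {F R : Coord → ℝ}
    {W : Fin 3 → Coord → ℝ} (hF : ContDiffOn ℝ ∞ F {z | z 0 ∈ T})
    (hR : ContDiffOn ℝ ∞ R {z | z 0 ∈ T}) (hW : ∀ i, ContDiffOn ℝ ∞ (W i) {z | z 0 ∈ T})
    (hF0 : ∀ z, z 0 ∈ T → spacePart z ∉ K → F z = 0) (hR0 : ∀ z, z 0 ∈ T → spacePart z ∉ K → R z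
    = 0) (hW0 : ∀ i z, z 0 ∈ T → spacePart z ∉ K → W i z = 0)
    (h : ∀ z, z 0 ∈ T → pd 0 F z = R z - ∑ i : Fin 3, pd i.succ (W i) z) : ContinuousOn
    (fun θ => ∫ y, R (mkCoord θ y)) T ∧ ∀ t₀ ∈ T, ∀ t ∈ T, ∫ y, F (mkCoord t y)
    = (∫ y, F (mkCoord t₀ y)) + ∫ θ in t₀..t, ∫ y, R (mkCoord θ y) := by
  have hd : ∀ {φ : Coord → ℝ}, ContDiffOn ℝ ∞ φ {z | z 0 ∈ T} → ∀ θ ∈ T, ∀ y,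
      DifferentiableAt ℝ φ (mkCoord θ y) := fun hφ θ hθ y =>
    (hφ.differentiableOn (by simp)).differentiableAt
      ((hT.preimage (continuous_apply 0)).mem_nhds hθ)
  have hW1 : ∀ θ ∈ T, ∀ i, Integrable fun y => pd i.succ (W i) (mkCoord θ y) := fun θ hθ i =>
    integrable_slice (continuousOn_pd hT (hW i) _) hK (pd_eq_zero hT hK (hW0 i) _) hθ
  have hW2 : ∀ θ ∈ T, ∀ i, ∫ y, pd i.succ (W i) (mkCoord θ y) = 0 := fun θ hθ i => by
    have := integral_bilinear_hasLineDerivAt_right_eq_neg_left_of_integrable (μ := volume)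
      (f := fun _ : E3 => (1 : ℝ)) (f' := fun _ => 0) (g := fun y => W i (mkCoord θ y))
      (g' := fun y => pd i.succ (W i) (mkCoord θ y)) (v := EuclideanSpace.single i 1)
      (B := ContinuousLinearMap.mul ℝ ℝ) (by simp) (by simpa using hW1 θ hθ i)
      (by simpa using integrable_slice (hW i).continuousOn hK (hW0 i) hθ)
      (fun y _ => by simpa [HasLineDerivAt] using hasDerivAt_const (0 : ℝ) (1 : ℝ))
      fun y _ => hasLineDerivAt_space i (hd (hW i) θ hθ y)
    simpa using this
  have hcont : ∀ {φ : Coord → ℝ}, ContinuousOn φ {z | z 0 ∈ T} → ContinuousOn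
      (Function.uncurry fun θ y => φ (mkCoord θ y)) (T ×ˢ univ) := fun hφ =>
    hφ.comp continuous_mkCoord.continuousOn fun q hq => hq.1
  refine ⟨continuousOn_integral_of_compact_support hK (hcont hR.continuousOn)
    fun θ y hθ hy => hR0 _ hθ hy, fun t₀ ht₀ t ht => ?_⟩
  have hsub := hT'.uIcc_subset ht₀ ht
  have hsub' := uIoc_subset_uIcc.trans hsub
  have hInt : Integrable (Function.uncurry fun θ y => pd 0 F (mkCoord θ y))
      ((volume.restrict (uIoc t₀ t)).prod (volume : Measure E3)) := by
    rw [← Measure.restrict_univ (μ := (volume : Measure E3)), Measure.prod_restrict]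
    refine IntegrableOn.of_forall_diff_eq_zero (s := uIcc t₀ t ×ˢ K)
      (((hcont (continuousOn_pd hT hF 0)).mono (prod_mono hsub (subset_univ K))).integrableOn_compact
        (isCompact_uIcc.prod hK)) (measurableSet_uIoc.prod MeasurableSet.univ) fun q hq => ?_
    exact pd_eq_zero hT hK hF0 0 _ (hsub' hq.1.1)
      fun hy => hq.2 ⟨uIoc_subset_uIcc hq.1.1, hy⟩
  have h1 := intervalIntegral_integral_swap hInt
  have h2 : ∀ y, ∫ θ in t₀..t, pd 0 F (mkCoord θ y) = F (mkCoord t y) - F (mkCoord t₀ y) :=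
    fun y => intervalIntegral.integral_eq_sub_of_hasDerivAt
      (fun θ hθ => hasDerivAt_time (hd hF θ (hsub hθ) y))
      (((hcont (continuousOn_pd hT hF 0)).comp (by fun_prop : Continuous fun θ : ℝ => (θ, y)).continuousOn
        fun θ hθ => ⟨hsub hθ, mem_univ y⟩).intervalIntegrable)
  have h3 : ∀ θ ∈ uIcc t₀ t, ∫ y, pd 0 F (mkCoord θ y) = ∫ y, R (mkCoord θ y) := fun θ hθ => by
    have hR' := integrable_slice hR.continuousOn hK hR0 (hsub hθ)
    simp only [fun y => h (mkCoord θ y) (hsub hθ)]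
    rw [integral_sub hR' (integrable_finset_sum _ fun i _ => hW1 θ (hsub hθ) i),
      integral_finset_sum _ fun i _ => hW1 θ (hsub hθ) i]
    simp [hW2 θ (hsub hθ)]
  rw [intervalIntegral.integral_congr h3] at h1
  simp only [h2] at h1
  rw [h1, integral_sub (integrable_slice hF.continuousOn hK hF0 ht)
    (integrable_slice hF.continuousOn hK hF0 ht₀), add_sub_cancel]

end

/-! ### The integrated energy balance -/

lemma contDiffOn_extend {T : Set ℝ} (hT : IsOpen T) {U K : Set E3} (hU : IsOpen U) (hK : IsClosed K)
    (hKU : K ⊆ U) {G : Coord → ℝ} (hG : ContDiffOn ℝ ∞ G {z | z 0 ∈ T ∧ spacePart z ∈ U})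
    (h0 : ∀ z, spacePart z ∈ U → spacePart z ∉ K → G z = 0) : ContDiffOn ℝ ∞
    (indicator (spacePart ⁻¹' U) G) {z | z 0 ∈ T} := fun z hz => by
  have hU' := hU.preimage contDiff_spacePart.continuous
  by_cases h : spacePart z ∈ U
  · refine ((hG.contDiffAt (((hT.preimage (continuous_apply 0)).inter hU').mem_nhds
      ⟨hz, h⟩)).congr_of_eventuallyEq ?_).contDiffWithinAt
    filter_upwards [hU'.mem_nhds h] with w hw using indicator_of_mem hw _
  · refine (contDiffAt_const (c := (0 : ℝ))).congr_of_eventuallyEq ?_ |>.contDiffWithinAt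
    filter_upwards [(hK.isOpen_compl.preimage contDiff_spacePart.continuous).mem_nhds
      fun h' => h (hKU h')] with w hw
    exact indicator_apply_eq_zero.2 fun hw' => h0 w hw' hw

section

variable {S : Type*} [TopologicalSpace S] [ChartedSpace E3 S] [IsManifold 𝓘(ℝ, E3) ∞ S] {T : Set ℝ}

/-- Expressions in charts that define a continuous scalar. -/
structure IsScalar (hT : IsOpen T) (φ : Chart S → Coord → ℝ) : Prop where
  continuousOn : ∀ e ∈ smoothAtlas S, ContinuousOn (φ e) (chartDomain T e)
  transition : ∀ e ∈ smoothAtlas S,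
    ∀ e' ∈ smoothAtlas S, ∀ z ∈ overlap hT e e',
      φ e' (transition e e' z) = φ e z

namespace IsScalar

variable {hT : IsOpen T} {φ : Chart S → Coord → ℝ}

lemma scalarAt_symm (hφ : IsScalar hT φ) {e : Chart S} (he : e ∈ smoothAtlas S) {t : ℝ} (ht : t ∈ T)
    {y : E3} (hy : y ∈ e.target) : scalarAt φ t (e.symm y) = φ e (mkCoord t y) :=
  hφ.transition e he _ (IsManifold.chart_mem_maximalAtlas _) (mkCoord t y)
    ⟨ht, hy, mem_chart_source E3 (e.symm y)⟩

lemma continuous (hφ : IsScalar hT φ) {t : ℝ} (ht : t ∈ T) : Continuous (scalarAt φ t) := by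
  refine continuous_iff_continuousAt.2 fun x => ?_
  have he := IsManifold.chart_mem_maximalAtlas (I := 𝓘(ℝ, E3)) (n := ∞) x
  have hx := (chartAt E3 x).open_source.mem_nhds (mem_chart_source E3 x)
  have h : ContinuousOn (fun x' => φ (chartAt E3 x) (mkCoord t (chartAt E3 x x')))
      (chartAt E3 x).source :=
    (hφ.continuousOn _ he).comp ((continuous_mkCoord.comp (Continuous.prodMk_right t)).comp_continuousOn
      (chartAt E3 x).continuousOn) fun x' hx' => ⟨ht, (chartAt E3 x).map_source hx'⟩
  refine (h.continuousAt hx).congr ?_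
  filter_upwards [hx] with x' hx'
  rw [← hφ.scalarAt_symm he ht ((chartAt E3 x).map_source hx'), (chartAt E3 x).left_inv hx']

end IsScalar

namespace PerfectFluid

variable {M : SlicedSpacetime S T} {eos : EquationOfState} (Φ : PerfectFluid M eos)

lemma isScalar_energyIn (hT : IsOpen T) (hE : Φ.Einstein) (hEu : Φ.Euler) :
    IsScalar hT Φ.energyIn where
  continuousOn _ he := (Φ.local_balance hT he hE hEu (χ := fun _ => 0)
    contMDiff_const).1.continuousOn
  transition _ he _ he' _ hz := Φ.energyIn_transition hT he he' hz

lemma isScalar_rateIn (hT : IsOpen T) (hE : Φ.Einstein) (hEu : Φ.Euler) :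
    IsScalar hT (Φ.rateIn gravForm fluidForm) where
  continuousOn _ he := (Φ.local_balance hT he hE hEu (χ := fun _ => 0)
    contMDiff_const).2.1.continuousOn
  transition _ he _ he' _ hz := Φ.rateIn_transition hT he he' hE hEu hz

lemma isScalar_fluxIn (hT : IsOpen T) (hE : Φ.Einstein) (hEu : Φ.Euler) {χ : S → ℝ}
    (hχ : ContMDiff 𝓘(ℝ, E3) 𝓘(ℝ, ℝ) ∞ χ) : IsScalar hT (Φ.fluxIn χ) where
  continuousOn _ he := (Φ.local_balance hT he hE hEu hχ).2.2.1.continuousOn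
  transition _ he _ he' _ hz := Φ.fluxIn_transition hT he he' hχ hz

lemma continuousOn_density (hT : IsOpen T) {e : Chart S}
    (he : e ∈ smoothAtlas S) (hE : Φ.Einstein) (hEu : Φ.Euler) {t : ℝ}
    (ht : t ∈ T) : ContinuousOn (fun y => Real.sqrt (bilinIn e (M.h t) y).det) e.target := by
  have h := (Φ.local_balance hT he hE hEu (χ := fun _ => 0) contMDiff_const).2.2.2.1.continuousOn
  exact h.comp (f := fun y => mkCoord t y)
    (continuous_mkCoord.comp (Continuous.prodMk_right t)).continuousOn fun _ hy => ⟨ht, hy⟩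

lemma fluxIn_eq_zero {χ : S → ℝ} {e : Chart S} {z : Coord} (hz : spacePart z ∈ e.target)
    (h : e.symm (spacePart z) ∉ tsupport χ) : Φ.fluxIn χ e z = 0 := by
  have h0 : scalarIn e (fun _ => χ) =ᶠ[nhds z] fun _ => 0 := by
    filter_upwards [((e.symm.isOpen_inter_preimage (isClosed_tsupport χ).isOpen_compl).preimage
      contDiff_spacePart.continuous).mem_nhds ⟨hz, h⟩] with w hw
    exact image_eq_zero_of_notMem_tsupport (f := χ) hw.2
  refine Finset.sum_eq_zero fun γ _ => ?_
  rw [LocalMetric.D_eq_sum, Finset.sum_eq_zero, mul_zero]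
  intro a _
  rw [pd, h0.fderiv_eq, fderiv_const_apply]
  exact mul_zero _

lemma sum_fluxIn {ι : Type*} [Fintype ι] {χ : ι → S → ℝ} (hχ : ∀ k, ContMDiff 𝓘(ℝ, E3) 𝓘(ℝ, ℝ) ∞
    (χ k)) (h1 : ∀ x, ∑ k, χ k x = 1) {e : Chart S} (he : e ∈ smoothAtlas S) {z : Coord}
    (hz : spacePart z ∈ e.target) : ∑ k, Φ.fluxIn (χ k) e z = 0 := by
  have hpd : ∀ a, ∑ k, pd a (scalarIn e fun _ => χ k) z = 0 := fun a => by
    have h := fderiv_fun_sum (u := Finset.univ) (x := z) (𝕜 := ℝ)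
      (A := fun k => scalarIn e fun _ => χ k) fun k _ =>
        (((contDiffOn_scalarIn he (hχ k)).differentiableOn (by simp)).differentiableAt
          ((e.open_target.preimage contDiff_spacePart.continuous).mem_nhds hz))
    have h2 : (fun w => ∑ k, scalarIn e (fun _ => χ k) w) = fun _ => 1 := funext fun w => h1 _
    rw [h2, fderiv_const_apply] at h
    have := congrArg (fun A : Coord →L[ℝ] ℝ => A (Pi.single a 1)) h
    simpa [pd, ContinuousLinearMap.sum_apply] using this.symm
  simp only [fluxIn, LocalMetric.D_eq_sum]
  rw [sum_comm]
  refine Finset.sum_eq_zero fun γ _ => ?_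
  rw [← mul_sum, sum_comm]
  simp only [← mul_sum, hpd, mul_zero, sum_const_zero]

variable [T2Space S] [CompactSpace S] [MeasurableSpace S] [BorelSpace S]

/-- The integrated balance law of `χ 𝓔`, for a function `χ` supported in the domain of a chart. -/
lemma chart_balance (hT : IsOpen T) (hT' : T.OrdConnected) (hE : Φ.Einstein) (hEu : Φ.Euler)
    {e : Chart S} (he₀ : e ∈ atlas E3 S) {χ : S → ℝ} (hχ : ContMDiff 𝓘(ℝ, E3) 𝓘(ℝ, ℝ) ∞ χ)
    (hs : tsupport χ ⊆ e.source) : ContinuousOn (fun θ => ∫ x, χ x * scalarAt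
    (Φ.rateIn gravForm fluidForm) θ x + scalarAt (Φ.fluxIn χ) θ x ∂volMeasure (M.h θ)) T
    ∧ ∀ t₀ ∈ T, ∀ t ∈ T, ∫ x, χ x * scalarAt Φ.energyIn t x ∂volMeasure (M.h t)
    = ∫ x, χ x * scalarAt Φ.energyIn t₀ x ∂volMeasure (M.h t₀)
    + ∫ θ in t₀..t, ∫ x, χ x * scalarAt (Φ.rateIn gravForm fluidForm) θ x
    + scalarAt (Φ.fluxIn χ) θ x ∂volMeasure (M.h θ) := by
  have he := IsManifold.subset_maximalAtlas (I := 𝓘(ℝ, E3)) (n := ∞) he₀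
  obtain ⟨hE1, hr, hf, hρ, W, hW, hb⟩ := Φ.local_balance hT he hE hEu hχ
  set K : Set E3 := e '' tsupport χ
  have hK : IsCompact K := (isClosed_tsupport χ).isCompact.image_of_continuousOn
    (e.continuousOn.mono hs)
  have hKU : K ⊆ e.target := by
    rintro _ ⟨x, hx, rfl⟩; exact e.map_source (hs hx)
  have hX := (contDiffOn_scalarIn he hχ).mono fun w (hw : w ∈ chartDomain T e) => hw.2
  have hsupp : ∀ z, spacePart z ∈ e.target → spacePart z ∉ K → e.symm (spacePart z) ∉ tsupport χ :=
    fun z hz hzK h => hzK ⟨_, h, e.right_inv hz⟩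
  have hχ0 : ∀ z, spacePart z ∈ e.target → spacePart z ∉ K → scalarIn e (fun _ => χ) z = 0 :=
    fun z hz hzK => image_eq_zero_of_notMem_tsupport (f := χ) (hsupp z hz hzK)
  set F : Coord → ℝ := fun w => Real.sqrt ((M.inChart e).h w).det
    * (scalarIn e (fun _ => χ) w * Φ.energyIn e w)
  set R : Coord → ℝ := fun w => Real.sqrt ((M.inChart e).h w).det * (scalarIn e (fun _ => χ) w
    * Φ.rateIn gravForm fluidForm e w + Φ.fluxIn χ e w)
  set V : Fin 3 → Coord → ℝ := fun i w => scalarIn e (fun _ => χ) w * W i w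
  have hF0 : ∀ z, spacePart z ∈ e.target → spacePart z ∉ K → F z = 0 := fun z hz hzK => by
    simp [F, hχ0 z hz hzK]
  have hR0 : ∀ z, spacePart z ∈ e.target → spacePart z ∉ K → R z = 0 := fun z hz hzK => by
    simp [R, hχ0 z hz hzK, Φ.fluxIn_eq_zero hz (hsupp z hz hzK)]
  have hV0 : ∀ i z, spacePart z ∈ e.target → spacePart z ∉ K → V i z = 0 := fun i z hz hzK => by
    simp [V, hχ0 z hz hzK]
  have ext0 : ∀ {G : Coord → ℝ}, (∀ z, spacePart z ∈ e.target → spacePart z ∉ K → G z = 0) →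
      ∀ z, z 0 ∈ T → spacePart z ∉ K → indicator (spacePart ⁻¹' e.target) G z = 0 :=
    fun hG z _ hzK => indicator_apply_eq_zero.2 fun hz => hG z hz hzK
  have hloc : ∀ (G : Coord → ℝ) (a : Fin 4) {z : Coord}, spacePart z ∈ e.target →
      pd a (indicator (spacePart ⁻¹' e.target) G) z = pd a G z := fun G a z hz => by
    have h : indicator (spacePart ⁻¹' e.target) G =ᶠ[nhds z] G := by
      filter_upwards [(e.open_target.preimage contDiff_spacePart.continuous).mem_nhds hz] with w hw
        using indicator_of_mem hw _
    rw [pd, h.fderiv_eq, pd]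
  have key := integral_balance (F := indicator (spacePart ⁻¹' e.target) F)
    (R := indicator (spacePart ⁻¹' e.target) R)
    (W := fun i => indicator (spacePart ⁻¹' e.target) (V i)) hT hT' hK
    (contDiffOn_extend hT e.open_target hK.isClosed hKU (hρ.mul (hX.mul hE1)) hF0)
    (contDiffOn_extend hT e.open_target hK.isClosed hKU (hρ.mul ((hX.mul hr).add hf)) hR0)
    (fun i => contDiffOn_extend hT e.open_target hK.isClosed hKU (hX.mul (hW i)) (hV0 i))
    (ext0 hF0) (ext0 hR0) (fun i => ext0 (hV0 i)) (fun z hz => by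
      by_cases hzU : spacePart z ∈ e.target
      · simp only [hloc _ _ hzU]
        rw [indicator_of_mem (show z ∈ spacePart ⁻¹' e.target from hzU)]
        exact hb z ⟨hz, hzU⟩
      · have hzK := fun h => hzU (hKU h)
        rw [pd_eq_zero hT hK (ext0 hF0) 0 z hz hzK, ext0 hR0 z hz hzK]
        simp only [fun i : Fin 3 => pd_eq_zero hT hK (ext0 (hV0 i)) i.succ z hz hzK, sum_const_zero,
          sub_zero])
  have hInt : ∀ {g : S → ℝ} {G : Coord → ℝ} {t : ℝ}, t ∈ T → Continuous g
      → (∀ x ∉ e.source, g x = 0) → (∀ y ∈ e.target, Real.sqrt (bilinIn e (M.h t) y).det * g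
      (e.symm y) = G (mkCoord t y)) → ∫ x, g x ∂volMeasure (M.h t)
      = ∫ y, indicator (spacePart ⁻¹' e.target) G (mkCoord t y) := fun ht hg h0 hG => by
    rw [integral_volMeasure he₀ (Φ.continuousOn_density hT he hE hEu ht) hg h0,
      setIntegral_congr_fun e.open_target.measurableSet hG,
      ← integral_indicator e.open_target.measurableSet]
    rfl
  have hs0 : ∀ x ∉ e.source, χ x = 0 := fun x hx =>
    image_eq_zero_of_notMem_tsupport fun h => hx (hs h)
  have hflS : ∀ t ∈ T, ∀ x ∉ e.source, scalarAt (Φ.fluxIn χ) t x = 0 := fun t ht x hx =>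
    Φ.fluxIn_eq_zero (mem_chart_target E3 x) (by
      rw [spacePart_mkCoord, (chartAt E3 x).left_inv (mem_chart_source E3 x)]
      exact fun h => hx (hs h))
  have h1 : ∀ t ∈ T, ∫ x, χ x * scalarAt Φ.energyIn t x ∂volMeasure (M.h t)
      = ∫ y, indicator (spacePart ⁻¹' e.target) F (mkCoord t y) := fun t ht =>
    hInt ht (hχ.continuous.mul ((Φ.isScalar_energyIn hT hE hEu).continuous ht))
      (fun x hx => by rw [hs0 x hx, zero_mul]) fun y hy => by
        rw [(Φ.isScalar_energyIn hT hE hEu).scalarAt_symm he ht hy]; rfl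
  have h2 : ∀ t ∈ T, ∫ x, χ x * scalarAt (Φ.rateIn gravForm fluidForm) t x
      + scalarAt (Φ.fluxIn χ) t x ∂volMeasure (M.h t)
      = ∫ y, indicator (spacePart ⁻¹' e.target) R (mkCoord t y) := fun t ht =>
    hInt ht ((hχ.continuous.mul ((Φ.isScalar_rateIn hT hE hEu).continuous ht)).add
      ((Φ.isScalar_fluxIn hT hE hEu hχ).continuous ht))
      (fun x hx => by rw [hs0 x hx, zero_mul, zero_add, hflS t ht x hx]) fun y hy => by
        rw [(Φ.isScalar_rateIn hT hE hEu).scalarAt_symm he ht hy,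
          (Φ.isScalar_fluxIn hT hE hEu hχ).scalarAt_symm he ht hy]; rfl
  refine ⟨key.1.congr h2, fun t₀ ht₀ t ht => ?_⟩
  rw [h1 t ht, h1 t₀ ht₀, key.2 t₀ ht₀ t ht, intervalIntegral.integral_congr fun θ hθ =>
    h2 θ (hT'.uIcc_subset ht₀ ht hθ)]

theorem energy_balance (hT : IsOpen T) (hT' : T.OrdConnected) (hE : Φ.Einstein) (hEu : Φ.Euler) :
    (∀ t ∈ T, Integrable (scalarAt Φ.energyIn t) (volMeasure (M.h t))
    ∧ Integrable (scalarAt (Φ.rateIn gravForm fluidForm) t) (volMeasure (M.h t)))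
    ∧ ∀ t₀ ∈ T, ∀ t ∈ T, IntervalIntegrable (fun θ => ∫ x, scalarAt
    (Φ.rateIn gravForm fluidForm) θ x ∂(volMeasure (M.h θ))) volume t₀ t
    ∧ ∫ x, scalarAt Φ.energyIn t x ∂(volMeasure (M.h t))
    = ∫ x, scalarAt Φ.energyIn t₀ x ∂(volMeasure (M.h t₀))
    + ∫ θ in t₀..t, ∫ x, scalarAt (Φ.rateIn gravForm fluidForm) θ x ∂(volMeasure (M.h θ)) := by
  have hi : ∀ t ∈ T, ∀ {g : S → ℝ}, Continuous g → Integrable g (volMeasure (M.h t)) :=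
    fun t ht g hg => by
      have := isLocallyFiniteMeasure_volMeasure (b := M.h t) fun e he =>
        Φ.continuousOn_density hT (IsManifold.subset_maximalAtlas he) hE hEu ht
      exact hg.integrable_of_hasCompactSupport (HasCompactSupport.of_compactSpace g)
  have cE := fun t ht => (Φ.isScalar_energyIn hT hE hEu).continuous (t := t) ht
  have cR := fun t ht => (Φ.isScalar_rateIn hT hE hEu).continuous (t := t) ht
  refine ⟨fun t ht => ⟨hi t ht (cE t ht), hi t ht (cR t ht)⟩, ?_⟩
  obtain ⟨p, -, hp⟩ := isCompact_univ.elim_nhds_subcover (fun x : S => (chartAt E3 x).source)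
    fun x _ => (chartAt E3 x).open_source.mem_nhds (mem_chart_source E3 x)
  obtain ⟨χ, hχ⟩ := SmoothPartitionOfUnity.exists_isSubordinate 𝓘(ℝ, E3) isClosed_univ
    (fun k : p => (chartAt E3 k.1).source) (fun k => (chartAt E3 k.1).open_source) (fun x hx => by
      obtain ⟨k, hk, hx⟩ := mem_iUnion₂.1 (hp hx)
      exact mem_iUnion.2 ⟨⟨k, hk⟩, hx⟩)
  have hsm : ∀ k, ContMDiff 𝓘(ℝ, E3) 𝓘(ℝ, ℝ) ∞ (χ k) := fun k => (χ k).contMDiff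
  have h1 : ∀ x, ∑ k, χ k x = 1 := fun x => by
    rw [← finsum_eq_sum_of_fintype]; exact χ.sum_eq_one (mem_univ x)
  have cF := fun t ht k => (Φ.isScalar_fluxIn hT hE hEu (hsm k)).continuous (t := t) ht
  have hb := fun k => Φ.chart_balance hT hT' hE hEu (chart_mem_atlas E3 k.1) (hsm k) (hχ k)
  have hA : ∀ t ∈ T, ∫ x, scalarAt Φ.energyIn t x ∂volMeasure (M.h t)
      = ∑ k, ∫ x, χ k x * scalarAt Φ.energyIn t x ∂volMeasure (M.h t) := fun t ht => by
    rw [← integral_finset_sum (f := fun k x => χ k x * scalarAt Φ.energyIn t x) _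
      fun k _ => hi t ht ((hsm k).continuous.mul (cE t ht))]
    simp only [← sum_mul, h1, one_mul]
  have hB : ∀ t ∈ T, ∫ x, scalarAt (Φ.rateIn gravForm fluidForm) t x ∂volMeasure (M.h t)
      = ∑ k, ∫ x, χ k x * scalarAt (Φ.rateIn gravForm fluidForm) t x
      + scalarAt (Φ.fluxIn (χ k)) t x ∂volMeasure (M.h t) := fun t ht => by
    rw [← integral_finset_sum (f := fun k x => χ k x * scalarAt (Φ.rateIn gravForm fluidForm) t x
      + scalarAt (Φ.fluxIn (χ k)) t x) _ fun k _ => hi t ht (((hsm k).continuous.mul (cR t ht)).add (cF t ht k))]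
    refine integral_congr_ae (Filter.Eventually.of_forall fun x => ?_)
    have := Φ.sum_fluxIn hsm h1 (IsManifold.chart_mem_maximalAtlas x)
      (z := mkCoord t (chartAt E3 x x)) (mem_chart_target E3 x)
    simp only [sum_add_distrib, ← sum_mul, h1, one_mul]
    exact (add_eq_left.2 this).symm
  intro t₀ ht₀ t ht
  have hsub := hT'.uIcc_subset ht₀ ht
  have hc := fun k => ((hb k).1.mono hsub).intervalIntegrable (μ := volume)
  refine ⟨(ContinuousOn.congr (continuousOn_finset_sum _ fun k _ => (hb k).1.mono hsub)
    fun θ hθ => hB θ (hsub hθ)).intervalIntegrable, ?_⟩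
  rw [intervalIntegral.integral_congr fun θ hθ => hB θ (hsub hθ),
    intervalIntegral.integral_finset_sum fun k _ => hc k, hA t ht, hA t₀ ht₀,
    ← sum_add_distrib]
  exact sum_ext fun k => (hb k).2 t₀ ht₀ t ht

end PerfectFluid
end

end BianchiEuler

end

theorem mainTheorem3 :
    ∃ (QG : GravForm) (QF : FluidForm),
      ∀ (S : Type*) [TopologicalSpace S] [ChartedSpace E3 S] [IsManifold 𝓘(ℝ, E3) ∞ S]
        [T2Space S] [CompactSpace S] [MeasurableSpace S] [BorelSpace S]
        (T : Set ℝ) (_ : IsOpen T) (_ : T.OrdConnected)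
        (M : SlicedSpacetime S T) (eos : EquationOfState) (Φ : PerfectFluid M eos)
        (_ : Φ.Einstein) (_ : Φ.Euler),
        (∀ e ∈ IsManifold.maximalAtlas 𝓘(ℝ, E3) ∞ S,
          -- the Riemann tensor and the dynamical acceleration satisfy the Bianchi-Euler system
          (∀ z ∈ chartDomain T e,
            system (M.inChart e) (Φ.state e)
              (fun w => packUnknown ((M.inChart e).riem w) (Φ.acc e w)) z = 0 ∧
            riemPart (packUnknown ((M.inChart e).riem z) (Φ.acc e z)) = (M.inChart e).riem z) ∧
          -- which is symmetric hyperbolic, with energy density `𝓑 + 𝓕`, if `μ'_p ≥ 1`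
          ((∀ z ∈ chartDomain T e, 1 ≤ (Φ.state e z).mu1) →
            IsFOSH (system (M.inChart e) (Φ.state e)) (chartDomain T e)
              (fun z v => (Φ.state e z).totalEnergy (riemPart v) (accPart v))) ∧
          -- `∂₀ 𝓑 + ∇̄_h {N η^{lh}_i (E^{ij} H_{lj} - B^{ij} D_{lj})} = Q_G + 𝓢`
          (∀ z ∈ chartDomain T e,
            (M.inChart e).D 0 (PerfectFluid.belRobinsonIn (M := M) e) z
              + (M.inChart e).div (fun w => belRobinsonFlux ((M.inChart e).N w)
                  ((M.inChart e).h w) ((M.inChart e).riem w)) z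
              = QG.eval (M.inChart e) z + Φ.sourceIn e z) ∧
          -- `∂₀ 𝓕 + ∇̄_i 𝓗^i = Q_F`
          (∀ z ∈ chartDomain T e,
            (M.inChart e).D 0 (Φ.fluidEnergyIn e) z
              + (M.inChart e).div (fun w => (Φ.state e w).fluidFlux (Φ.acc e w)) z
              = QF.eval Φ e z)) ∧
        -- the integrals are meaningful, and the integral equality holds
        (∀ t ∈ T, Integrable (scalarAt Φ.energyIn t) (volMeasure (M.h t)) ∧
          Integrable (scalarAt (Φ.rateIn QG QF) t) (volMeasure (M.h t))) ∧
        ∀ t₀ ∈ T, ∀ t ∈ T,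
          IntervalIntegrable
            (fun θ => ∫ x, scalarAt (Φ.rateIn QG QF) θ x ∂(volMeasure (M.h θ))) volume t₀ t ∧
          ∫ x, scalarAt Φ.energyIn t x ∂(volMeasure (M.h t))
            = ∫ x, scalarAt Φ.energyIn t₀ x ∂(volMeasure (M.h t₀))
              + ∫ θ in t₀..t, ∫ x, scalarAt (Φ.rateIn QG QF) θ x ∂(volMeasure (M.h θ)) := by
  refine ⟨gravForm, fluidForm, fun S _ _ _ _ _ _ _ T hT hT' M eos Φ hE hEu =>
    ⟨fun e he => ?_, Φ.energy_balance hT hT' hE hEu⟩⟩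
  have hM := M.regularOn hT he
  have hF := Φ.regularOn hT he
  have hEE := Φ.einsteinEulerOn hT he hE hEu
  have hR : ∀ z ∈ chartDomain T e, riemPart (packUnknown ((M.inChart e).riem z) (Φ.acc e z))
      = (M.inChart e).riem z := fun z hz =>
    riemPart_packUnknown (hM.riem_antisymm hz) (hM.riem_antisymm' hz)
  refine ⟨fun z hz => ⟨hF.system_eq_zero hM hEE hR (fun _ _ => rfl) z hz, hR z hz⟩,
    fun hmu => hF.isFOSH hM hmu, fun z hz => ?_, fun z hz => hF.fluid_energy hM hEE hz⟩
  refine (hF.bianchi_energy hM hEE hz).trans ?_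
  rw [PerfectFluid.sourceIn, Φ.J_eq hT he hz]
  rfl
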